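/- **Setting.** Let $G=(V,E,root)$ be a finite directed acyclic graph with $E\subseteq V\times V$ and a distinguished vertex $root$, and let $u\in V$. A set $A\subseteq V$ *dominates* $B\subseteq V$ if every path from a vertex of $B$ to $root$ contains a vertex of $A$; $A$ is a *dominator* of $u$ if $A$ dominates $\{u\}$ and no $A\setminus\{v\}$, $v\in A$, does. Let $D_u$ be the set of all two-element dominators of $u$ (double-vertex dominators). If $v$ belongs to some pair in $D_u$, its *matching vector* $M_u(v)$ lists without repetition all $w$ with $\{v,w\}\in D_u$, where $w'$ precedes $w$ if $w\ne w'$ and $\{v,w\}$ dominates $\{v,w'\}$. Let $\mathbb M_u$ be the set of all these vectors. A *cluster* is a nonempty set $S\subseteq\mathbb M_u$ such that no vector of $S$ shares a vertex with a vector of $\mathbb M_u\setminus S$ and $S$ cannot be partitioned into two nonempty sets with this property. A *composition vector* $C(S)$ is a vector without repetitions that contains every vector of $S$ as a contiguous subvector and contains only vertices of vectors of $S$. Clusters $S,\overline S$ are *complementary* if $\overline S=\{M_u(v): v\in C(S)\}$ and $S=\{M_u(v): v\in C(\overline S)\}$. A *dominator chain* of $u$ is a vector of pairs $$\mathcal D(u)=\big(\{C(S^1),C(\overline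 S^1)\},\dots,\{C(S^k),C(\overline S^k)\}\big)$$ of composition vectors of complementary clusters in which every cluster of $\mathbb M_u$ occurs exactly once, ordered from $u$ towards $root$: if $i<j$ and $v$, $w$ are the first vertices of $C(S^j)$ and $C(\overline S^j)$, then $\{v,w\}$ dominates every vertex of $C(S^i)$ and of $C(\overline S^i)$. It is stored by the vectors $\mathcal L(u)=C(S^1)\cdots C(S^k)$ and $\mathcal R(u)=C(\overline S^1)\cdots C(\overline S^k)$, the end positions in them of the composition vectors, and for each vertex $v$ of the chain the fields $flag(v)\in\{left,right\}$ (whether $v$ is in $\mathcal L(u)$ or in $\mathcal R(u)$), $index(v)$ (its position there), and $\min(v),\max(v)$, the indices of the first and the last vertex of $M_u(v)$; $flag(v)$ is empty for all other vertices. **Algorithm DominatorChain.** The model is a random access machine with unit costs whose arithmetic consists of $\pm1$ and comparisons; all memory apart from the input is initially zero, and $G$ is given by the lists of the fanouts of its vertices. The algorithm finds a path from $u$ to $root$ and on it all single-vertex dominators of $u$. For every two consecutive ones $s,t$ among these (starting with $s=u$, ending with $t=root$) it works with source $s$ and sink $t$. By augmenting paths for max-flow with unit vertex capacities it finds two paths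 $P_1,P_2$ from $s$ to $t$ without common non-terminal vertices and searches for a third augmenting path. If there is one, this stage contributes nothing. Otherwise it runs AssignMinMax$(P_1,P_2)$ and AssignMinMax$(P_2,P_1)$ (which use FindReachable), ConstructVector$(P_1,P_2)$ and ConstructVector$(P_2,P_1)$, which append to $\mathcal L(u)$ and $\mathcal R(u)$, and ConvertMinMax on the appended parts. Finally ConstructD\_u splits $\mathcal L(u),\mathcal R(u)$ into the pairs of the chain. **Theorem.** There are absolute constants $C,c$ such that for every such $G$ and every $u\in V$: 1. DominatorChain halts after at most $C(|E|+1)$ steps, i.e. in $O(|E|)$ time, and returns a dominator chain $\mathcal D(u)$ of $u$, stored as described. 2. From what is stored, the look-up procedure that answers "yes" exactly if $flag(v)$ and $flag(w)$ are nonempty and different and $\min(v)\le index(w)\le\max(v)$ decides for any $v,w\in V$, in at most $c$ steps and without changing the stored chain, whether $\{v,w\}\in D_u$. -/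

import Mathlib

/-! ## Circuit graphs and dominators -/

/-- A directed acyclic graph with a distinguished vertex `root` (the circuit output). -/
structure CircuitGraph (V : Type*) where
  edges : Finset (V × V)
  root : V
  acyclic : ∀ v, ¬ Relation.TransGen (fun a b => (a, b) ∈ edges) v v

namespace CircuitGraph

variable {V : Type*} (G : CircuitGraph V)

/-- `p` is a path with source `x` and sink `y` (a nonempty vector of vertices in which consecutive
vertices are joined by edges). -/
def IsPath (p : List V) (x y : V) : Prop :=
  p.IsChain (fun a b => (a, b) ∈ G.edges) ∧ p.head? = some x ∧ p.getLast? = some y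

/-- `A` dominates `B` with respect to the sink set `C`. -/
def DominatesWrt (A B C : Set V) : Prop :=
  ∀ x ∈ B, ∀ y ∈ C, ∀ p : List V, G.IsPath p x y → ∃ a ∈ A, a ∈ p

/-- `A` dominates `B` (with respect to `root`). -/
def Dominates (A B : Set V) : Prop := G.DominatesWrt A B {G.root}

/-- `A` is a dominator of `B`: it dominates `B` and no `A - {v}`, `v ∈ A`, does. -/
def IsDominator (A B : Set V) : Prop :=
  G.Dominates A B ∧ ∀ v ∈ A, ¬ G.Dominates (A \ {v}) B

/-- The set `D_u` of all double-vertex dominators of `u`. -/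
def doubleDominators (u : V) : Set (Set V) :=
  {A | A.ncard = 2 ∧ G.IsDominator A {u}}

/-- `M` is the matching vector `M_u(v)`: it lists, without repetition, all `w` for which `{v, w}` is
a double-vertex dominator of `u`, and `w'` precedes `w` whenever `{v, w}` dominates `{v, w'}`. -/
def IsMatchingVector (u v : V) (M : List V) : Prop :=
  M.Nodup ∧ (∀ w, w ∈ M ↔ ({v, w} : Set V) ∈ G.doubleDominators u) ∧
    ∀ w ∈ M, ∀ w' ∈ M, w ≠ w' → G.Dominates {v, w} {v, w'} → [w', w].Sublist M

/-- The set `𝕄_u` of the matching vectors of all vertices that occur in `D_u`. -/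
def matchingVectors (u : V) : Set (List V) :=
  {M | M ≠ [] ∧ ∃ v, G.IsMatchingVector u v M}

/-- No vector of `S ⊆ 𝕄_u` has a vertex in common with a vector of `𝕄_u - S`. -/
def IsSeparated (u : V) (S : Set (List V)) : Prop :=
  S ⊆ G.matchingVectors u ∧ ∀ M ∈ S, ∀ M' ∈ G.matchingVectors u \ S, List.Disjoint M M'

/-- `S` is a cluster of `𝕄_u`: a nonempty separated set of matching vectors that cannot be
partitioned into two such sets. -/
def IsCluster (u : V) (S : Set (List V)) : Prop :=
  S.Nonempty ∧ G.IsSeparated u S ∧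
    ¬ ∃ S₁ S₂ : Set (List V), S₁.Nonempty ∧ S₂.Nonempty ∧ Disjoint S₁ S₂ ∧ S₁ ∪ S₂ = S ∧
      G.IsSeparated u S₁ ∧ G.IsSeparated u S₂

/-- `C` is a composition vector of the set `S` of matching vectors: it contains every vector of `S`
as a (contiguous) subvector, has no vertices outside these vectors, and has no repetition. -/
def IsComposition (S : Set (List V)) (C : List V) : Prop :=
  (∀ M ∈ S, M <:+: C) ∧ (∀ x ∈ C, ∃ M ∈ S, x ∈ M) ∧ C.Nodup

/-- The matching vectors of the vertices of `C`. -/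
def matchingVectorsOf (u : V) (C : List V) : Set (List V) :=
  {M | ∃ v ∈ C, G.IsMatchingVector u v M}

/-- `S` and `T` are complementary clusters with composition vectors `p.1` and `p.2`. -/
def IsComplementaryPair (u : V) (S T : Set (List V)) (p : List V × List V) : Prop :=
  G.IsCluster u S ∧ G.IsCluster u T ∧ IsComposition S p.1 ∧ IsComposition T p.2 ∧
    T = G.matchingVectorsOf u p.1 ∧ S = G.matchingVectorsOf u p.2

/-- `D` is a dominator chain of `u`: the vector of the pairs of composition vectors of complementary
clusters of `𝕄_u`, where every cluster occurs exactly once, ordered from `u` towards `root`: the pair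
of first vertices of a later entry dominates every vertex of an earlier entry. -/
def IsDominatorChain (u : V) (D : List (List V × List V)) : Prop :=
  (∃ cl : List (Set (List V) × Set (List V)),
    List.Forall₂ (fun c p => G.IsComplementaryPair u c.1 c.2 p) cl D ∧
    (cl.map Prod.fst ++ cl.map Prod.snd).Nodup ∧
    ∀ S, G.IsCluster u S → S ∈ cl.map Prod.fst ++ cl.map Prod.snd) ∧
  D.Pairwise (fun p q => ∀ v ∈ q.1.head?, ∀ w ∈ q.2.head?, ∀ x ∈ p.1 ++ p.2,
    G.Dominates {v, w} {x})

end CircuitGraph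

/-! ## A random access machine with unit costs

Programs act on registers (named by `R`) and one-dimensional arrays (named by `A`) of natural
numbers. The only arithmetic is `± 1` and comparison, so numbers stay of the size of the input.
Every evaluated node of an expression or a test and every executed command costs one step. -/

namespace RAM

structure State (R A : Type) where
  reg : R → ℕ
  arr : A → ℕ → ℕ

inductive Expr (R A : Type) where
  | lit (k : ℕ)
  | reg (x : R)
  | read (a : A) (i : Expr R A)
  | succ (e : Expr R A)
  | pred (e : Expr R A)

inductive Test (R A : Type) where
  | eq (e f : Expr R A)
  | lt (e f : Expr R A)
  | not (b : Test R A)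
  | and (b c : Test R A)

inductive Cmd (R A : Type) where
  | skip
  | assign (x : R) (e : Expr R A)
  | write (a : A) (i e : Expr R A)
  | seq (c d : Cmd R A)
  | ite (b : Test R A) (c d : Cmd R A)
  | while (b : Test R A) (c : Cmd R A)

variable {R A : Type}

instance : Coe R (Expr R A) := ⟨Expr.reg⟩

instance (k : ℕ) : OfNat (Expr R A) k := ⟨Expr.lit k⟩

infix:50 " ::= " => Cmd.assign
infixr:40 " ;; " => Cmd.seq

def Cmd.when (b : Test R A) (c : Cmd R A) : Cmd R A := .ite b c .skip

def Expr.eval (σ : State R A) : Expr R A → ℕ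
  | .lit k => k
  | .reg x => σ.reg x
  | .read a i => σ.arr a (i.eval σ)
  | .succ e => e.eval σ + 1
  | .pred e => e.eval σ - 1

def Expr.cost : Expr R A → ℕ
  | .lit _ => 1
  | .reg _ => 1
  | .read _ i => i.cost + 1
  | .succ e => e.cost + 1
  | .pred e => e.cost + 1

def Test.Holds (σ : State R A) : Test R A → Prop
  | .eq e f => e.eval σ = f.eval σ
  | .lt e f => e.eval σ < f.eval σ
  | .not b => ¬ b.Holds σ
  | .and b c => b.Holds σ ∧ c.Holds σ

def Test.cost : Test R A → ℕ
  | .eq e f => e.cost + f.cost + 1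
  | .lt e f => e.cost + f.cost + 1
  | .not b => b.cost + 1
  | .and b c => b.cost + c.cost + 1

variable [DecidableEq R] [DecidableEq A]

def State.setReg (σ : State R A) (x : R) (k : ℕ) : State R A :=
  { σ with reg := Function.update σ.reg x k }

def State.setArr (σ : State R A) (a : A) (i k : ℕ) : State R A :=
  { σ with arr := Function.update σ.arr a (Function.update (σ.arr a) i k) }

/-- `Exec c σ σ' t`: started in state `σ`, the program `c` halts in state `σ'` after `t` steps. -/
inductive Exec : Cmd R A → State R A → State R A → ℕ → Prop
  | skip (σ) : Exec .skip σ σ 1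
  | assign (x e σ) : Exec (.assign x e) σ (σ.setReg x (e.eval σ)) (e.cost + 1)
  | write (a i e σ) :
      Exec (.write a i e) σ (σ.setArr a (i.eval σ) (e.eval σ)) (i.cost + e.cost + 1)
  | seq {c d σ₁ σ₂ σ₃ t₁ t₂} : Exec c σ₁ σ₂ t₁ → Exec d σ₂ σ₃ t₂ →
      Exec (.seq c d) σ₁ σ₃ (t₁ + t₂ + 1)
  | ite_true {b c d σ σ' t} : b.Holds σ → Exec c σ σ' t → Exec (.ite b c d) σ σ' (b.cost + t + 1)
  | ite_false {b c d σ σ' t} : ¬ b.Holds σ → Exec d σ σ' t →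
      Exec (.ite b c d) σ σ' (b.cost + t + 1)
  | while_true {b c σ₁ σ₂ σ₃ t₁ t₂} : b.Holds σ₁ → Exec c σ₁ σ₂ t₁ →
      Exec (.while b c) σ₂ σ₃ t₂ → Exec (.while b c) σ₁ σ₃ (b.cost + t₁ + t₂ + 1)
  | while_false {b c σ} : ¬ b.Holds σ → Exec (.while b c) σ σ (b.cost + 1)

/-- The machine is deterministic: final state and number of steps are determined by the program and
the initial state. -/
theorem Exec.det {c : Cmd R A} {σ σ₁ σ₂ : State R A} {t₁ t₂ : ℕ} (h₁ : Exec c σ σ₁ t₁)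
    (h₂ : Exec c σ σ₂ t₂) : σ₁ = σ₂ ∧ t₁ = t₂ := by
  induction h₁ generalizing σ₂ t₂ with
  | skip => cases h₂; exact ⟨rfl, rfl⟩
  | assign => cases h₂; exact ⟨rfl, rfl⟩
  | write => cases h₂; exact ⟨rfl, rfl⟩
  | seq _ _ ih₁ ih₂ =>
    cases h₂ with
    | seq k₁ k₂ =>
      obtain ⟨rfl, rfl⟩ := ih₁ k₁
      obtain ⟨rfl, rfl⟩ := ih₂ k₂
      exact ⟨rfl, rfl⟩
  | ite_true hb _ ih =>
    cases h₂ with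
    | ite_true _ k => obtain ⟨rfl, rfl⟩ := ih k; exact ⟨rfl, rfl⟩
    | ite_false hb' _ => exact absurd hb hb'
  | ite_false hb _ ih =>
    cases h₂ with
    | ite_true hb' _ => exact absurd hb' hb
    | ite_false _ k => obtain ⟨rfl, rfl⟩ := ih k; exact ⟨rfl, rfl⟩
  | while_true hb _ _ ih₁ ih₂ =>
    cases h₂ with
    | while_true _ k₁ k₂ =>
      obtain ⟨rfl, rfl⟩ := ih₁ k₁
      obtain ⟨rfl, rfl⟩ := ih₂ k₂
      exact ⟨rfl, rfl⟩
    | while_false hb' => exact absurd hb hb'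
  | while_false hb =>
    cases h₂ with
    | while_true hb' _ _ => exact absurd hb' hb
    | while_false _ => exact ⟨rfl, rfl⟩

end RAM

/-! ## The algorithm -/

namespace DominatorAlg

open RAM

/-- Registers. A `Bool` parameter names one of the two disjoint paths (`false`: the path `P₁` and the
vector `L(u)`; `true`: the path `P₂` and the vector `R(u)`). -/
inductive Reg where
  /- input: the vertex `u` and the output of the circuit -/
  | u | root
  /- source and sink of the current stage; first edge of its first path -/
  | s | t | f
  /- graph search -/
  | sp | x | y | z | e | found | halt
  /- loop counters -/
  | i | j | d
  /- number of single-vertex dominators of `u` -/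
  | nd
  /- numbers of vertices of the paths -/
  | len (b : Bool)
  /- `AssignMinMax` for `(P₁, P₂)`: `reached_P₁`, `reached_P₂`, `new_reached_P₁`,
  `new_reached_P₂`, `last_prime` -/
  | reached₁ | reached₂ | newReached₁ | newReached₂ | lastPrime
  | lo | hi
  /- length of `L(u)`, `R(u)`, and their length at the beginning of the current stage -/
  | size (b : Bool) | start (b : Bool)
  /- `ConstructD_u` -/
  | pairs | endL | endR | newL | newR | go
  /- the query `{v, w}` and its answer -/
  | qv | qw | answer
  deriving DecidableEq

inductive Arr where
  /- input: the fanout of `v` is stored in `adj` from `off v` up to (excluding) `off (v + 1)` -/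
  | off | adj
  | stk
  /- flow through a vertex, successor and predecessor on its flow path -/
  | flow | nxt | prv
  /- `k`-th augmentation: visited copies (in-copy, out-copy) of the split vertices and the vertices
  from which they were visited -/
  | visIn (k : Fin 3) | visOut (k : Fin 3) | parIn (k : Fin 3) | parOut (k : Fin 3)
  /- first path from `u` to `root`, positions on it, indices of the single-vertex dominators -/
  | trunk | trunkSide | trunkPos | trunkMark | dom
  /- the disjoint paths of the current stage; membership of a vertex and its position -/
  | path (b : Bool) | side | pos
  /- `marked`, and the intermediate fields `min`, `max`, `prime` of the `i`-th vertex of a path -/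
  | marked (b : Bool) | lo (b : Bool) | hi (b : Bool) | prime (b : Bool)
  /- output: the vectors `L(u)` and `R(u)`, the last positions of the composition vectors in them,
  and the fields `flag`, `index`, `min`, `max` of the vertices -/
  | vec (b : Bool) | ends (b : Bool) | flag | index | min | max
  deriving DecidableEq

abbrev Prog := Cmd Reg Arr

/-- The value of `flag` for vertices in `L(u)` and in `R(u)`; it is `0` for other vertices. -/
def label (b : Bool) : ℕ := if b then 2 else 1

section
open Reg Arr

/-! ### Max-flow with unit vertex capacities

Every vertex `x` other than the source and the sink is split into an in-copy and an out-copy joined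
by an arc of capacity one. -/

/-- Visit the out-copy of `z`, coming from the in-copy of `y`. -/
def visitOutCopy (k : Fin 3) : Prog :=
  .when (.eq (.read (visOut k) z) 0)
    (.write (visOut k) z 1 ;;
     .write (parOut k) z y ;;
     .write stk sp z ;;
     sp ::= .succ sp)

/-- Search for a path from `s` to `t` in the residual network. The stack holds out-copies. -/
def residualSearch (k : Fin 3) : Prog :=
  found ::= 0 ;;
  .write (visOut k) s 1 ;;
  .write stk 0 s ;;
  sp ::= 1 ;;
  .while (.and (.not (.eq sp 0)) (.eq found 0))
    (sp ::= .pred sp ;;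
     x ::= .read stk sp ;;
     -- cancel the flow through `x` and on the edge into `x`
     .when (.and (.eq (.read flow x) 1) (.eq (.read (visIn k) x) 0))
       (.write (visIn k) x 1 ;;
        .write (parIn k) x x ;;
        y ::= x ;;
        z ::= .read prv x ;;
        visitOutCopy k) ;;
     e ::= .read off x ;;
     .while (.lt e (.read off (.succ x)))
       (y ::= .read adj e ;;
        e ::= .succ e ;;
        .ite (.eq y t)
          (.when (.not (.and (.eq (.read flow x) 1) (.eq (.read nxt x) t)))
            (found ::= 1 ;;
             .write (parIn k) t x))
          (.when (.eq (.read (visIn k) y) 0)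
            (.write (visIn k) y 1 ;;
             .write (parIn k) y x ;;
             -- if there is flow through `y`, only the flow on the edge into `y` can be cancelled
             .ite (.eq (.read flow y) 1) (z ::= .read prv y) (z ::= y) ;;
             visitOutCopy k))))

/-- Search for an augmenting path and, if one is found, augment the flow along it. -/
def augment (k : Fin 3) : Prog :=
  residualSearch k ;;
  .when (.eq found 1)
    (y ::= t ;;
     halt ::= 0 ;;
     .while (.eq halt 0)
       (x ::= .read (parIn k) y ;;
        .ite (.eq x y)
          (.write flow x 0)
          (.write prv y x ;; .write nxt x y) ;;
        .ite (.eq x s)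
          (halt ::= 1)
          (y ::= .read (parOut k) x ;;
           .when (.eq y x) (.write flow x 1))))

/-! ### `FindReachable` -/

/-- Depth-first search from `x` through unmarked vertices that are on neither path; updates the
maximal positions reached on the path `b` and on the other path. -/
def findReachable (mark side pos : Arr) (b : Bool) : Prog :=
  .write stk 0 x ;;
  sp ::= 1 ;;
  .while (.not (.eq sp 0))
    (sp ::= .pred sp ;;
     z ::= .read stk sp ;;
     e ::= .read off z ;;
     .while (.lt e (.read off (.succ z)))
       (y ::= .read adj e ;;
        e ::= .succ e ;;
        .when (.eq (.read mark y) 0)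
          (.write mark y 1 ;;
           .ite (.eq y t)
             (newReached₁ ::= len b ;; newReached₂ ::= len (!b))
             (.ite (.eq (.read side y) (.lit (label b)))
               (.when (.lt newReached₁ (.read pos y)) (newReached₁ ::= .read pos y))
               (.ite (.eq (.read side y) (.lit (label (!b))))
                 (.when (.lt newReached₂ (.read pos y)) (newReached₂ ::= .read pos y))
                 (.write stk sp y ;; sp ::= .succ sp))))))

/-! ### Single-vertex dominators of `u` -/

/-- Store the path from `u` to `root` found by the first augmentation. -/
def storeTrunk : Prog :=
  x ::= u ;;
  len false ::= 1 ;;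
  .write trunk 1 x ;;
  .while (.not (.eq x root))
    (x ::= .read nxt x ;;
     len false ::= .succ (len false) ;;
     .write trunk (len false) x ;;
     .write trunkSide x (.lit (label false)) ;;
     .write trunkPos x (len false))

/-- List (the positions on the stored path of) all single-vertex dominators of `u`: the vertices of
the path that no path between two of its other vertices avoids. -/
def singleDominators : Prog :=
  nd ::= 0 ;;
  reached₁ ::= 0 ;;
  newReached₁ ::= 0 ;;
  newReached₂ ::= 0 ;;
  i ::= 1 ;;
  .while (.lt i (len false))
    (.when (.not (.lt i reached₁))
       (nd ::= .succ nd ;; .write dom nd i) ;;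
     x ::= .read trunk i ;;
     findReachable trunkMark trunkSide trunkPos false ;;
     reached₁ ::= newReached₁ ;;
     i ::= .succ i) ;;
  nd ::= .succ nd ;;
  .write dom nd (len false)

/-! ### The procedures for one pair of disjoint paths from `s` to `t` -/

/-- Store the flow path from `s` to `t` whose second vertex is `x`. -/
def storePath (b : Bool) : Prog :=
  .write (path b) 1 s ;;
  len b ::= 1 ;;
  .while (.not (.eq x t))
    (len b ::= .succ (len b) ;;
     .write (path b) (len b) x ;;
     .write side x (.lit (label b)) ;;
     .write pos x (len b) ;;
     x ::= .read nxt x) ;;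
  len b ::= .succ (len b) ;;
  .write (path b) (len b) t

def assignMinMax (b : Bool) : Prog :=
  reached₁ ::= 0 ;;
  reached₂ ::= 1 ;;
  newReached₁ ::= reached₁ ;;
  newReached₂ ::= reached₂ ;;
  lastPrime ::= 0 ;;
  i ::= 1 ;;
  .while (.lt i (len b))
    (.ite (.lt i reached₁)
       (.write (Arr.lo b) i (len (!b)) ;;
        .write (prime b) i lastPrime)
       (.write (Arr.lo b) i reached₂ ;;
        .write (prime b) lastPrime i ;;
        lastPrime ::= i) ;;
     x ::= .read (path b) i ;;
     findReachable (marked b) side pos b ;;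
     .when (.lt reached₁ newReached₁) (reached₁ ::= newReached₁) ;;
     .when (.lt reached₂ newReached₂)
       (j ::= reached₂ ;;
        .while (.lt j newReached₂)
          (.write (Arr.hi (!b)) j i ;;
           j ::= .succ j) ;;
        reached₂ ::= newReached₂) ;;
     i ::= .succ i) ;;
  .write (prime b) lastPrime (len b)

def constructVector (b : Bool) : Prog :=
  i ::= 2 ;;
  .while (.lt i (len b))
    (Reg.lo ::= .read (Arr.lo b) i ;;
     Reg.hi ::= .read (Arr.hi b) i ;;
     .when (.not (.eq Reg.lo (len (!b))))
       ( -- closest prime descendant and closest prime ancestor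
        .when (.eq (.read (Arr.lo (!b)) Reg.lo) (len b))
          (Reg.lo ::= .read (prime (!b)) (.read (prime (!b)) Reg.lo)) ;;
        .when (.eq (.read (Arr.lo (!b)) Reg.hi) (len b))
          (Reg.hi ::= .read (prime (!b)) Reg.hi) ;;
        .when (.not (.lt Reg.hi Reg.lo))
          (x ::= .read (path b) i ;;
           size b ::= .succ (size b) ;;
           .write (vec b) (size b) x ;;
           .write index x (size b) ;;
           .write flag x (.lit (label b)) ;;
           .write Arr.min x Reg.lo ;;
           .write Arr.max x Reg.hi)) ;;
     i ::= .succ i)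

def convertMinMax (b : Bool) : Prog :=
  i ::= start b ;;
  .while (.lt i (size b))
    (i ::= .succ i ;;
     x ::= .read (vec b) i ;;
     .write Arr.min x (.read index (.read (path (!b)) (.read Arr.min x))) ;;
     .write Arr.max x (.read index (.read (path (!b)) (.read Arr.max x))))

/-- Split `L(u)` and `R(u)` into the composition vectors of complementary clusters. -/
def constructDu : Prog :=
  pairs ::= 0 ;;
  endL ::= 0 ;;
  endR ::= 0 ;;
  .while (.lt endL (size false))
    (endL ::= .succ endL ;;
     go ::= 1 ;;
     .while (.eq go 1)
       (newR ::= .read Arr.max (.read (vec false) endL) ;;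
        .ite (.eq newR endR)
          (go ::= 0)
          (endR ::= newR ;;
           newL ::= .read Arr.max (.read (vec true) endR) ;;
           .ite (.eq newL endL)
             (go ::= 0)
             (endL ::= newL))) ;;
     pairs ::= .succ pairs ;;
     .write (ends false) pairs endL ;;
     .write (ends true) pairs endR)

/-- Append to `L(u)` and `R(u)` the vertices of the double-vertex dominators of `s` with respect to
the sink `t`, where `t` is the immediate single-vertex dominator of `s` and `f` is the second vertex
of the first path from `s` to `t`. -/
def stage : Prog :=
  .write flow s 0 ;;
  augment 1 ;;
  .when (.eq found 1)
    (residualSearch 2 ;;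
     -- if there is a third disjoint path, there are no double-vertex dominators
     .when (.eq found 0)
       (x ::= f ;;
        storePath false ;;
        x ::= .read nxt s ;;
        storePath true ;;
        assignMinMax false ;;
        assignMinMax true ;;
        start false ::= size false ;;
        start true ::= size true ;;
        constructVector false ;;
        constructVector true ;;
        convertMinMax false ;;
        convertMinMax true))

/-- The algorithm `DominatorChain`. -/
def dominatorChain : Prog :=
  size false ::= 0 ;;
  size true ::= 0 ;;
  s ::= u ;;
  t ::= root ;;
  augment 0 ;;
  .when (.eq found 1)
    (storeTrunk ;;
     singleDominators ;;
     d ::= 1 ;;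
     .while (.lt d nd)
       (s ::= .read trunk (.read dom d) ;;
        f ::= .read trunk (.succ (.read dom d)) ;;
        d ::= .succ d ;;
        t ::= .read trunk (.read dom d) ;;
        stage)) ;;
  constructDu

/-- The look-up whether the pair `{qv, qw}` is a double-vertex dominator of `u`. -/
def isDominatorPair : Prog :=
  answer ::= 0 ;;
  .when (.and (.not (.eq (.read flag qv) 0)) (.not (.eq (.read flag qw) 0)))
    (.when (.not (.eq (.read flag qv) (.read flag qw)))
      (.when (.and (.not (.lt (.read index qw) (.read Arr.min qv)))
                   (.not (.lt (.read Arr.max qv) (.read index qw))))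
        (answer ::= 1)))

end

/-! ### Input and output -/

/-- The fanout list of the vertex `v` that is stored in memory. -/
def fanoutList (σ : State Reg Arr) (v : ℕ) : List ℕ :=
  (List.range' (σ.arr .off v) (σ.arr .off (v + 1) - σ.arr .off v)).map (σ.arr .adj)

/-- The memory holds `G` (by lists of the fanouts, in any order), its root and the vertex `u`; all
other arrays are zero. -/
structure IsInput {n : ℕ} (G : CircuitGraph (Fin n)) (u : Fin n) (σ : State Reg Arr) : Prop where
  source : σ.reg .u = u
  root : σ.reg .root = G.root
  mono : ∀ v : Fin n, σ.arr .off v ≤ σ.arr .off (v + 1)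
  nodup : ∀ v : Fin n, (fanoutList σ v).Nodup
  fanout : ∀ (v : Fin n) (w : ℕ), w ∈ fanoutList σ v ↔ ∃ w' : Fin n, (v, w') ∈ G.edges ∧ w = w'
  zero : ∀ a, a ≠ .off → a ≠ .adj → ∀ i, σ.arr a i = 0

/-- The left (`false`) or right (`true`) composition vector of a pair. -/
def part {V : Type*} (b : Bool) (p : List V × List V) : List V := if b then p.2 else p.1

/-- The concatenation of the left (right) composition vectors: `L(u)` and `R(u)`. -/
def partVec {V : Type*} (b : Bool) (D : List (List V × List V)) : List V :=
  (D.map (part b)).flatten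

/-- The memory holds the chain `D`: the vectors `L(u)` and `R(u)`, the ends in them of the composition
vectors, and for every vertex the fields `flag`, `index` (positions are counted from 1), and `min`,
`max`, which are the indices of the first and the last vertex of its matching vector. -/
structure Stores {n : ℕ} (G : CircuitGraph (Fin n)) (u : Fin n) (σ : State Reg Arr)
    (D : List (List (Fin n) × List (Fin n))) : Prop where
  pairs : σ.reg .pairs = D.length
  size : ∀ b, σ.reg (.size b) = (partVec b D).length
  vec : ∀ b i (h : i < (partVec b D).length), σ.arr (.vec b) (i + 1) = ((partVec b D)[i] : Fin n)
  ends : ∀ b k, k ≤ D.length → σ.arr (.ends b) k = (partVec b (D.take k)).length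
  flag : ∀ b, ∀ v ∈ partVec b D, σ.arr .flag v = label b
  flag_zero : ∀ v, (∀ b, v ∉ partVec b D) → σ.arr .flag v = 0
  index : ∀ b i (h : i < (partVec b D).length), σ.arr .index ((partVec b D)[i] : Fin n) = i + 1
  min : ∀ v M, G.IsMatchingVector u v M → ∀ w ∈ M.head?, σ.arr .min v = σ.arr .index w
  max : ∀ v M, G.IsMatchingVector u v M → ∀ w ∈ M.getLast?, σ.arr .max v = σ.arr .index w

end DominatorAlg

set_option linter.all false

/-! Every path from `u` to the root passes through all single-vertex dominators of `u`. Let s and t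
be two consecutive ones. A double-vertex dominator with one vertex strictly between s and t has both
vertices there, and it is the same as a two-vertex cut of s and t (`IsStage.pair_iff`); so the
problem splits into independent stages. Inside a stage the argument is that of Menger's theorem. No
single vertex cuts s from t, so the second augmentation succeeds (`ResDone.false_of_stage`). If a
third augmenting path exists, two vertices are no cut (`ResDone.av_of_found`). Otherwise each cut
has one vertex on each of the two disjoint paths (`TwoPaths.cut`).

Call a path a jump if its inner vertices avoid both paths. Position i of one path and position j of
the other form a cut exactly if no jump leads from before the chosen positions to behind one of them
(`Layout.cut_iff`). This means that both vertices are prime, i.e. no jump along their own path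
passes over them, and that no jump crosses over the vertex of the other path. The crossing
conditions are monotone in i and j, so the partners of a prime vertex are the prime vertices in an
interval (`Layout.interval`). The ends of the interval are read off from the furthest positions
reached by jumps from earlier vertices, and depth-first searches with common marks along one path
provide these.

The tables of the stages are concatenated. Besides the pairs, the invariant `Chain` keeps paths: one
from `u` to each listed v that avoids the other side and everything listed behind v, and one from v
onwards that avoids the other side and everything listed before v. These paths show in which order
pairs dominate (`Listing.ladder`) and allow crossing pairs to be exchanged (`Listing.uncross_left`,
`Listing.uncross_right`). Hence the ends of the intervals are monotone, the bipartite graph of the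
pairs is a staircase (`Listing.staircase`), and its connected components are blocks of consecutive
positions, which are found by alternately following the last neighbours. Intervals are matching
vectors (`Ladder.isMatchingVector_iff`), components are clusters (`Division.isCluster`), blocks are
composition vectors (`Division.isComposition`).

The time is bounded by potentials. `Net.work` holds a charge of degree plus one for every unvisited
vertex reachable from `u`. Marks are never cleared: apart from t itself, a vertex marked in a stage
lies on no path from t to the root (`Fresh.step`), so stale marks hide nothing and all searches
together are linear. Work along the paths is charged to vertices that cease to be live
(`pathWork_add_liveWork`). At most |E| + 1 vertices are reachable from `u`, which gives a bound in
|E| alone (`IsInput.work_le`). -/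

open Function

/-! ### Frame conditions and total-correctness rules with exact running times. -/

namespace RAM

variable {R A : Type}

/-- The registers that a command may change. -/
def Cmd.SetsReg : Cmd R A → R → Prop
  | .skip, _ => False
  | .assign y _, x => x = y
  | .write _ _ _, _ => False
  | .seq c d, x => c.SetsReg x ∨ d.SetsReg x
  | .ite _ c d, x => c.SetsReg x ∨ d.SetsReg x
  | .while _ c, x => c.SetsReg x

/-- The arrays that a command may change. -/
def Cmd.SetsArr : Cmd R A → A → Prop
  | .skip, _ => False
  | .assign _ _, _ => False
  | .write b _ _, a => a = b
  | .seq c d, a => c.SetsArr a ∨ d.SetsArr a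
  | .ite _ c d, a => c.SetsArr a ∨ d.SetsArr a
  | .while _ c, a => c.SetsArr a

/-- The two states agree on everything that the command cannot change. -/
def Cmd.Frame (c : Cmd R A) (σ σ' : State R A) : Prop :=
  (∀ x, ¬ c.SetsReg x → σ'.reg x = σ.reg x) ∧ ∀ a, ¬ c.SetsArr a → σ'.arr a = σ.arr a

theorem Cmd.Frame.refl (c : Cmd R A) (σ : State R A) : c.Frame σ σ :=
  ⟨fun _ _ => rfl, fun _ _ => rfl⟩

theorem Cmd.Frame.trans {c : Cmd R A} {σ₁ σ₂ σ₃ : State R A} (h : c.Frame σ₁ σ₂)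
    (h' : c.Frame σ₂ σ₃) : c.Frame σ₁ σ₃ :=
  ⟨fun x hx => (h'.1 x hx).trans (h.1 x hx), fun a ha => (h'.2 a ha).trans (h.2 a ha)⟩

theorem Cmd.Frame.mono {c d : Cmd R A} {σ₁ σ₂ : State R A} (h : c.Frame σ₁ σ₂)
    (hr : ∀ x, c.SetsReg x → d.SetsReg x) (ha : ∀ a, c.SetsArr a → d.SetsArr a) :
    d.Frame σ₁ σ₂ :=
  ⟨fun x hx => h.1 x fun k => hx (hr x k), fun a hx => h.2 a fun k => hx (ha a k)⟩

variable [DecidableEq R] [DecidableEq A]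

@[simp] theorem State.reg_setReg (σ : State R A) (x y : R) (k : ℕ) :
    (σ.setReg x k).reg y = if y = x then k else σ.reg y := by
  simp [State.setReg, Function.update_apply]

@[simp] theorem State.arr_setReg (σ : State R A) (x : R) (k : ℕ) :
    (σ.setReg x k).arr = σ.arr := rfl

@[simp] theorem State.reg_setArr (σ : State R A) (a : A) (i k : ℕ) :
    (σ.setArr a i k).reg = σ.reg := rfl

@[simp] theorem State.arr_setArr (σ : State R A) (a b : A) (i k : ℕ) :
    (σ.setArr a i k).arr b = if b = a then Function.update (σ.arr a) i k else σ.arr b := by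
  unfold State.setArr
  by_cases h : b = a
  · subst h; simp
  · simp [h]

theorem Exec.frame {c : Cmd R A} {σ σ' : State R A} {t : ℕ} (h : Exec c σ σ' t) :
    c.Frame σ σ' := by
  induction h with
  | skip => exact .refl _ _
  | assign => constructor <;> intro x hx <;> simp_all [Cmd.SetsReg]
  | write => constructor <;> intro x hx <;> simp_all [Cmd.SetsArr]
  | seq _ _ ih₁ ih₂ =>
    exact (ih₁.mono (fun _ => Or.inl) (fun _ => Or.inl)).trans
      (ih₂.mono (fun _ => Or.inr) (fun _ => Or.inr))
  | ite_true _ _ ih => exact ih.mono (fun _ => Or.inl) (fun _ => Or.inl)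
  | ite_false _ _ ih => exact ih.mono (fun _ => Or.inr) (fun _ => Or.inr)
  | while_true _ _ _ ih₁ ih₂ =>
    exact Cmd.Frame.trans (ih₁.mono (fun _ => id) (fun _ => id)) ih₂
  | while_false => exact .refl _ _

/-- The program halts, and the final state and the number of steps satisfy `Q`. -/
def WP (c : Cmd R A) (σ : State R A) (Q : State R A → ℕ → Prop) : Prop :=
  ∃ σ' t, Exec c σ σ' t ∧ Q σ' t

variable {c d : Cmd R A} {b : Test R A} {σ : State R A} {Q Q' : State R A → ℕ → Prop}

theorem WP.mono (h : WP c σ Q) (hQ : ∀ σ' t, Q σ' t → Q' σ' t) : WP c σ Q' := by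
  obtain ⟨σ', t, he, hq⟩ := h
  exact ⟨σ', t, he, hQ _ _ hq⟩

theorem WP.mono_frame (h : WP c σ Q) (hQ : ∀ σ' t, c.Frame σ σ' → Q σ' t → Q' σ' t) :
    WP c σ Q' := by
  obtain ⟨σ', t, he, hq⟩ := h
  exact ⟨σ', t, he, hQ _ _ he.frame hq⟩

theorem wp_skip : WP .skip σ Q ↔ Q σ 1 :=
  ⟨by rintro ⟨_, _, ⟨⟩, h⟩; exact h, fun h => ⟨_, _, .skip _, h⟩⟩

theorem wp_assign {x : R} {e : Expr R A} :
    WP (.assign x e) σ Q ↔ Q (σ.setReg x (e.eval σ)) (e.cost + 1) :=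
  ⟨by rintro ⟨_, _, ⟨⟩, h⟩; exact h, fun h => ⟨_, _, .assign _ _ _, h⟩⟩

theorem wp_write {a : A} {i e : Expr R A} :
    WP (.write a i e) σ Q ↔ Q (σ.setArr a (i.eval σ) (e.eval σ)) (i.cost + e.cost + 1) :=
  ⟨by rintro ⟨_, _, ⟨⟩, h⟩; exact h, fun h => ⟨_, _, .write _ _ _ _, h⟩⟩

theorem wp_seq : WP (.seq c d) σ Q ↔
    WP c σ fun σ₁ t₁ => WP d σ₁ fun σ₂ t₂ => Q σ₂ (t₁ + t₂ + 1) := by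
  constructor
  · rintro ⟨_, _, ⟨⟩, h⟩
    exact ⟨_, _, ‹_›, _, _, ‹_›, h⟩
  · rintro ⟨_, _, h₁, _, _, h₂, h⟩
    exact ⟨_, _, .seq h₁ h₂, h⟩

theorem wp_ite : WP (.ite b c d) σ Q ↔
    (b.Holds σ → WP c σ fun σ' t => Q σ' (b.cost + t + 1)) ∧
    (¬ b.Holds σ → WP d σ fun σ' t => Q σ' (b.cost + t + 1)) := by
  constructor
  · rintro ⟨_, _, he, h⟩
    cases he with
    | ite_true hb he => exact ⟨fun _ => ⟨_, _, he, h⟩, fun k => absurd hb k⟩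
    | ite_false hb he => exact ⟨fun k => absurd k hb, fun _ => ⟨_, _, he, h⟩⟩
  · rintro ⟨h₁, h₂⟩
    by_cases hb : b.Holds σ
    · obtain ⟨_, _, he, h⟩ := h₁ hb; exact ⟨_, _, .ite_true hb he, h⟩
    · obtain ⟨_, _, he, h⟩ := h₂ hb; exact ⟨_, _, .ite_false hb he, h⟩

theorem wp_when : WP (.when b c) σ Q ↔
    (b.Holds σ → WP c σ fun σ' t => Q σ' (b.cost + t + 1)) ∧
    (¬ b.Holds σ → Q σ (b.cost + 2)) := by
  rw [Cmd.when, wp_ite, wp_skip]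

/-- Loop rule: a bound on the time that the invariant provides ensures termination. -/
theorem WP.while {b : Test R A} {c : Cmd R A} {σ : State R A} {Q : State R A → ℕ → Prop}
    (I : State R A → ℕ → Prop) (B : ℕ) (h₀ : I σ 0)
    (hB : ∀ σ' t, I σ' t → t ≤ B)
    (step : ∀ σ' t, c.Frame σ σ' → I σ' t → b.Holds σ' →
      WP c σ' fun σ'' t' => I σ'' (t + t' + b.cost + 1))
    (exit : ∀ σ' t, c.Frame σ σ' → I σ' t → ¬ b.Holds σ' → Q σ' (t + b.cost + 1)) :
    WP (.while b c) σ Q := by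
  -- Induction on the unused budget: every round costs at least one step, so `B + 1 - t` drops,
  -- while the invariant itself keeps `t ≤ B`.
  suffices H : ∀ m σ' t, B + 1 - t ≤ m → c.Frame σ σ' → I σ' t →
      WP (.while b c) σ' fun σ'' t' => Q σ'' (t + t') by
    have := H _ σ 0 le_rfl (.refl _ _) h₀
    simpa using this
  intro m
  induction m with
  | zero => intro σ' t hm _ hI; have := hB _ _ hI; omega
  | succ m ih =>
    intro σ' t hm hf hI
    by_cases hb : b.Holds σ'
    · obtain ⟨σ₂, t₂, he, hI₂⟩ := step σ' t hf hI hb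
      obtain ⟨σ₃, t₃, he₃, hQ⟩ := ih σ₂ _ (by have := hB _ _ hI; omega) (hf.trans he.frame) hI₂
      refine ⟨σ₃, _, .while_true hb he he₃, ?_⟩
      convert hQ using 1; omega
    · exact ⟨σ', _, .while_false hb, by simpa [add_assoc] using exit σ' t hf hI hb⟩

/-- Rule for a loop whose number of rounds is known in advance. -/
theorem WP.while_count {b : Test R A} {c : Cmd R A} {σ : State R A} {Q : State R A → ℕ → Prop}
    (lo hi : ℕ) (hle : lo ≤ hi) (I : ℕ → State R A → ℕ → Prop) (h₀ : I lo σ 0)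
    (step : ∀ k σ' t, lo ≤ k → k < hi → c.Frame σ σ' → I k σ' t → b.Holds σ' ∧
      WP c σ' fun σ'' t' => I (k + 1) σ'' (t + t' + b.cost + 1))
    (exit : ∀ σ' t, c.Frame σ σ' → I hi σ' t → ¬ b.Holds σ' ∧ Q σ' (t + b.cost + 1)) :
    WP (.while b c) σ Q := by
  suffices H : ∀ m k σ' t, hi - k = m → lo ≤ k → k ≤ hi → c.Frame σ σ' → I k σ' t →
      WP (.while b c) σ' fun σ'' t' => Q σ'' (t + t') by
    have := H _ lo σ 0 rfl le_rfl hle (.refl _ _) h₀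
    simpa using this
  intro m
  induction m with
  | zero =>
    intro k σ' t hm _ hk hf hI
    obtain rfl : k = hi := by omega
    obtain ⟨hb, hq⟩ := exit σ' t hf hI
    exact ⟨σ', _, .while_false hb, by simpa [add_assoc] using hq⟩
  | succ m ih =>
    intro k σ' t hm hlo hk hf hI
    obtain ⟨hb, σ₂, t₂, he, hI₂⟩ := step k σ' t hlo (by omega) hf hI
    obtain ⟨σ₃, t₃, he₃, hQ⟩ := ih (k + 1) σ₂ _ (by omega) (by omega) (by omega)
      (hf.trans he.frame) hI₂
    refine ⟨σ₃, _, .while_true hb he he₃, ?_⟩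
    convert hQ using 1; omega

end RAM

/-! ### Scanning a fanout list. -/

namespace DominatorAlg

open RAM

attribute [simp] Cmd.SetsReg Cmd.SetsArr Cmd.when Expr.cost Test.cost Expr.eval Test.Holds

/-- One round of the scan of a fanout list. -/
def scan (body : Prog) : Prog :=
  Reg.y ::= .read .adj Reg.e ;; Reg.e ::= .succ Reg.e ;; body

attribute [simp] scan

/-- Rule for the scan of the fanout of a vertex. -/
theorem wp_fanout {v : Reg} {body : Prog} {σ : State Reg Arr} {Q : State Reg Arr → ℕ → Prop}
    (hv : v ≠ .y ∧ v ≠ .e ∧ ¬ body.SetsReg v) (he : ¬ body.SetsReg .e)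
    (ho : ¬ body.SetsArr .off)
    (hle : σ.reg .e ≤ σ.arr .off (σ.reg v + 1))
    (I : ℕ → State Reg Arr → ℕ → Prop) (h₀ : I (σ.reg .e) σ 0)
    (step : ∀ k σ' t, σ.reg .e ≤ k → k < σ.arr .off (σ.reg v + 1) → (scan body).Frame σ σ' →
      σ'.reg .e = k → I k σ' t →
      WP body ((σ'.setReg .y (σ'.arr .adj k)).setReg .e (k + 1))
        fun σ'' t' => I (k + 1) σ'' (t + t' + 14))
    (exit : ∀ σ' t, (scan body).Frame σ σ' →
      I (σ.arr .off (σ.reg v + 1)) σ' t → Q σ' (t + 6)) :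
    WP (.while (.lt Reg.e (.read .off (.succ v)))
      (Reg.y ::= .read .adj Reg.e ;; Reg.e ::= .succ Reg.e ;; body)) σ Q := by
  refine WP.while_count (σ.reg .e) _ hle (fun k σ' t => σ'.reg .e = k ∧ I k σ' t) ⟨rfl, h₀⟩ ?_ ?_
  · rintro k σ' t h₁ h₂ hf ⟨hk, hI⟩
    have ho' : σ'.arr .off = σ.arr .off := hf.2 _ (by simpa using ho)
    have hv' : σ'.reg v = σ.reg v := hf.1 _ (by simp [hv])
    refine ⟨by simp [hk, ho', hv', h₂], ?_⟩
    rw [wp_seq, wp_assign, wp_seq, wp_assign]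
    have := step k σ' t h₁ h₂ hf hk hI
    simp only [Expr.eval, State.reg_setReg, hk, reduceCtorEq, if_false]
    refine this.mono_frame fun σ'' t' hf' h => ⟨?_, ?_⟩
    · rw [hf'.1 _ he]; simp
    -- The 14 steps of a round are 3 for each of the two assignments, 2 for the sequencing and 6 for
    -- the loop test.
    · convert h using 1; simp; omega
  · rintro σ' t hf ⟨hk, hI⟩
    have ho' : σ'.arr .off = σ.arr .off := hf.2 _ (by simpa using ho)
    have hv' : σ'.reg v = σ.reg v := hf.1 _ (by simp [hv])
    exact ⟨by simp [hk, ho', hv'], by simpa using exit σ' t hf hI⟩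

end DominatorAlg

/-! ### Acyclic networks: reachability, avoidance, and potentials for the running time. -/

/-- A finite acyclic network on natural numbers that is stored by fanout lists; `h` witnesses that it is acyclic. -/
structure Net where
  n : ℕ
  E : ℕ → ℕ → Prop
  h : ℕ → ℕ
  off : ℕ → ℕ
  adj : ℕ → ℕ
  u : ℕ
  root : ℕ
  lt_right : ∀ {a b}, E a b → b < n
  h_lt : ∀ {a b}, E a b → h b < h a
  mono : ∀ v < n, off v ≤ off (v + 1)
  edge : ∀ v < n, ∀ w, E v w ↔ ∃ e, off v ≤ e ∧ e < off (v + 1) ∧ adj e = w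
  u_lt : u < n

namespace Net

variable (N : Net)

/-- Reachability. -/
def Reach : ℕ → ℕ → Prop := Relation.ReflTransGen N.E

/-- Reachability by a path that avoids the set `A`. -/
def Av (A : Set ℕ) (x y : ℕ) : Prop :=
  x ∉ A ∧ Relation.ReflTransGen (fun a b => N.E a b ∧ b ∉ A) x y

/-- The vertices on paths from `s` to the root. -/
def Live (s : ℕ) : Set ℕ := {v | N.Reach s v ∧ N.Reach v N.root}

variable {N}

theorem Reach.refl (x : ℕ) : N.Reach x x := Relation.ReflTransGen.refl
theorem Reach.trans {x y z : ℕ} (h : N.Reach x y) (h' : N.Reach y z) : N.Reach x z :=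
  Relation.ReflTransGen.trans h h'
theorem Reach.tail {x y z : ℕ} (h : N.Reach x y) (h' : N.E y z) : N.Reach x z :=
  Relation.ReflTransGen.tail h h'
theorem Reach.head {x y z : ℕ} (h' : N.E x y) (h : N.Reach y z) : N.Reach x z :=
  Relation.ReflTransGen.head h' h
theorem Reach.single {x y : ℕ} (h : N.E x y) : N.Reach x y := Relation.ReflTransGen.single h

/-- The height `h` turns acyclicity into arithmetic: it strictly drops along an edge and so never
increases along a path. -/
theorem Reach.h_le {x y : ℕ} (h : N.Reach x y) : N.h y ≤ N.h x := by
  induction h with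
  | refl => exact le_rfl
  | tail _ h ih => exact (N.h_lt h).le.trans ih

theorem Reach.eq_or_lt {x y : ℕ} (h : N.Reach x y) : x = y ∨ N.h y < N.h x := by
  induction h with
  | refl => exact .inl rfl
  | tail h₁ h ih => exact .inr ((N.h_lt h).trans_le (Reach.h_le h₁))

theorem Reach.antisymm {x y : ℕ} (h : N.Reach x y) (h' : N.Reach y x) : x = y := by
  rcases h.eq_or_lt with h1 | h1
  · exact h1
  · have := h'.h_le; omega

theorem not_E_of_reach {x y : ℕ} (h : N.Reach x y) : ¬ N.E y x := fun k => by
  have := N.h_lt k; have := h.h_le; omega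

theorem ne_of_E {x y : ℕ} (h : N.E x y) : x ≠ y := by
  rintro rfl; exact not_E_of_reach (.refl x) h

theorem Reach.lt {x y : ℕ} (h : N.Reach x y) (hx : x < N.n) : y < N.n := by
  induction h with
  | refl => exact hx
  | tail _ h _ => exact N.lt_right h

variable {A B : Set ℕ}

theorem Av.reach {x y : ℕ} (h : N.Av A x y) : N.Reach x y :=
  Relation.ReflTransGen.mono (fun _ _ k => k.1) _ _ h.2

theorem Av.refl {x : ℕ} (h : x ∉ A) : N.Av A x x := ⟨h, .refl⟩
theorem Av.left {x y : ℕ} (h : N.Av A x y) : x ∉ A := h.1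

theorem Av.right {x y : ℕ} (h : N.Av A x y) : y ∉ A := by
  obtain ⟨h0, h⟩ := h
  cases h with
  | refl => exact h0
  | tail _ h => exact h.2

theorem Av.trans {x y z : ℕ} (h : N.Av A x y) (h' : N.Av A y z) : N.Av A x z :=
  ⟨h.1, h.2.trans h'.2⟩
theorem Av.tail {x y z : ℕ} (h : N.Av A x y) (h' : N.E y z) (hz : z ∉ A) : N.Av A x z :=
  ⟨h.1, h.2.tail ⟨h', hz⟩⟩
theorem Av.head {x y z : ℕ} (h' : N.E x y) (hx : x ∉ A) (h : N.Av A y z) : N.Av A x z :=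
  ⟨hx, h.2.head ⟨h', h.1⟩⟩
theorem Av.mono {x y : ℕ} (hAB : A ⊆ B) (h : N.Av B x y) : N.Av A x y :=
  ⟨fun k => h.1 (hAB k), Relation.ReflTransGen.mono (fun _ _ k => ⟨k.1, fun l => k.2 (hAB l)⟩) _ _ h.2⟩

theorem Av.induction {x y : ℕ} {P : ℕ → Prop} (h : N.Av A x y) (h₀ : P x)
    (step : ∀ a b, N.Av A x a → P a → N.E a b → b ∉ A → P b) : P y := by
  obtain ⟨hx, h⟩ := h
  induction h with
  | refl => exact h₀
  | tail h₁ h ih => exact step _ _ ⟨hx, h₁⟩ ih h.1 h.2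

theorem Av.head_induction {x y : ℕ} {P : ℕ → Prop} (h : N.Av A x y) (h₀ : P y)
    (step : ∀ a b, N.E a b → a ∉ A → N.Av A b y → P b → P a) : P x := by
  obtain ⟨hx, h⟩ := h
  induction h using Relation.ReflTransGen.head_induction_on with
  | refl => exact h₀
  | head h₁ h ih => exact step _ _ h₁.1 hx ⟨h₁.2, h⟩ (ih h₁.2)

/-- A path either avoids `A ∪ B` or its first vertex in `A ∪ B` is reached while avoiding. -/
theorem Reach.first (A : Set ℕ) {x y : ℕ} (h : N.Reach x y) :
    N.Av A x y ∨ x ∈ A ∨ ∃ a b, N.Av A x a ∧ N.E a b ∧ b ∈ A ∧ N.Reach b y := by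
  by_cases hx : x ∈ A
  · exact .inr (.inl hx)
  induction h with
  | refl => exact .inl (.refl hx)
  | @tail b c h₁ h ih =>
    rcases ih with ih | ih | ⟨a, b', h2, h3, h4, h5⟩
    · by_cases hc : c ∈ A
      · exact .inr (.inr ⟨_, _, ih, h, hc, .refl _⟩)
      · exact .inl (ih.tail h hc)
    · exact absurd ih hx
    · exact .inr (.inr ⟨_, _, h2, h3, h4, h5.tail h⟩)

/-- A path that avoids `B` either avoids `A`, or has a first vertex in `A`. -/
theorem Av.first (A : Set ℕ) {x y : ℕ} (h : N.Av B x y) :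
    N.Av (A ∪ B) x y ∨ x ∈ A ∨ ∃ a b, N.Av (A ∪ B) x a ∧ N.E a b ∧ b ∈ A ∧ N.Av B b y := by
  by_cases hx : x ∈ A
  · exact .inr (.inl hx)
  refine h.induction (P := fun y => N.Av (A ∪ B) x y ∨ x ∈ A ∨ ∃ a b, N.Av (A ∪ B) x a ∧ N.E a b ∧
    b ∈ A ∧ N.Av B b y) (.inl (.refl (by simp [hx, h.1]))) ?_
  rintro b c - (ih | ih | ⟨a, b', h2, h3, h4, h5⟩) hE hc
  · by_cases hcA : c ∈ A
    · exact .inr (.inr ⟨_, _, ih, hE, hcA, .refl hc⟩)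
    · exact .inl (ih.tail hE (by simp [hc, hcA]))
  · exact absurd ih hx
  · exact .inr (.inr ⟨_, _, h2, h3, h4, h5.tail hE hc⟩)

/-- A vertex outside of the reach of `x` is avoided. -/
theorem Reach.av {x y : ℕ} (h : N.Reach x y) (hA : ∀ a ∈ A, N.Reach x a → ¬ N.Reach a y) :
    N.Av A x y := by
  rcases h.first A with h | h | ⟨a, b, h₁, h₂, h₃, h₄⟩
  · exact h
  · exact absurd ‹_› (hA _ h (.refl _))
  · exact absurd h₄ (hA _ h₃ (h₁.reach.tail h₂))

variable (N)

def deg (v : ℕ) : ℕ := N.off (v + 1) - N.off v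

open Classical in
/-- The vertices reachable from `u`. -/
noncomputable def verts : Finset ℕ := {v ∈ Finset.range N.n | N.Reach N.u v}

variable {N}

theorem mem_verts {v : ℕ} : v ∈ N.verts ↔ N.Reach N.u v := by
  simp only [verts, Finset.mem_filter, Finset.mem_range, and_iff_right_iff_imp]
  exact fun h => h.lt N.u_lt

variable (N)

/-- The work that remains for a search that visits the unmarked vertices. -/
noncomputable def work (vis : ℕ → ℕ) : ℕ :=
  ∑ v ∈ N.verts, if vis v = 0 then N.deg v + 1 else 0

/-- The work for the vertices on a stack. -/
def stackWork (stk : ℕ → ℕ) (sp : ℕ) : ℕ := ∑ i ∈ Finset.range sp, (N.deg (stk i) + 1)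

variable {N}

/-- Marking a vertex releases exactly its charge `deg v + 1`. The released amount pays for pushing
the vertex (`stackWork_push`) and later for scanning its fanout, so that several searches with
common marks are linear altogether. -/
theorem work_update {vis : ℕ → ℕ} {v k : ℕ} (hv : N.Reach N.u v) (h : vis v = 0) (hk : k ≠ 0) :
    N.work (update vis v k) + (N.deg v + 1) = N.work vis := by
  unfold work
  rw [← Finset.sum_erase_add _ _ (mem_verts.2 hv), ← Finset.sum_erase_add _ _ (mem_verts.2 hv)]
  simp only [update_self, hk, if_false, h, if_true, add_zero]
  congr 1
  refine Finset.sum_congr rfl fun x hx => ?_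
  rw [update_of_ne (Finset.ne_of_mem_erase hx)]

theorem stackWork_push {stk : ℕ → ℕ} {sp v : ℕ} :
    N.stackWork (update stk sp v) (sp + 1) = N.stackWork stk sp + (N.deg v + 1) := by
  unfold stackWork
  rw [Finset.sum_range_succ, update_self]
  congr 1
  refine Finset.sum_congr rfl fun x hx => ?_
  rw [update_of_ne (Finset.mem_range.1 hx).ne]

theorem stackWork_succ {stk : ℕ → ℕ} {sp : ℕ} :
    N.stackWork stk (sp + 1) = N.stackWork stk sp + (N.deg (stk sp) + 1) :=
  Finset.sum_range_succ _ _

/-- The memory holds the network. -/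
structure Holds (N : Net) (σ : RAM.State DominatorAlg.Reg DominatorAlg.Arr) : Prop where
  off : σ.arr .off = N.off
  adj : σ.arr .adj = N.adj

end Net

/-! ### Jumps and the search `FindReachable`. -/

namespace Net

/-- `y` is reached from `x` by an edge after a path that, apart from `x`, avoids `S`. -/
def Jump (N : Net) (S : Set ℕ) (x y : ℕ) : Prop :=
  ∃ z, Relation.ReflTransGen (fun a b => N.E a b ∧ b ∉ S) x z ∧ N.E z y

theorem Jump.reach {N : Net} {S : Set ℕ} {x y : ℕ} (h : N.Jump S x y) : N.Reach x y := by
  obtain ⟨z, h₁, h₂⟩ := h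
  exact Relation.ReflTransGen.tail (Relation.ReflTransGen.mono (fun _ _ k => k.1) _ _ h₁) h₂

end Net

namespace DominatorAlg

open RAM

/-- The position of `y` on a path to `t`, which is `0` if `y` is not on the path. -/
def posOn (t len lab : ℕ) (side pos : ℕ → ℕ) (y : ℕ) : ℕ :=
  if y = t then len else if side y = lab then pos y else 0

/-- The maximum `r'` of `r` and the values of `f` at newly marked vertices. -/
structure MaxInv (r r' : ℕ) (new jump : ℕ → Prop) (f : ℕ → ℕ) : Prop where
  le : r ≤ r'
  ub : ∀ y, new y → f y ≤ r'
  att : r' = r ∨ ∃ y, jump y ∧ f y = r'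

theorem MaxInv.visit {r r' : ℕ} {new new' jump : ℕ → Prop} {f : ℕ → ℕ} (h : MaxInv r r' new jump f)
    {y : ℕ} (hy : jump y) (hn : ∀ x, new' x → new x ∨ x = y) :
    MaxInv r (max r' (f y)) new' jump f := by
  refine ⟨h.le.trans (le_max_left _ _), fun x hx => ?_, ?_⟩
  · rcases hn x hx with h1 | rfl
    · exact (h.ub _ h1).trans (le_max_left _ _)
    · exact le_max_right _ _
  · rcases le_total (f y) r' with h1 | h1
    · rw [max_eq_left h1]; exact h.att
    · rw [max_eq_right h1]; exact .inr ⟨y, hy, rfl⟩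

variable {N : Net}

/-- Marks of earlier searches, `mark₀`, are respected, so only the start and newly marked vertices
have to be closed. The predicate `act` holds for the vertex whose fanout is just being scanned. The
`max` fields compare the maxima with all new vertices and, conversely, attribute an increase to some
jump. -/
structure FindInv (N : Net) (S : Set ℕ) (x₀ : ℕ) (mark₀ f₁ f₂ : ℕ → ℕ) (r₁ r₂ : ℕ)
    (act : ℕ → Prop) (mark stk : ℕ → ℕ) (sp n₁ n₂ : ℕ) : Prop where
  mono : ∀ y, mark₀ y ≠ 0 → mark y ≠ 0
  new : ∀ y, mark₀ y = 0 → mark y ≠ 0 → N.Jump S x₀ y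
  stack : ∀ i < sp, Relation.ReflTransGen (fun a b => N.E a b ∧ b ∉ S) x₀ (stk i)
  closed : ∀ v, (v = x₀ ∨ (mark₀ v = 0 ∧ mark v ≠ 0 ∧ v ∉ S)) →
    act v ∨ (∃ i < sp, stk i = v) ∨ ∀ y, N.E v y → mark y ≠ 0
  max₁ : MaxInv r₁ n₁ (fun y => mark₀ y = 0 ∧ mark y ≠ 0) (N.Jump S x₀) f₁
  max₂ : MaxInv r₂ n₂ (fun y => mark₀ y = 0 ∧ mark y ≠ 0) (N.Jump S x₀) f₂

variable {S : Set ℕ} {x₀ : ℕ} {mark₀ f₁ f₂ : ℕ → ℕ} {r₁ r₂ : ℕ} {act : ℕ → Prop}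
  {mark stk : ℕ → ℕ} {sp n₁ n₂ : ℕ}

/-- A vertex of `S` ends a jump: it is marked and its positions count for the maxima, but only
vertices outside `S` are pushed, because only they may be inner vertices of a jump. -/
theorem FindInv.visit (h : FindInv N S x₀ mark₀ f₁ f₂ r₁ r₂ act mark stk sp n₁ n₂) {z y : ℕ}
    (hz : Relation.ReflTransGen (fun a b => N.E a b ∧ b ∉ S) x₀ z) (hE : N.E z y)
    (hy : mark y = 0) {stk' : ℕ → ℕ} {sp' : ℕ}
    (hs : (y ∈ S ∧ stk' = stk ∧ sp' = sp) ∨ (y ∉ S ∧ stk' = update stk sp y ∧ sp' = sp + 1)) :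
    FindInv N S x₀ mark₀ f₁ f₂ r₁ r₂ act (update mark y 1) stk' sp' (max n₁ (f₁ y)) (max n₂ (f₂ y)) := by
  have hJ : N.Jump S x₀ y := ⟨z, hz, hE⟩
  have hm : ∀ v, update mark y 1 v ≠ 0 ↔ mark v ≠ 0 ∨ v = y := by
    intro v
    by_cases hv : v = y
    · subst hv; simp
    · simp [hv, update_of_ne]
  refine ⟨fun v hv => (hm v).2 (.inl (h.mono v hv)), fun v h0 h1 => ?_, ?_, ?_, ?_, ?_⟩
  · rcases (hm v).1 h1 with h1 | rfl
    · exact h.new v h0 h1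
    · exact hJ
  · intro i hi
    rcases hs with ⟨_, rfl, rfl⟩ | ⟨hyS, rfl, rfl⟩
    · exact h.stack i hi
    · by_cases his : i = sp
      · subst his; rw [update_self]; exact hz.tail ⟨hE, hyS⟩
      · rw [update_of_ne his]; exact h.stack i (by omega)
  · have hold : ∀ v, (v = x₀ ∨ (mark₀ v = 0 ∧ mark v ≠ 0 ∧ v ∉ S)) →
        act v ∨ (∃ i < sp', stk' i = v) ∨ ∀ y', N.E v y' → update mark y 1 y' ≠ 0 := by
      intro v hv
      rcases h.closed v hv with h1 | ⟨i, hi, h1⟩ | h1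
      · exact .inl h1
      · refine .inr (.inl ?_)
        rcases hs with ⟨_, rfl, rfl⟩ | ⟨hyS, rfl, rfl⟩
        · exact ⟨i, hi, h1⟩
        · exact ⟨i, by omega, by rw [update_of_ne (by omega), h1]⟩
      · exact .inr (.inr fun y' hy' => (hm y').2 (.inl (h1 y' hy')))
    rintro v (rfl | ⟨h0, h1, h2⟩)
    · exact hold _ (.inl rfl)
    · rcases (hm v).1 h1 with h1 | rfl
      · exact hold v (.inr ⟨h0, h1, h2⟩)
      · rcases hs with ⟨hyS, rfl, rfl⟩ | ⟨hyS, rfl, rfl⟩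
        · exact absurd hyS h2
        · exact .inr (.inl ⟨sp, by omega, by simp⟩)
  · exact h.max₁.visit hJ fun v hv => ((hm v).1 hv.2).imp_left fun k => ⟨hv.1, k⟩
  · exact h.max₂.visit hJ fun v hv => ((hm v).1 hv.2).imp_left fun k => ⟨hv.1, k⟩

/-- The result of a search from `x₀`. -/
structure Found (N : Net) (S : Set ℕ) (x₀ : ℕ) (mark₀ f₁ f₂ : ℕ → ℕ) (r₁ r₂ : ℕ)
    (mark : ℕ → ℕ) (n₁ n₂ : ℕ) : Prop where
  mono : ∀ y, mark₀ y ≠ 0 → mark y ≠ 0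
  new : ∀ y, mark₀ y = 0 → mark y ≠ 0 → N.Jump S x₀ y
  closed : ∀ v, (v = x₀ ∨ (mark₀ v = 0 ∧ mark v ≠ 0 ∧ v ∉ S)) → ∀ y, N.E v y → mark y ≠ 0
  max₁ : MaxInv r₁ n₁ (fun y => mark₀ y = 0 ∧ mark y ≠ 0) (N.Jump S x₀) f₁
  max₂ : MaxInv r₂ n₂ (fun y => mark₀ y = 0 ∧ mark y ≠ 0) (N.Jump S x₀) f₂

theorem label_inj {a b : Bool} : label a = label b ↔ a = b := by
  cases a <;> cases b <;> simp [label]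

theorem label_ne_zero {b : Bool} : label b ≠ 0 := by
  cases b <;> simp [label]

/-- The time is amortised by `work` and `stackWork`: a newly marked vertex gives up its charge,
which covers pushing it and scanning its fanout. The start is pushed without being marked, whence
the extra `deg + 1`. The sink has the last position on both paths, so reaching it raises both maxima
to the lengths. -/
theorem wp_findReachable {mark side pos : Arr} {b : Bool} {σ : State Reg Arr}
    (hσ : N.Holds σ) (hx : N.Reach N.u (σ.reg .x))
    (hd : mark ≠ .stk ∧ mark ≠ .off ∧ mark ≠ .adj ∧ mark ≠ side ∧ mark ≠ pos ∧ side ≠ .stk ∧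
      pos ≠ .stk)
    (hS : S = {y | y = σ.reg .t ∨ ∃ c, σ.arr side y = label c})
    (hf₁ : f₁ = posOn (σ.reg .t) (σ.reg (.len b)) (label b) (σ.arr side) (σ.arr pos))
    (hf₂ : f₂ = posOn (σ.reg .t) (σ.reg (.len !b)) (label !b) (σ.arr side) (σ.arr pos))
    (hle₁ : ∀ y, N.Reach (σ.reg .x) y → f₁ y ≤ σ.reg (.len b))
    (hle₂ : ∀ y, N.Reach (σ.reg .x) y → f₂ y ≤ σ.reg (.len !b))
    (hn₁ : σ.reg .newReached₁ ≤ σ.reg (.len b)) (hn₂ : σ.reg .newReached₂ ≤ σ.reg (.len !b)) :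
    WP (findReachable mark side pos b) σ fun σ' t =>
      Found N S (σ.reg .x) (σ.arr mark) f₁ f₂ (σ.reg .newReached₁) (σ.reg .newReached₂)
        (σ'.arr mark) (σ'.reg .newReached₁) (σ'.reg .newReached₂) ∧
      σ'.reg .newReached₁ ≤ σ.reg (.len b) ∧ σ'.reg .newReached₂ ≤ σ.reg (.len !b) ∧
      t + 100 * N.work (σ'.arr mark) ≤
        100 * N.work (σ.arr mark) + 100 * (N.deg (σ.reg .x) + 1) + 20 := by
  obtain ⟨d1, d2, d3, d4, d5, d6, d7⟩ := hd
  set x₀ := σ.reg .x with hx₀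
  set l₁ := σ.reg (.len b) with hl₁
  set l₂ := σ.reg (.len !b) with hl₂
  set tt := σ.reg .t with htt
  have hlab : label b ≠ label !b := by simp [label_inj]
  have hlab' : label (!b) ≠ label b := by simp [label_inj]
  unfold findReachable
  simp only [wp_seq, wp_write, wp_assign]
  refine WP.while (fun σ' t =>
    FindInv N S x₀ (σ.arr mark) f₁ f₂ (σ.reg .newReached₁) (σ.reg .newReached₂) (fun _ => False)
      (σ'.arr mark) (σ'.arr .stk) (σ'.reg .sp) (σ'.reg .newReached₁) (σ'.reg .newReached₂) ∧
    σ'.reg .newReached₁ ≤ l₁ ∧ σ'.reg .newReached₂ ≤ l₂ ∧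
    t + 100 * N.work (σ'.arr mark) + 100 * N.stackWork (σ'.arr .stk) (σ'.reg .sp) ≤
        100 * N.work (σ.arr mark) + 100 * (N.deg x₀ + 1))
    (100 * N.work (σ.arr mark) + 100 * (N.deg x₀ + 1)) ?_ ?_ ?_ ?_
  · refine ⟨⟨?_, ?_, ?_, ?_, ?_, ?_⟩, ?_, ?_, ?_⟩
    · simp [d1]
    · simp +contextual [d1]
    · intro i hi
      obtain rfl : i = 0 := by simpa using hi
      simpa using .refl
    · rintro v (rfl | h)
      · exact .inr (.inl ⟨0, by simp, by simp [hx₀]⟩)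
      · simp [d1] at h; omega
    · refine ⟨by simp, by simp +contextual [d1], .inl (by simp)⟩
    · refine ⟨by simp, by simp +contextual [d1], .inl (by simp)⟩
    · simpa
    · simpa
    · simp [d1, Net.stackWork, hx₀]
  · rintro σ' t ⟨_, _, _, h⟩; omega
  · rintro σ₁ t₁ hF ⟨hI, hl1, hl2, ht⟩ hb
    have e_side : σ₁.arr side = σ.arr side := by rw [hF.2]; simp [d6]; simp [d4.symm, d6]
    have e_pos : σ₁.arr pos = σ.arr pos := by rw [hF.2]; simp [d7]; simp [d5.symm, d7]
    have e_off : σ₁.arr .off = N.off := by rw [hF.2]; simp [hσ.off]; simp [d2.symm]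
    have e_adj : σ₁.arr .adj = N.adj := by rw [hF.2]; simp [hσ.adj]; simp [d3.symm]
    have e_t : σ₁.reg .t = tt := by rw [hF.1]; simp [htt]; simp
    have e_l1 : σ₁.reg (.len b) = l₁ := by rw [hF.1]; simp [hl₁]; simp
    have e_l2 : σ₁.reg (.len !b) = l₂ := by rw [hF.1]; simp [hl₂]; simp
    obtain ⟨sp, hsp⟩ : ∃ sp, σ₁.reg .sp = sp + 1 := by
      refine Nat.exists_eq_succ_of_ne_zero ?_; simpa using hb
    set z := σ₁.arr .stk sp with hz
    have hzr := hI.stack sp (by omega)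
    rw [← hz] at hzr
    have hxz : N.Reach x₀ z := Relation.ReflTransGen.mono (fun _ _ k => k.1) _ _ hzr
    have huz : N.Reach N.u z := hx.trans hxz
    have hzn := huz.lt N.u_lt
    simp only [wp_seq, wp_assign]
    -- While `z` is scanned it counts as active instead of stacked, and its charge is spent edge by
    -- edge; `k - off z` edges have been paid for.
    refine wp_fanout (v := .z) (by simp) (by simp) (by simp [d2.symm]) ?_ (fun k σ' t =>
      FindInv N S x₀ (σ.arr mark) f₁ f₂ (σ.reg .newReached₁) (σ.reg .newReached₂) (fun v => v = z)
        (σ'.arr mark) (σ'.arr .stk) (σ'.reg .sp) (σ'.reg .newReached₁) (σ'.reg .newReached₂) ∧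
      (∀ e, N.off z ≤ e → e < k → σ'.arr mark (N.adj e) ≠ 0) ∧
      σ'.reg .newReached₁ ≤ l₁ ∧ σ'.reg .newReached₂ ≤ l₂ ∧
      t₁ + t + 100 * N.work (σ'.arr mark) + 100 * N.stackWork (σ'.arr .stk) (σ'.reg .sp)
        + 100 * (N.deg z + 1) ≤
          100 * N.work (σ.arr mark) + 100 * (N.deg x₀ + 1) + 100 * (k - N.off z)) ?_ ?_ ?_
    · simpa [hsp, e_off, hz] using N.mono z hzn
    · rw [hsp, Net.stackWork_succ, ← hz] at ht
      refine ⟨⟨?_, ?_, ?_, ?_, ?_, ?_⟩, ?_, ?_, ?_, ?_⟩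
      · simpa using hI.mono
      · simpa using hI.new
      · intro i hi
        simp [hsp] at hi
        simpa using hI.stack i (by omega)
      · intro v hv
        rcases hI.closed v (by simpa using hv) with h1 | ⟨i, hi, h1⟩ | h1
        · exact h1.elim
        · by_cases his : i = sp
          · exact .inl (by rw [← h1, his])
          · exact .inr (.inl ⟨i, by simp [hsp]; omega, by simpa using h1⟩)
        · exact .inr (.inr (by simpa using h1))
      · simpa using hI.max₁
      · simpa using hI.max₂
      · intro e h1 h2
        simp [hsp, e_off, ← hz] at h2; omega
      · simpa using hl1
      · simpa using hl2
      · simp [hsp]; omega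
    · rintro k σ₂ t₂ hk1 hk2 hF₂ hke ⟨hI₂, hsc, h1, h2, ht₂⟩
      simp [hsp, e_off, ← hz] at hk1 hk2
      have f_side : σ₂.arr side = σ.arr side := by
        rw [hF₂.2]; simp [e_side]; simp [d4.symm, d6]
      have f_pos : σ₂.arr pos = σ.arr pos := by
        rw [hF₂.2]; simp [e_pos]; simp [d5.symm, d7]
      have f_adj : σ₂.arr .adj = N.adj := by rw [hF₂.2]; simp [e_adj]; simp [d3.symm]
      have f_t : σ₂.reg .t = tt := by rw [hF₂.1]; simp [e_t]; simp
      have f_l1 : σ₂.reg (.len b) = l₁ := by rw [hF₂.1]; simp [e_l1]; simp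
      have f_l2 : σ₂.reg (.len !b) = l₂ := by rw [hF₂.1]; simp [e_l2]; simp
      set y := N.adj k with hy
      have hE : N.E z y := (N.edge z hzn y).2 ⟨k, hk1, hk2, rfl⟩
      have hsc' : ∀ m : ℕ → ℕ, (∀ v, σ₂.arr mark v ≠ 0 → m v ≠ 0) → m y ≠ 0 →
          ∀ e, N.off z ≤ e → e < k + 1 → m (N.adj e) ≠ 0 := by
        intro m hm hmy e he1 he2
        rcases Nat.lt_succ_iff_lt_or_eq.1 he2 with he2 | rfl
        · exact hm _ (hsc e he1 he2)
        · exact hmy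
      have hfy1 := hle₁ y (hxz.tail hE)
      have hfy2 := hle₂ y (hxz.tail hE)
      simp only [f_adj, ← hy]
      rw [wp_when]
      simp only [Test.Holds, Expr.eval, State.arr_setReg, State.reg_setReg, Test.cost, Expr.cost,
        if_true, if_false, reduceCtorEq]
      constructor
      · intro hm0
        have hw := N.work_update (vis := σ₂.arr mark) (k := 1) (huz.tail hE) hm0 (by simp)
        have hmu : ∀ v, σ₂.arr mark v ≠ 0 → update (σ₂.arr mark) y 1 v ≠ 0 := by
          intro v hv
          by_cases hvy : v = y
          · subst hvy; simp
          · simpa [update_of_ne hvy] using hv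
        have hmy : update (σ₂.arr mark) y 1 y ≠ 0 := by simp
        have hsc₂ := hsc' _ hmu hmy
        rw [wp_seq, wp_write, wp_ite]
        simp only [Test.Holds, Expr.eval, State.arr_setReg, State.reg_setReg, Test.cost, Expr.cost,
          if_true, if_false, reduceCtorEq, State.reg_setArr, State.arr_setArr, d4.symm,
          d5.symm, d1.symm, f_t]
        constructor
        · intro hyt
          have hv := hI₂.visit hzr hE hm0 (stk' := σ₂.arr .stk) (sp' := σ₂.reg .sp)
            (.inl ⟨by rw [hS]; exact .inl hyt, rfl, rfl⟩)
          have g1 : f₁ y = l₁ := by rw [hf₁]; simp [posOn, hyt]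
          have g2 : f₂ y = l₂ := by rw [hf₂]; simp [posOn, hyt]
          rw [g1, g2, max_eq_right h1, max_eq_right h2] at hv
          simp [wp_seq, wp_assign, f_l1, f_l2, d1.symm]
          refine ⟨hv, fun e a b => hsc₂ e a (by omega), ?_⟩
          omega
        intro hyt
        rw [wp_ite]
        simp only [Test.Holds, Expr.eval, State.arr_setReg, State.reg_setReg, Test.cost, Expr.cost,
          if_true, if_false, reduceCtorEq, State.reg_setArr, State.arr_setArr, d4.symm,
          d5.symm, d1.symm, f_side]
        constructor
        · intro hys
          have hv := hI₂.visit hzr hE hm0 (stk' := σ₂.arr .stk) (sp' := σ₂.reg .sp)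
            (.inl ⟨by rw [hS]; exact .inr ⟨b, hys⟩, rfl, rfl⟩)
          have g1 : f₁ y = σ.arr pos y := by rw [hf₁]; simp [posOn, hyt, hys]
          have g2 : f₂ y = 0 := by rw [hf₂]; simp [posOn, hyt, hys, hlab]
          rw [g1, g2, max_eq_left (Nat.zero_le _)] at hv
          rw [wp_when]
          simp only [Test.Holds, Expr.eval, State.arr_setReg, State.reg_setReg, Test.cost,
            Expr.cost, if_true, if_false, reduceCtorEq, State.reg_setArr, State.arr_setArr, d4.symm,
            d5.symm, d1.symm, f_pos, wp_assign]
          constructor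
          · intro hlt
            rw [max_eq_right hlt.le] at hv
            refine ⟨hv, hsc₂, g1 ▸ hfy1, h2, ?_⟩
            omega
          · intro hlt
            rw [max_eq_left (not_lt.1 hlt)] at hv
            refine ⟨hv, hsc₂, h1, h2, ?_⟩
            omega
        intro hys
        rw [wp_ite]
        simp only [Test.Holds, Expr.eval, State.arr_setReg, State.reg_setReg, Test.cost, Expr.cost,
          if_true, if_false, reduceCtorEq, State.reg_setArr, State.arr_setArr, d4.symm,
          d5.symm, d1.symm, f_side]
        constructor
        · intro hys'
          have hv := hI₂.visit hzr hE hm0 (stk' := σ₂.arr .stk) (sp' := σ₂.reg .sp)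
            (.inl ⟨by rw [hS]; exact .inr ⟨!b, hys'⟩, rfl, rfl⟩)
          have g2 : f₂ y = σ.arr pos y := by rw [hf₂]; simp [posOn, hyt, hys']
          have g1 : f₁ y = 0 := by rw [hf₁]; simp [posOn, hyt, hys', hlab']
          rw [g1, g2, max_eq_left (Nat.zero_le _)] at hv
          rw [wp_when]
          simp only [Test.Holds, Expr.eval, State.arr_setReg, State.reg_setReg, Test.cost,
            Expr.cost, if_true, if_false, reduceCtorEq, State.reg_setArr, State.arr_setArr, d4.symm,
            d5.symm, d1.symm, f_pos, wp_assign]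
          constructor
          · intro hlt
            rw [max_eq_right hlt.le] at hv
            refine ⟨hv, hsc₂, h1, g2 ▸ hfy2, ?_⟩
            omega
          · intro hlt
            rw [max_eq_left (not_lt.1 hlt)] at hv
            refine ⟨hv, hsc₂, h1, h2, ?_⟩
            omega
        · intro hys'
          have hyS : y ∉ S := by
            rw [hS]
            rintro (h | ⟨c, hc⟩)
            · exact hyt h
            · cases c <;> cases b <;> simp_all
          have hv := hI₂.visit hzr hE hm0 (stk' := update (σ₂.arr .stk) (σ₂.reg .sp) y)
            (sp' := σ₂.reg .sp + 1) (.inr ⟨hyS, rfl, rfl⟩)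
          have g2 : f₂ y = 0 := by rw [hf₂]; simp [posOn, hyt, hys']
          have g1 : f₁ y = 0 := by rw [hf₁]; simp [posOn, hyt, hys]
          rw [g1, g2, max_eq_left (Nat.zero_le _), max_eq_left (Nat.zero_le _)] at hv
          simp [wp_seq, wp_assign, wp_write, d1.symm, d1, Net.stackWork_push]
          refine ⟨hv, fun e a b => hsc₂ e a (by omega), h1, h2, ?_⟩
          omega
      · intro hm0
        refine ⟨by simpa using hI₂, hsc' _ (fun _ => id) hm0, h1, h2, ?_⟩
        omega
    · rintro σ₂ t₂ hF₂ ⟨hI₂, hsc, h1, h2, ht₂⟩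
      simp [hsp, e_off, ← hz] at hsc ht₂
      refine ⟨⟨hI₂.mono, hI₂.new, hI₂.stack, fun v hv => ?_, hI₂.max₁, hI₂.max₂⟩, h1, h2, ?_⟩
      · rcases hI₂.closed v hv with h | h | h
        · refine .inr (.inr fun y hy => ?_)
          rw [h] at hy
          obtain ⟨e, he1, he2, rfl⟩ := (N.edge z hzn y).1 hy
          exact hsc e he1 he2
        · exact .inr (.inl h)
        · exact .inr (.inr h)
      · simp only [Net.deg] at ht₂ ⊢
        simp
        omega
  · rintro σ' t hF ⟨hI, h1, h2, ht⟩ hb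
    have hsp : σ'.reg .sp = 0 := by simpa using hb
    refine ⟨⟨hI.mono, hI.new, fun v hv => ?_, hI.max₁, hI.max₂⟩, h1, h2, ?_⟩
    · rcases hI.closed v hv with h | ⟨i, hi, _⟩ | h
      · exact h.elim
      · omega
      · exact h
    · simp; omega

end DominatorAlg

/-! ### Search in the residual network of a flow with unit vertex capacities. -/

namespace DominatorAlg

open RAM

variable {N : Net}

/-- The new visited in-copies or out-copies. -/
def New (v₀ v : ℕ → ℕ) (x : ℕ) : Prop := v₀ x = 0 ∧ v x ≠ 0

/-- The visited copies form a tree with root `s` in the residual network; `rI`, `rO` are the times of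
the visits and `m` is the present time. -/
structure ResTree (N : Net) (s t : ℕ) (flow prv I₀ O₀ : ℕ → ℕ) (I O pI pO rI rO : ℕ → ℕ) (m : ℕ) :
    Prop where
  monoI : ∀ y, I₀ y ≠ 0 → I y ≠ 0
  monoO : ∀ y, O₀ y ≠ 0 → O y ≠ 0
  source : New O₀ O s
  avI : ∀ y, New I₀ I y → N.Av {t} s y
  avO : ∀ y, New O₀ O y → N.Av {t} s y
  treeI : ∀ y, New I₀ I y → New O₀ O (pI y) ∧ rO (pI y) < rI y ∧
    ((pI y = y ∧ flow y = 1) ∨ N.E (pI y) y)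
  treeO : ∀ z, New O₀ O z → z ≠ s → New I₀ I (pO z) ∧ rI (pO z) < rO z ∧
    ((pO z = z ∧ flow z ≠ 1) ∨ (flow (pO z) = 1 ∧ prv (pO z) = z))
  ltI : ∀ y, New I₀ I y → rI y < m
  ltO : ∀ y, New O₀ O y → rO y < m

/-- An in-copy has a single relevant residual arc: to the out-copy of `prv y` if there is flow
through `y`, and to the out-copy of `y` otherwise. It is followed at once (`closedI`), so only
out-copies are stacked. An edge into `t` is refused only if it carries flow, that is, if `flow x =
1` and `nxt x = t`. -/
structure ResInv (N : Net) (s t : ℕ) (flow nxt prv I₀ O₀ : ℕ → ℕ) (act : ℕ → Prop)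
    (I O pI pO stk : ℕ → ℕ) (sp found m : ℕ) : Prop where
  tree : ∃ rI rO, ResTree N s t flow prv I₀ O₀ I O pI pO rI rO m
  stack : ∀ i < sp, New O₀ O (stk i)
  closedI : ∀ y, New I₀ I y → (flow y = 1 → O (prv y) ≠ 0) ∧ (flow y ≠ 1 → O y ≠ 0)
  closedO : ∀ x, New O₀ O x → act x ∨ (∃ i < sp, stk i = x) ∨ ((flow x = 1 → I x ≠ 0) ∧
    ∀ y, N.E x y → (y = t → found ≠ 0 ∨ (flow x = 1 ∧ nxt x = t)) ∧ (y ≠ t → I y ≠ 0))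
  hit : found ≠ 0 → New O₀ O (pI t) ∧ N.E (pI t) t
  found_le : found ≤ 1

variable {s t : ℕ} {flow nxt prv I₀ O₀ : ℕ → ℕ} {act : ℕ → Prop}
    {I O pI pO stk : ℕ → ℕ} {sp found m : ℕ}

theorem update_one_ne {v : ℕ → ℕ} {y x : ℕ} : update v y 1 x ≠ 0 ↔ v x ≠ 0 ∨ x = y := by
  by_cases hv : x = y
  · subst hv; simp
  · simp [hv, update_of_ne]

theorem New.update {v₀ v : ℕ → ℕ} {x y : ℕ} (h : New v₀ v x) : New v₀ (update v y 1) x :=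
  ⟨h.1, update_one_ne.2 (.inl h.2)⟩

/-- The two visits get the times `m` and `m + 1`, later than all others, so that times increase
along the tree. If the out-copy of `z` has been visited before, only the in-copy of `y` is new. By
`H`, stepping back along the flow stays among the vertices that `s` reaches without passing `t`. -/
theorem ResInv.visit (h : ResInv N s t flow nxt prv I₀ O₀ act I O pI pO stk sp found m)
    (H : ∀ y, N.Av {t} s y → flow y = 1 → N.Av {t} s (prv y)) {x y z : ℕ}
    (hx : New O₀ O x) (hy : I y = 0) (hxy : (x = y ∧ flow y = 1) ∨ N.E x y) (hyt : y ≠ t)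
    (hz : (flow y = 1 ∧ z = prv y) ∨ (flow y ≠ 1 ∧ z = y))
    {O' pO' stk' : ℕ → ℕ} {sp' : ℕ}
    (h' : (O z ≠ 0 ∧ O' = O ∧ pO' = pO ∧ stk' = stk ∧ sp' = sp) ∨
      (O z = 0 ∧ O' = update O z 1 ∧ pO' = update pO z y ∧ stk' = update stk sp z ∧ sp' = sp + 1)) :
    ResInv N s t flow nxt prv I₀ O₀ act (update I y 1) O' (update pI y x) pO' stk' sp' found
      (m + 2) := by
  obtain ⟨rI, rO, hT⟩ := h.tree
  have hI₀ : I₀ y = 0 := by by_contra k; exact hT.monoI y k hy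
  have hyN : ¬ New I₀ I y := fun k => k.2 hy
  have hyN' : New I₀ (update I y 1) y := ⟨hI₀, by simp⟩
  have hNI : ∀ v, New I₀ (update I y 1) v → New I₀ I v ∨ v = y := fun v hv =>
    (update_one_ne.1 hv.2).imp_left fun k => ⟨hv.1, k⟩
  have hxa := hT.avO x hx
  have hya : N.Av {t} s y := by
    rcases hxy with ⟨rfl, _⟩ | hE
    · exact hxa
    · exact hxa.tail hE hyt
  have hza : N.Av {t} s z := by
    rcases hz with ⟨h1, rfl⟩ | ⟨h1, rfl⟩
    · exact H _ hya h1
    · exact hya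
  have hOmono : ∀ v, O v ≠ 0 → O' v ≠ 0 := by
    intro v hv
    rcases h' with ⟨_, rfl, _⟩ | ⟨_, rfl, _⟩
    · exact hv
    · exact update_one_ne.2 (.inl hv)
  have hON : ∀ v, New O₀ O v → New O₀ O' v := fun v hv => ⟨hv.1, hOmono v hv.2⟩
  have hOz : O' z ≠ 0 := by
    rcases h' with ⟨h1, rfl, _⟩ | ⟨_, rfl, _⟩
    · exact h1
    · exact update_one_ne.2 (.inr rfl)
  have hpI : ∀ v, New I₀ I v → update pI y x v = pI v := fun v hv =>
    update_of_ne (by rintro rfl; exact hyN hv) _ _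
  refine ⟨?_, ?_, ?_, ?_, ?_, h.found_le⟩
  · have hrI : ∀ v, New I₀ I v → update rI y m v = rI v := fun v hv =>
      update_of_ne (by rintro rfl; exact hyN hv) _ _
    rcases h' with ⟨-, rfl, rfl, rfl, rfl⟩ | ⟨hOz0, rfl, rfl, rfl, rfl⟩
    · refine ⟨update rI y m, rO, fun v hv => update_one_ne.2 (.inl (hT.monoI v hv)), hT.monoO,
        hT.source, ?_, hT.avO, ?_, ?_, ?_, fun v hv => (hT.ltO v hv).trans (by omega)⟩
      · intro v hv
        rcases hNI v hv with hv | rfl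
        · exact hT.avI v hv
        · exact hya
      · intro v hv
        rcases hNI v hv with hv | rfl
        · rw [hpI v hv, hrI v hv]; exact hT.treeI v hv
        · simpa using ⟨hx, hT.ltO _ hx, hxy⟩
      · intro v hv hvs
        obtain ⟨h1, h2, h3⟩ := hT.treeO v hv hvs
        rw [hrI _ h1]
        exact ⟨h1.update, h2, h3⟩
      · intro v hv
        rcases hNI v hv with hv | rfl
        · rw [hrI _ hv]; exact (hT.ltI v hv).trans (by omega)
        · simp
    · have hO₀ : O₀ z = 0 := by by_contra k; exact hT.monoO z k hOz0
      have hzN : ¬ New O₀ O z := fun k => k.2 hOz0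
      have hNO : ∀ v, New O₀ (update O z 1) v → New O₀ O v ∨ v = z := fun v hv =>
        (update_one_ne.1 hv.2).imp_left fun k => ⟨hv.1, k⟩
      have hrO : ∀ v, New O₀ O v → update rO z (m + 1) v = rO v := fun v hv =>
        update_of_ne (by rintro rfl; exact hzN hv) _ _
      have hpO : ∀ v, New O₀ O v → update pO z y v = pO v := fun v hv =>
        update_of_ne (by rintro rfl; exact hzN hv) _ _
      refine ⟨update rI y m, update rO z (m + 1), fun v hv => update_one_ne.2 (.inl (hT.monoI v hv)),
        fun v hv => update_one_ne.2 (.inl (hT.monoO v hv)), hT.source.update, ?_, ?_, ?_, ?_, ?_, ?_⟩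
      · intro v hv
        rcases hNI v hv with hv | rfl
        · exact hT.avI v hv
        · exact hya
      · intro v hv
        rcases hNO v hv with hv | rfl
        · exact hT.avO v hv
        · exact hza
      · intro v hv
        rcases hNI v hv with hv | rfl
        · obtain ⟨h1, h2, h3⟩ := hT.treeI v hv
          rw [hpI v hv, hrI v hv, hrO _ h1]; exact ⟨h1.update, h2, h3⟩
        · have := hT.ltO _ hx
          simp only [update_self, hrO _ hx]
          exact ⟨hx.update, this, hxy⟩
      · intro v hv hvs
        rcases hNO v hv with hv | rfl
        · obtain ⟨h1, h2, h3⟩ := hT.treeO v hv hvs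
          rw [hpO v hv, hrO v hv, hrI _ h1]
          exact ⟨h1.update, h2, h3⟩
        · simp only [update_self]
          refine ⟨hyN', by omega, ?_⟩
          rcases hz with ⟨h1, h2⟩ | ⟨h1, h2⟩
          · exact .inr ⟨h1, h2.symm⟩
          · exact .inl ⟨h2.symm, h2 ▸ h1⟩
      · intro v hv
        rcases hNI v hv with hv | rfl
        · rw [hrI _ hv]; exact (hT.ltI v hv).trans (by omega)
        · simp
      · intro v hv
        rcases hNO v hv with hv | rfl
        · rw [hrO _ hv]; exact (hT.ltO v hv).trans (by omega)
        · simp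
  · intro i hi
    rcases h' with ⟨_, rfl, rfl, rfl, rfl⟩ | ⟨hOz', rfl, rfl, rfl, rfl⟩
    · exact h.stack i hi
    · by_cases his : i = sp
      · subst his; rw [update_self]
        exact ⟨by by_contra k; exact hT.monoO z k hOz', hOz⟩
      · rw [update_of_ne his]; exact (h.stack i (by omega)).update
  · intro v hv
    rcases hNI v hv with hv | rfl
    · exact ⟨fun k => hOmono _ ((h.closedI v hv).1 k), fun k => hOmono _ ((h.closedI v hv).2 k)⟩
    · rcases hz with ⟨h1, rfl⟩ | ⟨h1, rfl⟩
      · exact ⟨fun _ => hOz, fun k => absurd h1 k⟩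
      · exact ⟨fun k => absurd k h1, fun _ => hOz⟩
  · have hold : ∀ v, New O₀ O v → act v ∨ (∃ i < sp', stk' i = v) ∨
        ((flow v = 1 → update I y 1 v ≠ 0) ∧ ∀ y', N.E v y' →
          (y' = t → found ≠ 0 ∨ (flow v = 1 ∧ nxt v = t)) ∧ (y' ≠ t → update I y 1 y' ≠ 0)) := by
      intro v hv
      rcases h.closedO v hv with h1 | ⟨i, hi, h1⟩ | ⟨h1, h2⟩
      · exact .inl h1
      · refine .inr (.inl ?_)
        rcases h' with ⟨_, rfl, rfl, rfl, rfl⟩ | ⟨hOz', rfl, rfl, rfl, rfl⟩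
        · exact ⟨i, hi, h1⟩
        · exact ⟨i, by omega, by rw [update_of_ne (by omega), h1]⟩
      · exact .inr (.inr ⟨fun k => update_one_ne.2 (.inl (h1 k)), fun y' hy' =>
          ⟨(h2 y' hy').1, fun k => update_one_ne.2 (.inl ((h2 y' hy').2 k))⟩⟩)
    intro v hv
    rcases h' with ⟨_, rfl, rfl, rfl, rfl⟩ | ⟨hOz', rfl, rfl, rfl, rfl⟩
    · exact hold v hv
    · rcases update_one_ne.1 hv.2 with h1 | rfl
      · exact hold v ⟨hv.1, h1⟩
      · exact .inr (.inl ⟨sp, by omega, by simp⟩)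
  · intro hf
    obtain ⟨h1, h2⟩ := h.hit hf
    rw [update_of_ne hyt.symm]
    exact ⟨hON _ h1, h2⟩

/-- The sink is never a visited in-copy, so recording its parent leaves the tree untouched. -/
theorem ResInv.reach_t (h : ResInv N s t flow nxt prv I₀ O₀ act I O pI pO stk sp found m) {x : ℕ}
    (hx : New O₀ O x) (hE : N.E x t) :
    ResInv N s t flow nxt prv I₀ O₀ act I O (update pI t x) pO stk sp 1 m := by
  obtain ⟨rI, rO, hT⟩ := h.tree
  have hne : ∀ y, New I₀ I y → update pI t x y = pI y := fun y hy =>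
    update_of_ne (fun k => (hT.avI y hy).right (by simp [k])) _ _
  refine ⟨⟨rI, rO, hT.monoI, hT.monoO, hT.source, hT.avI, hT.avO, fun y hy => ?_, hT.treeO, hT.ltI,
    hT.ltO⟩, h.stack, h.closedI, fun v hv => ?_, fun _ => by simpa using ⟨hx, hE⟩, le_rfl⟩
  · rw [hne y hy]; exact hT.treeI y hy
  · rcases h.closedO v hv with h1 | h1 | ⟨h1, h2⟩
    · exact .inl h1
    · exact .inr (.inl h1)
    · exact .inr (.inr ⟨h1, fun y hy => ⟨fun _ => .inl (by simp), (h2 y hy).2⟩⟩)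

/-- The result of the search for an augmenting path. -/
structure ResDone (N : Net) (s t : ℕ) (flow nxt prv I₀ O₀ I O pI pO : ℕ → ℕ) (found m : ℕ) :
    Prop where
  tree : ∃ rI rO, ResTree N s t flow prv I₀ O₀ I O pI pO rI rO m
  closedI : ∀ y, New I₀ I y → (flow y = 1 → O (prv y) ≠ 0) ∧ (flow y ≠ 1 → O y ≠ 0)
  closedO : found = 0 → ∀ x, New O₀ O x → (flow x = 1 → I x ≠ 0) ∧
    ∀ y, N.E x y → (y = t → flow x = 1 ∧ nxt x = t) ∧ (y ≠ t → I y ≠ 0)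
  hit : found ≠ 0 → New O₀ O (pI t) ∧ N.E (pI t) t
  found_le : found ≤ 1

/-- The scan of the fanout of `x` in the residual search. -/
def residualScan (k : Fin 3) : Prog :=
  Reg.e ::= .read .off Reg.x ;;
     .while (.lt Reg.e (.read .off (.succ Reg.x)))
       (Reg.y ::= .read .adj Reg.e ;;
        Reg.e ::= .succ Reg.e ;;
        .ite (.eq Reg.y Reg.t)
          (.when (.not (.and (.eq (.read .flow Reg.x) 1) (.eq (.read .nxt Reg.x) Reg.t)))
            (Reg.found ::= 1 ;;
             .write (.parIn k) Reg.t Reg.x))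
          (.when (.eq (.read (.visIn k) Reg.y) 0)
            (.write (.visIn k) Reg.y 1 ;;
             .write (.parIn k) Reg.y Reg.x ;;
             .ite (.eq (.read .flow Reg.y) 1) (Reg.z ::= .read .prv Reg.y) (Reg.z ::= Reg.y) ;;
             visitOutCopy k)))

/-- The potential contains `60 * m` because the clock `m` bounds the length of a later trace back
through the tree: the search reserves the time that `wp_augment` will spend. Every visited in-copy
advances the clock by two. -/
theorem wp_residualScan {k : Fin 3} {S T x : ℕ} {fl nx pv : ℕ → ℕ} {B : ℕ}
    (hs : N.Reach N.u S) (H : ∀ y, N.Av {T} S y → fl y = 1 → N.Av {T} S (pv y))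
    (hxa : N.Av {T} S x)
    (σ₂ : State Reg Arr) (τ₂ m₂ : ℕ) (Q : State Reg Arr → ℕ → Prop)
    (g_fl : σ₂.arr .flow = fl) (g_nx : σ₂.arr .nxt = nx) (g_pv : σ₂.arr .prv = pv)
    (g_off : σ₂.arr .off = N.off) (g_adj : σ₂.arr .adj = N.adj)
    (g_t : ∀ z y, N.Reach S z → N.E z y → (y = σ₂.reg .t ↔ y = T))
    (g_x : σ₂.reg .x = x)
    (hI₂ : ResInv N S T fl nx pv I₀ O₀ (fun v => v = x)
      (σ₂.arr (.visIn k)) (σ₂.arr (.visOut k)) (σ₂.arr (.parIn k)) (σ₂.arr (.parOut k))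
      (σ₂.arr .stk) (σ₂.reg .sp) (σ₂.reg .found) m₂)
    (hIx : fl x = 1 → σ₂.arr (.visIn k) x ≠ 0) (hxN₂ : New O₀ (σ₂.arr (.visOut k)) x)
    (ht₂ : τ₂ + 60 * m₂ + 400 * N.work (σ₂.arr (.visOut k)) +
      400 * N.stackWork (σ₂.arr .stk) (σ₂.reg .sp) + 400 * N.deg x + 30 ≤ B)
    (hQ : ∀ σ' τ', (∃ m, ResInv N S T fl nx pv I₀ O₀ (fun _ => False)
      (σ'.arr (.visIn k)) (σ'.arr (.visOut k)) (σ'.arr (.parIn k)) (σ'.arr (.parOut k))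
      (σ'.arr .stk) (σ'.reg .sp) (σ'.reg .found) m ∧
      τ₂ + τ' + 60 * m + 400 * N.work (σ'.arr (.visOut k)) +
        400 * N.stackWork (σ'.arr .stk) (σ'.reg .sp) + 10 ≤ B) → Q σ' τ') :
    WP (residualScan k) σ₂ Q := by
  have hux : N.Reach N.u x := hs.trans hxa.reach
  have hxn := hux.lt N.u_lt
  unfold residualScan
  simp only [wp_seq, wp_assign]
  refine wp_fanout (v := .x) (by simp [visitOutCopy]) (by simp [visitOutCopy])
    (by simp [visitOutCopy]) ?_ (fun j σ' τ => ∃ m,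
    ResInv N S T fl nx pv I₀ O₀ (fun v => v = x)
      (σ'.arr (.visIn k)) (σ'.arr (.visOut k)) (σ'.arr (.parIn k)) (σ'.arr (.parOut k))
      (σ'.arr .stk) (σ'.reg .sp) (σ'.reg .found) m ∧
    (fl x = 1 → σ'.arr (.visIn k) x ≠ 0) ∧ New O₀ (σ'.arr (.visOut k)) x ∧
    (∀ e, N.off x ≤ e → e < j →
      (N.adj e = T → σ'.reg .found ≠ 0 ∨ (fl x = 1 ∧ nx x = T)) ∧
      (N.adj e ≠ T → σ'.arr (.visIn k) (N.adj e) ≠ 0)) ∧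
    τ₂ + τ + 60 * m + 400 * N.work (σ'.arr (.visOut k)) +
      400 * N.stackWork (σ'.arr .stk) (σ'.reg .sp) + 400 * N.deg x + 30 ≤
      B + 400 * (j - N.off x)) ?_ ?_ ?_
  · simpa [g_off, g_x] using N.mono x hxn
  · refine ⟨m₂, by simpa using hI₂, by simpa using hIx, by simpa using hxN₂, ?_, ?_⟩
    · intro e h1 h2
      simp [g_off, g_x] at h2; omega
    · simp [g_off, g_x]; omega
  · rintro j σ₃ τ₃ hj1 hj2 hF₃ hje ⟨m₃, hI₃, hIx₃, hxN₃, hsc, ht₃⟩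
    simp [g_off, g_x] at hj1 hj2
    have f_fl : σ₃.arr .flow = fl := by rw [hF₃.2]; simp [g_fl]; simp [visitOutCopy]
    have f_nx : σ₃.arr .nxt = nx := by rw [hF₃.2]; simp [g_nx]; simp [visitOutCopy]
    have f_pv : σ₃.arr .prv = pv := by rw [hF₃.2]; simp [g_pv]; simp [visitOutCopy]
    have f_adj : σ₃.arr .adj = N.adj := by rw [hF₃.2]; simp [g_adj]; simp [visitOutCopy]
    have f_t : σ₃.reg .t = σ₂.reg .t := by rw [hF₃.1]; simp; simp [visitOutCopy]
    have f_x : σ₃.reg .x = x := by rw [hF₃.1]; simp [g_x]; simp [visitOutCopy]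
    obtain ⟨rI₃, rO₃, hTr₃⟩ := hI₃.tree
    set y := N.adj j with hy
    have hE : N.E x y := (N.edge x hxn y).2 ⟨j, hj1, hj2, rfl⟩
    have hyT := g_t x y hxa.reach hE
    have hsc' : ∀ (vI : ℕ → ℕ) (fd : ℕ), (∀ v, σ₃.arr (.visIn k) v ≠ 0 → vI v ≠ 0) →
        (σ₃.reg .found ≠ 0 → fd ≠ 0) →
        ((y = T → fd ≠ 0 ∨ (fl x = 1 ∧ nx x = T)) ∧ (y ≠ T → vI y ≠ 0)) →
        ∀ e, N.off x ≤ e → e < j + 1 → (N.adj e = T → fd ≠ 0 ∨ (fl x = 1 ∧ nx x = T)) ∧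
          (N.adj e ≠ T → vI (N.adj e) ≠ 0) := by
      intro vI fd h1 h2 h3 e he1 he2
      rcases Nat.lt_succ_iff_lt_or_eq.1 he2 with he2 | rfl
      · exact ⟨fun k => ((hsc e he1 he2).1 k).imp_left h2, fun k => h1 _ ((hsc e he1 he2).2 k)⟩
      · exact h3
    simp only [f_adj, ← hy]
    rw [wp_ite]
    simp only [Test.Holds, Expr.eval, State.arr_setReg, State.reg_setReg, Test.cost, Expr.cost,
      if_true, if_false, reduceCtorEq, f_t]
    constructor
    · intro hyt
      replace f_t := f_t.trans (hyt.symm.trans (hyT.1 hyt))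
      replace hyt := hyT.1 hyt
      rw [wp_when]
      simp only [Test.Holds, Expr.eval, State.arr_setReg, State.reg_setReg, Test.cost, Expr.cost,
        if_true, if_false, reduceCtorEq, f_t, f_x, f_fl, f_nx]
      constructor
      · intro hsat
        have := hI₃.reach_t hxN₃ (hyt ▸ hE)
        simp only [wp_seq, wp_assign, wp_write, Expr.eval, State.arr_setReg, State.reg_setReg,
          State.arr_setArr, State.reg_setArr, Expr.cost,
          if_true, if_false, reduceCtorEq, f_t, f_x, Arr.parIn.injEq]
        refine ⟨m₃, this, hIx₃, hxN₃, hsc' _ _ (fun _ => id) (by simp)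
          ⟨fun _ => .inl (by simp), fun h => absurd hyt h⟩, by omega⟩
      · intro hsat
        refine ⟨m₃, hI₃, hIx₃, hxN₃, hsc' _ _ (fun _ => id) id
          ⟨fun _ => .inr (not_not.1 hsat), fun h => absurd hyt h⟩, by omega⟩
    · intro hyt
      replace hyt := fun k => hyt (hyT.2 k)
      rw [wp_when]
      simp only [Test.Holds, Expr.eval, State.arr_setReg, State.reg_setReg, Test.cost, Expr.cost,
        if_true, if_false, reduceCtorEq]
      constructor
      · intro hy0
        have hImono : ∀ v, σ₃.arr (.visIn k) v ≠ 0 → update (σ₃.arr (.visIn k)) y 1 v ≠ 0 :=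
          fun v hv => update_one_ne.2 (.inl hv)
        have hsc₁ := hsc' (update (σ₃.arr (.visIn k)) y 1) (σ₃.reg .found) hImono id
          ⟨fun h => absurd h hyt, fun _ => by simp⟩
        have hux' := hux.tail hE
        rw [wp_seq, wp_write, wp_seq, wp_write, wp_seq, wp_ite]
        simp only [Test.Holds, Expr.eval, State.arr_setReg, State.reg_setReg, Test.cost,
          Expr.cost, if_true, if_false, reduceCtorEq, State.arr_setArr, State.reg_setArr,
          f_fl, f_x, f_pv, wp_assign, visitOutCopy, wp_when, wp_seq, wp_write]
        refine ⟨fun hfy => ⟨fun hz => ?_, fun hz => ?_⟩, fun hfy => ⟨fun hz => ?_, fun hz => ?_⟩⟩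
        · have hv := hI₃.visit H hxN₃ hy0 (.inr hE) hyt (.inl ⟨hfy, rfl⟩)
            (.inr ⟨hz, rfl, rfl, rfl, rfl⟩)
          have hw := N.work_update (vis := σ₃.arr (.visOut k)) (k := 1)
            (hs.trans (H y (hxa.tail hE hyt) hfy).reach) hz (by simp)
          refine ⟨_, hv, fun h => hImono _ (hIx₃ h), hxN₃.update, hsc₁, ?_⟩
          rw [Net.stackWork_push]
          omega
        · have hv := hI₃.visit H hxN₃ hy0 (.inr hE) hyt (.inl ⟨hfy, rfl⟩)
            (.inl ⟨hz, rfl, rfl, rfl, rfl⟩)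
          refine ⟨_, hv, fun h => hImono _ (hIx₃ h), hxN₃, hsc₁, ?_⟩
          omega
        · have hv := hI₃.visit H hxN₃ hy0 (.inr hE) hyt (.inr ⟨hfy, rfl⟩)
            (.inr ⟨hz, rfl, rfl, rfl, rfl⟩)
          have hw := N.work_update (vis := σ₃.arr (.visOut k)) (k := 1)
            hux' hz (by simp)
          refine ⟨_, hv, fun h => hImono _ (hIx₃ h), hxN₃.update, hsc₁, ?_⟩
          rw [Net.stackWork_push]
          omega
        · have hv := hI₃.visit H hxN₃ hy0 (.inr hE) hyt (.inr ⟨hfy, rfl⟩)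
            (.inl ⟨hz, rfl, rfl, rfl, rfl⟩)
          refine ⟨_, hv, fun h => hImono _ (hIx₃ h), hxN₃, hsc₁, ?_⟩
          omega
      · intro hy0
        exact ⟨m₃, hI₃, hIx₃, hxN₃, hsc' _ _ (fun _ => id) id
          ⟨fun h => absurd h hyt, fun _ => hy0⟩, by omega⟩
  · rintro σ₃ τ₃ hF₃ ⟨m₃, hI₃, hIx₃, hxN₃, hsc, ht₃⟩
    simp [g_off, g_x] at hsc ht₃
    refine hQ _ _ ⟨m₃, ⟨hI₃.tree, hI₃.stack, hI₃.closedI, fun v hv => ?_, hI₃.hit,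
      hI₃.found_le⟩, ?_⟩
    · rcases hI₃.closedO v hv with h | h | h
      · refine .inr (.inr ⟨fun h1 => ?_, fun y hy => ?_⟩)
        · rw [h]; exact hIx₃ (h ▸ h1)
        · rw [h] at hy ⊢
          obtain ⟨e, he1, he2, rfl⟩ := (N.edge x hxn y).1 hy
          exact hsc e he1 he2
      · exact .inr (.inl h)
      · exact .inr (.inr h)
    · simp only [Net.deg] at ht₃ ⊢
      simp
      omega

/-- The sink may be any vertex `T` that the search does not distinguish from the one in the register. -/
theorem wp_residualSearch_sink {k : Fin 3} {σ : State Reg Arr} {T : ℕ} (hσ : N.Holds σ)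
    (hT : ∀ z y, N.Reach (σ.reg .s) z → N.E z y → (y = σ.reg .t ↔ y = T))
    (hs : N.Reach N.u (σ.reg .s)) (hst : σ.reg .s ≠ T) (hO : σ.arr (.visOut k) (σ.reg .s) = 0)
    (H : ∀ y, N.Av {T} (σ.reg .s) y → σ.arr .flow y = 1 → N.Av {T} (σ.reg .s) (σ.arr .prv y)) :
    WP (residualSearch k) σ fun σ' τ => ∃ m,
      ResDone N (σ.reg .s) T (σ.arr .flow) (σ.arr .nxt) (σ.arr .prv) (σ.arr (.visIn k))
        (σ.arr (.visOut k)) (σ'.arr (.visIn k)) (σ'.arr (.visOut k)) (σ'.arr (.parIn k))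
        (σ'.arr (.parOut k)) (σ'.reg .found) m ∧
      τ + 60 * m + 400 * N.work (σ'.arr (.visOut k)) ≤ 400 * N.work (σ.arr (.visOut k)) + 100 := by
  set S := σ.reg .s with hS
  set fl := σ.arr .flow with hfl
  set nx := σ.arr .nxt with hnx
  set pv := σ.arr .prv with hpv
  set I₀ := σ.arr (.visIn k) with hI₀
  set O₀ := σ.arr (.visOut k) with hO₀
  unfold residualSearch
  simp only [wp_seq, wp_write, wp_assign]
  refine WP.while (fun σ' τ => ∃ m, ResInv N S T fl nx pv I₀ O₀ (fun _ => False)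
      (σ'.arr (.visIn k)) (σ'.arr (.visOut k)) (σ'.arr (.parIn k)) (σ'.arr (.parOut k))
      (σ'.arr .stk) (σ'.reg .sp) (σ'.reg .found) m ∧
      τ + 60 * m + 400 * N.work (σ'.arr (.visOut k)) +
        400 * N.stackWork (σ'.arr .stk) (σ'.reg .sp) ≤ 400 * N.work O₀ + 60)
    (400 * N.work O₀ + 60) ?_ ?_ ?_ ?_
  -- Initially only the out-copy of the source is visited, at time 0; marking it pays for its place
  -- on the stack.
  · have hw := N.work_update (k := 1) hs hO (by simp)
    have hnew : ∀ v, New O₀ (update O₀ S 1) v → v = S := fun v hv =>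
      (update_one_ne.1 hv.2).resolve_left (by simpa using hv.1)
    refine ⟨1, ⟨⟨fun _ => 0, fun _ => 0, ?_, ?_, ?_, ?_, ?_, ?_, ?_, ?_, ?_⟩, ?_, ?_, ?_, ?_, ?_⟩, ?_⟩
    · simp [hI₀]
    · intro v hv; simpa [hO₀, hS] using update_one_ne.2 (.inl hv)
    · simpa [New, ← hS, ← hO₀] using hO
    · rintro v ⟨h1, h2⟩; exact absurd h1 (by simpa using h2)
    · intro v hv
      have := hnew v (by simpa using hv)
      rw [this]; exact .refl (by simpa using hst)
    · rintro v ⟨h1, h2⟩; exact absurd h1 (by simpa using h2)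
    · intro v hv h2; exact absurd (hnew v (by simpa using hv)) h2
    · simp
    · simp
    · intro i hi
      obtain rfl : i = 0 := by simpa using hi
      simpa [New, ← hS, ← hO₀] using hO
    · rintro v ⟨h1, h2⟩; exact absurd h1 (by simpa using h2)
    · intro v hv
      refine .inr (.inl ⟨0, by simp, ?_⟩)
      simpa using (hnew v (by simpa using hv)).symm
    · simp
    · simp
    · simp [Net.stackWork, ← hS, ← hO₀]; omega
  · rintro σ' τ ⟨m, _, h⟩; omega
  · rintro σ₁ τ₁ hF ⟨m₁, hI, ht⟩ hb
    have e_fl : σ₁.arr .flow = fl := by rw [hF.2]; simp [hfl]; simp [visitOutCopy]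
    have e_nx : σ₁.arr .nxt = nx := by rw [hF.2]; simp [hnx]; simp [visitOutCopy]
    have e_pv : σ₁.arr .prv = pv := by rw [hF.2]; simp [hpv]; simp [visitOutCopy]
    have e_off : σ₁.arr .off = N.off := by rw [hF.2]; simp [hσ.off]; simp [visitOutCopy]
    have e_adj : σ₁.arr .adj = N.adj := by rw [hF.2]; simp [hσ.adj]; simp [visitOutCopy]
    have e_t : σ₁.reg .t = σ.reg .t := by rw [hF.1]; simp; simp [visitOutCopy]
    simp only [Test.Holds, Expr.eval] at hb
    obtain ⟨sp, hsp⟩ : ∃ sp, σ₁.reg .sp = sp + 1 := Nat.exists_eq_succ_of_ne_zero hb.1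
    have hf0 : σ₁.reg .found = 0 := hb.2
    set x := σ₁.arr .stk sp with hx
    have hxN := hI.stack sp (by omega)
    rw [← hx] at hxN
    obtain ⟨rI, rO, hTr⟩ := hI.tree
    have hxa := hTr.avO x hxN
    have hux : N.Reach N.u x := hs.trans hxa.reach
    have hxn := hux.lt N.u_lt
    rw [hsp, Net.stackWork_succ, ← hx] at ht
    -- the state after the element `x` is removed from the stack
    have hI' : ResInv N S T fl nx pv I₀ O₀ (fun v => v = x)
      (σ₁.arr (.visIn k)) (σ₁.arr (.visOut k)) (σ₁.arr (.parIn k)) (σ₁.arr (.parOut k))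
      (σ₁.arr .stk) sp (σ₁.reg .found) m₁ := by
      refine ⟨hI.tree, fun i hi => hI.stack i (by omega), hI.closedI, fun v hv => ?_, hI.hit,
        hI.found_le⟩
      rcases hI.closedO v hv with h1 | ⟨i, hi, h1⟩ | h1
      · exact h1.elim
      · by_cases his : i = sp
        · exact .inl (by rw [← h1, his])
        · exact .inr (.inl ⟨i, by omega, h1⟩)
      · exact .inr (.inr h1)
    rw [wp_seq, wp_assign, wp_seq, wp_assign, wp_seq, wp_when, ← residualScan.eq_1]
    simp only [Test.Holds, Expr.eval, State.arr_setReg, State.reg_setReg, Test.cost,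
      Expr.cost, if_true, if_false, reduceCtorEq, hsp, Nat.add_sub_cancel, ← hx, e_fl]
    constructor
    · rintro ⟨hfx, hvx⟩
      have hxt : x ≠ T := by simpa using hxa.right
      simp only [Test.Holds, Expr.eval, State.arr_setReg, State.reg_setReg, Test.cost,
        Expr.cost, if_true, if_false, reduceCtorEq, State.arr_setArr, State.reg_setArr,
        e_pv, wp_assign, visitOutCopy, wp_when, wp_seq, wp_write]
      constructor
      · intro hz
        have hv := hI'.visit H hxN hvx (.inl ⟨rfl, hfx⟩) hxt (.inl ⟨hfx, rfl⟩)
                (.inr ⟨hz, rfl, rfl, rfl, rfl⟩)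
        have hw := N.work_update (vis := σ₁.arr (.visOut k)) (k := 1)
                (hs.trans (H x hxa hfx).reach) hz (by simp)
        refine wp_residualScan (I₀ := I₀) (O₀ := O₀) (nx := nx) (B := 400 * N.work O₀ + 60) hs H hxa _ (τ₁ + 80) (m₁ + 2) _ ?_ ?_ ?_ ?_ ?_ ?_ ?_ ?_ ?_ ?_ ?_ ?_
        · simp [e_fl]
        · simp [e_nx]
        · simp [e_pv]
        · simp [e_off]
        · simp [e_adj]
        · simpa [e_t] using hT
        · simp
        · simpa using hv
        · simp
        · simpa using hxN.update
        · simp [Net.stackWork_push]; omega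
        · rintro σ' τ' ⟨m, h1, h2⟩
          exact ⟨m, h1, by omega⟩
      · intro hz
        have hv := hI'.visit H hxN hvx (.inl ⟨rfl, hfx⟩) hxt (.inl ⟨hfx, rfl⟩)
                (.inl ⟨hz, rfl, rfl, rfl, rfl⟩)
        refine wp_residualScan (I₀ := I₀) (O₀ := O₀) (nx := nx) (B := 400 * N.work O₀ + 60) hs H hxa _ (τ₁ + 80) (m₁ + 2) _ ?_ ?_ ?_ ?_ ?_ ?_ ?_ ?_ ?_ ?_ ?_ ?_
        · simp [e_fl]
        · simp [e_nx]
        · simp [e_pv]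
        · simp [e_off]
        · simp [e_adj]
        · simpa [e_t] using hT
        · simp
        · simpa using hv
        · simp
        · simpa using hxN
        · simp; omega
        · rintro σ' τ' ⟨m, h1, h2⟩
          exact ⟨m, h1, by omega⟩
    · intro hvx
      refine wp_residualScan (I₀ := I₀) (O₀ := O₀) (nx := nx) (B := 400 * N.work O₀ + 60) hs H hxa _ (τ₁ + 40) m₁ _ ?_ ?_ ?_ ?_ ?_ ?_ ?_ ?_ ?_ ?_ ?_ ?_
      · simp [e_fl]
      · simp [e_nx]
      · simp [e_pv]
      · simp [e_off]
      · simp [e_adj]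
      · simpa [e_t] using hT
      · simp
      · simpa using hI'
      · exact fun h => by simpa using fun k => hvx ⟨h, by simpa using k⟩
      · simpa using hxN
      · simp; omega
      · rintro σ' τ' ⟨m, h1, h2⟩
        exact ⟨m, h1, by omega⟩
  · rintro σ' τ hF ⟨m, hI, ht⟩ hb
    refine ⟨m, ⟨hI.tree, hI.closedI, fun hf x hx => ?_, hI.hit, hI.found_le⟩, ?_⟩
    · rcases hI.closedO x hx with h | ⟨i, hi, _⟩ | h
      · exact h.elim
      · simp [hf] at hb; omega
      · simpa [hf] using h
    · simp; omega

theorem wp_residualSearch {k : Fin 3} {σ : State Reg Arr} (hσ : N.Holds σ)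
    (hs : N.Reach N.u (σ.reg .s)) (hst : σ.reg .s ≠ σ.reg .t) (hO : σ.arr (.visOut k) (σ.reg .s) = 0)
    (H : ∀ y, N.Av {σ.reg .t} (σ.reg .s) y → σ.arr .flow y = 1 →
      N.Av {σ.reg .t} (σ.reg .s) (σ.arr .prv y)) :
    WP (residualSearch k) σ fun σ' τ => ∃ m,
      ResDone N (σ.reg .s) (σ.reg .t) (σ.arr .flow) (σ.arr .nxt) (σ.arr .prv) (σ.arr (.visIn k))
        (σ.arr (.visOut k)) (σ'.arr (.visIn k)) (σ'.arr (.visOut k)) (σ'.arr (.parIn k))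
        (σ'.arr (.parOut k)) (σ'.reg .found) m ∧
      τ + 60 * m + 400 * N.work (σ'.arr (.visOut k)) ≤ 400 * N.work (σ.arr (.visOut k)) + 100 :=
  wp_residualSearch_sink hσ (fun _ _ _ _ => .rfl) hs hst hO H

end DominatorAlg

/-! ### Augmenting a flow along the tree of the residual search. -/

namespace DominatorAlg

open RAM

/-- The vertices strictly between `s` and `t`. -/
def Mid (N : Net) (s t : ℕ) (z : ℕ) : Prop := N.Av {t} s z ∧ z ≠ s ∧ N.Reach z t

/-- A flow from `s` to `t` given by the successors and predecessors of the vertices with flow, where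
`F` is the set of the first vertices of its paths and nothing need to flow into the vertex `y`. -/
structure FlowInv (N : Net) (s t : ℕ) (F : Set ℕ) (y : ℕ) (flow nxt prv : ℕ → ℕ) : Prop where
  next : ∀ z, flow z = 1 → Mid N s t z → N.E z (nxt z) ∧ (nxt z = t ∨
    (flow (nxt z) = 1 ∧ Mid N s t (nxt z) ∧ nxt z ≠ y ∧ prv (nxt z) = z))
  prev : ∀ z, flow z = 1 → Mid N s t z → z ≠ y → (z ∈ F ∧ prv z = s) ∨
    (flow (prv z) = 1 ∧ Mid N s t (prv z) ∧ nxt (prv z) = z)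
  first : ∀ z ∈ F, N.E s z ∧ (z = t ∨ (flow z = 1 ∧ Mid N s t z ∧ z ≠ y ∧ prv z = s))
  mid : ∀ z, N.Av {t} s z → flow z = 1 → Mid N s t z

variable {N : Net} {s t : ℕ} {F : Set ℕ}

theorem Mid.ne_right {z : ℕ} (h : Mid N s t z) : z ≠ t := by simpa using h.1.right

theorem FlowInv.prv_ne {y z : ℕ} {flow nxt prv : ℕ → ℕ} (h : FlowInv N s t F y flow nxt prv)
    (hz : flow z = 1) (hm : Mid N s t z) (hy : z ≠ y) : prv z ≠ z := by
  intro k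
  rcases h.prev z hz hm hy with ⟨_, h1⟩ | ⟨h1, h2, h3⟩
  · exact hm.2.1 (k.symm.trans h1)
  · rw [k] at h3
    exact Net.ne_of_E (h.next z hz hm).1 h3.symm

/-- This supplies the hypothesis of the residual search that stepping back along the flow does not
lead past `t`. -/
theorem FlowInv.av_prv {flow nxt prv : ℕ → ℕ} (h : FlowInv N s t F t flow nxt prv) (hst : s ≠ t)
    {z : ℕ} (hz : N.Av {t} s z) (hf : flow z = 1) : N.Av {t} s (prv z) := by
  have hm := h.mid z hz hf
  rcases h.prev z hf hm hm.ne_right with ⟨_, h1⟩ | ⟨_, h1, _⟩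
  · rw [h1]; exact .refl (by simpa using hst)
  · exact h1.1

/-- The invariant of the augmentation, when the vertex `y` is reached at time `r`. -/
structure TraceInv (N : Net) (s t : ℕ) (F : Set ℕ) (I₀ O₀ I O rI rO fl₀ nx₀ pv₀ : ℕ → ℕ) (m : ℕ)
    (y r : ℕ) (fl nx pv : ℕ → ℕ) : Prop where
  flow : FlowInv N s t F y fl nx pv
  origO : ∀ z, New O₀ O z → rO z < r → fl z = fl₀ z ∧ nx z = nx₀ z
  origI : ∀ z, New I₀ I z → rI z < r → pv z = pv₀ z ∧ (fl₀ z = 1 → fl z = 1)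
  cur : (y = t ∧ r = m) ∨ (New I₀ I y ∧ rI y = r ∧ fl y = 1 ∧ Mid N s t y)
  frame : ∀ z, ¬ Mid N s t z → fl z = fl₀ z ∧ (z ≠ s → nx z = nx₀ z) ∧ (z ≠ t → pv z = pv₀ z)

variable {I₀ O₀ I O pI pO rI rO fl₀ nx₀ pv₀ fl nx pv : ℕ → ℕ} {m y r x : ℕ}

theorem TraceInv.cur_ne (h : TraceInv N s t F I₀ O₀ I O rI rO fl₀ nx₀ pv₀ m y r fl nx pv) :
    y = t ∨ (fl y = 1 ∧ Mid N s t y) :=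
  h.cur.imp (fun k => k.1) fun k => k.2.2

theorem TraceInv.reach_t (h : TraceInv N s t F I₀ O₀ I O rI rO fl₀ nx₀ pv₀ m y r fl nx pv) :
    N.Reach y t := by
  rcases h.cur_ne with rfl | ⟨_, h⟩
  · exact .refl _
  · exact h.2.2

/-- The parent of the present in-copy. -/
theorem TraceInv.parent (h : TraceInv N s t F I₀ O₀ I O rI rO fl₀ nx₀ pv₀ m y r fl nx pv)
    (hT : ResTree N s t fl₀ pv₀ I₀ O₀ I O pI pO rI rO m) (ht : New O₀ O (pI t) ∧ N.E (pI t) t) :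
    New O₀ O (pI y) ∧ rO (pI y) < r ∧
      ((pI y = y ∧ fl₀ y = 1 ∧ New I₀ I y ∧ rI y = r) ∨ (pI y ≠ y ∧ N.E (pI y) y)) := by
  rcases h.cur with ⟨rfl, rfl⟩ | ⟨h1, rfl, _⟩
  · exact ⟨ht.1, hT.ltO _ ht.1, .inr ⟨Net.ne_of_E ht.2, ht.2⟩⟩
  · obtain ⟨h2, h3, h4⟩ := hT.treeI y h1
    refine ⟨h2, h3, h4.imp (fun k => ⟨k.1, k.2, h1, rfl⟩) fun k => ⟨Net.ne_of_E k, k⟩⟩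

/-- Cancelling the flow through a vertex. -/
theorem TraceInv.cancel (h : TraceInv N s t F I₀ O₀ I O rI rO fl₀ nx₀ pv₀ m y r fl nx pv)
    (hT : ResTree N s t fl₀ pv₀ I₀ O₀ I O pI pO rI rO m) (h₀ : FlowInv N s t F t fl₀ nx₀ pv₀)
    (hO : New O₀ O y) (hlt : rO y < r) (hy : fl₀ y = 1) (hI : New I₀ I y) (hr : rI y = r)
    (hys : y ≠ s) :
    pO y ≠ y ∧ rI (pO y) < r ∧
    TraceInv N s t F I₀ O₀ I O rI rO fl₀ nx₀ pv₀ m (pO y) (rI (pO y)) (update fl y 0) nx pv := by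
  obtain ⟨h1, h2, h3⟩ := hT.treeO y hO hys
  have hyt : y ≠ t := by simpa using (hT.avI y hI).right
  obtain ⟨h3, h4⟩ := h3.resolve_left fun k => k.2 hy
  set y' := pO y with hy'
  have hne : y' ≠ y := by rintro k; rw [k] at h2; omega
  have ha' := hT.avI _ h1
  have hm' := h₀.mid y' ha' h3
  have hm : Mid N s t y := h₀.mid y (hT.avI y hI) hy
  -- The flow leaves `y` along the edge to `y'`, so clearing the flow through `y` deprives exactly
  -- `y'` of its inflow.
  have hnx : nx₀ y = y' := by
    rcases h₀.prev y' h3 hm' hm'.ne_right with ⟨_, k⟩ | ⟨_, _, k⟩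
    · exact absurd (h4.symm.trans k) hys
    · rwa [h4] at k
  obtain ⟨o1, o2⟩ := h.origO y hO hlt
  obtain ⟨i1, i2⟩ := h.origI y' h1 (by omega)
  have hyF : fl y' = 1 := i2 h3
  refine ⟨hne, by omega, ⟨?_, ?_, ?_, ?_⟩, ?_, ?_, ?_, ?_⟩
  · intro z hz hzm
    have hzy : z ≠ y := by rintro rfl; simp at hz
    rw [update_of_ne hzy] at hz
    obtain ⟨k1, k2⟩ := h.flow.next z hz hzm
    refine ⟨k1, k2.imp_right ?_⟩
    rintro ⟨k2, k3, k4, k5⟩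
    refine ⟨by rw [update_of_ne k4]; exact k2, k3, ?_, k5⟩
    intro k
    rw [k, i1, h4] at k5
    exact hzy k5.symm
  · intro z hz hzm hzy'
    have hzy : z ≠ y := by rintro rfl; simp at hz
    rw [update_of_ne hzy] at hz
    rcases h.flow.prev z hz hzm hzy with k | ⟨k1, k2, k3⟩
    · exact .inl k
    · refine .inr ⟨?_, k2, k3⟩
      rw [update_of_ne, k1]
      intro k
      rw [k, o2, hnx] at k3
      exact hzy' k3.symm
  · intro z hz
    obtain ⟨k1, k2⟩ := h.flow.first z hz
    refine ⟨k1, k2.imp_right ?_⟩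
    rintro ⟨k2, k3, k4, k5⟩
    refine ⟨by rw [update_of_ne k4]; exact k2, k3, ?_, k5⟩
    intro k
    rw [k, i1, h4] at k5
    exact hys k5
  · intro z hz hf
    by_cases hzy : z = y
    · subst hzy; simp at hf
    · rw [update_of_ne hzy] at hf; exact h.flow.mid z hz hf
  · intro z hz hlt'
    have hzy : z ≠ y := by rintro rfl; omega
    rw [update_of_ne hzy]
    exact h.origO z hz (by omega)
  · intro z hz hlt'
    have hzy : z ≠ y := by rintro rfl; omega
    rw [update_of_ne hzy]
    exact h.origI z hz (by omega)
  · exact .inr ⟨h1, rfl, by rw [update_of_ne hne]; exact hyF, hm'⟩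
  · intro z hz
    have hzy : z ≠ y := by rintro rfl; exact hz hm
    rw [update_of_ne hzy]; exact h.frame z hz

/-- The augmentation along an edge `(x, y)`. -/
theorem TraceInv.edge (h : TraceInv N s t F I₀ O₀ I O rI rO fl₀ nx₀ pv₀ m y r fl nx pv)
    (hT : ResTree N s t fl₀ pv₀ I₀ O₀ I O pI pO rI rO m) (h₀ : FlowInv N s t F t fl₀ nx₀ pv₀)
    (hO : New O₀ O x) (hlt : rO x < r) (hE : N.E x y) (hxs : x ≠ s) :
    rI (pO x) < r ∧
    TraceInv N s t F I₀ O₀ I O rI rO fl₀ nx₀ pv₀ m (pO x) (rI (pO x))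
      (if pO x = x then update fl x 1 else fl) (update nx x y) (update pv y x) := by
  obtain ⟨h1, h2, h3⟩ := hT.treeO x hO hxs
  set y' := pO x with hy'
  have hxy : x ≠ y := Net.ne_of_E hE
  have hxa := hT.avO x hO
  have hxm : Mid N s t x := ⟨hxa, hxs, .head hE h.reach_t⟩
  obtain ⟨o1, o2⟩ := h.origO x hO hlt
  obtain ⟨i1, i2⟩ := h.origI y' h1 (by omega)
  have hy'y : y' ≠ y := by
    rintro k
    rcases h.cur with ⟨rfl, _⟩ | ⟨_, k2, _⟩
    · exact (hT.avI _ h1).right (by simp [k])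
    · rw [k] at h2; omega
  have hfr : ∀ z, ¬ Mid N s t z → ((z ≠ s → update nx x y z = nx₀ z) ∧
      (z ≠ t → update pv y x z = pv₀ z)) := by
    intro z hz
    have hzx : z ≠ x := by rintro rfl; exact hz hxm
    obtain ⟨k1, k2, k3⟩ := h.frame z hz
    rw [update_of_ne hzx]
    refine ⟨k2, fun hzt => ?_⟩
    rw [update_of_ne, k3 hzt]
    rintro rfl
    rcases h.cur_ne with h | ⟨_, h⟩
    · exact hzt h
    · exact hz h
  have hoI : ∀ z, New I₀ I z → rI z < rI y' → update pv y x z = pv₀ z := by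
    intro z hz hlt'
    rw [update_of_ne]
    · exact (h.origI z hz (by omega)).1
    · rintro rfl
      rcases h.cur with ⟨rfl, _⟩ | ⟨_, k, _⟩
      · exact (hT.avI _ hz).right (by simp)
      · omega
  have hoO : ∀ z, New O₀ O z → rO z < rI y' → update nx x y z = nx₀ z := by
    intro z hz hlt'
    rw [update_of_ne (by rintro rfl; omega)]
    exact (h.origO z hz (by omega)).2
  have hynext : y = t ∨ (fl y = 1 ∧ Mid N s t y) := h.cur_ne
  by_cases hcase : y' = x
  · -- flow through `x` is new
    -- The other rule of the tree would make `x` its own flow predecessor.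
    have hx0 : fl₀ x ≠ 1 := by
      rcases h3 with h3 | ⟨h3, h4⟩
      · exact h3.2
      · rw [hcase] at h3 h4
        exact absurd h4 (h₀.prv_ne h3 (h₀.mid x hxa h3) hxm.ne_right)
    have hflx : fl x ≠ 1 := by rw [o1]; exact hx0
    have hne : ∀ z, fl z = 1 → z ≠ x := by rintro z hz rfl; exact hflx hz
    rw [if_pos hcase]
    refine ⟨by omega, ⟨?_, ?_, ?_, ?_⟩, ?_, ?_, ?_, ?_⟩
    · intro z hz hzm
      by_cases hzx : z = x
      · subst hzx
        simp only [update_self]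
        refine ⟨hE, hynext.imp_right fun k => ⟨?_, k.2, hy'y.symm, trivial⟩⟩
        rw [update_of_ne hxy.symm]; exact k.1
      · rw [update_of_ne hzx] at hz ⊢
        obtain ⟨k1, k2⟩ := h.flow.next z hz hzm
        refine ⟨k1, k2.imp_right ?_⟩
        rintro ⟨k2, k3, k4, k5⟩
        have := hne _ k2
        exact ⟨by rwa [update_of_ne this], k3, by rwa [hcase], by rwa [update_of_ne k4]⟩
    · intro z hz hzm hzy'
      rw [hcase] at hzy'
      rw [update_of_ne hzy'] at hz
      by_cases hzy : z = y
      · subst hzy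
        simp only [update_self]
        exact .inr ⟨trivial, hxm, trivial⟩
      · rw [update_of_ne hzy]
        refine (h.flow.prev z hz hzm hzy).imp_right ?_
        rintro ⟨k1, k2, k3⟩
        have := hne _ k1
        exact ⟨by rwa [update_of_ne this], k2, by rwa [update_of_ne this]⟩
    · intro z hz
      obtain ⟨k1, k2⟩ := h.flow.first z hz
      refine ⟨k1, k2.imp_right ?_⟩
      rintro ⟨k2, k3, k4, k5⟩
      have := hne _ k2
      exact ⟨by rwa [update_of_ne this], k3, by rwa [hcase], by rwa [update_of_ne k4]⟩
    · intro z hz hf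
      by_cases hzx : z = x
      · subst hzx; exact hxm
      · rw [update_of_ne hzx] at hf; exact h.flow.mid z hz hf
    · intro z hz hlt'
      refine ⟨?_, hoO z hz hlt'⟩
      rw [update_of_ne (by rintro rfl; omega)]
      exact (h.origO z hz (by omega)).1
    · intro z hz hlt'
      refine ⟨hoI z hz hlt', fun k => ?_⟩
      have k' := (h.origI z hz (by omega)).2 k
      rwa [update_of_ne (hne _ k')]
    · exact .inr ⟨h1, rfl, by rw [hcase]; simp, by rw [hcase]; exact hxm⟩
    · intro z hz
      refine ⟨?_, hfr z hz⟩
      rw [update_of_ne (by rintro rfl; exact hz hxm)]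
      exact (h.frame z hz).1
  · -- the flow on the edge `(x, y')` is cancelled
    rw [if_neg hcase]
    obtain ⟨h3, h4⟩ := h3.resolve_left fun k => hcase k.1
    have hm' := h₀.mid y' (hT.avI _ h1) h3
    -- `x` keeps its flow but its successor changes from `y'` to `y`; now `y'` is the vertex without
    -- inflow.
    obtain ⟨k1, k2, hnx⟩ : fl₀ x = 1 ∧ Mid N s t x ∧ nx₀ x = y' := by
      rcases h₀.prev y' h3 hm' hm'.ne_right with ⟨_, k⟩ | ⟨k1, k2, k⟩
      · exact absurd (h4.symm.trans k) hxs
      · rw [h4] at k1 k2 k; exact ⟨k1, k2, k⟩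
    have hflx : fl x = 1 := o1.trans k1
    refine ⟨by omega, ⟨?_, ?_, ?_, h.flow.mid⟩, ?_, ?_, ?_, ?_⟩
    · intro z hz hzm
      by_cases hzx : z = x
      · subst hzx
        simp only [update_self]
        exact ⟨hE, hynext.imp_right fun k => ⟨k.1, k.2, hy'y.symm, trivial⟩⟩
      · rw [update_of_ne hzx]
        obtain ⟨k1, k2⟩ := h.flow.next z hz hzm
        refine ⟨k1, k2.imp_right ?_⟩
        rintro ⟨k2, k3, k4, k5⟩
        refine ⟨k2, k3, ?_, by rwa [update_of_ne k4]⟩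
        intro k
        rw [k, i1, h4] at k5
        exact hzx k5.symm
    · intro z hz hzm hzy'
      by_cases hzy : z = y
      · subst hzy
        simp only [update_self]
        exact .inr ⟨hflx, hxm, trivial⟩
      · rw [update_of_ne hzy]
        refine (h.flow.prev z hz hzm hzy).imp_right ?_
        rintro ⟨k1, k2, k3⟩
        refine ⟨k1, k2, ?_⟩
        rw [update_of_ne, k3]
        intro k
        rw [k, o2, hnx] at k3
        exact hzy' k3.symm
    · intro z hz
      obtain ⟨k1, k2⟩ := h.flow.first z hz
      refine ⟨k1, k2.imp_right ?_⟩
      rintro ⟨k2, k3, k4, k5⟩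
      refine ⟨k2, k3, ?_, by rwa [update_of_ne k4]⟩
      intro k
      rw [k, i1, h4] at k5
      exact hxs k5
    · exact fun z hz hlt' => ⟨(h.origO z hz (by omega)).1, hoO z hz hlt'⟩
    · exact fun z hz hlt' => ⟨hoI z hz hlt', (h.origI z hz (by omega)).2⟩
    · exact .inr ⟨h1, rfl, i2 h3, hm'⟩
    · exact fun z hz => ⟨(h.frame z hz).1, hfr z hz⟩

/-- The last step of the augmentation. -/
theorem TraceInv.last (h : TraceInv N s t F I₀ O₀ I O rI rO fl₀ nx₀ pv₀ m y r fl nx pv)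
    (hE : N.E s y) :
    FlowInv N s t (insert y F) t fl (update nx s y) (update pv y s) ∧ (y ∈ F → y = t) ∧
    ∀ z, ¬ Mid N s t z → fl z = fl₀ z ∧ (z ≠ s → update nx s y z = nx₀ z) ∧
      (z ≠ t → update pv y s z = pv₀ z) := by
  refine ⟨⟨?_, ?_, ?_, h.flow.mid⟩, ?_, ?_⟩
  · intro z hz hzm
    rw [update_of_ne hzm.2.1]
    obtain ⟨k1, k2⟩ := h.flow.next z hz hzm
    refine ⟨k1, k2.imp_right ?_⟩
    rintro ⟨k2, k3, k4, k5⟩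
    exact ⟨k2, k3, k3.ne_right, by rwa [update_of_ne k4]⟩
  · intro z hz hzm _
    by_cases hzy : z = y
    · subst hzy; exact .inl ⟨Set.mem_insert _ _, by simp⟩
    · rw [update_of_ne hzy]
      refine (h.flow.prev z hz hzm hzy).imp (fun k => ⟨Set.mem_insert_of_mem _ k.1, k.2⟩) ?_
      rintro ⟨k1, k2, k3⟩
      exact ⟨k1, k2, by rwa [update_of_ne k2.2.1]⟩
  · rintro z (rfl | hz)
    · refine ⟨hE, h.cur_ne.imp_right fun k => ⟨k.1, k.2, k.2.ne_right, by simp⟩⟩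
    · obtain ⟨k1, k2⟩ := h.flow.first z hz
      refine ⟨k1, k2.imp_right ?_⟩
      rintro ⟨k2, k3, k4, k5⟩
      exact ⟨k2, k3, k3.ne_right, by rwa [update_of_ne k4]⟩
  · intro hy
    rcases (h.flow.first y hy).2 with k | k
    · exact k
    · exact absurd rfl k.2.2.1
  · intro z hz
    obtain ⟨k1, k2, k3⟩ := h.frame z hz
    refine ⟨k1, fun hs => by rw [update_of_ne hs]; exact k2 hs, fun ht => ?_⟩
    rw [update_of_ne, k3 ht]
    rintro rfl
    rcases h.cur_ne with k | k
    · exact ht k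
    · exact hz k.2

/-- The effect of a successful augmentation. -/
structure Augmented (N : Net) (s t : ℕ) (F : Set ℕ) (fl₀ nx₀ pv₀ fl nx pv : ℕ → ℕ) : Prop where
  flow : FlowInv N s t (insert (nx s) F) t fl nx pv
  new : nx s ∈ F → nx s = t
  frame : ∀ z, ¬ Mid N s t z → fl z = fl₀ z ∧ (z ≠ s → nx z = nx₀ z) ∧ (z ≠ t → pv z = pv₀ z)

/-- While the path is traced back from `t`, `TraceInv` describes a flow in which only the current
vertex may lack inflow. The times of the visits decrease along the trace. Therefore the fields that
are still to be read have their original values, and the number of rounds is bounded by the clock of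
the search. -/
theorem wp_augment {k : Fin 3} {σ : State Reg Arr} (hσ : N.Holds σ)
    (hs : N.Reach N.u (σ.reg .s)) (hst : σ.reg .s ≠ σ.reg .t) (hO : σ.arr (.visOut k) (σ.reg .s) = 0)
    (hF : FlowInv N (σ.reg .s) (σ.reg .t) F (σ.reg .t) (σ.arr .flow) (σ.arr .nxt) (σ.arr .prv)) :
    WP (augment k) σ fun σ' τ =>
      (∀ y, New (σ.arr (.visIn k)) (σ'.arr (.visIn k)) y → N.Av {σ.reg .t} (σ.reg .s) y) ∧
      (∀ y, New (σ.arr (.visOut k)) (σ'.arr (.visOut k)) y → N.Av {σ.reg .t} (σ.reg .s) y) ∧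
      τ + 400 * N.work (σ'.arr (.visOut k)) ≤ 400 * N.work (σ.arr (.visOut k)) + 200 ∧
      ((σ'.reg .found = 0 ∧ σ'.arr .flow = σ.arr .flow ∧ σ'.arr .nxt = σ.arr .nxt ∧
        σ'.arr .prv = σ.arr .prv ∧ ∃ m, ResDone N (σ.reg .s) (σ.reg .t) (σ.arr .flow) (σ.arr .nxt)
          (σ.arr .prv) (σ.arr (.visIn k)) (σ.arr (.visOut k)) (σ'.arr (.visIn k))
          (σ'.arr (.visOut k)) (σ'.arr (.parIn k)) (σ'.arr (.parOut k)) 0 m) ∨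
      (σ'.reg .found = 1 ∧ Augmented N (σ.reg .s) (σ.reg .t) F (σ.arr .flow) (σ.arr .nxt)
        (σ.arr .prv) (σ'.arr .flow) (σ'.arr .nxt) (σ'.arr .prv))) := by
  unfold augment
  rw [wp_seq]
  refine (wp_residualSearch hσ hs hst hO fun y => hF.av_prv hst).mono_frame ?_
  rintro σ₁ τ₁ hfr ⟨m, hD, ht⟩
  obtain ⟨rI, rO, hT⟩ := hD.tree
  set S := σ.reg .s with hS
  set T := σ.reg .t with hT'
  have e_fl : σ₁.arr .flow = σ.arr .flow := hfr.2 _ (by simp [residualSearch, visitOutCopy])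
  have e_nx : σ₁.arr .nxt = σ.arr .nxt := hfr.2 _ (by simp [residualSearch, visitOutCopy])
  have e_pv : σ₁.arr .prv = σ.arr .prv := hfr.2 _ (by simp [residualSearch, visitOutCopy])
  have e_s : σ₁.reg .s = S := hfr.1 _ (by simp [residualSearch, visitOutCopy])
  have e_t : σ₁.reg .t = T := hfr.1 _ (by simp [residualSearch, visitOutCopy])
  have hle := hD.found_le
  rw [wp_when]
  simp only [Test.Holds, Expr.eval, Test.cost, Expr.cost]
  constructor
  swap
  · intro hf
    have hf0 : σ₁.reg .found = 0 := by omega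
    refine ⟨hT.avI, hT.avO, by omega, .inl ⟨hf0, e_fl, e_nx, e_pv, m, hf0 ▸ hD⟩⟩
  intro hf
  have hpt := hD.hit (by omega)
  simp only [wp_seq, wp_assign]
  refine WP.while (fun σ' τ => τ ≤ 60 * m ∧
    ((σ'.reg .halt = 0 ∧ ∃ r, τ + 60 * r ≤ 60 * m ∧
      TraceInv N S T F (σ.arr (.visIn k)) (σ.arr (.visOut k)) (σ₁.arr (.visIn k))
        (σ₁.arr (.visOut k)) rI rO (σ.arr .flow) (σ.arr .nxt) (σ.arr .prv) m (σ'.reg .y) r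
        (σ'.arr .flow) (σ'.arr .nxt) (σ'.arr .prv)) ∨
    (σ'.reg .halt = 1 ∧ Augmented N S T F (σ.arr .flow) (σ.arr .nxt) (σ.arr .prv) (σ'.arr .flow)
      (σ'.arr .nxt) (σ'.arr .prv)))) (60 * m) ?_ ?_ ?_ ?_
  · refine ⟨by omega, .inl ⟨by simp, m, by omega, ⟨?_, ?_, ?_, ?_, ?_⟩⟩⟩
    · simpa [e_fl, e_nx, e_pv, e_t] using hF
    · simp [e_fl, e_nx]
    · simp [e_fl, e_pv]
    · simp [e_t]
    · simp [e_fl, e_nx, e_pv]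
  · exact fun σ' τ h => h.1
  · rintro σ₂ τ₂ hF₂ ⟨hle₂, h⟩ hb
    rcases h with ⟨h0, r, hr, hI⟩ | ⟨h1, _⟩
    swap
    · simp [h1] at hb
    have f_pI : σ₂.arr (.parIn k) = σ₁.arr (.parIn k) := by rw [hF₂.2]; simp; simp
    have f_pO : σ₂.arr (.parOut k) = σ₁.arr (.parOut k) := by rw [hF₂.2]; simp; simp
    have f_s : σ₂.reg .s = S := by rw [hF₂.1]; simp [e_s]; simp
    obtain ⟨p1, p2, p3⟩ := hI.parent hT hpt
    set y := σ₂.reg .y with hy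
    set x := σ₁.arr (.parIn k) y with hx
    rw [wp_seq, wp_assign, wp_seq, wp_ite]
    simp only [Test.Holds, Expr.eval, Test.cost, Expr.cost, State.reg_setReg, State.arr_setReg,
      if_true, if_false, reduceCtorEq, f_pI, ← hy, ← hx]
    constructor
    · intro hxy
      rcases p3 with ⟨_, q2, q3, q4⟩ | ⟨q, _⟩
      swap
      · exact absurd hxy q
      rw [hxy] at p1 p2
      have hys : y ≠ S := by
        intro hc
        have hm := hF.mid y (hT.avI y q3) q2
        exact hm.2.1 hc
      obtain ⟨g1, g2, g3⟩ := hI.cancel hT hF p1 p2 q2 q3 q4 hys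
      simp only [Test.Holds, Expr.eval, Test.cost, Expr.cost, State.reg_setReg, State.arr_setReg,
        State.reg_setArr, State.arr_setArr,
        if_true, if_false, reduceCtorEq, f_pO, wp_write, wp_ite, wp_seq, wp_assign, f_s, hxy, wp_when]
      refine ⟨fun hc => absurd hc hys, fun _ => ⟨fun hc => absurd hc g1, fun _ => ?_⟩⟩
      exact ⟨by omega, .inl ⟨h0, _, by omega, g3⟩⟩
    · intro hxy
      rcases p3 with ⟨q, _⟩ | ⟨_, hE⟩
      · exact absurd q hxy
      rw [wp_seq, wp_write, wp_write]
      simp only [Test.Holds, Expr.eval, Test.cost, Expr.cost, State.reg_setReg, State.arr_setReg,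
        State.reg_setArr, State.arr_setArr,
        if_true, if_false, reduceCtorEq, wp_ite, wp_seq, wp_assign, f_s, wp_when, f_pO, ← hy]
      constructor
      · intro hxs
        rw [hxs] at hE p2 ⊢
        obtain ⟨g1, g2, g3⟩ := hI.last hE
        refine ⟨by omega, .inr ⟨by simp, ⟨?_, ?_, ?_⟩⟩⟩
        · simpa using g1
        · simpa using g2
        · simpa using g3
      · intro hxs
        obtain ⟨g1, g2⟩ := hI.edge hT hF p1 p2 hE hxs
        constructor
        · intro hc
          rw [if_pos hc] at g2
          rw [wp_write]
          simp only [Expr.eval, Expr.cost, State.reg_setReg, State.arr_setReg, State.reg_setArr,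
            State.arr_setArr, if_true, if_false, reduceCtorEq]
          exact ⟨by omega, .inl ⟨h0, _, by omega, g2⟩⟩
        · intro hc
          rw [if_neg hc] at g2
          exact ⟨by omega, .inl ⟨h0, _, by omega, g2⟩⟩
  · rintro σ₂ τ₂ hF₂ ⟨hle₂, h⟩ hb
    rcases h with ⟨h0, _⟩ | ⟨h1, h2⟩
    · simp [h0] at hb
    have f_vI : σ₂.arr (.visIn k) = σ₁.arr (.visIn k) := by rw [hF₂.2]; simp; simp
    have f_vO : σ₂.arr (.visOut k) = σ₁.arr (.visOut k) := by rw [hF₂.2]; simp; simp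
    have f_f : σ₂.reg .found = 1 := by rw [hF₂.1]; simp [hf]; simp
    rw [f_vI, f_vO]
    refine ⟨hT.avI, hT.avO, ?_, .inr ⟨f_f, h2⟩⟩
    simp; omega

end DominatorAlg

/-! ### Stages between consecutive single-vertex dominators, flow paths, and what the searches
prove. -/

namespace DominatorAlg

variable {N : Net} {s t : ℕ}

/-- `s` and `t` are consecutive single-vertex dominators of `u`. -/
structure IsStage (N : Net) (s t : ℕ) : Prop where
  us : N.Reach N.u s
  ne : s ≠ t
  st : N.Reach s t
  tr : N.Reach t N.root
  dom_s : ¬ N.Av {s} N.u N.root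
  dom_t : ¬ N.Av {t} N.u N.root
  cut : ∀ v, v ≠ s → v ≠ t → N.Av {v} s t

/-- In an acyclic graph a vertex other than `t` that still reaches `t` cannot be behind `t`, so the
condition of avoiding `t` is automatic. -/
theorem mid_iff {z : ℕ} : Mid N s t z ↔ N.Reach s z ∧ N.Reach z t ∧ z ≠ s ∧ z ≠ t := by
  constructor
  · intro h
    exact ⟨h.1.reach, h.2.2, h.2.1, h.ne_right⟩
  · rintro ⟨h1, h2, h3, h4⟩
    refine ⟨h1.av ?_, h3, h2⟩
    rintro a rfl _ h5
    exact h4 (h2.antisymm h5)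

theorem IsStage.av_us (h : IsStage N s t) : N.Av {t} N.u s := by
  refine h.us.av ?_
  rintro a rfl _ h5
  exact h.ne (h.st.antisymm h5)

/-- Otherwise a path from `u` through `s` and `v` to the root would avoid the dominator `t`. -/
theorem IsStage.reach_t (h : IsStage N s t) {v : ℕ} (hv : N.Av {t} s v) (hr : N.Reach v N.root) :
    N.Reach v t := by
  rcases hr.first {t} with h1 | h1 | ⟨a, b, h1, h2, rfl, _⟩
  · exact absurd ((h.av_us.trans hv).trans h1) h.dom_t
  · rw [show v = t from h1]; exact .refl _
  · exact h1.reach.tail h2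

theorem IsStage.live_cases (h : IsStage N s t) {v : ℕ} (hv : v ∈ N.Live s) :
    v = s ∨ Mid N s t v ∨ v ∈ N.Live t := by
  by_cases hvs : v = s
  · exact .inl hvs
  rcases hv.1.first {t} with h1 | h1 | ⟨a, b, _, _, rfl, h4⟩
  · exact .inr (.inl ⟨h1, hvs, h.reach_t h1 hv.2⟩)
  · exact absurd h1 h.ne
  · exact .inr (.inr ⟨h4, hv.2⟩)

theorem IsStage.live_mono (h : IsStage N s t) : N.Live t ⊆ N.Live s := fun _ hv =>
  ⟨h.st.trans hv.1, hv.2⟩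

theorem IsStage.not_live (h : IsStage N s t) : s ∉ N.Live t := fun k =>
  h.ne (h.st.antisymm k.1)

theorem Mid.not_live {z : ℕ} (h : Mid N s t z) : z ∉ N.Live t := fun k =>
  h.ne_right (h.2.2.antisymm k.1)

theorem Mid.live (h : IsStage N s t) {z : ℕ} (hz : Mid N s t z) : z ∈ N.Live s :=
  ⟨hz.1.reach, hz.2.2.trans h.tr⟩

/-! ### Paths of a flow -/

/-- `p 1, …, p L` is the path of a flow with the second vertex `g`. -/
structure FlowPath (N : Net) (s t g : ℕ) (fl nx pv : ℕ → ℕ) (p : ℕ → ℕ) (L : ℕ) : Prop where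
  first : p 1 = s
  second : p 2 = g
  last : p L = t
  two_le : 2 ≤ L
  inner : ∀ i, 2 ≤ i → i < L → fl (p i) = 1 ∧ Mid N s t (p i) ∧ nx (p i) = p (i + 1)
  prev : ∀ i, 1 ≤ i → i + 1 < L → pv (p (i + 1)) = p i
  edge : ∀ i, 1 ≤ i → i < L → N.E (p i) (p (i + 1))

variable {F : Set ℕ} {fl nx pv : ℕ → ℕ}

theorem FlowInv.iterate (h : FlowInv N s t F t fl nx pv) (z : ℕ)
    (hz : z = t ∨ (fl z = 1 ∧ Mid N s t z)) :
    ∃ k, nx^[k] z = t ∧ ∀ i < k, fl (nx^[i] z) = 1 ∧ Mid N s t (nx^[i] z) := by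
  induction hm : N.h z using Nat.strong_induction_on generalizing z with
  | _ m ih =>
    rcases hz with rfl | hz
    · exact ⟨0, rfl, by simp⟩
    · obtain ⟨h1, h2⟩ := h.next z hz.1 hz.2
      obtain ⟨k, k1, k2⟩ := ih _ (hm ▸ N.h_lt h1) (nx z) (h2.imp_right fun k => ⟨k.1, k.2.1⟩) rfl
      refine ⟨k + 1, k1, fun i hi => ?_⟩
      cases i with
      | zero => exact hz
      | succ i => exact k2 i (by omega)

theorem FlowInv.path (h : FlowInv N s t F t fl nx pv) {g : ℕ} (hg : g ∈ F) :
    ∃ p L, FlowPath N s t g fl nx pv p L := by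
  obtain ⟨h1, h2⟩ := h.first g hg
  obtain ⟨k, k1, k2⟩ := h.iterate g (h2.imp_right fun k => ⟨k.1, k.2.1⟩)
  obtain ⟨p, hp1, hp⟩ : ∃ p : ℕ → ℕ, p 1 = s ∧ ∀ i, 2 ≤ i → p i = nx^[i - 2] g :=
    ⟨fun i => if i = 1 then s else nx^[i - 2] g, rfl, fun i hi => if_neg (by omega)⟩
  have hp' : ∀ i, 2 ≤ i → nx (nx^[i - 2] g) = nx^[i + 1 - 2] g := by
    intro i hi
    rw [← iterate_succ_apply' nx]; congr 2; omega
  refine ⟨p, k + 2, ⟨hp1, hp 2 le_rfl, ?_, by omega, ?_, ?_, ?_⟩⟩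
  · rw [hp _ (by omega)]; exact k1
  · intro i hi1 hi2
    rw [hp _ hi1, hp _ (by omega), hp' _ hi1]
    exact ⟨(k2 _ (by omega)).1, (k2 _ (by omega)).2, rfl⟩
  · intro i hi1 hi2
    rw [hp _ (by omega)]
    rcases Nat.lt_or_ge i 2 with hi | hi
    · obtain rfl : i = 1 := by omega
      rcases h2 with h2 | h2
      · have := (k2 0 (by omega)).2.ne_right
        exact absurd h2 this
      · rw [hp1]; exact h2.2.2.2
    · rw [hp _ hi, ← hp' _ hi]
      obtain ⟨f1, f2⟩ := k2 (i - 2) (by omega)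
      rcases (h.next _ f1 f2).2 with f3 | f3
      · have := (k2 (i + 1 - 2) (by omega)).2.ne_right
        rw [hp' _ hi] at f3
        exact absurd f3 this
      · exact f3.2.2.2
  · intro i hi1 hi2
    rw [hp (i + 1) (by omega)]
    rcases Nat.lt_or_ge i 2 with hi | hi
    · obtain rfl : i = 1 := by omega
      rw [hp1]; exact h1
    · rw [hp _ hi, ← hp' _ hi]
      obtain ⟨f1, f2⟩ := k2 (i - 2) (by omega)
      exact (h.next _ f1 f2).1

/-- Every vertex with flow is on one of the paths. -/
theorem FlowInv.complete (h : FlowInv N s t F t fl nx pv) {z : ℕ} (hz : fl z = 1)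
    (hm : Mid N s t z) : ∃ g ∈ F, ∀ p L, FlowPath N s t g fl nx pv p L → ∃ i, 2 ≤ i ∧ i < L ∧ p i = z := by
  induction hk : N.h s - N.h z using Nat.strong_induction_on generalizing z with
  | _ m ih =>
    rcases h.prev z hz hm hm.ne_right with ⟨h1, h2⟩ | ⟨h1, h2, h3⟩
    · refine ⟨z, h1, fun p L hp => ⟨2, le_rfl, ?_, hp.second⟩⟩
      have := hp.two_le
      by_contra hc
      obtain rfl : L = 2 := by omega
      exact hm.ne_right (hp.second.symm.trans hp.last)
    · have hE := (h.next _ h1 h2).1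
      rw [h3] at hE
      have hle := h2.1.reach.h_le
      have hlt := N.h_lt hE
      obtain ⟨g, hg, hp⟩ := ih (N.h s - N.h (pv z)) (by omega) h1 h2 rfl
      refine ⟨g, hg, fun p L hpL => ?_⟩
      obtain ⟨i, hi1, hi2, hi3⟩ := hp p L hpL
      have h4 := (hpL.inner i hi1 hi2).2.2
      rw [hi3, h3] at h4
      refine ⟨i + 1, by omega, ?_, h4.symm⟩
      by_contra hc
      obtain rfl : L = i + 1 := by omega
      exact hm.ne_right (h4.trans hpL.last)

/-- A vertex has only one `prv`, so a common vertex propagates backwards along both paths in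
lockstep until one of them is at its second vertex. Then either the second vertices agree or an
inner vertex equals `s`. -/
theorem FlowPath.disjoint {g g' : ℕ} {p p' : ℕ → ℕ} {L L' : ℕ} (h : FlowPath N s t g fl nx pv p L)
    (h' : FlowPath N s t g' fl nx pv p' L') (hne : g ≠ g') (i j : ℕ) (hi1 : 2 ≤ i) (hi : i < L)
    (hj1 : 2 ≤ j) (hj : j < L') : p i ≠ p' j := by
  induction i using Nat.strong_induction_on generalizing j with
  | _ i ih =>
    intro hc
    have q1 := h.prev (i - 1) (by omega) (by omega)
    have q2 := h'.prev (j - 1) (by omega) (by omega)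
    rw [Nat.sub_add_cancel (by omega)] at q1 q2
    rw [hc, q2] at q1
    rcases Nat.lt_or_ge i 3 with hi3 | hi3
    · obtain rfl : i = 2 := by omega
      rcases Nat.lt_or_ge j 3 with hj3 | hj3
      · obtain rfl : j = 2 := by omega
        exact hne (h.second.symm.trans (hc.trans h'.second))
      · exact (h'.inner (j - 1) (by omega) (by omega)).2.1.2.1 (q1.trans h.first)
    · rcases Nat.lt_or_ge j 3 with hj3 | hj3
      · obtain rfl : j = 2 := by omega
        exact (h.inner (i - 1) (by omega) (by omega)).2.1.2.1 (q1.symm.trans h'.first)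
      · exact ih (i - 1) (by omega) (j - 1) (by omega) (by omega) (by omega) (by omega) q1.symm

/-! ### Paths in general -/

/-- `p 1, …, p L` is a path from `s` to `t`. -/
structure PathOn (N : Net) (s t : ℕ) (p : ℕ → ℕ) (L : ℕ) : Prop where
  first : p 1 = s
  last : p L = t
  two_le : 2 ≤ L
  edge : ∀ i, 1 ≤ i → i < L → N.E (p i) (p (i + 1))

theorem FlowPath.pathOn {g : ℕ} {p : ℕ → ℕ} {L : ℕ} (h : FlowPath N s t g fl nx pv p L) :
    PathOn N s t p L := ⟨h.first, h.last, h.two_le, h.edge⟩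

variable {p : ℕ → ℕ} {L : ℕ}

theorem PathOn.av (h : PathOn N s t p L) {A : Set ℕ} {i j : ℕ} (h1 : 1 ≤ i) (hij : i ≤ j)
    (hj : j ≤ L) (hA : ∀ k, i ≤ k → k ≤ j → p k ∉ A) : N.Av A (p i) (p j) := by
  induction j, hij using Nat.le_induction with
  | base => exact .refl (hA i le_rfl le_rfl)
  | succ j hij ih =>
    exact (ih (by omega) fun k k1 k2 => hA k k1 (by omega)).tail (h.edge j (by omega) (by omega))
      (hA _ (by omega) le_rfl)

theorem PathOn.reach (h : PathOn N s t p L) {i j : ℕ} (h1 : 1 ≤ i) (hij : i ≤ j)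
    (hj : j ≤ L) : N.Reach (p i) (p j) :=
  (h.av (A := ∅) h1 hij hj (by simp)).reach

theorem PathOn.ne (h : PathOn N s t p L) {i j : ℕ} (h1 : 1 ≤ i) (hij : i < j)
    (hj : j ≤ L) : p i ≠ p j := by
  intro hc
  have hr := h.reach (i := i + 1) (by omega) (by omega : i + 1 ≤ j) hj
  rw [← hc] at hr
  exact Net.not_E_of_reach hr (h.edge i h1 (by omega))

theorem PathOn.inj (h : PathOn N s t p L) {i j : ℕ} (h1 : 1 ≤ i) (hi : i ≤ L) (h2 : 1 ≤ j)
    (hj : j ≤ L) (hc : p i = p j) : i = j := by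
  rcases lt_trichotomy i j with k | k | k
  · exact absurd hc (h.ne h1 k hj)
  · exact k
  · exact absurd hc.symm (h.ne h2 k hi)

theorem PathOn.le_of_reach (h : PathOn N s t p L) {i j : ℕ} (h1 : 1 ≤ i) (hi : i ≤ L) (h2 : 1 ≤ j)
    (hj : j ≤ L) (hc : N.Reach (p i) (p j)) : i ≤ j := by
  by_contra hlt
  exact h.ne h2 (not_le.1 hlt) hi ((h.reach h2 (not_le.1 hlt).le hi).antisymm hc)

theorem PathOn.from_s (h : PathOn N s t p L) {j : ℕ} (h1 : 1 ≤ j) (hj : j ≤ L) : N.Reach s (p j) := by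
  rw [← h.first]; exact h.reach le_rfl h1 hj

theorem PathOn.to_t (h : PathOn N s t p L) {j : ℕ} (h1 : 1 ≤ j) (hj : j ≤ L) : N.Reach (p j) t := by
  rw [← h.last]; exact h.reach h1 hj le_rfl

theorem PathOn.mid (h : PathOn N s t p L) {j : ℕ} (h1 : 1 < j) (hj : j < L) : Mid N s t (p j) := by
  have := h.ne le_rfl h1 hj.le
  have h2 := h.ne h1.le hj le_rfl
  rw [h.first] at this; rw [h.last] at h2
  exact mid_iff.2 ⟨h.from_s h1.le hj.le, h.to_t h1.le hj.le, this.symm, h2⟩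

/-- Two paths from `s` to `t` without common inner vertices. -/
structure TwoPaths (N : Net) (s t : ℕ) (p : Bool → ℕ → ℕ) (L : Bool → ℕ) : Prop where
  path : ∀ b, PathOn N s t (p b) (L b)
  disj : ∀ b i j, 1 < i → i < L b → 1 < j → j < L (!b) → p b i ≠ p (!b) j

/-- A two-vertex cut has a vertex on each of two disjoint paths. -/
theorem TwoPaths.cut {p : Bool → ℕ → ℕ} {L : Bool → ℕ} (h : TwoPaths N s t p L) {v w : ℕ}
    (hv : v ≠ s ∧ v ≠ t) (hw : w ≠ s ∧ w ≠ t) (hc : ¬ N.Av {v, w} s t) :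
    ∃ b i j, 1 < i ∧ i < L b ∧ 1 < j ∧ j < L (!b) ∧ v = p b i ∧ w = p (!b) j := by
  have key : ∀ b, ∃ i, 1 < i ∧ i < L b ∧ (p b i = v ∨ p b i = w) := by
    intro b
    by_contra hcon
    push Not at hcon
    have hp := h.path b
    have := hp.av (A := {v, w}) le_rfl (by have := hp.two_le; omega : 1 ≤ L b) le_rfl ?_
    · rw [hp.first, hp.last] at this; exact hc this
    · intro k hk1 hk2 hk3
      rcases Nat.lt_or_ge k 2 with h2 | h2
      · obtain rfl : k = 1 := by omega
        rw [hp.first] at hk3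
        rcases hk3 with rfl | rfl
        · exact hv.1 rfl
        · exact hw.1 rfl
      rcases eq_or_lt_of_le hk2 with rfl | hlt
      · rw [hp.last] at hk3
        rcases hk3 with rfl | rfl
        · exact hv.2 rfl
        · exact hw.2 rfl
      · obtain ⟨k3, k4⟩ := hcon k h2 hlt
        rcases hk3 with hk3 | hk3
        · exact k3 hk3
        · exact k4 hk3
  obtain ⟨i, hi1, hi2, hi3⟩ := key false
  obtain ⟨j, hj1, hj2, hj3⟩ := key true
  have hd := h.disj false i j hi1 hi2 hj1 hj2
  simp only [Bool.not_false] at hd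
  rcases hi3 with rfl | rfl <;> rcases hj3 with hj3 | hj3
  · exact absurd hj3.symm hd
  · exact ⟨false, i, j, hi1, hi2, hj1, hj2, rfl, hj3.symm⟩
  · exact ⟨true, j, i, hj1, hj2, hi1, hi2, hj3.symm, rfl⟩
  · exact absurd hj3.symm hd

/-! ### Consequences of the searches -/

variable {I₀ O₀ I O pI pO : ℕ → ℕ} {m : ℕ}

/-- Between consecutive single-vertex dominators there is a second path. -/
theorem ResDone.false_of_stage {f : ℕ} (hS : IsStage N s t) (hfs : fl s ≠ 1)
    (hF : FlowInv N s t {f} t fl nx pv) (h : ResDone N s t fl nx pv I₀ O₀ I O pI pO 0 m)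
    (hI₀ : ∀ z, Mid N s t z → I₀ z = 0) (hO₀ : ∀ z, Mid N s t z → O₀ z = 0) : False := by
  obtain ⟨rI, rO, hT⟩ := h.tree
  obtain ⟨p, L, hp⟩ := hF.path (g := f) rfl
  have hcomp : ∀ z, fl z = 1 → Mid N s t z → ∃ i, 2 ≤ i ∧ i < L ∧ p i = z := by
    intro z h1 h2
    obtain ⟨g, rfl, k⟩ := hF.complete h1 h2
    exact k p L hp
  have hL := hp.two_le
  -- the last vertex of the path is not visited
  have hlast : ∀ z, New O₀ O z → fl z = 1 → nx z ≠ t := by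
    intro z hz hfz hn
    have hm := hF.mid z (hT.avO z hz) hfz
    obtain ⟨k1, _, k2⟩ := hT.treeO z hz hm.2.1
    obtain ⟨k2, k3⟩ := k2.resolve_left fun k => k.2 hfz
    have hm' := hF.mid _ (hT.avI _ k1) k2
    rcases hF.prev _ k2 hm' hm'.ne_right with ⟨_, k4⟩ | ⟨_, _, k4⟩
    · exact hm.2.1 (k3.symm.trans k4)
    · rw [k3, hn] at k4; exact hm'.ne_right k4.symm
  -- An edge from `s` to `t` counts as saturated only if `flow s = 1`, so a failed search excludes
  -- it.
  have hst : ¬ N.E s t := fun hE => hfs (((h.closedO rfl s hT.source).2 t hE).1 rfl).1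
  -- From a visited out-copy with flow one gets to the in-copy of the same vertex and from there to
  -- the out-copy of its predecessor. Thus the visited out-copies form an initial part of the path.
  have hdown : ∀ i, 2 ≤ i → i < L → O (p i) ≠ 0 → O (p (i - 1)) ≠ 0 := by
    intro i hi1 hi2 hO
    obtain ⟨h1, h2, h3⟩ := hp.inner i hi1 hi2
    have hIi := (h.closedO rfl (p i) ⟨hO₀ _ h2, hO⟩).1 h1
    have := (h.closedI (p i) ⟨hI₀ _ h2, hIi⟩).1 h1
    have k := hp.prev (i - 1) (by omega) (by omega)
    rw [Nat.sub_add_cancel (by omega)] at k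
    rwa [k] at this
  by_cases hex : ∃ c, 2 ≤ c ∧ c < L ∧ O (p c) = 0
  · obtain ⟨c, hc1, hc2, hc3⟩ := hex
    have hup : ∀ i, c ≤ i → i < L → O (p i) = 0 := by
      intro i hi
      induction i, hi using Nat.le_induction with
      | base => exact fun _ => hc3
      | succ i hi ih =>
        intro hiL
        by_contra hne
        exact hdown (i + 1) (by omega) hiL hne (ih (by omega))
    classical
    obtain ⟨c, ⟨hc1, hc2, hc3⟩, hmin⟩ : ∃ c, (2 ≤ c ∧ c < L ∧ O (p c) = 0) ∧
        ∀ i, 2 ≤ i → i < c → O (p i) ≠ 0 := by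
      have hex : ∃ c, 2 ≤ c ∧ c < L ∧ O (p c) = 0 := ⟨c, hc1, hc2, hc3⟩
      refine ⟨Nat.find hex, Nat.find_spec hex, fun i h1 h2 h3 => Nat.find_min hex h2 ⟨h1, ?_, h3⟩⟩
      have := (Nat.find_spec hex).2.1; omega
    clear hup
    have hup : ∀ i, c ≤ i → i < L → O (p i) = 0 := by
      intro i hi
      induction i, hi using Nat.le_induction with
      | base => exact fun _ => hc3
      | succ i hi ih =>
        intro hiL
        by_contra hne
        exact hdown (i + 1) (by omega) hiL hne (ih (by omega))
    -- The first unvisited `p c` would be a single-vertex cut: along a path that avoids it, every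
    -- vertex that reaches `t` has a visited out-copy, and the search could not have missed `t`.
    have hcm := (hp.inner c hc1 hc2).2.1
    have hav := hS.cut (p c) hcm.2.1 hcm.ne_right
    have key := hav.induction (P := fun b => b ≠ t ∧ (N.Reach b t → O b ≠ 0))
      ⟨hS.ne, fun _ => hT.source.2⟩ ?_
    · exact key.1 rfl
    · rintro a b ha ⟨hat, hPa⟩ hE hb
      have hnewa : N.Reach a t → New O₀ O a := by
        intro hr
        refine ⟨?_, hPa hr⟩
        by_cases has : a = s
        · rw [has]; exact hT.source.1
        · exact hO₀ _ (mid_iff.2 ⟨ha.reach, hr, has, hat⟩)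
      have hbt : b ≠ t := by
        rintro rfl
        have hna := hnewa (.single hE)
        obtain ⟨k1, k2⟩ := ((h.closedO rfl a hna).2 b hE).1 rfl
        exact hlast a hna k1 k2
      refine ⟨hbt, fun hr => ?_⟩
      have hna := hnewa (.head hE hr)
      have hIb := ((h.closedO rfl a hna).2 b hE).2 hbt
      have hmb : Mid N s t b := by
        refine mid_iff.2 ⟨ha.reach.tail hE, hr, ?_, hbt⟩
        rintro rfl
        exact Net.not_E_of_reach ha.reach hE
      obtain ⟨k1, k2⟩ := h.closedI b ⟨hI₀ _ hmb, hIb⟩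
      by_cases hfb : fl b = 1
      · obtain ⟨j, hj1, hj2, rfl⟩ := hcomp b hfb hmb
        have k3 := k1 hfb
        have k := hp.prev (j - 1) (by omega) (by omega)
        rw [Nat.sub_add_cancel (by omega)] at k
        rw [k] at k3
        have hjc : j ≠ c := by rintro rfl; simp at hb
        rcases Nat.lt_or_ge j c with hlt | hge
        · exact hmin j hj1 hlt
        · exact absurd (hup (j - 1) (by omega) (by omega)) k3
      · exact k2 hfb
  -- If all out-copies on the path are visited, either its last inner vertex or the edge from `s` to
  -- `t` yields the contradiction.
  · push Not at hex
    rcases Nat.lt_or_ge L 3 with h3 | h3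
    · obtain rfl : L = 2 := by omega
      have := hp.edge 1 le_rfl (by omega)
      rw [hp.first, hp.last] at this
      exact hst this
    · obtain ⟨h1, h2, h3⟩ := hp.inner (L - 1) (by omega) (by omega)
      refine hlast (p (L - 1)) ⟨hO₀ _ h2, hex _ (by omega) (by omega)⟩ h1 ?_
      rw [h3, Nat.sub_add_cancel (by omega), hp.last]

/-- The two paths of a flow of value two. -/
theorem FlowInv.twoPaths {f g : ℕ} (hF : FlowInv N s t {g, f} t fl nx pv) (hfg : f ≠ g) :
    ∃ (p : Bool → ℕ → ℕ) (L : Bool → ℕ), TwoPaths N s t p L ∧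
      ∀ b, FlowPath N s t (if b then g else f) fl nx pv (p b) (L b) := by
  obtain ⟨p, L, hp⟩ := hF.path (g := f) (by simp)
  obtain ⟨q, M, hq⟩ := hF.path (g := g) (by simp)
  refine ⟨fun b => if b then q else p, fun b => if b then M else L, ⟨?_, ?_⟩, ?_⟩
  · rintro (_ | _)
    · exact hp.pathOn
    · exact hq.pathOn
  · rintro (_ | _) i j h1 h2 h3 h4
    · exact hp.disjoint hq hfg i j h1 h2 h3 h4
    · exact hq.disjoint hp hfg.symm i j h1 h2 h3 h4
  · rintro (_ | _)
    · exact hp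
    · exact hq

/-- If there are three disjoint paths, then two vertices do not separate `s` and `t`. -/
theorem ResDone.av_of_found {f g v w found : ℕ} (hst : s ≠ t)
    (hF : FlowInv N s t {g, f} t fl nx pv) (hfg : f ≠ g ∨ g = t)
    (h : ResDone N s t fl nx pv I₀ O₀ I O pI pO found m) (hfound : found ≠ 0)
    (hv : v ≠ s ∧ v ≠ t) (hw : w ≠ s ∧ w ≠ t) : N.Av {v, w} s t := by
  have hsA : s ∉ ({v, w} : Set ℕ) := by simp [hv.1.symm, hw.1.symm]
  have htA : t ∉ ({v, w} : Set ℕ) := by simp [hv.2.symm, hw.2.symm]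
  by_contra hcut
  -- Such an edge would avoid the cut. This also excludes `g = t`, so the two flow paths have
  -- distinct second vertices.
  have hE : ¬ N.E s t := fun hE => hcut ((Net.Av.refl hsA).tail hE htA)
  have hgt : g ≠ t := by
    rintro rfl; exact hE (hF.first g (by simp)).1
  obtain ⟨rI, rO, hT⟩ := h.tree
  obtain ⟨p, L, hP, hp⟩ := hF.twoPaths (hfg.resolve_right hgt)
  obtain ⟨c, i, j, hi1, hi2, hj1, hj2, rfl, rfl⟩ := hP.cut hv hw hcut
  -- a vertex with flow that is not behind the cut has its predecessor before the cut
  have hfi := ((hp c).inner i hi1 hi2).1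
  have hfj := ((hp !c).inner j hj1 hj2).1
  have hnin : ∀ b k i', (b = c ∧ i' = i) ∨ (b = (!c) ∧ i' = j) → 1 ≤ k → k ≤ L b → k ≠ i' →
      p b k ∉ ({p c i, p (!c) j} : Set ℕ) := by
    intro b k i' hb hk1 hk2 hki hmem
    rcases Nat.lt_or_ge k 2 with h2 | h2
    · obtain rfl : k = 1 := by omega
      rw [(hp b).first] at hmem; exact hsA hmem
    rcases eq_or_lt_of_le hk2 with rfl | hlt
    · rw [(hp b).last] at hmem; exact htA hmem
    rcases hb with ⟨rfl, rfl⟩ | ⟨rfl, rfl⟩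
    · rcases hmem with hmem | hmem
      · exact hki ((hP.path b).inj hk1 hk2 (by omega) (by omega) hmem)
      · exact hP.disj b k j h2 hlt hj1 hj2 hmem
    · rcases hmem with hmem | hmem
      · exact hP.disj c i k hi1 hi2 h2 hlt hmem.symm
      · exact hki ((hP.path _).inj hk1 hk2 (by omega) (by omega) hmem)
  have hback : ∀ y, fl y = 1 → Mid N s t y → (N.Av {p c i, p (!c) j} s y ∨ y = p c i ∨
      y = p (!c) j) → N.Av {p c i, p (!c) j} s (pv y) := by
    intro y hfy hmy hy
    have : ∃ b k i', ((b = c ∧ i' = i) ∨ (b = (!c) ∧ i' = j)) ∧ 2 ≤ k ∧ k < L b ∧ p b k = y := by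
      obtain ⟨g', hg', hk⟩ := hF.complete hfy hmy
      obtain ⟨b, rfl⟩ : ∃ b : Bool, g' = if b then g else f := by
        rcases hg' with rfl | rfl
        · exact ⟨true, rfl⟩
        · exact ⟨false, rfl⟩
      obtain ⟨k, k1, k2, k3⟩ := hk _ _ (hp b)
      by_cases hbc : b = c
      · exact ⟨b, k, i, .inl ⟨hbc, rfl⟩, k1, k2, k3⟩
      · exact ⟨b, k, j, .inr ⟨by cases b <;> cases c <;> simp_all, rfl⟩, k1, k2, k3⟩
    obtain ⟨b, k, i', hb, hk1, hk2, rfl⟩ := this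
    have hi' : 1 < i' ∧ i' < L b ∧ p b i' ∈ ({p c i, p (!c) j} : Set ℕ) := by
      rcases hb with ⟨rfl, rfl⟩ | ⟨rfl, rfl⟩
      · exact ⟨hi1, hi2, by simp⟩
      · exact ⟨hj1, hj2, by simp⟩
    have hki : k ≤ i' := by
      rcases hy with hy | hy
      · by_contra hlt
        apply hcut
        have := (hP.path b).av (A := {p c i, p (!c) j}) (i := k) (j := L b) (by omega) hk2.le le_rfl
          fun l hl1 hl2 => hnin b l i' hb (by omega) hl2 (by omega)
        rw [(hp b).last] at this
        exact hy.trans this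
      · by_contra hlt
        exact hnin b k i' hb (by omega) hk2.le (by omega) (by simpa using hy)
    have hpk := (hp b).prev (k - 1) (by omega) (by omega)
    rw [Nat.sub_add_cancel (by omega)] at hpk
    rw [hpk, ← (hp b).first]
    exact (hP.path b).av le_rfl (by omega) (by omega) fun l hl1 hl2 =>
      hnin b l i' hb hl1 (by omega) (by omega)
  -- Induction on the time of the visit. The cut is saturated: an in-copy of one of its vertices
  -- carries flow and so leads back only, and cancelling flow never crosses the cut forwards. So no
  -- visited out-copy of a vertex that reaches `t` is beyond the cut.
  have key : ∀ r x, New O₀ O x → N.Reach x t → rO x = r → N.Av {p c i, p (!c) j} s x := by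
    intro r
    induction r using Nat.strong_induction_on with
    | _ r ih =>
      intro z hz hzt hr
      by_cases hzs : z = s
      · rw [hzs]; exact .refl hsA
      obtain ⟨k1, k2, k3⟩ := hT.treeO z hz hzs
      obtain ⟨l1, l2, l3⟩ := hT.treeI _ k1
      set y := pO z
      have hya := hT.avI y k1
      have hyt : N.Reach y t := by
        rcases k3 with ⟨k3, _⟩ | ⟨k3, _⟩
        · rw [k3]; exact hzt
        · exact (hF.mid y hya k3).2.2
      have hxt : N.Reach (pI y) t := by
        rcases l3 with ⟨l3, _⟩ | l3
        · rw [l3]; exact hyt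
        · exact .head l3 hyt
      have hx := ih (rO (pI y)) (by omega) _ l1 hxt rfl
      have hyc : N.Av {p c i, p (!c) j} s y ∨ y = p c i ∨ y = p (!c) j := by
        rcases l3 with ⟨l3, _⟩ | l3
        · rw [l3] at hx; exact .inl hx
        · by_cases hmem : y ∈ ({p c i, p (!c) j} : Set ℕ)
          · exact .inr hmem
          · exact .inl (hx.tail l3 hmem)
      rcases k3 with ⟨k3, k4⟩ | ⟨k3, k4⟩
      · rw [← k3]
        rw [← k3] at k4
        rcases hyc with hyc | hyc | hyc
        · exact hyc
        · rw [hyc] at k4; exact absurd hfi k4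
        · rw [hyc] at k4; exact absurd hfj k4
      · rw [← k4]
        exact hback y k3 (hF.mid y hya k3) hyc
  obtain ⟨h1, h2⟩ := h.hit hfound
  exact hcut ((key _ _ h1 (.single h2) rfl).tail h2 htA)

end DominatorAlg

/-! ### Jumps between two disjoint paths and two-vertex cuts. -/

namespace DominatorAlg

variable {N : Net} {s t : ℕ} {p : Bool → ℕ → ℕ} {L : Bool → ℕ} {S : Set ℕ} {ps : Bool → ℕ → ℕ}

/-- Two disjoint paths, the set `S` of their vertices without `s`, and the positions on them. -/
structure Layout (N : Net) (s t : ℕ) (p : Bool → ℕ → ℕ) (L : Bool → ℕ) (S : Set ℕ)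
    (ps : Bool → ℕ → ℕ) : Prop where
  two : TwoPaths N s t p L
  three_le : ∀ b, 3 ≤ L b
  stop_iff : ∀ y, N.Reach s y → (y ∈ S ↔ y = t ∨ ∃ b i, 1 < i ∧ i < L b ∧ y = p b i)
  ps_t : ∀ b, ps b t = L b
  ps_inner : ∀ b i, 1 < i → i < L b → ps b (p b i) = i
  ps_pos : ∀ b y, N.Reach s y → ps b y ≠ 0 → y = t ∨ ∃ i, 1 < i ∧ i < L b ∧ y = p b i

/-- A jump from a vertex of the path `b` before the position `i` passes over position `j` of the
path `c`. -/
def Over (N : Net) (S : Set ℕ) (p ps : Bool → ℕ → ℕ) (b c : Bool) (i j : ℕ) : Prop :=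
  ∃ i', 1 ≤ i' ∧ i' < i ∧ ∃ y, N.Jump S (p b i') y ∧ j < ps c y

namespace Layout

variable (H : Layout N s t p L S ps)
include H

theorem ps_eq {b : Bool} {i : ℕ} (h1 : 1 < i) (h2 : i ≤ L b) : ps b (p b i) = i := by
  rcases eq_or_lt_of_le h2 with rfl | h2
  · rw [(H.two.path b).last, H.ps_t]
  · exact H.ps_inner b i h1 h2

theorem of_ps {b : Bool} {y : ℕ} (hy : N.Reach s y) (h : ps b y ≠ 0) :
    1 < ps b y ∧ ps b y ≤ L b ∧ p b (ps b y) = y := by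
  rcases H.ps_pos b y hy h with rfl | ⟨i, h1, h2, rfl⟩
  · rw [H.ps_t]; exact ⟨by have := H.three_le b; omega, le_rfl, (H.two.path b).last⟩
  · rw [H.ps_inner b i h1 h2]; exact ⟨h1, h2.le, rfl⟩

theorem ps_le {b : Bool} {y : ℕ} (hy : N.Reach s y) : ps b y ≤ L b := by
  by_cases h : ps b y = 0
  · omega
  · exact (H.of_ps hy h).2.1

theorem mem_stopSet {b : Bool} {i : ℕ} (h1 : 1 < i) (h2 : i ≤ L b) : p b i ∈ S := by
  rw [H.stop_iff _ ((H.two.path b).from_s h1.le h2)]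
  rcases eq_or_lt_of_le h2 with rfl | h2
  · exact .inl (H.two.path b).last
  · exact .inr ⟨b, i, h1, h2, rfl⟩

/-- The characterization of the two-vertex cuts by jumps. -/
theorem cut_iff {ix : Bool → ℕ} (h1 : ∀ b, 1 < ix b) (h2 : ∀ b, ix b < L b) :
    N.Av {x | ∃ b, x = p b (ix b)} s t ↔ ∃ b c, Over N S p ps b c (ix b) (ix c) := by
  set A := {x | ∃ b, x = p b (ix b)} with hA
  have hAS : A ⊆ S := by rintro _ ⟨b, rfl⟩; exact H.mem_stopSet (h1 b) (h2 b).le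
  have hnA : ∀ b k, 1 ≤ k → k ≤ L b → k ≠ ix b → p b k ∉ A := by
    rintro b k k1 k2 k3 ⟨c, hc⟩
    by_cases hbc : c = b
    · subst hbc
      exact k3 ((H.two.path c).inj k1 k2 (h1 c).le (h2 c).le hc)
    · obtain rfl : c = !b := by cases b <;> cases c <;> simp_all
      have hm := (H.two.path (!b)).mid (h1 _) (h2 _)
      rw [← hc] at hm
      have hk1 : k ≠ 1 := by rintro rfl; exact hm.2.1 (H.two.path b).first
      have hk2 : k ≠ L b := by rintro rfl; exact hm.ne_right (H.two.path b).last
      exact H.two.disj b k _ (by omega) (by omega) (h1 _) (h2 _) hc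
  constructor
  · intro hav
    by_contra hno
    push Not at hno
    -- Invariant along the avoiding path: the path vertex met last (or `s`) lies before the chosen
    -- position of its path, and no vertex of `S` has been met since. Without a jump over a chosen
    -- position this persists for ever, so `t` is not reached.
    have := hav.induction (P := fun x => x ≠ t ∧ ∃ c i, 1 ≤ i ∧ i < ix c ∧
      Relation.ReflTransGen (fun a b => N.E a b ∧ b ∉ S) (p c i) x) ⟨?_, ?_⟩ ?_
    · exact this.1 rfl
    · rintro rfl
      have := (H.two.path true).ne le_rfl (by have := H.three_le true; omega : 1 < L true) le_rfl
      rw [(H.two.path true).first, (H.two.path true).last] at this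
      exact this rfl
    · exact ⟨true, 1, le_rfl, h1 _, by rw [(H.two.path true).first]⟩
    · rintro a b ha ⟨hat, c, i, hi1, hi2, hr⟩ hE hb
      have hsb := ha.reach.tail hE
      have hJ : N.Jump S (p c i) b := ⟨a, hr, hE⟩
      have hover : ∀ d, ps d b ≤ ix d := fun d => by
        by_contra hlt
        exact hno c d ⟨i, hi1, hi2, b, hJ, not_le.1 hlt⟩
      by_cases hbS : b ∈ S
      · rcases (H.stop_iff b hsb).1 hbS with rfl | ⟨d, k, k1, k2, rfl⟩
        · have := hover true
          rw [H.ps_t] at this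
          have := h2 true
          omega
        · have h3 := hover d
          rw [H.ps_inner d k k1 k2] at h3
          have hne : k ≠ ix d := by rintro rfl; exact hb ⟨d, rfl⟩
          exact ⟨((H.two.path d).mid k1 k2).ne_right, d, k, k1.le, by omega, .refl⟩
      · refine ⟨?_, c, i, hi1, hi2, hr.tail ⟨hE, hbS⟩⟩
        rintro rfl
        exact hbS ((H.stop_iff b hsb).2 (.inl rfl))
  · rintro ⟨b, c, i, hi1, hi2, y, ⟨z, hz, hE⟩, hj⟩
    -- Three pieces avoid both chosen vertices: the path `b` up to the start of the jump, the jump,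
    -- and the path `c` from the landing point on.
    have hi3 := h2 b
    have a1 := (H.two.path b).av (A := A) le_rfl hi1 (by omega) fun k k1 k2 =>
      hnA b k k1 (by omega) (by omega)
    rw [(H.two.path b).first] at a1
    have a2 : N.Av A (p b i) z := ⟨hnA b i hi1 (by omega) (by omega),
      Relation.ReflTransGen.mono (fun _ _ k => ⟨k.1, fun l => k.2 (hAS l)⟩) _ _ hz⟩
    have hsy := (a1.trans a2).reach.tail hE
    obtain ⟨q1, q2, q3⟩ := H.of_ps hsy (b := c) (by omega)
    have a3 := (H.two.path c).av (A := A) (i := ps c y) (by omega) q2 le_rfl fun k k1 k2 =>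
      hnA c k (by omega) k2 (by omega)
    rw [(H.two.path c).last, q3] at a3
    exact (a1.trans a2).trans (Net.Av.head hE a2.right a3)

end Layout

/-- The vertex at position `i` of the path `b` is prime: no edge or path from an earlier vertex of
this path passes over it. -/
def Prime (N : Net) (S : Set ℕ) (p ps : Bool → ℕ → ℕ) (b : Bool) (i : ℕ) : Prop :=
  ¬ Over N S p ps b b i i

/-- This monotonicity is what makes the partners of a vertex an interval among the prime vertices.
-/
theorem Over.mono {b c : Bool} {i i' j j' : ℕ} (h : Over N S p ps b c i j) (hi : i ≤ i')
    (hj : j' ≤ j) : Over N S p ps b c i' j' := by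
  obtain ⟨k, h1, h2, y, h3, h4⟩ := h
  exact ⟨k, h1, by omega, y, h3, by omega⟩

/-- The vertices at position `i` of the path `b` and at position `j` of the other path separate `s`
and `t`. -/
def Match (N : Net) (L : Bool → ℕ) (S : Set ℕ) (p ps : Bool → ℕ → ℕ) (b : Bool) (i j : ℕ) : Prop :=
  (1 < i ∧ i < L b) ∧ (1 < j ∧ j < L !b) ∧ Prime N S p ps b i ∧ Prime N S p ps (!b) j ∧
    ¬ Over N S p ps b (!b) i j ∧ ¬ Over N S p ps (!b) b j i

theorem Match.symm {b : Bool} {i j : ℕ} (h : Match N L S p ps b i j) :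
    Match N L S p ps (!b) j i := by
  obtain ⟨h1, h2, h3, h4, h5, h6⟩ := h
  refine ⟨h2, ?_, h4, ?_, ?_, ?_⟩ <;> simpa

/-- The choice of the starting and of the landing path in `Layout.cut_iff` gives four cases: two
state that the vertices are prime, and two that no jump from one path passes over the vertex on the
other. -/
theorem Layout.match_iff (H : Layout N s t p L S ps) {b : Bool} {i j : ℕ} (hi : 1 < i ∧ i < L b)
    (hj : 1 < j ∧ j < L !b) :
    Match N L S p ps b i j ↔ ¬ N.Av {p b i, p (!b) j} s t := by
  have h := H.cut_iff (ix := fun c => if c = b then i else j) ?_ ?_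
  · have hset : ({x | ∃ c, x = p c (if c = b then i else j)} : Set ℕ) = {p b i, p (!b) j} := by
      ext x
      constructor
      · rintro ⟨c, rfl⟩
        by_cases hcb : c = b
        · subst hcb; simp
        · obtain rfl : c = !b := by cases b <;> cases c <;> simp_all
          simp
      · rintro (rfl | rfl)
        · exact ⟨b, by simp⟩
        · exact ⟨!b, by simp⟩
    rw [hset] at h
    rw [h]
    unfold Match Prime
    constructor
    · rintro ⟨_, _, h1, h2, h3, h4⟩ ⟨c, d, hcd⟩
      by_cases hcb : c = b <;> by_cases hdb : d = b
      · subst hcb; subst hdb; simp at hcd; exact h1 hcd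
      · obtain rfl : d = !b := by cases b <;> cases d <;> simp_all
        subst hcb; simp at hcd; exact h3 hcd
      · obtain rfl : c = !b := by cases b <;> cases c <;> simp_all
        subst hdb; simp at hcd; exact h4 hcd
      · obtain rfl : d = !b := by cases b <;> cases d <;> simp_all
        obtain rfl : c = !b := by cases b <;> cases c <;> simp_all
        simp at hcd; exact h2 hcd
    · intro hno
      refine ⟨hi, hj, fun h => hno ⟨b, b, by simpa⟩, fun h => hno ⟨!b, !b, by simpa⟩,
        fun h => hno ⟨b, !b, by simpa⟩, fun h => hno ⟨!b, b, by simpa⟩⟩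
  · intro c; split_ifs
    exacts [hi.1, hj.1]
  · intro c
    by_cases hcb : c = b
    · subst hcb; simpa using hi.2
    · obtain rfl : c = !b := by cases b <;> cases c <;> simp_all
      simpa using hj.2

/-- The fields that `AssignMinMax` computes for the path `b`; `hi` is the field of the other path. -/
structure MinMax (N : Net) (L : Bool → ℕ) (S : Set ℕ) (p ps : Bool → ℕ → ℕ) (b : Bool)
    (lo hi prime : ℕ → ℕ) : Prop where
  lo_prime : ∀ i, 1 ≤ i → i < L b → Prime N S p ps b i → lo i < L (!b) ∧
    ∀ j, 1 ≤ j → (lo i ≤ j ↔ ¬ Over N S p ps b (!b) i j)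
  lo_not : ∀ i, 1 ≤ i → i < L b → ¬ Prime N S p ps b i → lo i = L (!b)
  hi_spec : ∀ j, 1 ≤ j → j < L (!b) → 1 ≤ hi j ∧ hi j < L b ∧
    ¬ Over N S p ps b (!b) (hi j) j ∧ Over N S p ps b (!b) (hi j + 1) j
  prime_prime : ∀ i, 1 ≤ i → i < L b → Prime N S p ps b i → i < prime i ∧ prime i ≤ L b ∧
    (prime i < L b → Prime N S p ps b (prime i)) ∧
    ∀ k, i < k → k < prime i → ¬ Prime N S p ps b k
  prime_not : ∀ i, 1 ≤ i → i < L b → ¬ Prime N S p ps b i → 1 ≤ prime i ∧ prime i < i ∧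
    Prime N S p ps b (prime i) ∧ ∀ k, prime i < k → k ≤ i → ¬ Prime N S p ps b k

/-- The interval of the prime vertices of the other path that match the prime vertex at position `i`,
as computed by `ConstructVector`. -/
theorem Layout.interval (H : Layout N s t p L S ps) {b : Bool} {lo hi prime : Bool → ℕ → ℕ}
    (hM : ∀ c, MinMax N L S p ps c (lo c) (hi !c) (prime c)) {i : ℕ} (hi1 : 1 < i) (hi2 : i < L b)
    (hP : Prime N S p ps b i) {l h : ℕ}
    (hl : l = if lo (!b) (lo b i) = L b then prime (!b) (prime (!b) (lo b i)) else lo b i)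
    (hh : h = if lo (!b) (hi b i) = L b then prime (!b) (hi b i) else hi b i) :
    (∀ j, Match N L S p ps b i j ↔ l ≤ j ∧ j ≤ h ∧ Prime N S p ps (!b) j) ∧
    (l ≤ h → Match N L S p ps b i l ∧ Match N L S p ps b i h) := by
  have hMb := hM b
  have hMb' := hM (!b)
  rw [Bool.not_not] at hMb'
  obtain ⟨a1, a2⟩ := hMb.lo_prime i hi1.le hi2 hP
  obtain ⟨c1, c2, c3, c4⟩ := hMb'.hi_spec i hi1.le (by simpa using hi2)
  rw [Bool.not_not] at c3 c4
  -- The first edge of the other path is a jump from `s` over position 1.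
  have hlo2 : 2 ≤ lo b i := by
    by_contra hlt
    have := (a2 1 le_rfl).1 (by omega)
    apply this
    refine ⟨1, le_rfl, hi1, p (!b) 2, ⟨p b 1, .refl, ?_⟩, ?_⟩
    · have := (H.two.path (!b)).edge 1 le_rfl (by have := H.three_le (!b); omega)
      rwa [(H.two.path (!b)).first, ← (H.two.path b).first] at this
    · rw [H.ps_eq (by omega) (by have := H.three_le (!b); omega)]; omega
  -- `lo` doubles as a flag: the length of the opposite path is the value at exactly those vertices
  -- that are not prime.
  have hlop : ∀ k, 1 ≤ k → k < L !b → (lo (!b) k = L b ↔ ¬ Prime N S p ps (!b) k) := by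
    intro k k1 k2
    constructor
    · intro h1 h2
      have := (hMb'.lo_prime k k1 k2 h2).1
      rw [Bool.not_not] at this
      omega
    · intro h
      have := hMb'.lo_not k k1 k2 h
      rwa [Bool.not_not] at this
  have hlok := hlop (lo b i) (by omega) a1
  have hhik := hlop (hi b i) c1 c2
  -- the first prime position from `lo` on
  have hl' : lo b i ≤ l ∧ l ≤ L (!b) ∧ (l < L (!b) → Prime N S p ps (!b) l) ∧
      ∀ k, lo b i ≤ k → k < l → ¬ Prime N S p ps (!b) k := by
    by_cases hp : Prime N S p ps (!b) (lo b i)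
    · rw [if_neg (by rw [hlok]; simpa)] at hl
      subst hl
      exact ⟨le_rfl, a1.le, fun _ => hp, fun k h1 h2 => by omega⟩
    -- At a vertex that is not prime, `prime` points to the previous prime vertex, and there it
    -- points to the next one, which is the first prime position behind `lo`.
    · rw [if_pos (hlok.2 hp)] at hl
      obtain ⟨d1, d2, d3, d4⟩ := hMb'.prime_not (lo b i) (by omega) a1 hp
      obtain ⟨e1, e2, e3, e4⟩ := hMb'.prime_prime _ d1 (by omega) d3
      rw [← hl] at e1 e2 e3 e4
      refine ⟨?_, e2, e3, fun k k1 k2 => e4 k (by omega) k2⟩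
      by_contra hlt
      exact d4 l e1 (by omega) (e3 (by omega))
  have hh' : 1 ≤ h ∧ h ≤ hi b i ∧ Prime N S p ps (!b) h ∧
      ∀ k, h < k → k ≤ hi b i → ¬ Prime N S p ps (!b) k := by
    by_cases hp : Prime N S p ps (!b) (hi b i)
    · rw [if_neg (by rw [hhik]; simpa)] at hh
      subst hh
      exact ⟨c1, le_rfl, hp, fun k h1 h2 => by omega⟩
    · rw [if_pos (hhik.2 hp)] at hh
      obtain ⟨d1, d2, d3, d4⟩ := hMb'.prime_not (hi b i) c1 c2 hp
      rw [← hh] at d1 d2 d3 d4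
      exact ⟨d1, d2.le, d3, d4⟩
  -- Between `lo b i` and `hi b i` both crossing conditions hold and outside one of them fails; so
  -- only primality matters, and rounding the bounds to prime positions loses nothing.
  have hiff : ∀ j, Match N L S p ps b i j ↔ l ≤ j ∧ j ≤ h ∧ Prime N S p ps (!b) j := by
    intro j
    constructor
    · rintro ⟨_, ⟨j1, j2⟩, _, j3, j4, j5⟩
      have g1 := (a2 j (by omega)).2 j4
      have g2 : j ≤ hi b i := by
        by_contra hlt
        exact j5 (c4.mono (by omega) le_rfl)
      refine ⟨?_, ?_, j3⟩
      · by_contra hlt; exact hl'.2.2.2 j g1 (by omega) j3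
      · by_contra hlt; exact hh'.2.2.2 j (by omega) g2 j3
    · rintro ⟨j1, j2, j3⟩
      have g1 := hl'.1
      have g2 := hh'.2.1
      refine ⟨⟨hi1, hi2⟩, ⟨by omega, by omega⟩, hP, j3, (a2 j (by omega)).1 (by omega), ?_⟩
      intro ho
      exact c3 (ho.mono (by omega) le_rfl)
  have g2 := hh'.2.1
  exact ⟨hiff, fun hlh => ⟨(hiff l).2 ⟨le_rfl, hlh, hl'.2.2.1 (by omega)⟩,
    (hiff h).2 ⟨hlh, le_rfl, hh'.2.2.1⟩⟩⟩

end DominatorAlg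

/-! ### Storing paths, and the fields computed from furthest jumps. -/

namespace DominatorAlg

open RAM

variable {N : Net}

theorem wp_storePath {b : Bool} {σ : State Reg Arr} {s t g : ℕ} {fl pv p : ℕ → ℕ} {L : ℕ}
    (hp : FlowPath N s t g fl (σ.arr .nxt) pv p L) (hs : σ.reg .s = s) (ht : σ.reg .t = t)
    (hx : σ.reg .x = g) :
    WP (storePath b) σ fun σ' τ => τ ≤ 50 * L ∧ σ'.reg (.len b) = L ∧
      (∀ i, 1 ≤ i → i ≤ L → σ'.arr (.path b) i = p i) ∧
      (∀ i, 1 < i → i < L → σ'.arr .side (p i) = label b ∧ σ'.arr .pos (p i) = i) ∧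
      ∀ y, (∀ i, 1 < i → i < L → y ≠ p i) →
        σ'.arr .side y = σ.arr .side y ∧ σ'.arr .pos y = σ.arr .pos y := by
  have hP := hp.pathOn
  have hL := hp.two_le
  unfold storePath
  simp only [wp_seq, wp_write, wp_assign]
  refine WP.while_count 2 L hL (fun k σ' τ => τ ≤ 35 * (k - 2) ∧ σ'.reg (.len b) = k - 1 ∧
    σ'.reg .x = p k ∧ (∀ i, 1 ≤ i → i < k → σ'.arr (.path b) i = p i) ∧
    (∀ i, 1 < i → i < k → σ'.arr .side (p i) = label b ∧ σ'.arr .pos (p i) = i) ∧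
    ∀ y, (∀ i, 1 < i → i < k → y ≠ p i) →
        σ'.arr .side y = σ.arr .side y ∧ σ'.arr .pos y = σ.arr .pos y) ?_ ?_ ?_
  · refine ⟨by omega, by simp, by simp [hx, hp.second], ?_, ?_, ?_⟩
    · intro i h1 h2
      obtain rfl : i = 1 := by omega
      simp [hs, hp.first]
    · intro i h1 h2; omega
    · intro y _; simp
  · rintro k σ₁ τ₁ hk1 hk2 hF ⟨h1, h2, h3, h4, h5, h6⟩
    have e_nx : σ₁.arr .nxt = σ.arr .nxt := by rw [hF.2]; simp; simp
    have e_t : σ₁.reg .t = t := by rw [hF.1]; simp [ht]; simp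
    have hkt : p k ≠ t := by rw [← hp.last]; exact hP.ne (by omega) hk2 le_rfl
    refine ⟨by simp [h3, e_t, hkt], ?_⟩
    simp only [wp_seq, wp_write, wp_assign]
    have hlen : k - 1 + 1 = k := by omega
    simp [h2, h3, e_nx, hlen]
    refine ⟨by omega, (hp.inner k hk1 hk2).2.2, ?_, ?_, ?_⟩
    · intro i hi1 hi2
      by_cases hik : i = k
      · subst hik; simp
      · rw [update_of_ne hik]; exact h4 i hi1 (by omega)
    · intro i hi1 hi2
      by_cases hik : i = k
      · subst hik; simp
      · have : p i ≠ p k := hP.ne (by omega) (by omega) (by omega)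
        rw [update_of_ne this, update_of_ne this]; exact h5 i hi1 (by omega)
    · intro y hy
      have : y ≠ p k := hy k (by omega) (by omega)
      rw [update_of_ne this, update_of_ne this]
      exact h6 y fun i hi1 hi2 => hy i hi1 (by omega)
  · rintro σ₁ τ₁ hF ⟨h1, h2, h3, h4, h5, h6⟩
    have e_t : σ₁.reg .t = t := by rw [hF.1]; simp [ht]; simp
    have hlen : L - 1 + 1 = L := by omega
    have hLt : p L = t := hp.last
    refine ⟨by simp [h3, e_t, hLt], ?_⟩
    simp [wp_seq, wp_write, wp_assign, h2, hlen, e_t]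
    refine ⟨by omega, ?_, h5, h6⟩
    intro i hi1 hi2
    by_cases hiL : i = L
    · subst hiL; simp [hLt]
    · rw [update_of_ne hiL]; exact h4 i hi1 (by omega)

theorem wp_storeTrunk {σ : State Reg Arr} {s t g : ℕ} {fl pv p : ℕ → ℕ} {L : ℕ}
    (hp : FlowPath N s t g fl (σ.arr .nxt) pv p L) (hs : σ.reg .u = s) (ht : σ.reg .root = t)
    (hg : σ.arr .nxt s = g) :
    WP storeTrunk σ fun σ' τ => τ ≤ 50 * L ∧ σ'.reg (.len false) = L ∧
      (∀ i, 1 ≤ i → i ≤ L → σ'.arr .trunk i = p i) ∧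
      (∀ i, 1 < i → i ≤ L → σ'.arr .trunkSide (p i) = label false ∧ σ'.arr .trunkPos (p i) = i) ∧
      ∀ y, (∀ i, 1 < i → i ≤ L → y ≠ p i) →
        σ'.arr .trunkSide y = σ.arr .trunkSide y ∧ σ'.arr .trunkPos y = σ.arr .trunkPos y := by
  have hP := hp.pathOn
  have hL := hp.two_le
  have hnx : ∀ k, 1 ≤ k → k < L → σ.arr .nxt (p k) = p (k + 1) := by
    intro k h1 h2
    rcases Nat.lt_or_ge k 2 with h3 | h3
    · obtain rfl : k = 1 := by omega
      rw [hp.first, hg, hp.second]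
    · exact (hp.inner k h3 h2).2.2
  unfold storeTrunk
  simp only [wp_seq, wp_write, wp_assign]
  refine WP.while_count 1 L (by omega) (fun k σ' τ => τ ≤ 35 * (k - 1) ∧ σ'.reg (.len false) = k ∧
    σ'.reg .x = p k ∧ (∀ i, 1 ≤ i → i ≤ k → σ'.arr .trunk i = p i) ∧
    (∀ i, 1 < i → i ≤ k → σ'.arr .trunkSide (p i) = label false ∧ σ'.arr .trunkPos (p i) = i) ∧
    ∀ y, (∀ i, 1 < i → i ≤ k → y ≠ p i) →
        σ'.arr .trunkSide y = σ.arr .trunkSide y ∧ σ'.arr .trunkPos y = σ.arr .trunkPos y) ?_ ?_ ?_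
  · refine ⟨by omega, by simp, by simp [hs, hp.first], ?_, ?_, ?_⟩
    · intro i h1 h2
      obtain rfl : i = 1 := by omega
      simp [hs, hp.first]
    · intro i h1 h2; omega
    · intro y _; simp
  · rintro k σ₁ τ₁ hk1 hk2 hF ⟨h1, h2, h3, h4, h5, h6⟩
    have e_nx : σ₁.arr .nxt = σ.arr .nxt := by rw [hF.2]; simp; simp
    have e_t : σ₁.reg .root = t := by rw [hF.1]; simp [ht]; simp
    have hkt : p k ≠ t := by rw [← hp.last]; exact hP.ne (by omega) hk2 le_rfl
    refine ⟨by simp [h3, e_t, hkt], ?_⟩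
    simp only [wp_seq, wp_write, wp_assign]
    simp [h2, h3, e_nx, hnx k hk1 hk2]
    refine ⟨by omega, ?_, ?_, ?_⟩
    · intro i hi1 hi2
      by_cases hik : i = k + 1
      · subst hik; simp
      · rw [update_of_ne hik]; exact h4 i hi1 (by omega)
    · intro i hi1 hi2
      by_cases hik : i = k + 1
      · subst hik; simp
      · have : p i ≠ p (k + 1) := hP.ne (by omega) (by omega) (by omega)
        rw [update_of_ne this, update_of_ne this]; exact h5 i hi1 (by omega)
    · intro y hy
      have : y ≠ p (k + 1) := hy (k + 1) (by omega) (by omega)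
      rw [update_of_ne this, update_of_ne this]
      exact h6 y fun i hi1 hi2 => hy i hi1 (by omega)
  · rintro σ₁ τ₁ hF ⟨h1, h2, h3, h4, h5, h6⟩
    have e_t : σ₁.reg .root = t := by rw [hF.1]; simp [ht]; simp
    have hLt : p L = t := hp.last
    refine ⟨by simp [h3, e_t, hLt], ?_⟩
    simp
    exact ⟨by omega, h2, h4, h5, h6⟩

/-! ### `AssignMinMax` -/

/-- The work for the first vertices of a path. -/
def pathWork (N : Net) (p : ℕ → ℕ) (i : ℕ) : ℕ := ∑ k ∈ Finset.Ico 1 i, (N.deg (p k) + 1)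

theorem pathWork_succ {p : ℕ → ℕ} {i : ℕ} (hi : 1 ≤ i) :
    pathWork N p (i + 1) = pathWork N p i + (N.deg (p i) + 1) :=
  Finset.sum_Ico_succ_top hi _

theorem le_pathWork {p : ℕ → ℕ} {i : ℕ} : i ≤ pathWork N p i + 1 := by
  have : ∑ k ∈ Finset.Ico 1 i, 1 ≤ pathWork N p i := Finset.sum_le_sum fun k _ => by omega
  simp at this
  omega

/-- The marks after the searches from the vertices before position `i`. -/
structure Marks (N : Net) (S : Set ℕ) (p f₁ f₂ m₀ : ℕ → ℕ) (c₁ c₂ i : ℕ) (m : ℕ → ℕ) (r₁ r₂ : ℕ) :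
    Prop where
  new : ∀ y, New m₀ m y → ∃ i', 1 ≤ i' ∧ i' < i ∧ N.Jump S (p i') y
  closed : ∀ v, ((∃ i', 1 ≤ i' ∧ i' < i ∧ v = p i') ∨ (New m₀ m v ∧ v ∉ S)) →
    ∀ y, N.E v y → m y ≠ 0
  max₁ : MaxInv c₁ r₁ (New m₀ m) (fun y => ∃ i', 1 ≤ i' ∧ i' < i ∧ N.Jump S (p i') y) f₁
  max₂ : MaxInv c₂ r₂ (New m₀ m) (fun y => ∃ i', 1 ≤ i' ∧ i' < i ∧ N.Jump S (p i') y) f₂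

section
variable {S : Set ℕ} {p f₁ f₂ m₀ m m' : ℕ → ℕ} {c₁ c₂ i r₁ r₂ r₁' r₂' : ℕ}

theorem MaxInv.comp {r r' r'' : ℕ} {n n₁ n₂ j j₁ j₂ : ℕ → Prop} {f : ℕ → ℕ}
    (h : MaxInv r r' n₁ j₁ f) (h' : MaxInv r' r'' n₂ j₂ f) (hn : ∀ y, n y → n₁ y ∨ n₂ y)
    (hj₁ : ∀ y, j₁ y → j y) (hj₂ : ∀ y, j₂ y → j y) : MaxInv r r'' n j f := by
  refine ⟨h.le.trans h'.le, fun y hy => ?_, ?_⟩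
  · rcases hn y hy with k | k
    · exact (h.ub y k).trans h'.le
    · exact h'.ub y k
  · rcases h'.att with k | ⟨y, k1, k2⟩
    · rw [k]; exact h.att.imp_right fun ⟨y, k1, k2⟩ => ⟨y, hj₁ y k1, k2⟩
    · exact .inr ⟨y, hj₂ y k1, k2⟩

theorem Marks.zero : Marks N S p f₁ f₂ m₀ c₁ c₂ 1 m₀ c₁ c₂ := by
  refine ⟨?_, ?_, ?_, ?_⟩
  · rintro y ⟨h1, h2⟩; exact absurd h1 h2
  · rintro v (⟨i', h1, h2, _⟩ | ⟨⟨h1, h2⟩, _⟩)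
    · omega
    · exact absurd h1 h2
  · exact ⟨le_rfl, by rintro y ⟨h1, h2⟩; exact absurd h1 h2, .inl rfl⟩
  · exact ⟨le_rfl, by rintro y ⟨h1, h2⟩; exact absurd h1 h2, .inl rfl⟩

theorem Marks.step (h : Marks N S p f₁ f₂ m₀ c₁ c₂ i m r₁ r₂) (hi : 1 ≤ i)
    (hF : Found N S (p i) m f₁ f₂ r₁ r₂ m' r₁' r₂') :
    Marks N S p f₁ f₂ m₀ c₁ c₂ (i + 1) m' r₁' r₂' := by
  have hnew : ∀ y, New m₀ m' y → New m₀ m y ∨ (m y = 0 ∧ m' y ≠ 0) := by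
    intro y hy
    by_cases hmy : m y = 0
    · exact .inr ⟨hmy, hy.2⟩
    · exact .inl ⟨hy.1, hmy⟩
  have hlift : ∀ y, (∃ i', 1 ≤ i' ∧ i' < i ∧ N.Jump S (p i') y) →
      ∃ i', 1 ≤ i' ∧ i' < i + 1 ∧ N.Jump S (p i') y :=
    fun y ⟨i', h1, h2, h3⟩ => ⟨i', h1, by omega, h3⟩
  refine ⟨fun y hy => ?_, fun v hv y hE => ?_, ?_, ?_⟩
  · rcases hnew y hy with k | k
    · exact hlift y (h.new y k)
    · exact ⟨i, hi, by omega, hF.new y k.1 k.2⟩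
  · rcases hv with ⟨i', h1, h2, rfl⟩ | ⟨hv, hvS⟩
    · by_cases hii : i' = i
      · subst hii; exact hF.closed _ (.inl rfl) y hE
      · exact hF.mono y (h.closed _ (.inl ⟨i', h1, by omega, rfl⟩) y hE)
    · rcases hnew v hv with k | k
      · exact hF.mono y (h.closed _ (.inr ⟨k, hvS⟩) y hE)
      · exact hF.closed v (.inr ⟨k.1, k.2, hvS⟩) y hE
  · exact h.max₁.comp hF.max₁ hnew hlift fun y k => ⟨i, hi, by omega, k⟩
  · exact h.max₂.comp hF.max₂ hnew hlift fun y k => ⟨i, hi, by omega, k⟩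

/-- Every jump to a vertex `y` is seen if the marks were fresh on the vertices in between. -/
theorem Marks.jump (h : Marks N S p f₁ f₂ m₀ c₁ c₂ i m r₁ r₂) {i' y : ℕ} (h1 : 1 ≤ i') (h2 : i' < i)
    (hJ : N.Jump S (p i') y) (hfresh : ∀ v, v ≠ p i' → N.Reach (p i') v → N.Reach v y → m₀ v = 0) :
    New m₀ m y := by
  obtain ⟨z, hz, hE⟩ := hJ
  -- Walking along the jump: an inner vertex was unmarked at first and is outside `S`; once it is
  -- known to be marked it is new, hence closed, hence its successor is marked as well.
  have key : ∀ x, Relation.ReflTransGen (fun a b => N.E a b ∧ b ∉ S) (p i') x → N.Reach x y →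
      x = p i' ∨ (New m₀ m x ∧ x ∉ S) := by
    intro x hx
    induction hx with
    | refl => exact fun _ => .inl rfl
    | @tail a c ha hac ih =>
      intro hr
      have hne : c ≠ p i' := by
        rintro rfl
        exact Net.not_E_of_reach (Relation.ReflTransGen.mono (fun _ _ k => k.1) _ _ ha) hac.1
      have hrc : N.Reach (p i') c :=
        Net.Reach.tail (Relation.ReflTransGen.mono (fun _ _ k => k.1) _ _ ha) hac.1
      refine .inr ⟨⟨hfresh c hne hrc hr, ?_⟩, hac.2⟩
      refine h.closed a ?_ c hac.1
      rcases ih (.head hac.1 hr) with rfl | k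
      · exact .inl ⟨i', h1, h2, rfl⟩
      · exact .inr k
  have hpz : N.Reach (p i') z := Relation.ReflTransGen.mono (fun _ _ k => k.1) _ _ hz
  refine ⟨hfresh y ?_ (hpz.tail hE) (.refl _), ?_⟩
  · rintro rfl; exact Net.not_E_of_reach hpz hE
  · refine h.closed z ?_ y hE
    rcases key z hz (.single hE) with rfl | k
    · exact .inl ⟨i', h1, h2, rfl⟩
    · exact .inr k

end

variable {s t : ℕ} {p : Bool → ℕ → ℕ} {L : Bool → ℕ} {S : Set ℕ} {ps : Bool → ℕ → ℕ}

/-- Only `t` and inner vertices of the paths have positions, and all of these reach `t`. So it is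
enough that the jumps to vertices reaching `t` have been seen; stale marks elsewhere do no harm. The
maximum of the positions then decides whether `j` is passed. -/
theorem Layout.over_iff (H : Layout N s t p L S ps) {b c : Bool} {m₀ m : ℕ → ℕ} {r c₀ i j : ℕ}
    (hM : MaxInv c₀ r (New m₀ m) (fun y => ∃ i', 1 ≤ i' ∧ i' < i ∧ N.Jump S (p b i') y) (ps c))
    (hj : c₀ ≤ j) (hi : i ≤ L b)
    (hJ : ∀ i' y, 1 ≤ i' → i' < i → N.Jump S (p b i') y → N.Reach y t → New m₀ m y) :
    Over N S p ps b c i j ↔ j < r := by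
  constructor
  · rintro ⟨i', h1, h2, y, h3, h4⟩
    have hsy : N.Reach s y := ((H.two.path b).from_s h1 (by omega)).trans h3.reach
    obtain ⟨k1, k2, k3⟩ := H.of_ps hsy (b := c) (by omega)
    have hyt : N.Reach y t := by
      have := (H.two.path c).to_t k1.le k2
      rwa [k3] at this
    exact h4.trans_le (hM.ub y (hJ i' y h1 h2 h3 hyt))
  · intro h
    rcases hM.att with k | ⟨y, ⟨i', h1, h2, h3⟩, k⟩
    · omega
    · exact ⟨i', h1, h2, y, h3, by rw [k]; exact h⟩

/-- The fields `min`, `prime` and `max` after the first rounds of `AssignMinMax`. -/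
structure MinMaxUpTo (N : Net) (L : Bool → ℕ) (S : Set ℕ) (p ps : Bool → ℕ → ℕ) (b : Bool)
    (i r₂ lp : ℕ) (lo hi prime : ℕ → ℕ) : Prop where
  lo_prime : ∀ k, 1 ≤ k → k < i → Prime N S p ps b k → lo k < L (!b) ∧
    ∀ j, 1 ≤ j → (lo k ≤ j ↔ ¬ Over N S p ps b (!b) k j)
  lo_not : ∀ k, 1 ≤ k → k < i → ¬ Prime N S p ps b k → lo k = L (!b)
  hi_spec : ∀ j, 1 ≤ j → j < r₂ → 1 ≤ hi j ∧ hi j < i ∧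
    ¬ Over N S p ps b (!b) (hi j) j ∧ Over N S p ps b (!b) (hi j + 1) j
  last : (i = 1 ∧ lp = 0) ∨ (1 ≤ lp ∧ lp < i ∧ Prime N S p ps b lp ∧
    ∀ k, lp < k → k < i → ¬ Prime N S p ps b k)
  prime_prime : ∀ k, 1 ≤ k → k < i → k ≠ lp → Prime N S p ps b k → k < prime k ∧ prime k < i ∧
    Prime N S p ps b (prime k) ∧ ∀ l, k < l → l < prime k → ¬ Prime N S p ps b l
  prime_not : ∀ k, 1 ≤ k → k < i → ¬ Prime N S p ps b k → 1 ≤ prime k ∧ prime k < k ∧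
    Prime N S p ps b (prime k) ∧ ∀ l, prime k < l → l ≤ k → ¬ Prime N S p ps b l

theorem MinMaxUpTo.step_prime {b : Bool} {i r₂ lp : ℕ} {lo hi prime : ℕ → ℕ}
    (h : MinMaxUpTo N L S p ps b i r₂ lp lo hi prime) (hi1 : 1 ≤ i) (hP : Prime N S p ps b i)
    (hlo : r₂ < L (!b) ∧ ∀ j, 1 ≤ j → (r₂ ≤ j ↔ ¬ Over N S p ps b (!b) i j)) :
    MinMaxUpTo N L S p ps b (i + 1) r₂ i (update lo i r₂) hi (update prime lp i) := by
  have hlpi : lp < i := by rcases h.last with k | k <;> omega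
  refine ⟨?_, ?_, ?_, .inr ⟨hi1, by omega, hP, fun k _ _ => by omega⟩, ?_, ?_⟩
  · intro k h1 h2 h3
    by_cases hki : k = i
    · subst hki; simpa using hlo
    · rw [update_of_ne hki]; exact h.lo_prime k h1 (by omega) h3
  · intro k h1 h2 h3
    have hki : k ≠ i := by rintro rfl; exact h3 hP
    rw [update_of_ne hki]; exact h.lo_not k h1 (by omega) h3
  · intro j h1 h2
    obtain ⟨a, b, c⟩ := h.hi_spec j h1 h2
    exact ⟨a, by omega, c⟩
  · intro k h1 h2 h3 h4
    by_cases hkl : k = lp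
    · subst hkl
      rw [update_self]
      -- In the first round `lp = 0`; the entry written there belongs to no vertex, and `1 ≤ k`
      -- excludes it.
      rcases h.last with ⟨_, hl⟩ | ⟨_, _, _, hl⟩
      · omega
      · exact ⟨hlpi, by omega, hP, fun l l1 l2 => hl l l1 l2⟩
    · rw [update_of_ne hkl]
      obtain ⟨a, b, c, d⟩ := h.prime_prime k h1 (by omega) hkl h4
      exact ⟨a, by omega, c, d⟩
  · intro k h1 h2 h3
    have hki : k ≠ i := by rintro rfl; exact h3 hP
    have hkl : k ≠ lp := by
      rintro rfl
      rcases h.last with ⟨_, hl⟩ | ⟨_, _, hl, _⟩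
      · omega
      · exact h3 hl
    rw [update_of_ne hkl]; exact h.prime_not k h1 (by omega) h3

theorem not_over_one {b c : Bool} {j : ℕ} : ¬ Over N S p ps b c 1 j := by
  rintro ⟨i', h1, h2, _⟩; omega

theorem MinMaxUpTo.step_not {b : Bool} {i r₂ lp : ℕ} {lo hi prime : ℕ → ℕ}
    (h : MinMaxUpTo N L S p ps b i r₂ lp lo hi prime) (hi1 : 1 ≤ i) (hP : ¬ Prime N S p ps b i) :
    MinMaxUpTo N L S p ps b (i + 1) r₂ lp (update lo i (L !b)) hi (update prime i lp) := by
  -- Position 1 is always prime, hence a previous prime position exists.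
  have hne : i ≠ 1 := by rintro rfl; exact hP not_over_one
  obtain ⟨l1, l2, l3, l4⟩ := h.last.resolve_left fun k => hne k.1
  refine ⟨?_, ?_, ?_, .inr ⟨l1, by omega, l3, fun k k1 k2 => ?_⟩, ?_, ?_⟩
  · intro k h1 h2 h3
    have hki : k ≠ i := by rintro rfl; exact hP h3
    rw [update_of_ne hki]; exact h.lo_prime k h1 (by omega) h3
  · intro k h1 h2 h3
    by_cases hki : k = i
    · subst hki; simp
    · rw [update_of_ne hki]; exact h.lo_not k h1 (by omega) h3
  · intro j h1 h2
    obtain ⟨a, b, c⟩ := h.hi_spec j h1 h2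
    exact ⟨a, by omega, c⟩
  · by_cases hki : k = i
    · subst hki; exact hP
    · exact l4 k k1 (by omega)
  · intro k h1 h2 h3 h4
    have hki : k ≠ i := by rintro rfl; exact hP h4
    rw [update_of_ne hki]
    obtain ⟨a, b, c, d⟩ := h.prime_prime k h1 (by omega) h3 h4
    exact ⟨a, by omega, c, d⟩
  · intro k h1 h2 h3
    by_cases hki : k = i
    · subst hki
      rw [update_self]
      refine ⟨l1, l2, l3, fun l k1 k2 => ?_⟩
      rcases eq_or_lt_of_le k2 with rfl | k2
      · exact hP
      · exact l4 l k1 k2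
    · rw [update_of_ne hki]; exact h.prime_not k h1 (by omega) h3

theorem MinMaxUpTo.finish {b : Bool} {lp : ℕ} {lo hi prime : ℕ → ℕ} (hL : 3 ≤ L b)
    (h : MinMaxUpTo N L S p ps b (L b) (L !b) lp lo hi prime) :
    MinMax N L S p ps b lo hi (update prime lp (L b)) := by
  obtain ⟨l1, l2, l3, l4⟩ := h.last.resolve_left fun k => by omega
  refine ⟨h.lo_prime, h.lo_not, h.hi_spec, ?_, ?_⟩
  · intro k h1 h2 h3
    by_cases hkl : k = lp
    · subst hkl
      rw [update_self]
      exact ⟨h2, le_rfl, fun k => by omega, fun l k1 k2 => l4 l k1 k2⟩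
    · rw [update_of_ne hkl]
      obtain ⟨a, b, c, d⟩ := h.prime_prime k h1 h2 hkl h3
      exact ⟨a, by omega, fun _ => c, d⟩
  · intro k h1 h2 h3
    have hkl : k ≠ lp := by rintro rfl; exact h3 l3
    rw [update_of_ne hkl]; exact h.prime_not k h1 h2 h3

end DominatorAlg

namespace DominatorAlg

open RAM

variable {N : Net} {s t : ℕ} {p : Bool → ℕ → ℕ} {L : Bool → ℕ} {S : Set ℕ} {ps : Bool → ℕ → ℕ}

/-- The positions from `r₂` up to `r₂'` are passed for the first time by jumps from vertex `i`; thus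
`i` is the last vertex before which no jump passes over them. -/
theorem MinMaxUpTo.step_hi {b : Bool} {i r₂ r₂' lp : ℕ} {lo hi hi' prime : ℕ → ℕ}
    (h : MinMaxUpTo N L S p ps b (i + 1) r₂ lp lo hi prime) (hi1 : 1 ≤ i)
    (hold : ∀ j, j < r₂ → hi' j = hi j) (hnew : ∀ j, r₂ ≤ j → j < r₂' → hi' j = i)
    (ho : ∀ j, 1 ≤ j → r₂ ≤ j → j < r₂' → ¬ Over N S p ps b (!b) i j ∧ Over N S p ps b (!b) (i + 1) j) :
    MinMaxUpTo N L S p ps b (i + 1) r₂' lp lo hi' prime := by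
  refine ⟨h.lo_prime, h.lo_not, fun j h1 h2 => ?_, h.last, h.prime_prime, h.prime_not⟩
  rcases Nat.lt_or_ge j r₂ with h3 | h3
  · rw [hold j h3]; exact h.hi_spec j h1 h3
  · rw [hnew j h3 h2]; exact ⟨hi1, by omega, ho j h1 h3 h2⟩

theorem MinMaxUpTo.zero {b : Bool} {lo hi prime : ℕ → ℕ} :
    MinMaxUpTo N L S p ps b 1 1 0 lo hi prime :=
  ⟨fun k h1 h2 => by omega, fun k h1 h2 => by omega, fun k h1 h2 => by omega, .inl ⟨rfl, rfl⟩,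
    fun k h1 h2 => by omega, fun k h1 h2 => by omega⟩

/-- Everything between a path vertex and a vertex that reaches `t` is itself strictly between `s`
and `t`, or equal to `t`. Freshness of the marks is needed only there. -/
theorem Layout.marks_jump (H : Layout N s t p L S ps) {b : Bool} {f₁ f₂ m₀ m : ℕ → ℕ}
    {c₁ c₂ i r₁ r₂ : ℕ} (h : Marks N S (p b) f₁ f₂ m₀ c₁ c₂ i m r₁ r₂) (hi : i ≤ L b)
    (hm : ∀ z, Mid N s t z ∨ z = t → m₀ z = 0) (i' y : ℕ) (h1 : 1 ≤ i') (h2 : i' < i)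
    (hJ : N.Jump S (p b i') y) (hy : N.Reach y t) : New m₀ m y := by
  refine h.jump h1 h2 hJ fun v hv hr hvy => hm v ?_
  by_cases hvt : v = t
  · exact .inr hvt
  refine .inl (mid_iff.2 ⟨((H.two.path b).from_s h1 (by omega)).trans hr, hvy.trans hy, ?_, hvt⟩)
  rintro rfl
  exact hv (((H.two.path b).from_s h1 (by omega)).antisymm hr)

/-- Before round `i` the two maxima are the furthest positions reached by jumps from earlier
vertices, so a comparison with them decides `Over`. Each position of the other path receives its
`hi` once, when `reached₂` passes it, which accounts for `30 * L (!b)`. The rounds share the marks,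
so beyond the released charges they cost only the start vertices, counted by `pathWork`. -/
theorem wp_assignMinMax {b : Bool} {σ : State Reg Arr} (hσ : N.Holds σ)
    (H : Layout N s t p L S ps) (hus : N.Reach N.u s) (ht : σ.reg .t = t)
    (hL : ∀ c, σ.reg (.len c) = L c) (hp : ∀ i, 1 ≤ i → i < L b → σ.arr (.path b) i = p b i)
    (hS : S = {y | y = t ∨ ∃ c, σ.arr .side y = label c})
    (hps : ∀ c, ps c = posOn t (L c) (label c) (σ.arr .side) (σ.arr .pos))
    (hm : ∀ z, Mid N s t z ∨ z = t → σ.arr (.marked b) z = 0) :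
    WP (assignMinMax b) σ fun σ' τ =>
      MinMax N L S p ps b (σ'.arr (.lo b)) (σ'.arr (.hi !b)) (σ'.arr (.prime b)) ∧
      (∀ y, New (σ.arr (.marked b)) (σ'.arr (.marked b)) y → y = t ∨ N.Av {t} s y) ∧
      τ + 100 * N.work (σ'.arr (.marked b)) ≤ 100 * N.work (σ.arr (.marked b)) +
        300 * pathWork N (p b) (L b) + 30 * L (!b) + 50 := by
  have hL3 := H.three_le
  have hpath := H.two.path
  set m₀ := σ.arr (.marked b) with hm₀
  have hnb : (!b) ≠ b := by cases b <;> simp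
  have hbn : b ≠ !b := hnb.symm
  have hps_le : ∀ c y, N.Reach s y → ps c y ≤ L c := fun c y h => H.ps_le h
  unfold assignMinMax
  simp only [wp_seq, wp_write, wp_assign]
  refine WP.while_count 1 (L b) (by have := hL3 b; omega) (fun i σ' τ => σ'.reg .i = i ∧
    Marks N S (p b) (ps b) (ps !b) m₀ 0 1 i (σ'.arr (.marked b)) (σ'.reg .reached₁) (σ'.reg .reached₂) ∧
    σ'.reg .newReached₁ = σ'.reg .reached₁ ∧ σ'.reg .newReached₂ = σ'.reg .reached₂ ∧
    σ'.reg .reached₁ ≤ L b ∧ σ'.reg .reached₂ ≤ L (!b) ∧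
    MinMaxUpTo N L S p ps b i (σ'.reg .reached₂) (σ'.reg .lastPrime) (σ'.arr (.lo b))
      (σ'.arr (.hi !b)) (σ'.arr (.prime b)) ∧
    τ + 100 * N.work (σ'.arr (.marked b)) ≤
      100 * N.work m₀ + 300 * pathWork N (p b) i + 30 * σ'.reg .reached₂) ?_ ?_ ?_
  · refine ⟨by simp, ?_, by simp, by simp, by simp, ?_, ?_, ?_⟩
    · simpa using Marks.zero
    · simp; have := hL3 (!b); omega
    · simpa using MinMaxUpTo.zero
    · simp [← hm₀]; omega
  · rintro i σ₁ τ₁ hi1 hi2 hF ⟨a1, a2, a3, a4, a5, a6, a7, a8⟩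
    have e_t : σ₁.reg .t = t := by rw [hF.1]; simp [ht]; simp [findReachable, visitOutCopy]
    have e_L : ∀ c, σ₁.reg (.len c) = L c := by intro c; rw [hF.1]; simp [hL]; simp [findReachable]
    have e_p : σ₁.arr (.path b) = σ.arr (.path b) := by rw [hF.2]; simp; simp [findReachable]
    have e_side : σ₁.arr .side = σ.arr .side := by rw [hF.2]; simp; simp [findReachable]
    have e_pos : σ₁.arr .pos = σ.arr .pos := by rw [hF.2]; simp; simp [findReachable]
    have e_off : σ₁.arr .off = N.off := by rw [hF.2]; simp [hσ.off]; simp [findReachable]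
    have e_adj : σ₁.arr .adj = N.adj := by rw [hF.2]; simp [hσ.adj]; simp [findReachable]
    clear hF
    have hsp : N.Reach s (p b i) := (hpath b).from_s hi1 hi2.le
    have hj₁ := H.marks_jump a2 hi2.le hm
    have hprime : Prime N S p ps b i ↔ ¬ i < σ₁.reg .reached₁ := by
      unfold Prime
      rw [H.over_iff a2.max₁ (Nat.zero_le _) hi2.le hj₁]
    have hover : ∀ j, 1 ≤ j → (Over N S p ps b (!b) i j ↔ j < σ₁.reg .reached₂) := fun j hj =>
      H.over_iff a2.max₂ hj hi2.le hj₁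
    refine ⟨by simp [a1, e_L, hi2], ?_⟩
    rw [wp_seq]
    -- the first assignment
    have h1 : WP (R := Reg) (A := Arr) (.ite (.lt Reg.i Reg.reached₁)
       (.write (Arr.lo b) Reg.i (Reg.len (!b)) ;;
        .write (Arr.prime b) Reg.i Reg.lastPrime)
       (.write (Arr.lo b) Reg.i Reg.reached₂ ;;
        .write (Arr.prime b) Reg.lastPrime Reg.i ;;
        Reg.lastPrime ::= Reg.i)) σ₁ fun σ₂ τ₂ => τ₂ ≤ 20 ∧
        MinMaxUpTo N L S p ps b (i + 1) (σ₁.reg .reached₂) (σ₂.reg .lastPrime) (σ₂.arr (.lo b))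
      (σ₂.arr (.hi !b)) (σ₂.arr (.prime b)) := by
      rw [wp_ite]
      constructor
      · intro hb
        have hb' : i < σ₁.reg .reached₁ := by simpa [a1] using hb
        have := a7.step_not hi1 (by rw [hprime]; simpa using hb')
        simp only [wp_seq, wp_write, wp_assign]
        simpa [a1, e_L] using this
      · intro hb
        have hb' : ¬ i < σ₁.reg .reached₁ := by simpa [a1] using hb
        have hP := hprime.2 hb'
        -- Had the other path been reached up to its end, the sink would have been met, and
        -- `reached₁` would be the full length of the path `b`, against primality of `i`.
        have hlt : σ₁.reg .reached₂ < L (!b) := by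
          refine lt_of_le_of_ne a6 fun heq => hb' ?_
          rcases a2.max₂.att with k | ⟨y, ⟨i', k1, k2, k3⟩, k4⟩
          · have := hL3 (!b); omega
          · have hsy : N.Reach s y := ((hpath b).from_s k1 (by omega)).trans k3.reach
            obtain ⟨_, _, k5⟩ := H.of_ps hsy (b := !b) (by have := hL3 (!b); omega)
            rw [k4, heq, (hpath (!b)).last] at k5
            subst k5
            have := a2.max₁.ub t (hj₁ i' t k1 k2 k3 (.refl _))
            rw [H.ps_t] at this
            omega
        have := a7.step_prime hi1 hP ⟨hlt, fun j hj => by rw [hover j hj, not_lt]⟩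
        simp only [wp_seq, wp_write, wp_assign]
        simpa [a1] using this
    refine h1.mono_frame fun σ₂ τ₂ hF₂ ⟨b1, b2⟩ => ?_
    have hreg : ∀ x, x ≠ .lastPrime → σ₂.reg x = σ₁.reg x := fun x hx => hF₂.1 x (by simpa using hx)
    have harr : ∀ a, a ≠ .lo b → a ≠ .prime b → σ₂.arr a = σ₁.arr a := fun a h1 h2 =>
      hF₂.2 a (by simp [h1, h2])
    clear hF₂ h1
    rw [wp_seq, wp_assign]
    have e_x : σ₂.arr (.path b) (σ₂.reg .i) = p b i := by
      rw [harr _ (by simp) (by simp), hreg _ (by simp), a1, e_p, hp i hi1 hi2]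
    simp only [Expr.eval, Expr.cost, e_x]
    rw [wp_seq]
    have hg1 : σ₂.reg .newReached₁ = σ₁.reg .reached₁ := by rw [hreg _ (by simp), a3]
    have hg2 : σ₂.reg .newReached₂ = σ₁.reg .reached₂ := by rw [hreg _ (by simp), a4]
    have hmk : σ₂.arr (.marked b) = σ₁.arr (.marked b) := harr _ (by simp) (by simp)
    refine (wp_findReachable (N := N) (mark := .marked b) (side := .side) (pos := .pos) (b := b)
      (S := S) (f₁ := ps b) (f₂ := ps !b)
      ⟨by simp [harr, e_off], by simp [harr, e_adj]⟩ (by simpa using hus.trans hsp) (by simp)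
      (by simp [hreg, harr, e_t, e_side, hS]) (by simp [hreg, harr, e_t, e_side, e_pos, e_L, hps])
      (by simp [hreg, harr, e_t, e_side, e_pos, e_L, hps])
      (by simpa [hreg, e_L] using fun y hy => hps_le b y (hsp.trans hy))
      (by simpa [hreg, e_L] using fun y hy => hps_le (!b) y (hsp.trans hy))
      (by simpa [hreg, e_L, a3] using a5) (by simpa [hreg, e_L, a4] using a6)).mono_frame ?_
    rintro σ₃ τ₃ hF₃ ⟨c1, c2, c3, c4⟩
    have hreg₃ : ∀ x, ¬ (findReachable (.marked b) .side .pos b).SetsReg x → x ≠ .x →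
        σ₃.reg x = σ₂.reg x := fun x h1 h2 => by rw [hF₃.1 x h1]; simp [h2]
    have harr₃ : ∀ a, a ≠ .marked b → a ≠ .stk → σ₃.arr a = σ₂.arr a := fun a h1 h2 => by
      rw [hF₃.2 a (by simp [findReachable, h1, h2])]; simp
    clear hF₃
    simp only [State.reg_setReg, State.arr_setReg, reduceCtorEq, if_false, if_true, hg1, hg2, hmk,
      hreg _ (show Reg.len _ ≠ Reg.lastPrime by simp), e_L] at c1 c2 c3 c4
    have q1 : σ₃.reg .i = i := by
      rw [hreg₃ _ (by simp [findReachable]) (by simp), hreg _ (by simp), a1]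
    have q2 : σ₃.reg .reached₁ = σ₁.reg .reached₁ := by
      rw [hreg₃ _ (by simp [findReachable]) (by simp), hreg _ (by simp)]
    have q3 : σ₃.reg .reached₂ = σ₁.reg .reached₂ := by
      rw [hreg₃ _ (by simp [findReachable]) (by simp), hreg _ (by simp)]
    have q4 : σ₃.reg .lastPrime = σ₂.reg .lastPrime := hreg₃ _ (by simp [findReachable]) (by simp)
    have hmarks := a2.step hi1 c1
    have hj₂ := H.marks_jump hmarks (by omega) hm
    have hover' : ∀ j, 1 ≤ j → (Over N S p ps b (!b) (i + 1) j ↔ j < σ₃.reg .newReached₂) :=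
      fun j hj => H.over_iff hmarks.max₂ hj (by omega) hj₂
    have le1 := c1.max₁.le
    have le2 := c1.max₂.le
    rw [wp_seq]
    have h3 : WP (R := Reg) (A := Arr) (.when (.lt Reg.reached₁ Reg.newReached₁) (Reg.reached₁ ::= Reg.newReached₁)) σ₃
        fun σ₄ τ₄ => τ₄ ≤ 10 ∧ σ₄ = σ₃.setReg .reached₁ (σ₃.reg .newReached₁) := by
      rw [wp_when, wp_assign]
      refine ⟨fun _ => by simp, fun hb => ⟨by simp, ?_⟩⟩
      have : σ₃.reg .newReached₁ = σ₃.reg .reached₁ := by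
        simp at hb; rw [q2]; rw [q2] at hb; omega
      cases σ₃ with
      | mk r a =>
        simp only [State.setReg, State.mk.injEq, and_true] at this ⊢
        rw [this, update_eq_self]
    refine h3.mono fun σ₄ τ₄ ⟨d1, d2⟩ => ?_
    subst d2
    clear h3
    rw [wp_seq]
    have h4 : WP (R := Reg) (A := Arr) (.when (.lt Reg.reached₂ Reg.newReached₂)
       (Reg.j ::= Reg.reached₂ ;;
        .while (.lt Reg.j Reg.newReached₂)
          (.write (Arr.hi (!b)) Reg.j Reg.i ;;
           Reg.j ::= .succ Reg.j) ;;
        Reg.reached₂ ::= Reg.newReached₂)) (σ₃.setReg .reached₁ (σ₃.reg .newReached₁))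
        fun σ₄ τ₄ => τ₄ ≤ 30 * (σ₃.reg .newReached₂ - σ₁.reg .reached₂) + 10 ∧
          σ₄.reg .reached₂ = σ₃.reg .newReached₂ ∧
          (∀ j, j < σ₁.reg .reached₂ → σ₄.arr (.hi !b) j = σ₃.arr (.hi !b) j) ∧
          ∀ j, σ₁.reg .reached₂ ≤ j → j < σ₃.reg .newReached₂ → σ₄.arr (.hi !b) j = i := by
      rw [wp_when]
      constructor
      · intro hb
        simp [q3] at hb
        simp only [wp_seq, wp_assign]
        refine WP.while_count (σ₁.reg .reached₂) (σ₃.reg .newReached₂) le2 (fun k σ' τ =>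
          τ ≤ 15 * (k - σ₁.reg .reached₂) ∧ σ'.reg .j = k ∧
          (∀ j, j < σ₁.reg .reached₂ → σ'.arr (.hi !b) j = σ₃.arr (.hi !b) j) ∧
          ∀ j, σ₁.reg .reached₂ ≤ j → j < k → σ'.arr (.hi !b) j = i) ?_ ?_ ?_
        · refine ⟨by omega, by simp [q3], by simp, fun j _ _ => by omega⟩
        · rintro k σ' τ hk1 hk2 hF ⟨f1, f2, f3, f4⟩
          have e1 : σ'.reg .newReached₂ = σ₃.reg .newReached₂ := by rw [hF.1]; simp; simp
          have e2 : σ'.reg .i = i := by rw [hF.1]; simp [q1]; simp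
          refine ⟨by simp [f2, e1, hk2], ?_⟩
          simp [wp_seq, wp_assign, wp_write, f2, e2]
          refine ⟨by omega, fun j hj => ?_, fun j j1 j2 => ?_⟩
          · rw [update_of_ne (by omega)]; exact f3 j hj
          · by_cases hjk : j = k
            · subst hjk; simp
            · rw [update_of_ne hjk]; exact f4 j j1 (by omega)
        · rintro σ' τ hF ⟨f1, f2, f3, f4⟩
          have e1 : σ'.reg .newReached₂ = σ₃.reg .newReached₂ := by rw [hF.1]; simp; simp
          refine ⟨by simp [f2, e1], ?_⟩
          simp [e1]
          exact ⟨by omega, f3, f4⟩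
      · intro hb
        simp [q3] at hb
        refine ⟨by simp, ?_, by simp, fun j j1 j2 => by omega⟩
        simp [q3]; omega
    refine h4.mono_frame fun σ₄ τ₄ hF₄ ⟨d1', d2, d3, d4⟩ => ?_
    have hreg₄ : ∀ x, x ≠ .j → x ≠ .reached₂ → x ≠ .reached₁ → σ₄.reg x = σ₃.reg x := fun x h1 h2 h3 => by
      rw [hF₄.1 x (by simp [h1, h2])]; simp [h3]
    have r1 : σ₄.reg .reached₁ = σ₃.reg .newReached₁ := by rw [hF₄.1]; simp; simp
    have harr₄ : ∀ a, a ≠ .hi !b → σ₄.arr a = σ₃.arr a := fun a h1 => by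
      rw [hF₄.2 a (by simp [h1])]; simp
    clear hF₄ h4
    have eh : σ₃.arr (.hi !b) = σ₂.arr (.hi !b) := harr₃ _ (by simp) (by simp)
    have hhi := b2.step_hi hi1 (hi' := σ₄.arr (.hi !b)) (r₂' := σ₃.reg .newReached₂)
      (fun j hj => by rw [d3 j hj, eh]) d4
      fun j j1 j2 j3 => ⟨by rw [hover j j1]; omega, (hover' j j1).2 j3⟩
    simp only [wp_assign, Expr.eval, Expr.cost, Test.cost, State.reg_setReg, State.arr_setReg,
      reduceCtorEq, if_false, if_true]
    have s1 : σ₄.reg .newReached₁ = σ₃.reg .newReached₁ := hreg₄ _ (by simp) (by simp) (by simp)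
    have s2 : σ₄.reg .newReached₂ = σ₃.reg .newReached₂ := hreg₄ _ (by simp) (by simp) (by simp)
    have s3 : σ₄.reg .lastPrime = σ₂.reg .lastPrime := by rw [hreg₄ _ (by simp) (by simp) (by simp), q4]
    have s4 : σ₄.reg .i = i := by rw [hreg₄ _ (by simp) (by simp) (by simp), q1]
    have s5 : σ₄.arr (.marked b) = σ₃.arr (.marked b) := harr₄ _ (by simp)
    have s6 : σ₄.arr (.lo b) = σ₂.arr (.lo b) := by rw [harr₄ _ (by simp), harr₃ _ (by simp) (by simp)]
    have s7 : σ₄.arr (.prime b) = σ₂.arr (.prime b) := by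
      rw [harr₄ _ (by simp), harr₃ _ (by simp) (by simp)]
    rw [s1, s2, s3, s4, s5, s6, s7, d2, r1]
    refine ⟨rfl, hmarks, rfl, rfl, c2, c3, hhi, ?_⟩
    rw [pathWork_succ hi1]
    omega
  · rintro σ₁ τ₁ hF ⟨a1, a2, a3, a4, a5, a6, a7, a8⟩
    have e_L : ∀ c, σ₁.reg (.len c) = L c := by intro c; rw [hF.1]; simp [hL]; simp [findReachable]
    refine ⟨by simp [a1, e_L], ?_⟩
    have hL3b := hL3 b
    -- The last edge of the path `b` leads to `t`, so in the end every position of the other path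
    -- has been passed and has got its `hi`.
    have hr2 : σ₁.reg .reached₂ = L !b := by
      refine le_antisymm a6 ?_
      have hE := (hpath b).edge (L b - 1) (by omega) (by omega)
      rw [Nat.sub_add_cancel (by omega), (hpath b).last] at hE
      have := a2.max₂.ub t (H.marks_jump a2 le_rfl hm (L b - 1) t (by omega) (by omega)
        ⟨_, .refl, hE⟩ (.refl _))
      rwa [H.ps_t] at this
    rw [hr2] at a7
    have := a7.finish hL3b
    simp [e_L, -Cmd.SetsReg, -Cmd.SetsArr]
    refine ⟨this, fun y hy => ?_, by omega⟩
    obtain ⟨i', k1, k2, z, hz, hE⟩ := a2.new y hy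
    by_cases hyt : y = t
    · exact .inl hyt
    refine .inr ?_
    have htS : t ∈ S := by rw [hS]; exact .inl rfl
    have g1 : N.Av {t} s (p b i') := by
      have := (hpath b).av (A := {t}) le_rfl k1 (by omega) fun k l1 l2 l3 => by
        have := (hpath b).ne l1 (by omega : k < L b) le_rfl
        rw [(hpath b).last] at this
        exact this l3
      rwa [(hpath b).first] at this
    have g2 : N.Av {t} (p b i') z :=
      ⟨g1.right, Relation.ReflTransGen.mono (fun _ _ k => ⟨k.1, fun l => k.2 (by
        rw [Set.mem_singleton_iff.1 l]; exact htS)⟩) _ _ hz⟩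
    exact (g1.trans g2).tail hE hyt

end DominatorAlg

/-! ### Collecting the vertices of the cuts and the ends of their intervals. -/

namespace RAM

variable {R A : Type} [DecidableEq R] [DecidableEq A]

theorem State.setReg_self {σ : State R A} {x : R} : σ.setReg x (σ.reg x) = σ := by
  cases σ; simp [State.setReg]

open Classical in
theorem wp_when_assign {b : Test R A} {x : R} {e : Expr R A} {σ : State R A} :
    WP (.when b (x ::= e)) σ fun σ' t => t ≤ b.cost + e.cost + 3 ∧
      σ' = σ.setReg x (if b.Holds σ then e.eval σ else σ.reg x) := by
  rw [wp_when, wp_assign]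
  refine ⟨fun h => ⟨by omega, by rw [if_pos h]⟩, fun h => ⟨by omega, by rw [if_neg h, State.setReg_self]⟩⟩

end RAM

namespace DominatorAlg

open RAM

variable {N : Net} {s t : ℕ} {p : Bool → ℕ → ℕ} {L : Bool → ℕ} {S : Set ℕ} {ps : Bool → ℕ → ℕ}

/-- The vertex at position `i` of the path `b` belongs to some two-vertex cut. -/
def Used (N : Net) (L : Bool → ℕ) (S : Set ℕ) (p ps : Bool → ℕ → ℕ) (b : Bool) (i : ℕ) : Prop :=
  ∃ j, Match N L S p ps b i j

/-- The vertices before position `m` of the path `b` that belong to some cut are appended to the vector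
of length `n₀`, which now has length `n`. -/
structure Appended (U : ℕ → Prop) (p : ℕ → ℕ) (n₀ m n lab : ℕ)
    (vec₀ index₀ flag₀ vec index flag : ℕ → ℕ) : Prop where
  le : n₀ ≤ n
  used : ∀ i, i < m → U i → n₀ < index (p i) ∧ index (p i) ≤ n ∧ vec (index (p i)) = p i ∧ flag (p i) = lab
  vec_used : ∀ k, n₀ < k → k ≤ n → ∃ i, i < m ∧ U i ∧ vec k = p i ∧ index (p i) = k
  mono : ∀ i j, i < j → j < m → U i → U j → index (p i) < index (p j)
  vec_old : ∀ k, k ≤ n₀ → vec k = vec₀ k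
  old : ∀ y, (∀ i, i < m → U i → y ≠ p i) → index y = index₀ y ∧ flag y = flag₀ y

theorem Appended.skip {U : ℕ → Prop} {p : ℕ → ℕ} {n₀ m n lab : ℕ}
    {vec₀ index₀ flag₀ vec index flag : ℕ → ℕ}
    (h : Appended U p n₀ m n lab vec₀ index₀ flag₀ vec index flag) (hU : ¬ U m) :
    Appended U p n₀ (m + 1) n lab vec₀ index₀ flag₀ vec index flag := by
  have key : ∀ i, i < m + 1 → U i → i < m := fun i h1 h2 => by
    rcases Nat.lt_succ_iff_lt_or_eq.1 h1 with h1 | rfl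
    · exact h1
    · exact absurd h2 hU
  refine ⟨h.le, fun i hi hu => h.used i (key i hi hu) hu, fun k k1 k2 => ?_, fun i j hij hj hi' hj' =>
    h.mono i j hij (key j hj hj') hi' hj', h.vec_old, fun y hy => h.old y fun i hi => hy i (by omega)⟩
  obtain ⟨i, hi, h2⟩ := h.vec_used k k1 k2
  exact ⟨i, by omega, h2⟩

theorem Appended.push {U : ℕ → Prop} {p : ℕ → ℕ} {n₀ m n lab : ℕ}
    {vec₀ index₀ flag₀ vec index flag : ℕ → ℕ}
    (h : Appended U p n₀ m n lab vec₀ index₀ flag₀ vec index flag) (hU : U m)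
    (hp : ∀ i, i < m → U i → p i ≠ p m) :
    Appended U p n₀ (m + 1) (n + 1) lab vec₀ index₀ flag₀ (update vec (n + 1) (p m))
      (update index (p m) (n + 1)) (update flag (p m) lab) := by
  have hle := h.le
  refine ⟨by omega, fun i hi hu => ?_, fun k k1 k2 => ?_, fun i j hij hj hi' hj' => ?_, fun k hk => ?_,
    fun y hy => ?_⟩
  · rcases Nat.lt_succ_iff_lt_or_eq.1 hi with hi | rfl
    · obtain ⟨h1, h2, h3, h4⟩ := h.used i hi hu
      have hne := hp i hi hu
      rw [update_of_ne hne, update_of_ne hne, update_of_ne (by omega)]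
      exact ⟨h1, by omega, h3, h4⟩
    · rw [update_self, update_self, update_self]
      exact ⟨by omega, le_rfl, rfl, rfl⟩
  · rcases Nat.lt_or_ge n k with hk | hk
    · obtain rfl : k = n + 1 := by omega
      exact ⟨m, by omega, hU, by simp, by simp⟩
    · obtain ⟨i, h1, h2, h3, h4⟩ := h.vec_used k k1 hk
      refine ⟨i, by omega, h2, ?_, ?_⟩
      · rw [update_of_ne (by omega), h3]
      · rw [update_of_ne (hp i h1 h2), h4]
  · have hi2 : i < m := by omega
    rw [update_of_ne (hp i hi2 hi')]
    rcases Nat.lt_succ_iff_lt_or_eq.1 hj with hj | rfl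
    · rw [update_of_ne (hp j hj hj')]; exact h.mono i j hij hj hi' hj'
    · have := (h.used i hi2 hi').2.1
      rw [update_self]; omega
  · rw [update_of_ne (by omega)]; exact h.vec_old k hk
  · have hne : y ≠ p m := hy m (by omega) hU
    rw [update_of_ne hne, update_of_ne hne]
    exact h.old y fun i hi => hy i (by omega)

/-- The positions `min` and `max` of the first and last match of the vertices before position `m`. -/
structure Ranged (U : ℕ → Prop) (M : ℕ → ℕ → Prop) (p : ℕ → ℕ) (m : ℕ)
    (min₀ max₀ min max : ℕ → ℕ) : Prop where
  used : ∀ i, i < m → U i → M i (min (p i)) ∧ M i (max (p i)) ∧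
    ∀ j, M i j → min (p i) ≤ j ∧ j ≤ max (p i)
  old : ∀ y, (∀ i, i < m → U i → y ≠ p i) → min y = min₀ y ∧ max y = max₀ y

theorem Ranged.skip {U : ℕ → Prop} {M : ℕ → ℕ → Prop} {p : ℕ → ℕ} {m : ℕ} {min₀ max₀ min max : ℕ → ℕ}
    (h : Ranged U M p m min₀ max₀ min max) (hU : ¬ U m) : Ranged U M p (m + 1) min₀ max₀ min max := by
  refine ⟨fun i hi hu => h.used i ?_ hu, fun y hy => h.old y fun i hi => hy i (by omega)⟩
  rcases Nat.lt_succ_iff_lt_or_eq.1 hi with hi | rfl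
  · exact hi
  · exact absurd hu hU

theorem Ranged.push {U : ℕ → Prop} {M : ℕ → ℕ → Prop} {p : ℕ → ℕ} {m l r : ℕ}
    {min₀ max₀ min max : ℕ → ℕ} (h : Ranged U M p m min₀ max₀ min max) (hU : U m)
    (hp : ∀ i, i < m → U i → p i ≠ p m) (hM : M m l ∧ M m r ∧ ∀ j, M m j → l ≤ j ∧ j ≤ r) :
    Ranged U M p (m + 1) min₀ max₀ (update min (p m) l) (update max (p m) r) := by
  refine ⟨fun i hi hu => ?_, fun y hy => ?_⟩
  · rcases Nat.lt_succ_iff_lt_or_eq.1 hi with hi | rfl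
    · have hne := hp i hi hu
      rw [update_of_ne hne, update_of_ne hne]
      exact h.used i hi hu
    · rwa [update_self, update_self]
  · have hne : y ≠ p m := hy m (by omega) hU
    rw [update_of_ne hne, update_of_ne hne]
    exact h.old y fun i hi => hy i (by omega)

/-- A vertex belongs to some cut exactly if it is prime and the interval from `Layout.interval` is
nonempty; the ends of the interval are then its first and its last partner. -/
theorem wp_constructVector {b : Bool} {σ : State Reg Arr} (H : Layout N s t p L S ps)
    (hL : ∀ c, σ.reg (.len c) = L c) (hp : ∀ i, 1 ≤ i → i < L b → σ.arr (.path b) i = p b i)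
    (hM : ∀ c, MinMax N L S p ps c (σ.arr (.lo c)) (σ.arr (.hi !c)) (σ.arr (.prime c))) :
    WP (constructVector b) σ fun σ' τ =>
      Appended (Used N L S p ps b) (p b) (σ.reg (.size b)) (L b) (σ'.reg (.size b)) (label b)
        (σ.arr (.vec b)) (σ.arr .index) (σ.arr .flag)
        (σ'.arr (.vec b)) (σ'.arr .index) (σ'.arr .flag) ∧
      Ranged (Used N L S p ps b) (Match N L S p ps b) (p b) (L b)
        (σ.arr .min) (σ.arr .max) (σ'.arr .min) (σ'.arr .max) ∧ τ ≤ 200 * L b := by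
  have hL3 := H.three_le
  have hpath := H.two.path
  have hused1 : ∀ i, Used N L S p ps b i → 1 < i := fun i ⟨j, h⟩ => h.1.1
  unfold constructVector
  simp only [wp_seq, wp_assign]
  refine WP.while_count 2 (L b) (by have := hL3 b; omega) (fun i σ' τ => σ'.reg .i = i ∧
    Appended (Used N L S p ps b) (p b) (σ.reg (.size b)) i (σ'.reg (.size b)) (label b)
        (σ.arr (.vec b)) (σ.arr .index) (σ.arr .flag)
        (σ'.arr (.vec b)) (σ'.arr .index) (σ'.arr .flag) ∧
      Ranged (Used N L S p ps b) (Match N L S p ps b) (p b) i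
        (σ.arr .min) (σ.arr .max) (σ'.arr .min) (σ'.arr .max) ∧ τ ≤ 150 * (i - 2)) ?_ ?_ ?_
  · refine ⟨by simp, ⟨by simp, ?_, ?_, ?_, by simp, by simp⟩, ⟨?_, by simp⟩, by omega⟩
    · intro i hi hu; have := hused1 i hu; omega
    · intro k k1 k2; simp at k2; omega
    · intro i j _ hj hi; have := hused1 i hi; omega
    · intro i hi hu; have := hused1 i hu; omega
  · rintro i σ₁ τ₁ hi1 hi2 hF ⟨a1, a2, a3, a4⟩
    have e_L : ∀ c, σ₁.reg (.len c) = L c := by intro c; rw [hF.1]; simp [hL]; simp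
    have e_p : σ₁.arr (.path b) = σ.arr (.path b) := by rw [hF.2]; simp; simp
    have e_lo : ∀ c, σ₁.arr (.lo c) = σ.arr (.lo c) := by intro c; rw [hF.2]; simp; simp
    have e_hi : ∀ c, σ₁.arr (.hi c) = σ.arr (.hi c) := by intro c; rw [hF.2]; simp; simp
    have e_pr : ∀ c, σ₁.arr (.prime c) = σ.arr (.prime c) := by intro c; rw [hF.2]; simp; simp
    have hinj : ∀ k, k < i → Used N L S p ps b k → p b k ≠ p b i := fun k hk hu =>
      (hpath b).ne (hused1 k hu).le hk hi2.le
    refine ⟨by simp [a1, e_L, hi2], ?_⟩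
    simp only [wp_seq, wp_assign]
    rw [wp_when]
    simp only [Test.Holds, Expr.eval, State.reg_setReg, State.arr_setReg, if_true, if_false,
      reduceCtorEq, a1, e_lo, e_hi, e_L, Test.cost, Expr.cost]
    have hlo : σ.arr (.lo b) i ≠ L (!b) ↔ Prime N S p ps b i := by
      constructor
      · intro h; by_contra hP; exact h ((hM b).lo_not i (by omega) hi2 hP)
      · intro h; exact ((hM b).lo_prime i (by omega) hi2 h).1.ne
    constructor
    · intro hne
      have hP := hlo.1 hne
      have hint := H.interval (lo := fun c => σ.arr (.lo c)) (hi := fun c => σ.arr (.hi c))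
        (prime := fun c => σ.arr (.prime c)) hM (by omega) hi2 hP rfl rfl
      obtain ⟨l, hl⟩ : ∃ l, l = (if σ.arr (.lo !b) (σ.arr (.lo b) i) = L b then
        σ.arr (.prime !b) (σ.arr (.prime !b) (σ.arr (.lo b) i)) else σ.arr (.lo b) i) := ⟨_, rfl⟩
      obtain ⟨h, hh⟩ : ∃ h, h = (if σ.arr (.lo !b) (σ.arr (.hi b) i) = L b then
        σ.arr (.prime !b) (σ.arr (.hi b) i) else σ.arr (.hi b) i) := ⟨_, rfl⟩
      rw [← hl, ← hh] at hint
      rw [wp_seq]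
      refine wp_when_assign.mono fun σ₂ τ₂ ⟨b1, b2⟩ => ?_
      simp only [Test.Holds, Expr.eval, State.reg_setReg, State.arr_setReg, if_true, if_false,
        reduceCtorEq, e_lo, e_hi, e_L, e_pr, ← hl, Test.cost, Expr.cost] at b1 b2
      subst b2
      rw [wp_seq]
      refine wp_when_assign.mono fun σ₂ τ₃ ⟨b1', b2⟩ => ?_
      simp only [Test.Holds, Expr.eval, State.reg_setReg, State.arr_setReg, if_true, if_false,
        reduceCtorEq, e_lo, e_hi, e_L, e_pr, ← hh, Test.cost, Expr.cost] at b1' b2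
      subst b2
      rw [wp_when]
      simp only [Test.Holds, Expr.eval, State.reg_setReg, State.arr_setReg, if_true, if_false,
        reduceCtorEq, not_lt, not_le, Test.cost, Expr.cost]
      constructor
      · intro hlh
        have hm := hint.2 hlh
        have hU : Used N L S p ps b i := ⟨l, hm.1⟩
        simp only [wp_seq, wp_assign, wp_write, Test.Holds, Expr.eval, State.reg_setReg, State.arr_setReg,
          State.reg_setArr, State.arr_setArr, if_true, if_false, reduceCtorEq, a1, e_p, e_L,
          Arr.vec.injEq, Reg.size.injEq, hp i (by omega) hi2, Test.cost, Expr.cost]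
        refine ⟨trivial, a2.push hU hinj, a3.push hU hinj ⟨hm.1, hm.2, fun j hj => ?_⟩, by omega⟩
        exact ⟨((hint.1 j).1 hj).1, ((hint.1 j).1 hj).2.1⟩
      · intro hlh
        have hU : ¬ Used N L S p ps b i := by
          rintro ⟨j, hj⟩
          have := (hint.1 j).1 hj
          omega
        simp only [Expr.eval, State.reg_setReg, State.arr_setReg, if_true, if_false, reduceCtorEq, a1,
          Expr.cost]
        exact ⟨trivial, a2.skip hU, a3.skip hU, by omega⟩
    · intro hne
      have hU : ¬ Used N L S p ps b i := by
        rintro ⟨j, hj⟩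
        exact hne (hlo.2 hj.2.2.1)
      exact ⟨trivial, a2.skip hU, a3.skip hU, by omega⟩
  · rintro σ₁ τ₁ hF ⟨a1, a2, a3, a4⟩
    have e_L : ∀ c, σ₁.reg (.len c) = L c := by intro c; rw [hF.1]; simp [hL]; simp
    refine ⟨by simp [a1, e_L], a2, a3, ?_⟩
    have := hL3 b
    simp; omega

/-- Positions on the other path are replaced by indices in the other vector. By `hidx` the vertices
of the new part are distinct, so each field is still unconverted when it is read. -/
theorem wp_convertMinMax {b : Bool} {σ : State Reg Arr} (hle : σ.reg (.start b) ≤ σ.reg (.size b))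
    (hidx : ∀ k, σ.reg (.start b) < k → k ≤ σ.reg (.size b) → σ.arr .index (σ.arr (.vec b) k) = k) :
    WP (convertMinMax b) σ fun σ' τ =>
      (∀ k, σ.reg (.start b) < k → k ≤ σ.reg (.size b) →
        σ'.arr .min (σ.arr (.vec b) k) =
          σ.arr .index (σ.arr (.path !b) (σ.arr .min (σ.arr (.vec b) k))) ∧
        σ'.arr .max (σ.arr (.vec b) k) =
          σ.arr .index (σ.arr (.path !b) (σ.arr .max (σ.arr (.vec b) k)))) ∧
      (∀ y, (∀ k, σ.reg (.start b) < k → k ≤ σ.reg (.size b) → y ≠ σ.arr (.vec b) k) →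
        σ'.arr .min y = σ.arr .min y ∧ σ'.arr .max y = σ.arr .max y) ∧
      τ ≤ 50 * (σ.reg (.size b) - σ.reg (.start b)) + 10 := by
  unfold convertMinMax
  simp only [wp_seq, wp_assign]
  refine WP.while_count (σ.reg (.start b)) (σ.reg (.size b)) hle (fun i σ' τ => σ'.reg .i = i ∧
      (∀ k, σ.reg (.start b) < k → k ≤ i →
        σ'.arr .min (σ.arr (.vec b) k) =
          σ.arr .index (σ.arr (.path !b) (σ.arr .min (σ.arr (.vec b) k))) ∧
        σ'.arr .max (σ.arr (.vec b) k) =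
          σ.arr .index (σ.arr (.path !b) (σ.arr .max (σ.arr (.vec b) k)))) ∧
      (∀ y, (∀ k, σ.reg (.start b) < k → k ≤ i → y ≠ σ.arr (.vec b) k) →
        σ'.arr .min y = σ.arr .min y ∧ σ'.arr .max y = σ.arr .max y) ∧
      τ ≤ 50 * (i - σ.reg (.start b))) ?_ ?_ ?_
  · refine ⟨by simp, fun k k1 k2 => by omega, by simp, by omega⟩
  · rintro i σ₁ τ₁ hi1 hi2 hF ⟨a1, a2, a3, a4⟩
    have e_sz : σ₁.reg (.size b) = σ.reg (.size b) := by rw [hF.1]; simp; simp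
    have e_v : σ₁.arr (.vec b) = σ.arr (.vec b) := by rw [hF.2]; simp; simp
    have e_i : σ₁.arr .index = σ.arr .index := by rw [hF.2]; simp; simp
    have e_p : σ₁.arr (.path !b) = σ.arr (.path !b) := by rw [hF.2]; simp; simp
    have hne : ∀ k, σ.reg (.start b) < k → k ≤ i → σ.arr (.vec b) k ≠ σ.arr (.vec b) (i + 1) := by
      intro k k1 k2 hc
      have h1 := hidx k k1 (by omega)
      have h2 := hidx (i + 1) (by omega) (by omega)
      rw [hc] at h1; omega
    obtain ⟨o1, o2⟩ := a3 (σ.arr (.vec b) (i + 1)) fun k k1 k2 => (hne k k1 k2).symm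
    refine ⟨by simp [a1, e_sz, hi2], ?_⟩
    simp only [wp_seq, wp_assign, wp_write, Test.Holds, Expr.eval, State.reg_setReg, State.arr_setReg,
      State.reg_setArr, State.arr_setArr, if_true, if_false, reduceCtorEq, a1, e_p, e_v, e_i, o1, o2,
      Test.cost, Expr.cost]
    refine ⟨trivial, fun k k1 k2 => ?_, fun y hy => ?_, by omega⟩
    · by_cases hk : k = i + 1
      · subst hk; simp
      · have := hne k k1 (by omega)
        rw [update_of_ne this, update_of_ne this]
        exact a2 k k1 (by omega)
    · have := hy (i + 1) (by omega) le_rfl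
      rw [update_of_ne this, update_of_ne this]
      exact a3 y fun k k1 k2 => hy k k1 (by omega)
  · rintro σ₁ τ₁ hF ⟨a1, a2, a3, a4⟩
    have e_sz : σ₁.reg (.size b) = σ.reg (.size b) := by rw [hF.1]; simp; simp
    refine ⟨by simp [a1, e_sz], a2, a3, ?_⟩
    simp; omega

end DominatorAlg

/-! ### Double-vertex dominators and the composition of stages. -/

namespace Net

variable {N : Net} {A B : Set ℕ}

/-- The vertices of the set `B` that no path from `x` to `y` meets can be avoided as well. -/
theorem Av.add {x y : ℕ} (h : N.Av A x y) (hB : ∀ b ∈ B, N.Reach x b → ¬ N.Reach b y) :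
    N.Av (A ∪ B) x y := by
  rcases h.first B with k | k | ⟨a, b, h₁, h₂, h₃, h₄⟩
  · rwa [Set.union_comm]
  · exact absurd h.reach (hB _ k (.refl _))
  · exact absurd h₄.reach (hB _ h₃ (h₁.reach.tail h₂))

/-- A path that avoids `A` passes through every dominator. -/
theorem Av.through {x y z : ℕ} (h : N.Av A x y) (hz : ¬ N.Av {z} x y) :
    z = x ∨ N.Av A x z ∧ N.Av A z y := by
  rcases h.first {z} with h | h | ⟨a, b, h₁, h₂, h₃, h₄⟩
  · exact absurd (h.mono (by simp)) hz
  · exact .inl (Set.mem_singleton_iff.1 h).symm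
  · obtain rfl : b = z := h₃
    exact .inr ⟨(h₁.mono (by simp)).tail h₂ h₄.left, h₄⟩

theorem Av.through' {x y z : ℕ} (h : N.Av A x y) (hz : ¬ N.Av {z} x y) :
    N.Av A x z ∧ N.Av A z y := by
  rcases h.through hz with rfl | h'
  · exact ⟨.refl h.left, h⟩
  · exact h'

end Net

namespace DominatorAlg

variable {N : Net} {s t : ℕ}

/-- `{v, w}` is a double-vertex dominator. -/
structure Pair (N : Net) (v w : ℕ) : Prop where
  left : N.Av {v} N.u N.root
  right : N.Av {w} N.u N.root
  dom : ¬ N.Av {v, w} N.u N.root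

theorem Pair.symm {v w : ℕ} (h : Pair N v w) : Pair N w v :=
  ⟨h.right, h.left, by rw [Set.pair_comm]; exact h.dom⟩

/-- A vertex on no path from `u` to the root could be dropped, and `w` alone would dominate. -/
theorem Pair.live {v w : ℕ} (h : Pair N v w) : v ∈ N.Live N.u := by
  by_contra hv
  refine h.dom ((h.right.add (B := {v}) ?_).mono ?_)
  · rintro b rfl h1 h2; exact hv ⟨h1, h2⟩
  · rw [Set.pair_comm]; rfl

theorem Pair.ne {v w : ℕ} (h : Pair N v w) : v ≠ w := by
  rintro rfl; exact h.dom (by simpa using h.left)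

/-- The vertices `v` and `w` separate `s` and `t`. -/
def Cut (N : Net) (s t v w : ℕ) : Prop := Mid N s t w ∧ ¬ N.Av {v, w} s t

/-- Every path from `u` to the root splits at `s` and `t`. A vertex strictly between them is met
neither before `s` nor behind `t`, and no single vertex separates `s` from `t`; so the outer parts
of the path are irrelevant and the partner of `v` has to lie in the same stage. -/
theorem IsStage.pair_iff (h : IsStage N s t) {v w : ℕ} (hv : Mid N s t v) :
    Pair N v w ↔ Cut N s t v w := by
  have hvs : v ≠ s := hv.2.1
  have hvt := hv.ne_right
  have hroot : N.Av {v} t N.root := h.tr.av (by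
    rintro a rfl h1 _; exact hvt (hv.2.2.antisymm h1))
  have hus : N.Av {v} N.u s := h.us.av (by
    rintro a rfl _ h2; exact hvs (h2.antisymm hv.1.reach))
  have huv : N.Av {v} N.u N.root := (hus.trans (h.cut v hvs hvt)).trans hroot
  constructor
  · intro hp
    have hsplit := hp.right.through' h.dom_s
    have hsplit₂ := hp.right.through' h.dom_t
    have h1 : N.Av {w, v} N.u s := (hsplit.1.add (B := {v}) (by
      rintro a rfl _ h2; exact hvs (h2.antisymm hv.1.reach)))
    have h2 : N.Av {w, v} t N.root := (hsplit₂.2.add (B := {v}) (by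
      rintro a rfl h1 _; exact hvt (hv.2.2.antisymm h1)))
    have hno : ¬ N.Av {v, w} s t := fun h3 => hp.dom (by
      rw [Set.pair_comm] at h1 h2
      exact (h1.trans h3).trans h2)
    refine ⟨?_, hno⟩
    -- A partner outside the stage is neither `s` nor `t` and lies on no path from `s` to `t`, so a
    -- path from `s` to `t` that avoids `v` avoids both.
    by_contra hw
    refine hno (((h.cut v hvs hvt).add (B := {w}) ?_).mono (by rfl))
    rintro a rfl h3 h4
    refine hw (mid_iff.2 ⟨h3, h4, ?_, ?_⟩)
    · rintro rfl; exact hsplit.1.right rfl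
    · rintro rfl; exact hsplit₂.1.right rfl
  · rintro ⟨hw, hno⟩
    have hws : w ≠ s := hw.2.1
    have hwt := hw.ne_right
    refine ⟨huv, ?_, fun h3 => hno ?_⟩
    · refine ((h.us.av ?_).trans (h.cut w hws hwt)).trans (h.tr.av ?_)
      · rintro a rfl _ h2; exact hws (h2.antisymm hw.1.reach)
      · rintro a rfl h1 _; exact hwt (hw.2.2.antisymm h1)
    · have h4 := (h3.through' h.dom_s).2
      refine (h4.through' (z := t) fun h5 => ?_).1
      exact h.dom_t (h.av_us.trans h5)

theorem Mid.ne_left {z : ℕ} (h : Mid N s t z) : z ≠ s := h.2.1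

theorem IsStage.pair_ne (h : IsStage N s t) {v w : ℕ} (hp : Pair N v w) : v ≠ s := by
  rintro rfl; exact h.dom_s hp.left

/-- The content of the vectors and of the fields of the vertices. -/
structure Tables where
  size : Bool → ℕ
  vec : Bool → ℕ → ℕ
  index : ℕ → ℕ
  flag : ℕ → ℕ
  min : ℕ → ℕ
  max : ℕ → ℕ

/-- The vertices of the other vector. -/
def Tables.Opp (T : Tables) (b : Bool) : Set ℕ := {y | T.flag y = label !b}

/-- The vertices of the other vector and the vertices behind `v` in its vector. -/
def Tables.After (T : Tables) (b : Bool) (v : ℕ) : Set ℕ :=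
  {y | T.flag y = label (!b) ∨ (T.flag y = label b ∧ T.index v < T.index y)}

/-- The vertices of the other vector and the vertices before `v` in its vector. -/
def Tables.Before (T : Tables) (b : Bool) (v : ℕ) : Set ℕ :=
  {y | T.flag y = label (!b) ∨ (T.flag y = label b ∧ T.index y < T.index v)}

/-- The tables list the double-vertex dominators between `s` and `t` from position `start` on. -/
structure StageTables (N : Net) (s t : ℕ) (start : Bool → ℕ) (T : Tables) : Prop where
  start_le : ∀ b, start b ≤ T.size b
  vec_flag : ∀ b k, start b < k → k ≤ T.size b → Mid N s t (T.vec b k) ∧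
    T.flag (T.vec b k) = label b ∧ T.index (T.vec b k) = k
  flag_vec : ∀ v, Mid N s t v → T.flag v ≠ 0 → ∃ b, T.flag v = label b ∧ start b < T.index v ∧
    T.index v ≤ T.size b ∧ T.vec b (T.index v) = v
  partner : ∀ v, Mid N s t v → T.flag v ≠ 0 → ∃ w, Cut N s t v w
  cut_flag : ∀ v w, Mid N s t v → Cut N s t v w → ∃ b, T.flag v = label b ∧ T.flag w = label !b
  cut_iff : ∀ b v w, Mid N s t v → Mid N s t w → T.flag v = label b → T.flag w = label (!b) →
    (Cut N s t v w ↔ T.min v ≤ T.index w ∧ T.index w ≤ T.max v)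
  min : ∀ b v, Mid N s t v → T.flag v = label b → ∃ w, T.flag w = label (!b) ∧ Cut N s t v w ∧
    T.index w = T.min v
  max : ∀ b v, Mid N s t v → T.flag v = label b → ∃ w, T.flag w = label (!b) ∧ Cut N s t v w ∧
    T.index w = T.max v
  thru : ∀ b, N.Av (T.Opp b ∩ {y | Mid N s t y}) s t
  fwd : ∀ b v, Mid N s t v → T.flag v = label b → N.Av (T.After b v ∩ {y | Mid N s t y}) s v
  bwd : ∀ b v, Mid N s t v → T.flag v = label b → N.Av (T.Before b v ∩ {y | Mid N s t y}) v t

/-- The tables list all double-vertex dominators before `s`. -/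
structure Chain (N : Net) (s : ℕ) (T : Tables) : Prop where
  vec_flag : ∀ b k, 1 ≤ k → k ≤ T.size b → T.flag (T.vec b k) = label b ∧ T.index (T.vec b k) = k
  flag_vec : ∀ v, T.flag v ≠ 0 → ∃ b, T.flag v = label b ∧ 1 ≤ T.index v ∧ T.index v ≤ T.size b ∧
    T.vec b (T.index v) = v
  done : ∀ v, T.flag v ≠ 0 → v ∉ N.Live s ∧ ∃ w, Pair N v w
  pair_flag : ∀ v w, Pair N v w → v ∉ N.Live s → ∃ b, T.flag v = label b ∧ T.flag w = label !b
  pair_iff : ∀ b v w, T.flag v = label b → T.flag w = label (!b) →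
    (Pair N v w ↔ T.min v ≤ T.index w ∧ T.index w ≤ T.max v)
  min : ∀ b v, T.flag v = label b → ∃ w, T.flag w = label (!b) ∧ Pair N v w ∧ T.index w = T.min v
  max : ∀ b v, T.flag v = label b → ∃ w, T.flag w = label (!b) ∧ Pair N v w ∧ T.index w = T.max v
  thru : ∀ b, N.Av (T.Opp b) N.u s
  fwd : ∀ b v, T.flag v = label b → N.Av (T.After b v) N.u v
  bwd : ∀ b v, T.flag v = label b → N.Av (T.Before b v) v s

theorem Chain.init {T : Tables} (hs : ∀ b, T.size b = 0) (hf : ∀ v, T.flag v = 0) :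
    Chain N N.u T := by
  have h0 : ∀ b v, T.flag v ≠ label b := fun b v h => label_ne_zero (h.symm.trans (hf v))
  refine ⟨fun b k h1 h2 => ?_, fun v h => absurd (hf v) h, fun v h => absurd (hf v) h,
    fun v w h1 h2 => absurd h1.live h2, fun b v w h => absurd h (h0 b v), fun b v h => absurd h (h0 b v),
    fun b v h => absurd h (h0 b v), fun b => .refl (h0 _ _), fun b v h => absurd h (h0 b v),
    fun b v h => absurd h (h0 b v)⟩
  rw [hs] at h2; omega

section
variable {T : Tables}

/-- A listed vertex reaches the root, so being reachable from `s` would make it live at `s`. -/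
theorem Chain.not_reach (h : Chain N s T) {y : ℕ} (hy : T.flag y ≠ 0) : ¬ N.Reach s y := fun hr => by
  obtain ⟨h1, w, hw⟩ := h.done y hy
  exact h1 ⟨hr, hw.live.2⟩

/-- A stage without double-vertex dominators. -/
theorem Chain.skip (h : Chain N s T) (hS : IsStage N s t)
    (hno : ∀ v w, Mid N s t v → ¬ Cut N s t v w) : Chain N t T := by
  have hst : ∀ A : Set ℕ, (∀ y ∈ A, T.flag y ≠ 0) → N.Av A s t := fun A hA =>
    hS.st.av fun a ha hr _ => h.not_reach (hA a ha) hr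
  have hb : ∀ b v, ∀ y ∈ T.Before b v, T.flag y ≠ 0 := by
    rintro b v y (hy | hy)
    · rw [hy]; exact label_ne_zero
    · rw [hy.1]; exact label_ne_zero
  have ho : ∀ b, ∀ y ∈ T.Opp b, T.flag y ≠ 0 := by
    intro b y hy
    rw [show T.flag y = _ from hy]; exact label_ne_zero
  refine ⟨h.vec_flag, h.flag_vec, fun v hv => ⟨fun hl => (h.done v hv).1 (hS.live_mono hl),
    (h.done v hv).2⟩, fun v w hp hl => ?_, h.pair_iff, h.min, h.max,
    fun b => (h.thru b).trans (hst _ (ho b)), h.fwd, fun b v hv => (h.bwd b v hv).trans (hst _ (hb b v))⟩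
  refine h.pair_flag v w hp fun hls => ?_
  rcases hS.live_cases hls with rfl | hm | hm
  · exact hS.pair_ne hp rfl
  · exact hno v w hm ((hS.pair_iff hm).1 hp)
  · exact hl hm

/-- A stage that appends its double-vertex dominators. -/
theorem Chain.step {T' : Tables} (h : Chain N s T) (hS : IsStage N s t)
    (hT : StageTables N s t T.size T')
    (hold : ∀ y, ¬ Mid N s t y → T'.flag y = T.flag y ∧ T'.index y = T.index y ∧
      T'.min y = T.min y ∧ T'.max y = T.max y)
    (hvec : ∀ b k, k ≤ T.size b → T'.vec b k = T.vec b k) : Chain N t T' := by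
  have hflag0 : ∀ {y b}, T.flag y = label b → T.flag y ≠ 0 := fun h => by
    rw [h]; exact label_ne_zero
  have hflag0' : ∀ {y b}, T'.flag y = label b → T'.flag y ≠ 0 := fun h => by
    rw [h]; exact label_ne_zero
  have hnm : ∀ {y}, T.flag y ≠ 0 → ¬ Mid N s t y := fun hy hm => h.not_reach hy hm.1.reach
  have hidx : ∀ b y, T.flag y = label b → 1 ≤ T.index y ∧ T.index y ≤ T.size b := by
    intro b y hy
    obtain ⟨c, h1, h2, h3, _⟩ := h.flag_vec y (hflag0 hy)
    obtain rfl := label_inj.1 (h1.symm.trans hy)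
    exact ⟨h2, h3⟩
  have hidx' : ∀ b y, Mid N s t y → T'.flag y = label b → T.size b < T'.index y := by
    intro b y hm hy
    obtain ⟨c, h1, h2, h3, _⟩ := hT.flag_vec y hm (hflag0' hy)
    obtain rfl := label_inj.1 (h1.symm.trans hy)
    exact h2
  -- The vertices of the new stage lie behind `s`, and `s` reaches no vertex listed earlier. Hence a
  -- path up to `s` avoids the former and a path from `s` on avoids the latter for free, and the
  -- path fields of the two parts can be joined.
  have addMid : ∀ {X : Set ℕ} {x z}, N.Av X x z → (z = s ∨ T.flag z ≠ 0) →
      N.Av (X ∪ {y | Mid N s t y}) x z := by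
    intro X x z hx hz
    refine hx.add fun y hy _ hyz => ?_
    rcases hz with rfl | hz
    · exact Mid.ne_left hy (hyz.antisymm hy.1.reach)
    · exact h.not_reach hz (hy.1.reach.trans hyz)
  have addOld : ∀ {X : Set ℕ} {x z}, N.Av X x z → N.Reach s x →
      N.Av (X ∪ {y | T.flag y ≠ 0}) x z := by
    intro X x z hx hsx
    exact hx.add fun y hy hxy _ => h.not_reach hy (hsx.trans hxy)
  have cases' : ∀ {y b}, T'.flag y = label b → Mid N s t y ∨ (¬ Mid N s t y ∧ T.flag y = label b ∧
      T'.index y = T.index y ∧ T'.min y = T.min y ∧ T'.max y = T.max y) := by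
    intro y b hy
    by_cases hm : Mid N s t y
    · exact .inl hm
    · obtain ⟨h1, h2⟩ := hold y hm
      exact .inr ⟨hm, h1 ▸ hy, h2⟩
  have hflagold : ∀ {y b}, T.flag y = label b → T'.flag y = label b := fun hy => by
    rw [(hold _ (hnm (hflag0 hy))).1, hy]
  have hOpp : ∀ b, T'.Opp b ⊆ T.Opp b ∪ {y | Mid N s t y} := by
    intro b y hy
    rcases cases' hy with hm | hm
    · exact .inr hm
    · exact .inl hm.2.1
  have hthru₁ : ∀ b, N.Av (T.Opp b ∪ {y | Mid N s t y}) N.u s := fun b => addMid (h.thru b) (.inl rfl)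
  have hthru₂ : ∀ b, N.Av (T'.Opp b ∩ {y | Mid N s t y} ∪ {y | T.flag y ≠ 0}) s t := fun b =>
    addOld (hT.thru b) (.refl _)
  refine ⟨fun b k h1 h2 => ?_, fun v hv => ?_, fun v hv => ?_, fun v w hp hl => ?_,
    fun b v w hv hw => ?_, fun b v hv => ?_, fun b v hv => ?_, fun b => ?_, fun b v hv => ?_,
    fun b v hv => ?_⟩
  · rcases Nat.lt_or_ge (T.size b) k with h3 | h3
    · exact (hT.vec_flag b k h3 h2).2
    · rw [hvec b k h3]
      obtain ⟨h4, h5⟩ := h.vec_flag b k h1 h3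
      exact ⟨hflagold h4, by rw [(hold _ (hnm (hflag0 h4))).2.1, h5]⟩
  · by_cases hm : Mid N s t v
    · obtain ⟨b, h1, h2, h3, h4⟩ := hT.flag_vec v hm hv
      exact ⟨b, h1, by omega, h3, h4⟩
    · obtain ⟨e1, e2, _⟩ := hold v hm
      rw [e1] at hv
      obtain ⟨b, h1, h2, h3, h4⟩ := h.flag_vec v hv
      rw [e1, e2]
      exact ⟨b, h1, h2, h3.trans (hT.start_le b), by rw [hvec b _ h3, h4]⟩
  · by_cases hm : Mid N s t v
    · obtain ⟨w, hw⟩ := hT.partner v hm hv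
      exact ⟨hm.not_live, w, (hS.pair_iff hm).2 hw⟩
    · rw [(hold v hm).1] at hv
      exact ⟨fun hl => (h.done v hv).1 (hS.live_mono hl), (h.done v hv).2⟩
  · by_cases hls : v ∈ N.Live s
    · rcases hS.live_cases hls with rfl | hm | hm
      · exact absurd rfl (hS.pair_ne hp)
      · exact hT.cut_flag v w hm ((hS.pair_iff hm).1 hp)
      · exact absurd hm hl
    · obtain ⟨b, h1, h2⟩ := h.pair_flag v w hp hls
      exact ⟨b, hflagold h1, hflagold h2⟩
  · rcases cases' hv with hvm | ⟨hvm, v1, v2, v3, v4⟩ <;> rcases cases' hw with hwm | ⟨hwm, w1, w2, _, _⟩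
    · rw [hS.pair_iff hvm]; exact hT.cut_iff b v w hvm hwm hv hw
    · constructor
      · intro hp; exact absurd ((hS.pair_iff hvm).1 hp).1 hwm
      -- All indices of the new stage exceed the old ones, so the index interval of a new vertex
      -- contains no old index.
      · rintro ⟨h1, _⟩
        obtain ⟨w', q1, q2, q3⟩ := hT.min b v hvm hv
        have := hidx' _ w' q2.1 q1
        have := hidx _ w w1
        omega
    · constructor
      · intro hp; exact absurd ((hS.pair_iff hwm).1 hp.symm).1 hvm
      · rintro ⟨_, h1⟩
        obtain ⟨w', q1, q2, q3⟩ := h.max b v v1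
        have := hidx _ w' q1
        have := hidx' _ w hwm hw
        omega
    · rw [v3, v4, w2]; exact h.pair_iff b v w v1 w1
  · rcases cases' hv with hm | ⟨hm, v1, v2, v3, v4⟩
    · obtain ⟨w, h1, h2, h3⟩ := hT.min b v hm hv
      exact ⟨w, h1, (hS.pair_iff hm).2 h2, h3⟩
    · obtain ⟨w, h1, h2, h3⟩ := h.min b v v1
      exact ⟨w, hflagold h1, h2, by rw [v3, (hold w (hnm (hflag0 h1))).2.1, h3]⟩
  · rcases cases' hv with hm | ⟨hm, v1, v2, v3, v4⟩
    · obtain ⟨w, h1, h2, h3⟩ := hT.max b v hm hv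
      exact ⟨w, h1, (hS.pair_iff hm).2 h2, h3⟩
    · obtain ⟨w, h1, h2, h3⟩ := h.max b v v1
      exact ⟨w, hflagold h1, h2, by rw [v4, (hold w (hnm (hflag0 h1))).2.1, h3]⟩
  · refine ((hthru₁ b).mono (hOpp b)).trans ((hthru₂ b).mono fun y hy => ?_)
    rcases cases' hy with hm | hm
    · exact .inl ⟨hy, hm⟩
    · exact .inr (hflag0 hm.2.1)
  · rcases cases' hv with hvm | ⟨hvm, v1, v2, v3, v4⟩
    · refine ((hthru₁ b).mono ?_).trans ((addOld (hT.fwd b v hvm hv) (.refl _)).mono ?_)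
      · rintro y (hy | ⟨hy, hlt⟩)
        · exact hOpp b hy
        · rcases cases' hy with hm | ⟨_, y1, y2, _⟩
          · exact .inr hm
          · have := hidx' b v hvm hv
            have := hidx b y y1
            omega
      · rintro y hy
        by_cases hm : Mid N s t y
        · exact .inl ⟨hy, hm⟩
        · refine .inr ?_
          rcases hy with hy | ⟨hy, _⟩
          · rcases cases' hy with k | k
            · exact absurd k hm
            · exact hflag0 k.2.1
          · rcases cases' hy with k | k
            · exact absurd k hm
            · exact hflag0 k.2.1
    · refine (addMid (h.fwd b v v1) (.inr (hflag0 v1))).mono ?_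
      rintro y (hy | ⟨hy, hlt⟩)
      · rcases cases' hy with hm | ⟨_, y1, _⟩
        · exact .inr hm
        · exact .inl (.inl y1)
      · rcases cases' hy with hm | ⟨_, y1, y2, _⟩
        · exact .inr hm
        · exact .inl (.inr ⟨y1, by omega⟩)
  · rcases cases' hv with hvm | ⟨hvm, v1, v2, v3, v4⟩
    · refine (addOld (hT.bwd b v hvm hv) hvm.1.reach).mono ?_
      rintro y hy
      by_cases hm : Mid N s t y
      · exact .inl ⟨hy, hm⟩
      · refine .inr ?_
        rcases hy with hy | ⟨hy, _⟩
        · rcases cases' hy with k | k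
          · exact absurd k hm
          · exact hflag0 k.2.1
        · rcases cases' hy with k | k
          · exact absurd k hm
          · exact hflag0 k.2.1
    · refine ((addMid (h.bwd b v v1) (.inl rfl)).mono ?_).trans ((hthru₂ b).mono ?_)
      · rintro y (hy | ⟨hy, hlt⟩)
        · rcases cases' hy with hm | ⟨_, y1, _⟩
          · exact .inr hm
          · exact .inl (.inl y1)
        · rcases cases' hy with hm | ⟨_, y1, y2, _⟩
          · exact .inr hm
          · exact .inl (.inr ⟨y1, by omega⟩)
      · rintro y (hy | ⟨hy, hlt⟩)
        · rcases cases' hy with hm | ⟨_, y1, _⟩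
          · exact .inl ⟨hy, hm⟩
          · exact .inr (hflag0 y1)
        · rcases cases' hy with hm | ⟨_, y1, y2, _⟩
          · have := hidx' b y hm hy
            have := hidx b v v1
            omega
          · exact .inr (hflag0 y1)

end

/-! ### The tables of one stage -/

variable {p : Bool → ℕ → ℕ} {L : Bool → ℕ} {S : Set ℕ} {ps : Bool → ℕ → ℕ}

/-- The path `b` itself realises the three path fields: all of it, its part up to `v`, and its part
from `v` on. This works because a path contains no vertex of the opposite vector and indices
increase along it. -/
theorem Layout.stageTables (H : Layout N s t p L S ps) {start : Bool → ℕ} {T : Tables}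
    (hle : ∀ b, start b ≤ T.size b)
    (hU : ∀ b i, Used N L S p ps b i → start b < T.index (p b i) ∧ T.index (p b i) ≤ T.size b ∧
      T.vec b (T.index (p b i)) = p b i ∧ T.flag (p b i) = label b)
    (hV : ∀ b k, start b < k → k ≤ T.size b → ∃ i, Used N L S p ps b i ∧ T.vec b k = p b i ∧
      T.index (p b i) = k)
    (hmono : ∀ b i j, i < j → Used N L S p ps b i → Used N L S p ps b j →
      T.index (p b i) < T.index (p b j))
    (hold : ∀ y, Mid N s t y → (∀ b i, Used N L S p ps b i → y ≠ p b i) → T.flag y = 0)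
    (hR : ∀ b i, Used N L S p ps b i → ∃ l h, Match N L S p ps b i l ∧ Match N L S p ps b i h ∧
      (∀ j, Match N L S p ps b i j → l ≤ j ∧ j ≤ h) ∧ T.min (p b i) = T.index (p (!b) l) ∧
      T.max (p b i) = T.index (p (!b) h)) : StageTables N s t start T := by
  have hnn : ∀ {b i j}, Match N L S p ps b i j → Match N L S p ps (!b) j i := fun h => h.symm
  have hpos : ∀ b i, Used N L S p ps b i → 1 < i ∧ i < L b := fun b i ⟨j, h⟩ => h.1
  have hmid : ∀ b i, Used N L S p ps b i → Mid N s t (p b i) := fun b i h =>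
    (H.two.path b).mid (hpos b i h).1 (hpos b i h).2
  have hmono' : ∀ b i j, Used N L S p ps b i → Used N L S p ps b j →
      (T.index (p b i) ≤ T.index (p b j) ↔ i ≤ j) := by
    intro b i j hi hj
    rcases lt_trichotomy i j with h | rfl | h
    · have := hmono b i j h hi hj; omega
    · simp
    · have := hmono b j i h hj hi; omega
  have hflag : ∀ b v, Mid N s t v → T.flag v = label b → ∃ i, Used N L S p ps b i ∧ v = p b i := by
    intro b v hm hf
    by_contra hno
    push Not at hno
    refine label_ne_zero (hf.symm.trans (hold v hm fun c i hi => ?_))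
    by_cases hcb : c = b
    · subst hcb; exact hno i hi
    · rintro rfl
      exact hcb (label_inj.1 ((hU c i hi).2.2.2.symm.trans hf))
  have hcut : ∀ {b i j}, Match N L S p ps b i j → Cut N s t (p b i) (p (!b) j) := by
    intro b i j h
    exact ⟨hmid (!b) j ⟨i, h.symm⟩, (H.match_iff h.1 h.2.1).1 h⟩
  have hcut' : ∀ {b i j}, Used N L S p ps b i → Used N L S p ps (!b) j →
      (Cut N s t (p b i) (p (!b) j) ↔ Match N L S p ps b i j) := by
    intro b i j hi hj
    exact ⟨fun h => (H.match_iff (hpos b i hi) (hpos (!b) j hj)).2 h.2, hcut⟩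
  have havoid : ∀ (b : Bool) (X : Set ℕ) (m n : ℕ), 1 ≤ m → m ≤ n → n ≤ L b →
      (∀ y ∈ X, Mid N s t y) → (∀ y ∈ X, T.flag y = label (!b) ∨ ∃ i, Used N L S p ps b i ∧ y = p b i ∧
        (i < m ∨ n < i)) → N.Av X (p b m) (p b n) := by
    intro b X m n h1 h2 h3 hX1 hX
    refine (H.two.path b).av h1 h2 h3 fun k k1 k2 hk => ?_
    have hm := hX1 _ hk
    have k3 : 1 < k := by
      by_contra hlt
      obtain rfl : k = 1 := by omega
      exact Mid.ne_left hm (H.two.path b).first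
    have k4 : k < L b := by
      by_contra hlt
      obtain rfl : k = L b := by omega
      exact hm.ne_right (H.two.path b).last
    rcases hX _ hk with hf | ⟨i, hi1, hi2, hi3⟩
    · obtain ⟨j, hj1, hj2⟩ := hflag (!b) _ hm hf
      exact H.two.disj b k j k3 k4 (hpos _ j hj1).1 (hpos _ j hj1).2 hj2
    · have := (H.two.path b).inj (by omega) (by omega) (hpos b i hi1).1.le (hpos b i hi1).2.le hi2
      omega
  refine ⟨hle, fun b k h1 h2 => ?_, fun v hv hf => ?_, fun v hv hf => ?_, fun v w hv hc => ?_,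
    fun b v w hv hw hfv hfw => ?_, fun b v hv hf => ?_, fun b v hv hf => ?_, fun b => ?_,
    fun b v hv hf => ?_, fun b v hv hf => ?_⟩
  · obtain ⟨i, hi1, hi2, hi3⟩ := hV b k h1 h2
    rw [hi2]
    exact ⟨hmid b i hi1, (hU b i hi1).2.2.2, hi3⟩
  · by_contra hno
    push Not at hno
    refine hf (hold v hv ?_)
    rintro b i hi rfl
    obtain ⟨h1, h2, h3, h4⟩ := hU b i hi
    exact hno b h4 h1 h2 h3
  · by_contra hno
    refine hf (hold v hv ?_)
    rintro b i ⟨j, hj⟩ rfl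
    exact hno ⟨_, hcut hj⟩
  · obtain ⟨b, i, j, h1, h2, h3, h4, rfl, rfl⟩ := H.two.cut ⟨Mid.ne_left hv, hv.ne_right⟩
      ⟨Mid.ne_left hc.1, hc.1.ne_right⟩ hc.2
    have hm := (H.match_iff ⟨h1, h2⟩ ⟨h3, h4⟩).2 hc.2
    exact ⟨b, (hU b i ⟨j, hm⟩).2.2.2, (hU (!b) j ⟨i, hm.symm⟩).2.2.2⟩
  · obtain ⟨i, hi, rfl⟩ := hflag b v hv hfv
    obtain ⟨j, hj, rfl⟩ := hflag (!b) w hw hfw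
    obtain ⟨l, h, m1, m2, m3, m4, m5⟩ := hR b i hi
    rw [hcut' hi hj, m4, m5, hmono' (!b) l j ⟨i, m1.symm⟩ hj, hmono' (!b) j h hj ⟨i, m2.symm⟩]
    -- A used vertex between the first and the last partner is prime, and it inherits one crossing
    -- condition from each of these two.
    refine ⟨m3 j, fun ⟨k1, k2⟩ => ?_⟩
    obtain ⟨i', hj⟩ := hj
    refine ⟨m1.1, hj.1, m1.2.2.1, hj.2.2.1, fun ho => m1.2.2.2.2.1 (ho.mono le_rfl k1),
      fun ho => m2.2.2.2.2.2 (ho.mono k2 le_rfl)⟩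
  · obtain ⟨i, hi, rfl⟩ := hflag b v hv hf
    obtain ⟨l, h, m1, m2, m3, m4, m5⟩ := hR b i hi
    exact ⟨_, (hU (!b) l ⟨i, m1.symm⟩).2.2.2, hcut m1, m4.symm⟩
  · obtain ⟨i, hi, rfl⟩ := hflag b v hv hf
    obtain ⟨l, h, m1, m2, m3, m4, m5⟩ := hR b i hi
    exact ⟨_, (hU (!b) h ⟨i, m2.symm⟩).2.2.2, hcut m2, m5.symm⟩
  · have := havoid b (T.Opp b ∩ {y | Mid N s t y}) 1 (L b) le_rfl (by have := H.three_le b; omega)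
      le_rfl (fun y hy => hy.2) fun y hy => .inl hy.1
    rwa [(H.two.path b).first, (H.two.path b).last] at this
  · obtain ⟨i, hi, rfl⟩ := hflag b v hv hf
    have := havoid b (T.After b (p b i) ∩ {y | Mid N s t y}) 1 i le_rfl (hpos b i hi).1.le
      (hpos b i hi).2.le (fun y hy => hy.2) ?_
    · rwa [(H.two.path b).first] at this
    · rintro y ⟨hy | ⟨hy, hlt⟩, hm⟩
      · exact .inl hy
      · obtain ⟨j, hj, rfl⟩ := hflag b y hm hy
        refine .inr ⟨j, hj, rfl, .inr ?_⟩
        by_contra hle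
        have := (hmono' b j i hj hi).2 (by omega)
        omega
  · obtain ⟨i, hi, rfl⟩ := hflag b v hv hf
    have := havoid b (T.Before b (p b i) ∩ {y | Mid N s t y}) i (L b) (hpos b i hi).1.le
      (hpos b i hi).2.le le_rfl (fun y hy => hy.2) ?_
    · rwa [(H.two.path b).last] at this
    · rintro y ⟨hy | ⟨hy, hlt⟩, hm⟩
      · exact .inl hy
      · obtain ⟨j, hj, rfl⟩ := hflag b y hm hy
        refine .inr ⟨j, hj, rfl, .inl ?_⟩
        by_contra hle
        have := (hmono' b i j hi hj).2 (by omega)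
        omega

end DominatorAlg

/-! ### The work on the two disjoint paths of one stage. -/

namespace DominatorAlg

open RAM

variable {N : Net} {s t : ℕ} {p : Bool → ℕ → ℕ} {L : Bool → ℕ}

open Classical in
/-- The work for the vertices on the paths from `s` to the root. -/
noncomputable def liveWork (N : Net) (s : ℕ) : ℕ := ∑ v ∈ N.verts with v ∈ N.Live s, (N.deg v + 1)

/-- The vertices of the path before `t` are live at `s` but no longer at `t`. So the charges of
different stages are disjoint, and their sum telescopes. -/
theorem pathWork_add_liveWork (hS : IsStage N s t) {p : ℕ → ℕ} {L : ℕ} (hp : PathOn N s t p L) :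
    pathWork N p L + liveWork N t ≤ liveWork N s := by
  classical
  have hmem : ∀ k ∈ Finset.Ico 1 L, N.Reach N.u (p k) ∧ p k ∈ N.Live s ∧ p k ∉ N.Live t := by
    intro k hk
    rw [Finset.mem_Ico] at hk
    have h1 := hp.from_s hk.1 hk.2.le
    have h2 := hp.to_t hk.1 hk.2.le
    refine ⟨hS.us.trans h1, ⟨h1, h2.trans hS.tr⟩, fun h3 => ?_⟩
    have := hp.ne hk.1 hk.2 le_rfl
    rw [hp.last] at this
    exact this (h2.antisymm h3.1)
  have hinj : Set.InjOn p (Finset.Ico 1 L) := by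
    intro i hi j hj h
    simp only [Finset.coe_Ico, Set.mem_Ico] at hi hj
    exact hp.inj hi.1 hi.2.le hj.1 hj.2.le h
  unfold pathWork liveWork
  rw [← Finset.sum_image (f := fun v => N.deg v + 1) hinj, ← Finset.sum_union]
  · refine Finset.sum_le_sum_of_subset fun v hv => ?_
    rcases Finset.mem_union.1 hv with hv | hv
    · obtain ⟨k, hk, rfl⟩ := Finset.mem_image.1 hv
      obtain ⟨h1, h2, _⟩ := hmem k hk
      exact Finset.mem_filter.2 ⟨Net.mem_verts.2 h1, h2⟩
    · rw [Finset.mem_filter] at hv ⊢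
      exact ⟨hv.1, hS.live_mono hv.2⟩
  · rw [Finset.disjoint_left]
    intro v hv h
    obtain ⟨k, hk, rfl⟩ := Finset.mem_image.1 hv
    exact (hmem k hk).2.2 (Finset.mem_filter.1 h).2

/-- Without an edge from `s` to `t` both paths have inner vertices. On the vertices that `s`
reaches, the labels describe just these two paths; labels elsewhere do not matter. -/
theorem TwoPaths.layout (H : TwoPaths N s t p L) (hE : ¬ N.E s t) {side pos : ℕ → ℕ}
    (hin : ∀ b i, 1 < i → i < L b → side (p b i) = label b ∧ pos (p b i) = i)
    (hout : ∀ y, N.Reach s y → (∀ b i, 1 < i → i < L b → y ≠ p b i) → side y = 0) :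
    Layout N s t p L {y | y = t ∨ ∃ c, side y = label c}
      fun c => posOn t (L c) (label c) side pos := by
  have h3 : ∀ b, 3 ≤ L b := by
    intro b
    have h2 := (H.path b).two_le
    by_contra hlt
    have hL : L b = 2 := by omega
    have := (H.path b).edge 1 le_rfl (by omega)
    rw [(H.path b).first, show 1 + 1 = L b by omega, (H.path b).last] at this
    exact hE this
  have hcases : ∀ y c, N.Reach s y → side y = label c → ∃ i, 1 < i ∧ i < L c ∧ y = p c i := by
    intro y c hy hc
    by_contra hno
    push Not at hno
    refine label_ne_zero (hc.symm.trans (hout y hy fun b i h1 h2 => ?_))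
    by_cases hbc : b = c
    · subst hbc; exact hno i h1 h2
    · rintro rfl
      exact hbc (label_inj.1 ((hin b i h1 h2).1.symm.trans hc))
  have hnt : ∀ b i, 1 < i → i < L b → p b i ≠ t := fun b i h1 h2 => ((H.path b).mid h1 h2).ne_right
  refine ⟨H, h3, fun y hy => ⟨?_, ?_⟩, fun b => by simp [posOn], fun b i h1 h2 => ?_,
    fun b y hy hne => ?_⟩
  · rintro (rfl | ⟨c, hc⟩)
    · exact .inl rfl
    · obtain ⟨i, h⟩ := hcases y c hy hc
      exact .inr ⟨c, i, h⟩
  · rintro (rfl | ⟨b, i, h1, h2, rfl⟩)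
    · exact .inl rfl
    · exact .inr ⟨b, (hin b i h1 h2).1⟩
  · simp [posOn, hnt b i h1 h2, hin b i h1 h2]
  · by_cases hyt : y = t
    · exact .inl hyt
    · by_cases hs : side y = label b
      · exact .inr (hcases y b hy hs)
      · simp [posOn, hyt, hs] at hne

/-- The tables in the memory. -/
def tables (σ : State Reg Arr) : Tables where
  size b := σ.reg (.size b)
  vec b := σ.arr (.vec b)
  index := σ.arr .index
  flag := σ.arr .flag
  min := σ.arr .min
  max := σ.arr .max

section
open Reg Arr

/-- The procedures that compute the intermediate fields. -/
def analyzePaths : Prog :=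
  x ::= f ;;
  storePath false ;;
  x ::= .read nxt Reg.s ;;
  storePath true ;;
  assignMinMax false ;;
  assignMinMax true

/-- The procedures that append to the vectors. -/
def appendVectors : Prog :=
  start false ::= size false ;;
  start true ::= size true ;;
  constructVector false ;;
  constructVector true ;;
  convertMinMax false ;;
  convertMinMax true

end

theorem wp_seq_assoc {a b c : Prog} {σ : State Reg Arr} {Q : State Reg Arr → ℕ → Prop} :
    WP ((a ;; b) ;; c) σ Q ↔ WP (a ;; b ;; c) σ Q := by
  simp only [wp_seq]
  constructor <;>
  · intro h
    refine h.mono fun σ₁ t₁ h => h.mono fun σ₂ t₂ h => h.mono fun σ₃ t₃ h => ?_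
    convert h using 1; omega

/-- The result of the analysis of two paths. -/
structure Analyzed (N : Net) (s t : ℕ) (p : Bool → ℕ → ℕ) (L : Bool → ℕ) (S : Set ℕ)
    (ps : Bool → ℕ → ℕ) (σ : State Reg Arr) : Prop where
  layout : Layout N s t p L S ps
  len : ∀ b, σ.reg (.len b) = L b
  path : ∀ b i, 1 ≤ i → i ≤ L b → σ.arr (.path b) i = p b i
  minMax : ∀ b, MinMax N L S p ps b (σ.arr (.lo b)) (σ.arr (.hi !b)) (σ.arr (.prime b))

theorem wp_analyzePaths {σ : State Reg Arr} {fl pv : ℕ → ℕ} {g : Bool → ℕ} (hσ : N.Holds σ)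
    (hus : N.Reach N.u s) (H : TwoPaths N s t p L)
    (hp : ∀ b, FlowPath N s t (g b) fl (σ.arr .nxt) pv (p b) (L b)) (hE : ¬ N.E s t)
    (hs : σ.reg .s = s) (ht : σ.reg .t = t) (hf : σ.reg .f = g false) (hg : σ.arr .nxt s = g true)
    (hside : ∀ y, σ.arr .side y ≠ 0 → ¬ N.Reach s y)
    (hm : ∀ b z, Mid N s t z ∨ z = t → σ.arr (.marked b) z = 0) :
    WP analyzePaths σ fun σ' τ => (∃ S ps, Analyzed N s t p L S ps σ') ∧
      (∀ y, σ'.arr .side y ≠ 0 → σ.arr .side y ≠ 0 ∨ Mid N s t y) ∧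
      (∀ b y, New (σ.arr (.marked b)) (σ'.arr (.marked b)) y → y = t ∨ N.Av {t} s y) ∧
      τ + 100 * (N.work (σ'.arr (.marked false)) + N.work (σ'.arr (.marked true))) ≤
        100 * (N.work (σ.arr (.marked false)) + N.work (σ.arr (.marked true))) +
        400 * (pathWork N (p false) (L false) + pathWork N (p true) (L true)) + 500 := by
  unfold analyzePaths
  rw [wp_seq, wp_assign, wp_seq]
  simp only [Expr.eval, Expr.cost]
  refine (wp_storePath (b := false) (N := N) (s := s) (t := t) (g := g false) (fl := fl) (pv := pv)
    (p := p false) (L := L false) (by simpa using hp false) (by simpa) (by simpa)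
    (by simpa using hf)).mono_frame ?_
  rintro σ₁ τ₁ hF₁ ⟨a1, a2, a3, a4, a5⟩
  have f1 : ∀ y, y ≠ .x → y ≠ .len false → σ₁.reg y = σ.reg y := fun y h1 h2 => by
    rw [hF₁.1 y (by simp [storePath, h1, h2])]; simp [h1]
  have g1 : ∀ a, a ≠ .path false → a ≠ .side → a ≠ .pos → σ₁.arr a = σ.arr a := fun a h1 h2 h3 => by
    rw [hF₁.2 a (by simp [storePath, h1, h2, h3])]; simp
  clear hF₁
  simp only [State.arr_setReg] at a5
  rw [wp_seq, wp_assign, wp_seq]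
  simp only [Expr.eval, Expr.cost]
  refine (wp_storePath (b := true) (N := N) (s := s) (t := t) (g := g true) (fl := fl) (pv := pv)
    (p := p true) (L := L true) (by simpa [g1] using hp true) (by simp [f1, hs]) (by simp [f1, ht])
    (by simp [f1, g1, hs, hg])).mono_frame ?_
  rintro σ₂ τ₂ hF₂ ⟨b1, b2, b3, b4, b5⟩
  have f2 : ∀ y, y ≠ .x → y ≠ .len true → σ₂.reg y = σ₁.reg y := fun y h1 h2 => by
    rw [hF₂.1 y (by simp [storePath, h1, h2])]; simp [h1]
  have g2 : ∀ a, a ≠ .path true → a ≠ .side → a ≠ .pos → σ₂.arr a = σ₁.arr a := fun a h1 h2 h3 => by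
    rw [hF₂.2 a (by simp [storePath, h1, h2, h3])]; simp
  clear hF₂
  simp only [State.arr_setReg] at b5
  have hlay : Layout N s t p L {y | y = t ∨ ∃ c, σ₂.arr .side y = label c}
      fun c => posOn t (L c) (label c) (σ₂.arr .side) (σ₂.arr .pos) := by
    refine H.layout hE ?_ ?_
    · rintro (_ | _) i h1 h2
      · obtain ⟨c1, c2⟩ := b5 (p false i) fun j h3 h4 => H.disj false i j h1 h2 h3 h4
        rw [c1, c2]; exact a4 i h1 h2
      · exact b4 i h1 h2
    · intro y hy hno
      rw [(b5 y (hno true)).1, (a5 y (hno false)).1]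
      by_contra h; exact hside y h hy
  have hsd : ∀ y, σ₂.arr .side y ≠ 0 → σ.arr .side y ≠ 0 ∨ Mid N s t y := by
    intro y hy
    by_cases hno : ∀ b i, 1 < i → i < L b → y ≠ p b i
    · rw [(b5 y (hno true)).1, (a5 y (hno false)).1] at hy
      exact .inl hy
    · push Not at hno
      obtain ⟨b, i, h1, h2, rfl⟩ := hno
      exact .inr ((H.path b).mid h1 h2)
  have hlen₂ : ∀ c, σ₂.reg (.len c) = L c := by
    rintro (_ | _)
    · rw [f2 _ (by simp) (by simp), a2]
    · exact b2
  have hpath₂ : ∀ b i, 1 ≤ i → i ≤ L b → σ₂.arr (.path b) i = p b i := by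
    rintro (_ | _) i h1 h2
    · rw [g2 _ (by simp) (by simp) (by simp)]; exact a3 i h1 h2
    · exact b3 i h1 h2
  have hmark₂ : ∀ b, σ₂.arr (.marked b) = σ.arr (.marked b) := fun b => by
    rw [g2 _ (by simp) (by simp) (by simp), g1 _ (by simp) (by simp) (by simp)]
  rw [wp_seq]
  refine (wp_assignMinMax (b := false) (N := N) ⟨by simp [g2, g1, hσ.off], by simp [g2, g1, hσ.adj]⟩
    hlay hus (by simp [f2, f1, ht]) hlen₂ (fun i h1 h2 => hpath₂ false i h1 h2.le) rfl (fun c => rfl)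
    (by simpa [hmark₂] using hm false)).mono_frame ?_
  rintro σ₃ τ₃ hF₃ ⟨c1, c2, c3⟩
  have f3 : ∀ y, ¬ (assignMinMax false).SetsReg y → σ₃.reg y = σ₂.reg y := hF₃.1
  have g3 : ∀ a, ¬ (assignMinMax false).SetsArr a → σ₃.arr a = σ₂.arr a := hF₃.2
  clear hF₃
  refine (wp_assignMinMax (b := true) (N := N)
    ⟨by rw [g3 _ (by simp [assignMinMax, findReachable])]; simp [g2, g1, hσ.off],
     by rw [g3 _ (by simp [assignMinMax, findReachable])]; simp [g2, g1, hσ.adj]⟩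
    hlay hus (by rw [f3 _ (by simp [assignMinMax, findReachable])]; simp [f2, f1, ht])
    (fun c => by rw [f3 _ (by simp [assignMinMax, findReachable])]; exact hlen₂ c)
    (fun i h1 h2 => by rw [g3 _ (by simp [assignMinMax, findReachable])]; exact hpath₂ true i h1 h2.le)
    (by rw [g3 _ (by simp [assignMinMax, findReachable])])
    (fun c => by rw [g3 _ (by simp [assignMinMax, findReachable]),
      g3 _ (by simp [assignMinMax, findReachable])])
    (by rw [g3 _ (by simp [assignMinMax, findReachable])]; simpa [hmark₂] using hm true)).mono_frame ?_
  rintro σ₄ τ₄ hF₄ ⟨d1, d2, d3⟩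
  have f4 : ∀ y, ¬ (assignMinMax true).SetsReg y → σ₄.reg y = σ₃.reg y := hF₄.1
  have g4 : ∀ a, ¬ (assignMinMax true).SetsArr a → σ₄.arr a = σ₃.arr a := hF₄.2
  clear hF₄
  have mf : σ₄.arr (.marked false) = σ₃.arr (.marked false) :=
    g4 _ (by simp [assignMinMax, findReachable])
  have mt : σ₃.arr (.marked true) = σ₂.arr (.marked true) :=
    g3 _ (by simp [assignMinMax, findReachable])
  refine ⟨⟨_, _, ⟨hlay, fun b => ?_, fun b i h1 h2 => ?_, ?_⟩⟩, fun y hy => ?_, ?_, ?_⟩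
  · rw [f4 _ (by simp [assignMinMax, findReachable]), f3 _ (by simp [assignMinMax, findReachable])]
    exact hlen₂ b
  · rw [g4 _ (by simp [assignMinMax, findReachable]), g3 _ (by simp [assignMinMax, findReachable])]
    exact hpath₂ b i h1 h2
  · rintro (_ | _)
    · rw [g4 _ (by simp [assignMinMax, findReachable]), g4 _ (by simp [assignMinMax, findReachable]),
        g4 _ (by simp [assignMinMax, findReachable])]
      exact c1
    · exact d1
  · rw [g4 _ (by simp [assignMinMax, findReachable]), g3 _ (by simp [assignMinMax, findReachable])] at hy
    exact hsd y hy
  · rintro (_ | _) y hy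
    · rw [mf] at hy; rw [hmark₂] at c2; exact c2 y hy
    · rw [mt, hmark₂] at d2; exact d2 y hy
  · rw [mf]
    rw [hmark₂] at c3
    rw [mt, hmark₂] at d3
    have k1 := le_pathWork (N := N) (p := p false) (i := L false)
    have k2 := le_pathWork (N := N) (p := p true) (i := L true)
    simp only [Bool.not_false, Bool.not_true] at c3 d3
    omega


theorem wp_appendVectors {σ : State Reg Arr} {S : Set ℕ} {ps : Bool → ℕ → ℕ}
    (H : Analyzed N s t p L S ps σ) (hflag : ∀ y, Mid N s t y → σ.arr .flag y = 0) :
    WP appendVectors σ fun σ' τ => StageTables N s t (tables σ).size (tables σ') ∧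
      (∀ y, ¬ Mid N s t y → (tables σ').flag y = (tables σ).flag y ∧
        (tables σ').index y = (tables σ).index y ∧
        (tables σ').min y = (tables σ).min y ∧ (tables σ').max y = (tables σ).max y) ∧
      (∀ b k, k ≤ (tables σ).size b → (tables σ').vec b k = (tables σ).vec b k) ∧
      τ ≤ 300 * (L false + L true) + 100 := by
  have hlay := H.layout
  have hpos : ∀ b i, Used N L S p ps b i → 1 < i ∧ i < L b := fun b i ⟨j, h⟩ => h.1
  have hmid : ∀ b i, Used N L S p ps b i → Mid N s t (p b i) := fun b i h =>
    (hlay.two.path b).mid (hpos b i h).1 (hpos b i h).2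
  have hdis : ∀ i j, Used N L S p ps false i → Used N L S p ps true j → p false i ≠ p true j :=
    fun i j hi hj => hlay.two.disj false i j (hpos _ _ hi).1 (hpos _ _ hi).2 (hpos _ _ hj).1 (hpos _ _ hj).2
  unfold appendVectors
  rw [wp_seq, wp_assign, wp_seq, wp_assign, wp_seq]
  simp only [Expr.eval, Expr.cost, State.reg_setReg, reduceCtorEq, if_false]
  refine (wp_constructVector (b := false) (N := N) hlay (by simpa using H.len)
    (fun i h1 h2 => by simpa using H.path false i h1 h2.le) (by simpa using H.minMax)).mono_frame ?_
  rintro σ₂ τ₂ hF₂ ⟨a1, a2, a3⟩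
  have f2 : ∀ y, ¬ (constructVector false).SetsReg y → (∀ b, y ≠ .start b) → σ₂.reg y = σ.reg y :=
    fun y h1 h2 => by rw [hF₂.1 y h1]; simp [h2]
  have st2 : ∀ b, σ₂.reg (.start b) = σ.reg (.size b) := by
    intro b; rw [hF₂.1 _ (by simp [constructVector])]; cases b <;> simp
  have g2 : ∀ a, ¬ (constructVector false).SetsArr a → σ₂.arr a = σ.arr a := fun a h1 => by
    rw [hF₂.2 a h1]; simp
  clear hF₂
  simp only [State.reg_setReg, State.arr_setReg, reduceCtorEq, if_false] at a1 a2
  rw [wp_seq]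
  refine (wp_constructVector (b := true) (N := N) (σ := σ₂) hlay
    (fun c => by rw [f2 _ (by simp [constructVector]) (by simp), H.len])
    (fun i h1 h2 => by rw [g2 _ (by simp [constructVector])]; exact H.path true i h1 h2.le)
    (fun c => by
      rw [g2 _ (by simp [constructVector]), g2 _ (by simp [constructVector]),
        g2 _ (by simp [constructVector])]
      exact H.minMax c)).mono_frame ?_
  rintro σ₃ τ₃ hF₃ ⟨b1, b2, b3⟩
  have f3 : ∀ y, ¬ (constructVector true).SetsReg y → σ₃.reg y = σ₂.reg y := hF₃.1
  have g3 : ∀ a, ¬ (constructVector true).SetsArr a → σ₃.arr a = σ₂.arr a := hF₃.2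
  clear hF₃
  have st3 : ∀ b, σ₃.reg (.start b) = σ.reg (.size b) := by
    intro b; rw [f3 _ (by simp [constructVector]), st2]
  have szf : σ₃.reg (.size false) = σ₂.reg (.size false) := f3 _ (by simp [constructVector])
  have szt : σ₂.reg (.size true) = σ.reg (.size true) := f2 _ (by simp [constructVector]) (by simp)
  have vf : σ₃.arr (.vec false) = σ₂.arr (.vec false) := g3 _ (by simp [constructVector])
  have vt : σ₂.arr (.vec true) = σ.arr (.vec true) := g2 _ (by simp [constructVector])
  rw [szt] at b1
  rw [vt] at b1
  have hle : ∀ b, σ.reg (.size b) ≤ σ₃.reg (.size b) := by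
    rintro (_ | _)
    · rw [szf]; exact a1.le
    · exact b1.le
  have hfalse : ∀ i, Used N L S p ps false i → σ₃.arr .index (p false i) = σ₂.arr .index (p false i) ∧
      σ₃.arr .flag (p false i) = σ₂.arr .flag (p false i) ∧
      σ₃.arr .min (p false i) = σ₂.arr .min (p false i) ∧
      σ₃.arr .max (p false i) = σ₂.arr .max (p false i) := by
    intro i hi
    obtain ⟨h1, h2⟩ := b1.old (p false i) fun j _ hj => hdis i j hi hj
    obtain ⟨h3, h4⟩ := b2.old (p false i) fun j _ hj => hdis i j hi hj
    exact ⟨h1, h2, h3, h4⟩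
  have hU : ∀ b i, Used N L S p ps b i → σ.reg (.size b) < σ₃.arr .index (p b i) ∧
      σ₃.arr .index (p b i) ≤ σ₃.reg (.size b) ∧
      σ₃.arr (.vec b) (σ₃.arr .index (p b i)) = p b i ∧ σ₃.arr .flag (p b i) = label b := by
    rintro (_ | _) i hi
    · rw [(hfalse i hi).1, (hfalse i hi).2.1, vf, szf]
      exact a1.used i (hpos _ _ hi).2 hi
    · exact b1.used i (hpos _ _ hi).2 hi
  have hV : ∀ b k, σ.reg (.size b) < k → k ≤ σ₃.reg (.size b) → ∃ i, Used N L S p ps b i ∧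
      σ₃.arr (.vec b) k = p b i ∧ σ₃.arr .index (p b i) = k := by
    rintro (_ | _) k h1 h2
    · rw [szf] at h2
      obtain ⟨i, _, hi, h3, h4⟩ := a1.vec_used k h1 h2
      exact ⟨i, hi, by rw [vf, h3], by rw [(hfalse i hi).1, h4]⟩
    · obtain ⟨i, _, hi, h3, h4⟩ := b1.vec_used k h1 h2
      exact ⟨i, hi, h3, h4⟩
  have hmono : ∀ b i j, i < j → Used N L S p ps b i → Used N L S p ps b j →
      σ₃.arr .index (p b i) < σ₃.arr .index (p b j) := by
    rintro (_ | _) i j hij hi hj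
    · rw [(hfalse i hi).1, (hfalse j hj).1]
      exact a1.mono i j hij (hpos _ _ hj).2 hi hj
    · exact b1.mono i j hij (hpos _ _ hj).2 hi hj
  have hvold : ∀ b k, k ≤ σ.reg (.size b) → σ₃.arr (.vec b) k = σ.arr (.vec b) k := by
    rintro (_ | _) k hk
    · rw [vf]; exact a1.vec_old k hk
    · exact b1.vec_old k hk
  have hold : ∀ y, (∀ b i, Used N L S p ps b i → y ≠ p b i) → σ₃.arr .index y = σ.arr .index y ∧
      σ₃.arr .flag y = σ.arr .flag y ∧ σ₃.arr .min y = σ.arr .min y ∧ σ₃.arr .max y = σ.arr .max y := by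
    intro y hy
    obtain ⟨h1, h2⟩ := b1.old y fun i _ => hy true i
    obtain ⟨h3, h4⟩ := b2.old y fun i _ => hy true i
    obtain ⟨h5, h6⟩ := a1.old y fun i _ => hy false i
    obtain ⟨h7, h8⟩ := a2.old y fun i _ => hy false i
    exact ⟨h1.trans h5, h2.trans h6, h3.trans h7, h4.trans h8⟩
  have hR : ∀ b i, Used N L S p ps b i → Match N L S p ps b i (σ₃.arr .min (p b i)) ∧
      Match N L S p ps b i (σ₃.arr .max (p b i)) ∧
      ∀ j, Match N L S p ps b i j → σ₃.arr .min (p b i) ≤ j ∧ j ≤ σ₃.arr .max (p b i) := by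
    rintro (_ | _) i hi
    · rw [(hfalse i hi).2.2.1, (hfalse i hi).2.2.2]
      exact a2.used i (hpos _ _ hi).2 hi
    · exact b2.used i (hpos _ _ hi).2 hi
  have hpath₃ : ∀ b i, 1 ≤ i → i ≤ L b → σ₃.arr (.path b) i = p b i := by
    intro b i h1 h2
    rw [g3 _ (by simp [constructVector]), g2 _ (by simp [constructVector])]
    exact H.path b i h1 h2
  -- The appended indices are images of path positions, so there are at most `L b` of them.
  have hsz : ∀ b, σ₃.reg (.size b) ≤ σ.reg (.size b) + L b := by
    intro b
    by_contra hlt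
    have hmem : ∀ k ∈ Finset.Ioc (σ.reg (.size b)) (σ₃.reg (.size b)), ∃ i, i ∈ Finset.range (L b) ∧
        σ₃.arr .index (p b i) = k := by
      intro k hk
      rw [Finset.mem_Ioc] at hk
      obtain ⟨i, hi, _, h3⟩ := hV b k hk.1 hk.2
      exact ⟨i, Finset.mem_range.2 (hpos b i hi).2, h3⟩
    have hsub : Finset.Ioc (σ.reg (.size b)) (σ₃.reg (.size b)) ⊆
        (Finset.range (L b)).image fun i => σ₃.arr .index (p b i) := fun k hk => by
      obtain ⟨i, h1, h2⟩ := hmem k hk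
      exact Finset.mem_image.2 ⟨i, h1, h2⟩
    have := (Finset.card_le_card hsub).trans Finset.card_image_le
    simp at this
    omega
  have hidx : ∀ b k, σ.reg (.size b) < k → k ≤ σ₃.reg (.size b) →
      σ₃.arr .index (σ₃.arr (.vec b) k) = k := by
    intro b k h1 h2
    obtain ⟨i, _, h3, h4⟩ := hV b k h1 h2
    rw [h3, h4]
  clear a1 a2 b1 b2 hfalse
  rw [wp_seq]
  refine (wp_convertMinMax (b := false) (σ := σ₃) (by rw [st3]; exact hle false)
    (by rw [st3]; exact hidx false)).mono_frame ?_
  rintro σ₄ τ₄ hF₄ ⟨c1, c2, c3⟩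
  have f4 : ∀ y, y ≠ .x → y ≠ .i → σ₄.reg y = σ₃.reg y := fun y h1 h2 =>
    hF₄.1 y (by simp [convertMinMax, h1, h2])
  have g4 : ∀ a, a ≠ .min → a ≠ .max → σ₄.arr a = σ₃.arr a := fun a h1 h2 =>
    hF₄.2 a (by simp [convertMinMax, h1, h2])
  clear hF₄
  refine (wp_convertMinMax (b := true) (σ := σ₄)
    (by rw [f4 _ (by simp) (by simp), f4 _ (by simp) (by simp), st3]; exact hle true)
    (by rw [f4 _ (by simp) (by simp), f4 _ (by simp) (by simp), st3, g4 _ (by simp) (by simp),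
          g4 _ (by simp) (by simp)]
        exact hidx true)).mono_frame ?_
  rintro σ₅ τ₅ hF₅ ⟨d1, d2, d3⟩
  have f5 : ∀ y, y ≠ .x → y ≠ .i → σ₅.reg y = σ₃.reg y := fun y h1 h2 => by
    rw [hF₅.1 y (by simp [convertMinMax, h1, h2]), f4 y h1 h2]
  have g5 : ∀ a, a ≠ .min → a ≠ .max → σ₅.arr a = σ₃.arr a := fun a h1 h2 => by
    rw [hF₅.2 a (by simp [convertMinMax, h1, h2]), g4 a h1 h2]
  clear hF₅
  simp only [st3, f4 _ (show Reg.start _ ≠ Reg.x by simp) (show Reg.start _ ≠ Reg.i by simp),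
    f4 _ (show Reg.size _ ≠ Reg.x by simp) (show Reg.size _ ≠ Reg.i by simp),
    g4 _ (show Arr.vec _ ≠ Arr.min by simp) (show Arr.vec _ ≠ Arr.max by simp),
    g4 _ (show Arr.path _ ≠ Arr.min by simp) (show Arr.path _ ≠ Arr.max by simp),
    g4 _ (show Arr.index ≠ Arr.min by simp) (show Arr.index ≠ Arr.max by simp)] at c1 c2 c3 d1 d2 d3
  have hnot : ∀ y b, (∀ i, Used N L S p ps b i → y ≠ p b i) → ∀ k, σ.reg (.size b) < k →
      k ≤ σ₃.reg (.size b) → y ≠ σ₃.arr (.vec b) k := by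
    intro y b hy k h1 h2
    obtain ⟨i, hi, h3, _⟩ := hV b k h1 h2
    rw [h3]; exact hy i hi
  -- The two conversions concern disjoint sets of vertices and change neither `vec` nor `index`, so
  -- they do not interfere.
  have hfin : ∀ b i, Used N L S p ps b i →
      σ₅.arr .min (p b i) = σ₃.arr .index (p (!b) (σ₃.arr .min (p b i))) ∧
      σ₅.arr .max (p b i) = σ₃.arr .index (p (!b) (σ₃.arr .max (p b i))) := by
    intro b i hi
    obtain ⟨h1, h2, h3, h4⟩ := hU b i hi
    obtain ⟨m1, m2, _⟩ := hR b i hi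
    have m1 := m1.2.1
    have m2 := m2.2.1
    rcases b with _ | _
    · obtain ⟨k1, k2⟩ := d2 (p false i) (hnot _ true fun j hj => hdis i j hi hj)
      have := c1 _ h1 h2
      rw [h3, hpath₃ _ _ (by omega) (by omega), hpath₃ _ _ (by omega) (by omega)] at this
      rw [k1, k2]; exact this
    · have k := d1 _ h1 h2
      obtain ⟨k1, k2⟩ := c2 (p true i) (hnot _ false fun j hj => (hdis j i hj hi).symm)
      rw [h3, k1, k2, hpath₃ _ _ (by omega) (by omega), hpath₃ _ _ (by omega) (by omega)] at k
      exact k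
  have hfold : ∀ y, (∀ b i, Used N L S p ps b i → y ≠ p b i) →
      σ₅.arr .min y = σ.arr .min y ∧ σ₅.arr .max y = σ.arr .max y := by
    intro y hy
    obtain ⟨k1, k2⟩ := d2 y (hnot _ true (hy true))
    obtain ⟨k3, k4⟩ := c2 y (hnot _ false (hy false))
    obtain ⟨_, _, k5, k6⟩ := hold y hy
    rw [k1, k2, k3, k4, k5, k6]; exact ⟨rfl, rfl⟩
  have ei : σ₅.arr .index = σ₃.arr .index := g5 _ (by simp) (by simp)
  have ef : σ₅.arr .flag = σ₃.arr .flag := g5 _ (by simp) (by simp)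
  have ev : ∀ b, σ₅.arr (.vec b) = σ₃.arr (.vec b) := fun b => g5 _ (by simp) (by simp)
  have es : ∀ b, σ₅.reg (.size b) = σ₃.reg (.size b) := fun b => f5 _ (by simp) (by simp)
  refine ⟨?_, fun y hy => ?_, fun b k hk => ?_, ?_⟩
  · refine hlay.stageTables ?_ ?_ ?_ ?_ ?_ ?_
    · simpa [tables, es] using hle
    · simpa only [tables, es, ei, ef, ev] using hU
    · simpa only [tables, es, ei, ef, ev] using hV
    · simpa only [tables, es, ei, ef, ev] using hmono
    · intro y hy hno
      simp only [tables, ef]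
      rw [(hold y hno).2.1]; exact hflag y hy
    · intro b i hi
      obtain ⟨m1, m2, m3⟩ := hR b i hi
      obtain ⟨k1, k2⟩ := hfin b i hi
      simp only [tables, ei]
      exact ⟨_, _, m1, m2, m3, k1, k2⟩
  · have hno : ∀ b i, Used N L S p ps b i → y ≠ p b i := by
      rintro b i hi rfl; exact hy (hmid b i hi)
    simp only [tables, ei, ef]
    exact ⟨(hold y hno).2.1, (hold y hno).1, hfold y hno⟩
  · simp only [tables, ev]; exact hvold b k hk
  · have := hsz false
    have := hsz true
    omega

end DominatorAlg

/-! ### One stage of the algorithm. -/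

namespace DominatorAlg

open RAM

variable {N : Net} {s t : ℕ}

/-- The flow along the stored path behind position `i₀`. -/
structure TrunkFlow (N : Net) (P : ℕ → ℕ) (M i₀ : ℕ) (fl nx pv : ℕ → ℕ) : Prop where
  flow : ∀ i, i₀ < i → i < M → fl (P i) = 1
  nxt : ∀ i, i₀ ≤ i → i < M → nx (P i) = P (i + 1)
  prv : ∀ i, i₀ ≤ i → i + 1 < M → pv (P (i + 1)) = P i
  only : ∀ z, N.Reach (P i₀) z → fl z = 1 → ∃ i, i₀ ≤ i ∧ i < M ∧ z = P i

section
variable {P : ℕ → ℕ} {M i₀ j₀ : ℕ} {fl nx pv fl' nx' pv' : ℕ → ℕ}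

/-- The segment of the stored path between two single-vertex dominators is a flow. -/
theorem TrunkFlow.flowInv (h : TrunkFlow N P M i₀ fl nx pv) (hP : PathOn N N.u N.root P M)
    (hS : IsStage N (P i₀) (P j₀)) (h1 : 1 ≤ i₀) (hij : i₀ < j₀) (hj : j₀ ≤ M) :
    FlowInv N (P i₀) (P j₀) {P (i₀ + 1)} (P j₀) (update fl (P i₀) 0) nx pv := by
  have hmid : ∀ i, i₀ < i → i < j₀ → Mid N (P i₀) (P j₀) (P i) := fun i k1 k2 =>
    mid_iff.2 ⟨hP.reach h1 k1.le (by omega), hP.reach (by omega) k2.le hj,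
      (hP.ne h1 k1 (by omega)).symm, hP.ne (by omega) k2 hj⟩
  have hof : ∀ z, update fl (P i₀) 0 z = 1 → N.Av {P j₀} (P i₀) z →
      ∃ i, i₀ < i ∧ i < j₀ ∧ z = P i := by
    intro z hz hav
    have hne : z ≠ P i₀ := by rintro rfl; simp at hz
    rw [update_of_ne hne] at hz
    obtain ⟨i, k1, k2, rfl⟩ := h.only z hav.reach hz
    refine ⟨i, ?_, ?_, rfl⟩
    · rcases eq_or_lt_of_le k1 with rfl | k1
      · exact absurd rfl hne
      · exact k1
    · by_contra hlt
      have hr := hS.reach_t hav (by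
        have := hP.to_t (by omega : 1 ≤ i) (by omega); exact this)
      have h3 := hP.reach (by omega) (not_lt.1 hlt) (by omega)
      exact hav.right (hr.antisymm h3)
  have hfl : ∀ i, i₀ < i → i < j₀ → update fl (P i₀) 0 (P i) = 1 := by
    intro i k1 k2
    rw [update_of_ne (hP.ne h1 k1 (by omega)).symm]
    exact h.flow i k1 (by omega)
  refine ⟨fun z hz hm => ?_, fun z hz hm hne => ?_, ?_, fun z hav hz => ?_⟩
  · obtain ⟨i, k1, k2, rfl⟩ := hof z hz hm.1
    rw [h.nxt i k1.le (by omega)]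
    refine ⟨hP.edge i (by omega) (by omega), ?_⟩
    by_cases hi : i + 1 = j₀
    · exact .inl (by rw [hi])
    · exact .inr ⟨hfl _ (by omega) (by omega), hmid _ (by omega) (by omega),
        hP.ne (by omega) (by omega) hj, h.prv i k1.le (by omega)⟩
  · obtain ⟨i, k1, k2, rfl⟩ := hof z hz hm.1
    obtain ⟨i, rfl⟩ : ∃ i', i = i' + 1 := ⟨i - 1, by omega⟩
    rw [h.prv i (by omega) (by omega)]
    by_cases hi : i = i₀
    · subst hi; exact .inl ⟨rfl, rfl⟩
    · exact .inr ⟨hfl _ (by omega) (by omega), hmid _ (by omega) (by omega),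
        h.nxt i (by omega) (by omega)⟩
  · rintro z rfl
    refine ⟨hP.edge i₀ h1 (by omega), ?_⟩
    by_cases hi : i₀ + 1 = j₀
    · exact .inl (by rw [hi])
    · exact .inr ⟨hfl _ (by omega) (by omega), hmid _ (by omega) (by omega),
        hP.ne (by omega) (by omega) hj, h.prv i₀ le_rfl (by omega)⟩
  · obtain ⟨i, k1, k2, rfl⟩ := hof z hz hav
    exact hmid i k1 k2

/-- An augmentation changes the fields strictly between its source and sink, and besides only `nxt`
of the source and `prv` of the sink. Behind `P j₀` the stored path therefore keeps the flow of the
first augmentation, which later stages start from. -/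
theorem TrunkFlow.step (h : TrunkFlow N P M i₀ fl nx pv) (hP : PathOn N N.u N.root P M)
    (h1 : 1 ≤ i₀) (hij : i₀ < j₀) (hj : j₀ ≤ M)
    (hfr : ∀ z, ¬ Mid N (P i₀) (P j₀) z → fl' z = update fl (P i₀) 0 z ∧ (z ≠ P i₀ → nx' z = nx z) ∧
      (z ≠ P j₀ → pv' z = pv z)) : TrunkFlow N P M j₀ fl' nx' pv' := by
  have hnm : ∀ z, N.Reach (P j₀) z → ¬ Mid N (P i₀) (P j₀) z ∧ z ≠ P i₀ := by
    intro z hz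
    refine ⟨fun hm => hm.ne_right (hm.2.2.antisymm hz), ?_⟩
    rintro rfl
    exact hP.ne h1 hij hj ((hP.reach h1 hij.le hj).antisymm hz)
  have hnp : ∀ i, j₀ ≤ i → i ≤ M → ¬ Mid N (P i₀) (P j₀) (P i) ∧ P i ≠ P i₀ := fun i k1 k2 =>
    hnm _ (hP.reach (by omega) k1 k2)
  refine ⟨fun i k1 k2 => ?_, fun i k1 k2 => ?_, fun i k1 k2 => ?_, fun z hr hz => ?_⟩
  · obtain ⟨q1, q2⟩ := hnp i k1.le k2.le
    rw [(hfr _ q1).1, update_of_ne q2]; exact h.flow i (by omega) k2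
  · obtain ⟨q1, q2⟩ := hnp i k1 k2.le
    rw [(hfr _ q1).2.1 q2]; exact h.nxt i (by omega) k2
  · obtain ⟨q1, q2⟩ := hnp (i + 1) (by omega) k2.le
    rw [(hfr _ q1).2.2 (hP.ne (by omega) (by omega) k2.le).symm]
    exact h.prv i (by omega) k2
  · obtain ⟨q1, q2⟩ := hnm z hr
    rw [(hfr _ q1).1, update_of_ne q2] at hz
    obtain ⟨i, k1, k2, rfl⟩ := h.only z ((hP.reach h1 hij.le hj).trans hr) hz
    exact ⟨i, hP.le_of_reach (by omega) hj (by omega) k2.le hr, k2, rfl⟩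

end

/-- The vertices from `s` on have not been touched by earlier stages. -/
structure Fresh (N : Net) (s : ℕ) (σ : State Reg Arr) : Prop where
  visIn : ∀ k, k ≠ 0 → ∀ y ∈ N.Live s, σ.arr (.visIn k) y = 0
  visOut : ∀ k, k ≠ 0 → ∀ y ∈ N.Live s, σ.arr (.visOut k) y = 0
  marked : ∀ b, ∀ y ∈ N.Live s, y ≠ s → σ.arr (.marked b) y = 0
  side : ∀ y, σ.arr .side y ≠ 0 → ¬ N.Reach s y

theorem IsStage.not_av_of_live (hS : IsStage N s t) {y : ℕ} (hy : y ∈ N.Live t) :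
    ¬ N.Av {t} s y := fun h =>
  h.right ((hS.reach_t h hy.2).antisymm hy.1)

/-- Whatever the stage marks is `t` or is reached from `s` without passing `t`. Such a vertex is not
live at `t`: it would both reach `t` and be reached from `t`. A mark on `t` itself is harmless, as
the source of the next stage is exempt. -/
theorem Fresh.step {σ σ' : State Reg Arr} (h : Fresh N s σ) (hS : IsStage N s t)
    (hI : ∀ k, k ≠ 0 → ∀ y, New (σ.arr (.visIn k)) (σ'.arr (.visIn k)) y → N.Av {t} s y)
    (hO : ∀ k, k ≠ 0 → ∀ y, New (σ.arr (.visOut k)) (σ'.arr (.visOut k)) y → N.Av {t} s y)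
    (hm : ∀ b y, New (σ.arr (.marked b)) (σ'.arr (.marked b)) y → y = t ∨ N.Av {t} s y)
    (hs : ∀ y, σ'.arr .side y ≠ 0 → σ.arr .side y ≠ 0 ∨ Mid N s t y) : Fresh N t σ' := by
  refine ⟨fun k hk y hy => ?_, fun k hk y hy => ?_, fun b y hy hne => ?_, fun y hy hr => ?_⟩
  · by_contra h0
    exact hS.not_av_of_live hy (hI k hk y ⟨h.visIn k hk y (hS.live_mono hy), h0⟩)
  · by_contra h0
    exact hS.not_av_of_live hy (hO k hk y ⟨h.visOut k hk y (hS.live_mono hy), h0⟩)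
  · by_contra h0
    have hys : y ≠ s := by rintro rfl; exact hS.not_live hy
    rcases hm b y ⟨h.marked b y (hS.live_mono hy) hys, h0⟩ with k | k
    · exact hne k
    · exact hS.not_av_of_live hy k
  · rcases hs y hy with k | k
    · exact h.side y k (hS.st.trans hr)
    · exact k.ne_right (k.2.2.antisymm hr)

/-- The work that remains for the searches of the stages. -/
noncomputable def searchWork (N : Net) (σ : State Reg Arr) : ℕ :=
  400 * (N.work (σ.arr (.visOut 1)) + N.work (σ.arr (.visOut 2))) +
    100 * (N.work (σ.arr (.marked false)) + N.work (σ.arr (.marked true)))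

theorem wp_seq_right {c d d' : Prog} (hd : ∀ σ Q, WP d σ Q → WP d' σ Q) {σ : State Reg Arr}
    {Q : State Reg Arr → ℕ → Prop} (h : WP (c ;; d) σ Q) : WP (c ;; d') σ Q := by
  rw [wp_seq] at h ⊢
  exact h.mono fun _ _ h => hd _ _ h

theorem wp_handlePaths {σ : State Reg Arr} {Q : State Reg Arr → ℕ → Prop}
    (h : WP (analyzePaths ;; appendVectors) σ Q) :
    WP (Reg.x ::= Reg.f ;;
        storePath false ;;
        Reg.x ::= .read .nxt Reg.s ;;
        storePath true ;;
        assignMinMax false ;;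
        assignMinMax true ;;
        appendVectors) σ Q := by
  unfold analyzePaths at h
  rw [wp_seq_assoc] at h
  refine wp_seq_right (fun σ Q h => ?_) h
  rw [wp_seq_assoc] at h
  refine wp_seq_right (fun σ Q h => ?_) h
  rw [wp_seq_assoc] at h
  refine wp_seq_right (fun σ Q h => ?_) h
  rw [wp_seq_assoc] at h
  refine wp_seq_right (fun σ Q h => ?_) h
  rwa [wp_seq_assoc] at h

/-- The cost is paid by the drop of two potentials: `searchWork` for the searches, and `liveWork`
for everything proportional to the lengths of the two paths. -/
theorem wp_stage {P : ℕ → ℕ} {M i₀ j₀ : ℕ} {σ : State Reg Arr} (hσ : N.Holds σ)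
    (hP : PathOn N N.u N.root P M) (hS : IsStage N (P i₀) (P j₀)) (h1 : 1 ≤ i₀) (hij : i₀ < j₀)
    (hj : j₀ ≤ M) (hs : σ.reg .s = P i₀) (ht : σ.reg .t = P j₀) (hf : σ.reg .f = P (i₀ + 1))
    (hfresh : Fresh N (P i₀) σ) (htr : TrunkFlow N P M i₀ (σ.arr .flow) (σ.arr .nxt) (σ.arr .prv))
    (hch : Chain N (P i₀) (tables σ)) :
    WP stage σ fun σ' τ => Fresh N (P j₀) σ' ∧
      TrunkFlow N P M j₀ (σ'.arr .flow) (σ'.arr .nxt) (σ'.arr .prv) ∧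
      Chain N (P j₀) (tables σ') ∧
      τ + searchWork N σ' + 4000 * liveWork N (P j₀) ≤ searchWork N σ + 4000 * liveWork N (P i₀) := by
  set s := P i₀ with hs'
  set t := P j₀ with ht'
  have hlive : ∀ z, Mid N s t z → z ∈ N.Live s := fun z hz => hz.live hS
  have hsl : s ∈ N.Live s := ⟨.refl _, hS.st.trans hS.tr⟩
  have htl : t ∈ N.Live s := ⟨hS.st, hS.tr⟩
  have hFI := htr.flowInv hP hS h1 hij hj
  rw [← hs', ← ht'] at hFI
  -- The segment of the stored path between the two dominators, renumbered from 1, shows that some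
  -- charge is released; this pays for the constant overhead of the stage.
  have hlw : liveWork N t + 1 ≤ liveWork N s := by
    have hp : PathOn N s t (fun k => P (i₀ - 1 + k)) (j₀ - i₀ + 1) := by
      refine ⟨?_, ?_, by omega, fun i k1 k2 => ?_⟩
      · simp only [hs']; congr 1; omega
      · simp only [ht']; congr 1; omega
      · have := hP.edge (i₀ - 1 + i) (by omega) (by omega)
        exact this
    have k1 := pathWork_add_liveWork hS hp
    have k2 := le_pathWork (N := N) (p := fun k => P (i₀ - 1 + k)) (i := j₀ - i₀ + 1)
    omega
  have hnos : ¬ Mid N s t s := fun h => h.2.1 rfl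
  unfold stage
  rw [wp_seq, wp_write, wp_seq]
  simp only [Expr.eval, Expr.cost, hs]
  refine (wp_augment (N := N) (k := 1) (F := {P (i₀ + 1)}) ⟨by simp [hσ.off], by simp [hσ.adj]⟩
    (by simpa [hs] using hS.us) (by simpa [hs, ht] using hS.ne)
    (by simpa [hs] using hfresh.visOut 1 (by simp) s hsl)
    (by simpa [hs, ht] using hFI)).mono_frame ?_
  rintro σ₁ τ₁ hF₁ ⟨a1, a2, a3, a4⟩
  have f1 : ∀ r, ¬ (augment 1).SetsReg r → σ₁.reg r = σ.reg r := fun r h => by rw [hF₁.1 r h]; simp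
  have g1 : ∀ a, ¬ (augment 1).SetsArr a → a ≠ .flow → σ₁.arr a = σ.arr a := fun a h1 h2 => by
    rw [hF₁.2 a h1]; simp [h2]
  clear hF₁
  simp only [State.reg_setArr, State.arr_setArr, reduceCtorEq, if_false, if_true, hs, ht] at a1 a2 a3 a4
  rcases a4 with ⟨b1, b2, b3, b4, m, b5⟩ | ⟨b1, b2⟩
  -- A failed second search would produce a single vertex that separates consecutive dominators.
  · exact (b5.false_of_stage hS (by simp) hFI (fun z hz => hfresh.visIn 1 (by simp) z (hlive z hz))
      (fun z hz => hfresh.visOut 1 (by simp) z (hlive z hz))).elim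
  have htab₁ : tables σ₁ = tables σ := by
    simp [tables, f1, g1, augment, residualSearch, visitOutCopy]
  have vi₁ : σ₁.arr (.visIn 2) = σ.arr (.visIn 2) :=
    g1 _ (by simp [augment, residualSearch, visitOutCopy]) (by simp)
  have vo₁ : σ₁.arr (.visOut 2) = σ.arr (.visOut 2) :=
    g1 _ (by simp [augment, residualSearch, visitOutCopy]) (by simp)
  have mk₁ : ∀ b, σ₁.arr (.marked b) = σ.arr (.marked b) := fun b =>
    g1 _ (by simp [augment, residualSearch, visitOutCopy]) (by simp)
  have sd₁ : σ₁.arr .side = σ.arr .side :=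
    g1 _ (by simp [augment, residualSearch, visitOutCopy]) (by simp)
  have rs₁ : σ₁.reg .s = s := by rw [f1 _ (by simp [augment, residualSearch, visitOutCopy]), hs]
  have rt₁ : σ₁.reg .t = t := by rw [f1 _ (by simp [augment, residualSearch, visitOutCopy]), ht]
  have rf₁ : σ₁.reg .f = P (i₀ + 1) := by rw [f1 _ (by simp [augment, residualSearch, visitOutCopy]), hf]
  have of₁ : σ₁.arr .off = N.off := by
    rw [g1 _ (by simp [augment, residualSearch, visitOutCopy]) (by simp), hσ.off]
  have ad₁ : σ₁.arr .adj = N.adj := by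
    rw [g1 _ (by simp [augment, residualSearch, visitOutCopy]) (by simp), hσ.adj]
  clear f1 g1
  have hfs₁ : σ₁.arr .flow s ≠ 1 := by rw [(b2.frame s hnos).1]; simp
  have htr₁ : TrunkFlow N P M j₀ (σ₁.arr .flow) (σ₁.arr .nxt) (σ₁.arr .prv) :=
    htr.step hP h1 hij hj b2.frame
  have hfl₁ := b2.flow
  set g := σ₁.arr .nxt s with hg
  rw [wp_when]
  refine ⟨fun _ => ?_, fun hb => absurd (by simpa using b1) hb⟩
  rw [wp_seq]
  refine (wp_residualSearch (N := N) (k := 2) ⟨of₁, ad₁⟩ (by rw [rs₁]; exact hS.us)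
    (by rw [rs₁, rt₁]; exact hS.ne) (by rw [rs₁, vo₁]; exact hfresh.visOut 2 (by simp) s hsl)
    (by rw [rs₁, rt₁]; exact fun y => hfl₁.av_prv hS.ne)).mono_frame ?_
  rintro σ₂ τ₂ hF₂ ⟨m, c1, c2⟩
  have f2 : ∀ r, ¬ (residualSearch 2).SetsReg r → σ₂.reg r = σ₁.reg r := hF₂.1
  have g2 : ∀ a, ¬ (residualSearch 2).SetsArr a → σ₂.arr a = σ₁.arr a := hF₂.2
  clear hF₂
  rw [rs₁, rt₁] at c1
  have htab₂ : tables σ₂ = tables σ := by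
    rw [← htab₁]
    simp [tables, f2, g2, augment, residualSearch, visitOutCopy]
  have vi₂ : σ₂.arr (.visIn 1) = σ₁.arr (.visIn 1) := g2 _ (by simp [residualSearch, visitOutCopy])
  have vo₂ : σ₂.arr (.visOut 1) = σ₁.arr (.visOut 1) := g2 _ (by simp [residualSearch, visitOutCopy])
  have mk₂ : ∀ b, σ₂.arr (.marked b) = σ.arr (.marked b) := fun b => by
    rw [g2 _ (by simp [residualSearch, visitOutCopy]), mk₁]
  have sd₂ : σ₂.arr .side = σ.arr .side := by rw [g2 _ (by simp [residualSearch, visitOutCopy]), sd₁]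
  have fl₂ : σ₂.arr .flow = σ₁.arr .flow := g2 _ (by simp [residualSearch, visitOutCopy])
  have nx₂ : σ₂.arr .nxt = σ₁.arr .nxt := g2 _ (by simp [residualSearch, visitOutCopy])
  have pv₂ : σ₂.arr .prv = σ₁.arr .prv := g2 _ (by simp [residualSearch, visitOutCopy])
  have rs₂ : σ₂.reg .s = s := by rw [f2 _ (by simp [residualSearch, visitOutCopy]), rs₁]
  have rt₂ : σ₂.reg .t = t := by rw [f2 _ (by simp [residualSearch, visitOutCopy]), rt₁]
  have rf₂ : σ₂.reg .f = P (i₀ + 1) := by rw [f2 _ (by simp [residualSearch, visitOutCopy]), rf₁]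
  have of₂ : σ₂.arr .off = N.off := by rw [g2 _ (by simp [residualSearch, visitOutCopy]), of₁]
  have ad₂ : σ₂.arr .adj = N.adj := by rw [g2 _ (by simp [residualSearch, visitOutCopy]), ad₁]
  clear f2 g2
  have hvI : ∀ k : Fin 3, k ≠ 0 → ∀ y, New (σ.arr (.visIn k)) (σ₂.arr (.visIn k)) y →
      N.Av {t} s y := by
    intro k hk y hy
    obtain rfl | rfl : k = 1 ∨ k = 2 := by fin_cases k <;> simp_all
    · rw [vi₂] at hy; exact a1 y hy
    · rw [← vi₁] at hy
      obtain ⟨rI, rO, hT⟩ := c1.tree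
      exact hT.avI y hy
  have hvO : ∀ k : Fin 3, k ≠ 0 → ∀ y, New (σ.arr (.visOut k)) (σ₂.arr (.visOut k)) y →
      N.Av {t} s y := by
    intro k hk y hy
    obtain rfl | rfl : k = 1 ∨ k = 2 := by fin_cases k <;> simp_all
    · rw [vo₂] at hy; exact a2 y hy
    · rw [← vo₁] at hy
      obtain ⟨rI, rO, hT⟩ := c1.tree
      exact hT.avO y hy
  have hfg : P (i₀ + 1) ≠ g ∨ g = t := by
    by_cases h : P (i₀ + 1) = g
    · exact .inr (b2.new (Set.mem_singleton_iff.2 h.symm))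
    · exact .inl h
  rw [vo₁] at c2
  rw [wp_when]
  constructor
  · intro hb
    have hf0 : σ₂.reg .found = 0 := by simpa using hb
    -- As `flow s ≠ 1`, an edge from `s` to `t` is never regarded as saturated and would have made
    -- the third search succeed.
    have hE : ¬ N.E s t := by
      intro hE
      obtain ⟨rI, rO, hT⟩ := c1.tree
      exact hfs₁ (((c1.closedO hf0 s hT.source).2 t hE).1 rfl).1
    have hne : P (i₀ + 1) ≠ g := by
      rcases hfg with h | h
      · exact h
      · intro _
        have := (hfl₁.first g (by simp)).1
        rw [h] at this
        exact absurd this hE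
    obtain ⟨p, L, hTP, hFP⟩ := hfl₁.twoPaths hne
    refine wp_handlePaths ?_
    rw [wp_seq]
    refine (wp_analyzePaths (N := N) (σ := σ₂) (fl := σ₁.arr .flow) (pv := σ₁.arr .prv)
      (g := fun b => if b then g else P (i₀ + 1)) ⟨of₂, ad₂⟩ hS.us hTP (by rw [nx₂]; exact hFP) hE rs₂
      rt₂ (by simp [rf₂]) (by simp [nx₂, hg]) (by rw [sd₂]; exact hfresh.side)
      (fun b z hz => by
        rw [mk₂]
        rcases hz with hz | rfl
        · exact hfresh.marked b z (hlive z hz) hz.2.1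
        · exact hfresh.marked b _ htl hS.ne.symm)).mono_frame ?_
    rintro σ₃ τ₃ hF₃ ⟨⟨S, ps, d1⟩, d2, d3, d4⟩
    have f3 : ∀ r, ¬ analyzePaths.SetsReg r → σ₃.reg r = σ₂.reg r := hF₃.1
    have g3 : ∀ a, ¬ analyzePaths.SetsArr a → σ₃.arr a = σ₂.arr a := hF₃.2
    clear hF₃
    have htab₃ : tables σ₃ = tables σ := by
      rw [← htab₂]
      simp [tables, f3, g3, analyzePaths, assignMinMax, findReachable, storePath]
    have hT : ∀ (k : Fin 3), σ₃.arr (.visIn k) = σ₂.arr (.visIn k) ∧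
        σ₃.arr (.visOut k) = σ₂.arr (.visOut k) := fun k =>
      ⟨g3 _ (by simp [analyzePaths, assignMinMax, findReachable, storePath]),
        g3 _ (by simp [analyzePaths, assignMinMax, findReachable, storePath])⟩
    have fl₃ : σ₃.arr .flow = σ₁.arr .flow := by
      rw [g3 _ (by simp [analyzePaths, assignMinMax, findReachable, storePath]), fl₂]
    have nx₃ : σ₃.arr .nxt = σ₁.arr .nxt := by
      rw [g3 _ (by simp [analyzePaths, assignMinMax, findReachable, storePath]), nx₂]
    have pv₃ : σ₃.arr .prv = σ₁.arr .prv := by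
      rw [g3 _ (by simp [analyzePaths, assignMinMax, findReachable, storePath]), pv₂]
    clear f3 g3
    have hflag0 : ∀ y, Mid N s t y → σ₃.arr .flag y = 0 := by
      intro y hy
      by_contra h0
      refine hch.not_reach (y := y) ?_ hy.1.reach
      rw [← htab₃]; exact h0
    refine (wp_appendVectors d1 hflag0).mono_frame ?_
    rintro σ₄ τ₄ hF₄ ⟨e1, e2, e3, e4⟩
    have g4 : ∀ a, ¬ appendVectors.SetsArr a → σ₄.arr a = σ₃.arr a := hF₄.2
    clear hF₄
    rw [htab₃] at e1 e2 e3
    have hT₄ : ∀ (k : Fin 3), σ₄.arr (.visIn k) = σ₂.arr (.visIn k) ∧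
        σ₄.arr (.visOut k) = σ₂.arr (.visOut k) := fun k =>
      ⟨by rw [g4 _ (by simp [appendVectors, constructVector, convertMinMax]), (hT k).1],
        by rw [g4 _ (by simp [appendVectors, constructVector, convertMinMax]), (hT k).2]⟩
    have mk₄ : ∀ b, σ₄.arr (.marked b) = σ₃.arr (.marked b) := fun b =>
      g4 _ (by simp [appendVectors, constructVector, convertMinMax])
    refine ⟨?_, ?_, hch.step hS e1 e2 e3, ?_⟩
    · refine hfresh.step hS (fun k hk y hy => ?_) (fun k hk y hy => ?_) (fun b y hy => ?_) fun y hy => ?_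
      · rw [(hT₄ k).1] at hy; exact hvI k hk y hy
      · rw [(hT₄ k).2] at hy; exact hvO k hk y hy
      · rw [mk₄, ← mk₂] at hy; exact d3 b y hy
      · rw [g4 _ (by simp [appendVectors, constructVector, convertMinMax])] at hy
        rw [← sd₂]; exact d2 y hy
    · rw [g4 _ (by simp [appendVectors, constructVector, convertMinMax]),
        g4 _ (by simp [appendVectors, constructVector, convertMinMax]),
        g4 _ (by simp [appendVectors, constructVector, convertMinMax]), fl₃, nx₃, pv₃]
      exact htr₁
    · simp only [searchWork, (hT₄ 1).2, (hT₄ 2).2, mk₄, vo₂, Test.cost, Expr.cost]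
      rw [mk₂, mk₂] at d4
      have k1 := pathWork_add_liveWork hS (hTP.path false)
      have k2 := pathWork_add_liveWork hS (hTP.path true)
      have k3 := le_pathWork (N := N) (p := p false) (i := L false)
      have k4 := le_pathWork (N := N) (p := p true) (i := L true)
      omega
  · intro hb
    have hf0 : σ₂.reg .found ≠ 0 := by simpa using hb
    -- A third augmenting path leaves no two-vertex cut, so the stage adds nothing to the tables.
    have hno : ∀ v w, Mid N s t v → ¬ Cut N s t v w := fun v w hv hc =>
      hc.2 (c1.av_of_found hS.ne hfl₁ hfg hf0 ⟨hv.2.1, hv.ne_right⟩ ⟨hc.1.2.1, hc.1.ne_right⟩)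
    refine ⟨hfresh.step hS hvI hvO (fun b y hy => ?_) fun y hy => .inl ?_, ?_, ?_, ?_⟩
    · rw [mk₂] at hy; exact absurd hy.1 hy.2
    · rw [sd₂] at hy; exact hy
    · rw [fl₂, nx₂, pv₂]; exact htr₁
    · rw [htab₂]; exact hch.skip hS hno
    · simp only [searchWork, mk₂, vo₂, Test.cost, Expr.cost]
      omega

end DominatorAlg

/-! ### Single-vertex dominators on the stored path. -/

namespace DominatorAlg

open RAM

variable {N : Net} {P : ℕ → ℕ} {M : ℕ} {S : Set ℕ} {f : ℕ → ℕ}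

/-- The positions on the path `P`, and the set `S` of its vertices without the first one. -/
structure TrunkLayout (N : Net) (P : ℕ → ℕ) (M : ℕ) (S : Set ℕ) (f : ℕ → ℕ) : Prop where
  path : PathOn N N.u N.root P M
  stop_iff : ∀ y, y ∈ S ↔ ∃ i, 1 < i ∧ i ≤ M ∧ y = P i
  pos : ∀ i, 1 < i → i ≤ M → f (P i) = i
  of_pos : ∀ y, f y ≠ 0 → ∃ i, 1 < i ∧ i ≤ M ∧ y = P i

/-- A jump from a vertex before position `i` passes over position `i`. -/
def Skipped (N : Net) (P : ℕ → ℕ) (S : Set ℕ) (f : ℕ → ℕ) (i : ℕ) : Prop :=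
  ∃ i', 1 ≤ i' ∧ i' < i ∧ ∃ y, N.Jump S (P i') y ∧ i < f y

theorem TrunkLayout.le (H : TrunkLayout N P M S f) (y : ℕ) : f y ≤ M := by
  by_cases h : f y = 0
  · omega
  · obtain ⟨i, h1, h2, rfl⟩ := H.of_pos y h
    rw [H.pos i h1 h2]; exact h2

/-- On a path that avoids `P i`, the stored vertex met last always has a position before `i`, since
getting behind `i` would take a jump over `i`. So the last position, which is the root, is not
reached. -/
theorem TrunkLayout.not_av (H : TrunkLayout N P M S f) {i : ℕ} (h1 : 1 ≤ i) (h2 : i ≤ M)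
    (hi : ¬ Skipped N P S f i) : ¬ N.Av {P i} N.u N.root := by
  intro h
  have hM := H.path.two_le
  have hiM : i ≠ M := by rintro rfl; exact h.right H.path.last.symm
  have hi1 : i ≠ 1 := by rintro rfl; exact h.left H.path.first.symm
  have := h.induction (P := fun x => ∃ i', 1 ≤ i' ∧ i' < i ∧
    Relation.ReflTransGen (fun a b => N.E a b ∧ b ∉ S) (P i') x) ⟨1, le_rfl, by omega, ?_⟩ ?_
  · obtain ⟨i', k1, k2, k3⟩ := this
    rcases Relation.ReflTransGen.cases_tail k3 with k3 | ⟨a, _, _, k3⟩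
    · exact H.path.ne k1 (by omega : i' < M) le_rfl (k3.symm.trans H.path.last.symm)
    · exact k3 ((H.stop_iff _).2 ⟨M, by omega, le_rfl, H.path.last.symm⟩)
  · rw [H.path.first]
  · rintro a b - ⟨i', k1, k2, k3⟩ hE hb
    by_cases hbS : b ∈ S
    · obtain ⟨k, k4, k5, rfl⟩ := (H.stop_iff b).1 hbS
      refine ⟨k, k4.le, ?_, .refl⟩
      by_contra hlt
      have hne : k ≠ i := by rintro rfl; exact hb rfl
      exact hi ⟨i', k1, k2, P k, ⟨a, k3, hE⟩, by rw [H.pos k k4 k5]; omega⟩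
    · exact ⟨i', k1, k2, k3.tail ⟨hE, hbS⟩⟩

/-- A vertex that is not an inner vertex of the stored segment is avoided by the segment itself; an
inner one is bypassed by the jump over it. -/
theorem TrunkLayout.isStage (H : TrunkLayout N P M S f) {i j : ℕ} (h1 : 1 ≤ i) (hij : i < j)
    (hj : j ≤ M) (hi : ¬ Skipped N P S f i) (hj' : ¬ Skipped N P S f j)
    (hk : ∀ k, i < k → k < j → Skipped N P S f k) : IsStage N (P i) (P j) := by
  have hP := H.path
  refine ⟨hP.from_s h1 (by omega), hP.ne h1 hij hj, hP.reach h1 hij.le hj, hP.to_t (by omega) hj,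
    H.not_av h1 (by omega) hi, H.not_av (by omega) hj hj', fun v hvs hvt => ?_⟩
  by_cases hv : ∃ k, i < k ∧ k < j ∧ v = P k
  -- The jump over position `k` starts at `i` or later and ends at `j` or earlier, because neither
  -- `i` nor `j` is skipped; so the bypass stays within the segment.
  · obtain ⟨k, k1, k2, rfl⟩ := hv
    obtain ⟨i', q1, q2, y, ⟨z, hz, hE⟩, q3⟩ := hk k k1 k2
    obtain ⟨k', r1, r2, rfl⟩ := H.of_pos y (by omega)
    rw [H.pos k' r1 r2] at q3
    have hii : i ≤ i' := by
      by_contra hlt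
      exact hi ⟨i', q1, by omega, P k', ⟨z, hz, hE⟩, by rw [H.pos k' r1 r2]; omega⟩
    have hkj : k' ≤ j := by
      by_contra hlt
      exact hj' ⟨i', q1, by omega, P k', ⟨z, hz, hE⟩, by rw [H.pos k' r1 r2]; omega⟩
    have hne : ∀ l, 1 ≤ l → l ≤ M → l ≠ k → P l ∉ ({P k} : Set ℕ) := fun l l1 l2 l3 l4 =>
      l3 (hP.inj l1 l2 (by omega) (by omega) l4)
    have a1 := hP.av (A := {P k}) h1 hii (by omega) fun l l1 l2 => hne l (by omega) (by omega) (by omega)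
    have a2 : N.Av {P k} (P i') z := ⟨hne i' q1 (by omega) (by omega),
      Relation.ReflTransGen.mono (fun _ _ g => ⟨g.1, fun l => g.2 (by
        rw [Set.mem_singleton_iff.1 l]; exact (H.stop_iff _).2 ⟨k, by omega, by omega, rfl⟩)⟩) _ _ hz⟩
    have a3 := hP.av (A := {P k}) (by omega) hkj hj fun l l1 l2 => hne l (by omega) (by omega) (by omega)
    exact (a1.trans a2).trans (Net.Av.head hE a2.right a3)
  · refine hP.av h1 hij.le hj fun k k1 k2 hkv => ?_
    have hkv : P k = v := hkv
    rcases eq_or_lt_of_le k1 with rfl | k1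
    · exact hvs hkv.symm
    rcases eq_or_lt_of_le k2 with rfl | k2
    · exact hvt hkv.symm
    exact hv ⟨k, k1, k2, hkv.symm⟩

/-- The positions before `i` that are not skipped have been listed. -/
structure Listed (R : ℕ → Prop) (i nd : ℕ) (dom : ℕ → ℕ) : Prop where
  mem : ∀ d, 1 ≤ d → d ≤ nd → R (dom d) ∧ 1 ≤ dom d ∧ dom d < i
  gap : ∀ d, 1 ≤ d → d < nd → dom d < dom (d + 1) ∧ ∀ k, dom d < k → k < dom (d + 1) → ¬ R k
  last : (nd = 0 ∧ i = 1) ∨ (1 ≤ nd ∧ ∀ k, dom nd < k → k < i → ¬ R k)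
  first : 1 ≤ nd → dom 1 = 1

theorem Listed.skip {R : ℕ → Prop} {i nd : ℕ} {dom : ℕ → ℕ} (h : Listed R i nd dom) (h1 : R 1)
    (hi : ¬ R i) : Listed R (i + 1) nd dom := by
  refine ⟨fun d d1 d2 => ?_, h.gap, ?_, h.first⟩
  · obtain ⟨k1, k2, k3⟩ := h.mem d d1 d2
    exact ⟨k1, k2, by omega⟩
  · rcases h.last with ⟨_, rfl⟩ | ⟨k1, k2⟩
    · exact absurd h1 hi
    · refine .inr ⟨k1, fun k k3 k4 => ?_⟩
      rcases Nat.lt_succ_iff_lt_or_eq.1 k4 with k4 | rfl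
      · exact k2 k k3 k4
      · exact hi

theorem Listed.push {R : ℕ → Prop} {i nd : ℕ} {dom : ℕ → ℕ} (h : Listed R i nd dom) (hi1 : 1 ≤ i)
    (hi : R i) : Listed R (i + 1) (nd + 1) (update dom (nd + 1) i) := by
  have hu : ∀ d, d ≤ nd → update dom (nd + 1) i d = dom d := fun d hd => update_of_ne (by omega) _ _
  refine ⟨fun d d1 d2 => ?_, fun d d1 d2 => ?_, .inr ⟨by omega, fun k => ?_⟩, fun _ => ?_⟩
  · by_cases hd : d = nd + 1
    · subst hd; rw [update_self]; exact ⟨hi, hi1, by omega⟩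
    · rw [hu d (by omega)]
      obtain ⟨k1, k2, k3⟩ := h.mem d d1 (by omega)
      exact ⟨k1, k2, by omega⟩
  · rw [hu d (by omega)]
    by_cases hd : d = nd
    · subst hd
      rw [update_self]
      rcases h.last with ⟨k1, _⟩ | ⟨_, k2⟩
      · omega
      · exact ⟨(h.mem d d1 le_rfl).2.2, k2⟩
    · rw [hu (d + 1) (by omega)]
      exact h.gap d d1 (by omega)
  · rw [update_self]; intro k1 k2; omega
  · by_cases hd : nd = 0
    · subst hd
      rcases h.last with ⟨_, rfl⟩ | ⟨k, _⟩
      · simp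
      · omega
    · rw [hu 1 (by omega)]; exact h.first (by omega)

theorem pathWork_le {p : ℕ → ℕ} {L s t : ℕ} (hs : N.Reach N.u s) (hp : PathOn N s t p L) :
    pathWork N p L ≤ N.work fun _ => 0 := by
  have hinj : Set.InjOn p (Finset.Ico 1 L) := by
    intro i hi j hj h
    simp only [Finset.coe_Ico, Set.mem_Ico] at hi hj
    exact hp.inj hi.1 hi.2.le hj.1 hj.2.le h
  unfold pathWork Net.work
  rw [← Finset.sum_image (f := fun v => N.deg v + 1) hinj]
  simp only [if_true]
  refine Finset.sum_le_sum_of_subset fun v hv => ?_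
  obtain ⟨k, hk, rfl⟩ := Finset.mem_image.1 hv
  rw [Finset.mem_Ico] at hk
  exact Net.mem_verts.2 (hs.trans (hp.from_s hk.1 hk.2.le))

/-- Before round `i`, `reached₁` is the furthest position to which earlier vertices jump, so
position `i` is listed exactly if no jump passes over it. -/
theorem wp_singleDominators {σ : State Reg Arr} (hσ : N.Holds σ) (H : TrunkLayout N P M S f)
    (ht : σ.reg .t = N.root) (hL : σ.reg (.len false) = M)
    (hp : ∀ i, 1 ≤ i → i ≤ M → σ.arr .trunk i = P i)
    (hS : S = {y | y = N.root ∨ ∃ c, σ.arr .trunkSide y = label c})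
    (hf : f = posOn N.root M (label false) (σ.arr .trunkSide) (σ.arr .trunkPos))
    (hside : ∀ y, σ.arr .trunkSide y ≠ label true) (hm : ∀ y, σ.arr .trunkMark y = 0) :
    WP singleDominators σ fun σ' τ => 
      (∃ nd, σ'.reg .nd = nd ∧ 2 ≤ nd ∧ σ'.arr .dom 1 = 1 ∧ σ'.arr .dom nd = M ∧
        ∀ d, 1 ≤ d → d < nd → 1 ≤ σ'.arr .dom d ∧ σ'.arr .dom d < σ'.arr .dom (d + 1) ∧
          σ'.arr .dom (d + 1) ≤ M ∧ IsStage N (P (σ'.arr .dom d)) (P (σ'.arr .dom (d + 1)))) ∧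
      τ ≤ 500 * (N.work fun _ => 0) := by
  have hM := H.path.two_le
  have hm0 : σ.arr .trunkMark = fun _ => 0 := funext hm
  -- There is no second path here: its label does not occur, so the second maximum of the search can
  -- only be raised by the sink and is irrelevant.
  set f₂ := posOn N.root (σ.reg (.len true)) (label true) (σ.arr .trunkSide) (σ.arr .trunkPos) with hf₂
  have hf₂le : ∀ y, f₂ y ≤ σ.reg (.len true) := by
    intro y
    simp only [hf₂, posOn, hside y, if_false]
    split_ifs <;> omega
  have hno1 : ¬ Skipped N P S f 1 := by rintro ⟨i', h1, h2, _⟩; omega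
  have hnoM : ¬ Skipped N P S f M := by
    rintro ⟨i', _, _, y, _, h⟩
    have := H.le y; omega
  have hpw := pathWork_le (N := N) (.refl _) H.path
  unfold singleDominators
  simp only [wp_seq, wp_write, wp_assign]
  refine WP.while_count 1 M (by omega) (fun i σ' τ => σ'.reg .i = i ∧
    Marks N S P f f₂ (fun _ => 0) 0 0 i (σ'.arr .trunkMark) (σ'.reg .reached₁) (σ'.reg .newReached₂) ∧
    σ'.reg .newReached₁ = σ'.reg .reached₁ ∧ σ'.reg .reached₁ ≤ M ∧
    σ'.reg .newReached₂ ≤ σ.reg (.len true) ∧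
    Listed (fun i => ¬ Skipped N P S f i) i (σ'.reg .nd) (σ'.arr .dom) ∧
    τ + 100 * N.work (σ'.arr .trunkMark) ≤ 100 * (N.work fun _ => 0) + 300 * pathWork N P i) ?_ ?_ ?_
  · refine ⟨by simp, ?_, by simp, by simp, by simp, ?_, ?_⟩
    · simp only [State.arr_setReg, State.reg_setReg, hm0, reduceCtorEq, if_false, if_true, Expr.eval]
      exact Marks.zero
    · refine ⟨fun d d1 d2 => ?_, fun d d1 d2 => ?_, .inl ⟨by simp, rfl⟩, by simp⟩
      · simp at d2; omega
      · simp at d2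
    · simp [hm0]
  · rintro i σ₁ τ₁ hi1 hi2 hF ⟨a1, a2, a3, a4, a5, a6, a7⟩
    have e_t : σ₁.reg .t = N.root := by rw [hF.1]; simp [ht]; simp [findReachable]
    have e_L : ∀ c, σ₁.reg (.len c) = σ.reg (.len c) := by intro c; rw [hF.1]; simp; simp [findReachable]
    have e_p : σ₁.arr .trunk = σ.arr .trunk := by rw [hF.2]; simp; simp [findReachable]
    have e_side : σ₁.arr .trunkSide = σ.arr .trunkSide := by rw [hF.2]; simp; simp [findReachable]
    have e_pos : σ₁.arr .trunkPos = σ.arr .trunkPos := by rw [hF.2]; simp; simp [findReachable]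
    have e_off : σ₁.arr .off = N.off := by rw [hF.2]; simp [hσ.off]; simp [findReachable]
    have e_adj : σ₁.arr .adj = N.adj := by rw [hF.2]; simp [hσ.adj]; simp [findReachable]
    clear hF
    have hsp : N.Reach N.u (P i) := H.path.from_s hi1 hi2.le
    have hskip : Skipped N P S f i ↔ i < σ₁.reg .reached₁ := by
      constructor
      · rintro ⟨i', k1, k2, y, k3, k4⟩
        exact k4.trans_le (a2.max₁.ub y (a2.jump k1 k2 k3 fun _ _ _ _ => rfl))
      · intro h
        rcases a2.max₁.att with k | ⟨y, ⟨i', k1, k2, k3⟩, k4⟩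
        · omega
        · exact ⟨i', k1, k2, y, k3, by omega⟩
    refine ⟨by simp [a1, e_L, hL, hi2], ?_⟩
    rw [wp_seq]
    have h1 : WP (R := Reg) (A := Arr) (.when (.not (.lt Reg.i Reg.reached₁))
       (Reg.nd ::= .succ Reg.nd ;; .write .dom Reg.nd Reg.i)) σ₁ fun σ₂ τ₂ => τ₂ ≤ 20 ∧
        Listed (fun i => ¬ Skipped N P S f i) (i + 1) (σ₂.reg .nd) (σ₂.arr .dom) := by
      rw [wp_when]
      constructor
      · intro hb
        have hb' : ¬ i < σ₁.reg .reached₁ := by simpa [a1] using hb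
        have := a6.push hi1 (by rwa [hskip])
        simp only [wp_seq, wp_write, wp_assign]
        simpa [a1] using this
      · intro hb
        have hb' : i < σ₁.reg .reached₁ := by simpa [a1] using hb
        have := a6.skip hno1 (by rw [hskip]; simpa using hb')
        simpa using this
    refine h1.mono_frame fun σ₂ τ₂ hF₂ ⟨b1, b2⟩ => ?_
    have hreg : ∀ x, x ≠ .nd → σ₂.reg x = σ₁.reg x := fun x hx => hF₂.1 x (by simpa using hx)
    have harr : ∀ a, a ≠ .dom → σ₂.arr a = σ₁.arr a := fun a h1 => hF₂.2 a (by simp [h1])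
    clear hF₂ h1
    rw [wp_seq, wp_assign]
    have e_x : σ₂.arr .trunk (σ₂.reg .i) = P i := by
      rw [harr _ (by simp), hreg _ (by simp), a1, e_p, hp i hi1 hi2.le]
    simp only [Expr.eval, Expr.cost, e_x]
    rw [wp_seq]
    have hg1 : σ₂.reg .newReached₁ = σ₁.reg .reached₁ := by rw [hreg _ (by simp), a3]
    have hg2 : σ₂.reg .newReached₂ = σ₁.reg .newReached₂ := by rw [hreg _ (by simp)]
    have hmk : σ₂.arr .trunkMark = σ₁.arr .trunkMark := harr _ (by simp)
    refine (wp_findReachable (N := N) (mark := .trunkMark) (side := .trunkSide) (pos := .trunkPos)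
      (b := false) (S := S) (f₁ := f) (f₂ := f₂)
      ⟨by simp [harr, e_off], by simp [harr, e_adj]⟩ (by simpa using hsp) (by simp)
      (by simp [hreg, harr, e_t, e_side, hS]) (by simp [hreg, harr, e_t, e_side, e_pos, e_L, hf, hL])
      (by simp [hreg, harr, e_t, e_side, e_pos, e_L, hf₂])
      (by simpa [hreg, e_L, hL] using fun y _ => H.le y)
      (by simpa [hreg, e_L] using fun y _ => hf₂le y)
      (by simpa [hreg, e_L, a3, hL] using a4) (by simpa [hreg, e_L] using a5)).mono_frame ?_
    rintro σ₃ τ₃ hF₃ ⟨c1, c2, c3, c4⟩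
    have hreg₃ : ∀ x, ¬ (findReachable .trunkMark .trunkSide .trunkPos false).SetsReg x → x ≠ .x →
        σ₃.reg x = σ₂.reg x := fun x h1 h2 => by rw [hF₃.1 x h1]; simp [h2]
    have harr₃ : ∀ a, a ≠ .trunkMark → a ≠ .stk → σ₃.arr a = σ₂.arr a := fun a h1 h2 => by
      rw [hF₃.2 a (by simp [findReachable, h1, h2])]; simp
    clear hF₃
    simp only [State.reg_setReg, State.arr_setReg, reduceCtorEq, if_false, if_true, hg1, hg2, hmk,
      hreg _ (show Reg.len _ ≠ Reg.nd by simp), e_L, hL] at c1 c2 c3 c4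
    have q1 : σ₃.reg .i = i := by
      rw [hreg₃ _ (by simp [findReachable]) (by simp), hreg _ (by simp), a1]
    have q4 : σ₃.reg .nd = σ₂.reg .nd := hreg₃ _ (by simp [findReachable]) (by simp)
    have q5 : σ₃.arr .dom = σ₂.arr .dom := harr₃ _ (by simp) (by simp)
    simp only [wp_seq, wp_assign, Expr.eval, Expr.cost, Test.cost, State.reg_setReg, State.arr_setReg,
      reduceCtorEq, if_false, if_true, q1, q4, q5]
    refine ⟨trivial, a2.step hi1 c1, trivial, c2, c3, b2, ?_⟩
    rw [pathWork_succ hi1]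
    omega
  · rintro σ₁ τ₁ hF ⟨a1, a2, a3, a4, a5, a6, a7⟩
    have e_L : σ₁.reg (.len false) = M := by rw [hF.1]; simp [hL]; simp [findReachable]
    have hfin := a6.push (by omega) hnoM
    refine ⟨by simp [a1, e_L], ?_⟩
    simp only [wp_assign, wp_write, Expr.eval, Expr.cost, Test.cost, State.reg_setReg, State.arr_setReg,
      State.reg_setArr, State.arr_setArr, reduceCtorEq, if_false, if_true, e_L]
    have hnd : 1 ≤ σ₁.reg .nd := by
      rcases a6.last with ⟨_, k⟩ | ⟨k, _⟩
      · omega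
      · exact k
    refine ⟨⟨_, rfl, by omega, hfin.first (by omega), by simp, fun d d1 d2 => ?_⟩, ?_⟩
    · obtain ⟨k1, k2, k3⟩ := hfin.mem d d1 d2.le
      obtain ⟨k4, k5, k6⟩ := hfin.mem (d + 1) (by omega) (by omega)
      obtain ⟨k7, k8⟩ := hfin.gap d d1 d2
      exact ⟨k2, k7, by omega, H.isStage k2 k7 (by omega) k1 k4 fun k l1 l2 => not_not.1 (k8 k l1 l2)⟩
    · have := le_pathWork (N := N) (p := P) (i := M)
      omega

end DominatorAlg

/-! ### Connected components of a staircase and `ConstructD_u`. -/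

namespace DominatorAlg

open RAM

/-- The bipartite graph of the double-vertex dominators on the positions of their vertices: the
neighbours of `i` form an interval with last element `A i`, those of `j` one with last element `B j`. -/
structure Staircase (nL nR : ℕ) (A B : ℕ → ℕ) (Edge : ℕ → ℕ → Prop) : Prop where
  range : ∀ i j, Edge i j → 1 ≤ i ∧ i ≤ nL ∧ 1 ≤ j ∧ j ≤ nR
  edgeA : ∀ i, 1 ≤ i → i ≤ nL → Edge i (A i)
  edgeB : ∀ j, 1 ≤ j → j ≤ nR → Edge (B j) j
  leA : ∀ i j, Edge i j → j ≤ A i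
  leB : ∀ i j, Edge i j → i ≤ B j
  monoA : ∀ i i', 1 ≤ i → i ≤ i' → i' ≤ nL → A i ≤ A i'
  monoB : ∀ j j', 1 ≤ j → j ≤ j' → j' ≤ nR → B j ≤ B j'
  intervalA : ∀ i j j' k, Edge i j → Edge i j' → j ≤ k → k ≤ j' → Edge i k
  intervalB : ∀ i i' j k, Edge i j → Edge i' j → i ≤ k → k ≤ i' → Edge k j
  meet : ∀ i j i' j', Edge i j → Edge i' j' → i ≤ i' → j' ≤ j → Edge i j'

/-- No edge leaves the first `l` and the first `r` positions. -/
def Closed (Edge : ℕ → ℕ → Prop) (l r : ℕ) : Prop := ∀ i j, Edge i j → (i ≤ l ↔ j ≤ r)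

/-- The positions behind `l` up to `l'` and behind `r` up to `r'` are connected. -/
def Connected (Edge : ℕ → ℕ → Prop) (l r l' r' : ℕ) : Prop :=
  ∀ Q : Bool → ℕ → Prop, (∀ i j, Edge i j → (Q false i ↔ Q true j)) → Q false (l + 1) →
    (∀ i, l < i → i ≤ l' → Q false i) ∧ ∀ j, r < j → j ≤ r' → Q true j

/-- The division of both vectors into `m` blocks. -/
structure Blocks (Edge : ℕ → ℕ → Prop) (m : ℕ) (e : Bool → ℕ → ℕ) : Prop where
  zero : ∀ b, e b 0 = 0
  lt : ∀ b k, k < m → e b k < e b (k + 1)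
  closed : ∀ k, k ≤ m → Closed Edge (e false k) (e true k)
  conn : ∀ k, k < m → Connected Edge (e false k) (e true k) (e false (k + 1)) (e true (k + 1))

section
variable {nL nR : ℕ} {A B : ℕ → ℕ} {Edge : ℕ → ℕ → Prop}

/-- By monotonicity an edge from the first `l` positions ends at `A l = r` or before, and one from
the first `r` positions ends at `B r = l` or before. -/
theorem Staircase.closed (H : Staircase nL nR A B Edge) {l r : ℕ} (h1 : 1 ≤ l) (h2 : l ≤ nL)
    (h3 : A l = r) (h4 : B r = l) : Closed Edge l r := by
  intro i j h
  obtain ⟨i1, i2, j1, j2⟩ := H.range i j h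
  have hr := H.range l (A l) (H.edgeA l h1 h2)
  constructor
  · intro hi
    have := H.monoA i l i1 hi h2
    have := H.leA i j h
    omega
  · intro hj
    have := H.monoB j r j1 hj (by omega)
    have := H.leB i j h
    omega

/-- The first left position behind `l` has a neighbour behind `r`, and the first right position
behind `r` has one behind `l`. Uncrossing these two edges joins the two first positions. -/
theorem Staircase.first_edge (H : Staircase nL nR A B Edge) {l r : ℕ} (hc : Closed Edge l r)
    (hl : l < nL) : r < A (l + 1) ∧ Edge (l + 1) (r + 1) := by
  have h1 := H.edgeA (l + 1) (by omega) hl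
  have h2 : r < A (l + 1) := by
    have := hc _ _ h1
    omega
  have h3 := H.range _ _ h1
  have h4 := H.edgeB (r + 1) (by omega) (by omega)
  have h5 := hc _ _ h4
  exact ⟨h2, H.meet _ _ _ _ h1 h4 (by omega) (by omega)⟩

theorem Connected.extend_right {l r l' r' r'' : ℕ} (h : Connected Edge l r l' r') (hl : l < l')
    (hE : ∀ k, r < k → r' < k → k ≤ r'' → Edge l' k) : Connected Edge l r l' r'' := by
  intro Q hQ h0
  obtain ⟨h1, h2⟩ := h Q hQ h0
  refine ⟨h1, fun j j1 j2 => ?_⟩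
  by_cases hj : j ≤ r'
  · exact h2 j j1 hj
  · exact (hQ l' j (hE j j1 (by omega) j2)).1 (h1 l' hl le_rfl)

theorem Connected.extend_left {l r l' r' l'' : ℕ} (h : Connected Edge l r l' r') (hr : r < r')
    (hE : ∀ k, l' < k → k ≤ l'' → Edge k r') : Connected Edge l r l'' r' := by
  intro Q hQ h0
  obtain ⟨h1, h2⟩ := h Q hQ h0
  refine ⟨fun i i1 i2 => ?_, h2⟩
  by_cases hi : i ≤ l'
  · exact h1 i i1 hi
  · exact (hQ i r' (hE i (by omega) i2)).2 (h2 r' hr le_rfl)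

theorem Blocks.push {m : ℕ} {e : Bool → ℕ → ℕ} (h : Blocks Edge m e) {x : Bool → ℕ}
    (hlt : ∀ b, e b m < x b) (hcl : Closed Edge (x false) (x true))
    (hcn : Connected Edge (e false m) (e true m) (x false) (x true)) :
    Blocks Edge (m + 1) fun b => update (e b) (m + 1) (x b) := by
  have hu : ∀ b k, k ≤ m → update (e b) (m + 1) (x b) k = e b k := fun b k hk =>
    update_of_ne (by omega) _ _
  refine ⟨fun b => ?_, fun b k hk => ?_, fun k hk => ?_, fun k hk => ?_⟩
  · rw [hu b 0 (by omega)]; exact h.zero b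
  · rw [hu b k (by omega)]
    rcases Nat.lt_succ_iff_lt_or_eq.1 hk with hk | rfl
    · rw [hu b (k + 1) (by omega)]; exact h.lt b k hk
    · rw [update_self]; exact hlt b
  · rcases Nat.le_succ_iff.1 hk with hk | rfl
    · rw [hu _ k hk, hu _ k hk]; exact h.closed k hk
    · simp only [Nat.succ_eq_add_one, update_self]; exact hcl
  · rw [hu _ k (by omega), hu _ k (by omega)]
    rcases Nat.lt_succ_iff_lt_or_eq.1 hk with hk | rfl
    · rw [hu _ (k + 1) (by omega), hu _ (k + 1) (by omega)]; exact h.conn k hk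
    · simp only [update_self]; exact hcn

end

/-- Starting from one left vertex, the block grows by alternately moving its ends to `A l'` and `B
r'`. Each extension adds neighbours of a vertex already in the block, because neighbourhoods are
intervals; so the block stays connected. When both ends are stable it is closed, hence a component.
-/
theorem wp_constructDu {σ : State Reg Arr} {nL nR : ℕ} {A B : ℕ → ℕ} {Edge : ℕ → ℕ → Prop}
    (H : Staircase nL nR A B Edge) (hL : σ.reg (.size false) = nL)
    (hA : ∀ i, 1 ≤ i → i ≤ nL → σ.arr .max (σ.arr (.vec false) i) = A i)
    (hB : ∀ i, 1 ≤ i → i ≤ nR → σ.arr .max (σ.arr (.vec true) i) = B i)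
    (h0 : ∀ b, σ.arr (.ends b) 0 = 0) :
    WP constructDu σ fun σ' τ => 
      Blocks Edge (σ'.reg .pairs) (fun b => σ'.arr (.ends b)) ∧
      σ'.arr (.ends false) (σ'.reg .pairs) = nL ∧ σ'.arr (.ends true) (σ'.reg .pairs) = nR ∧
      τ ≤ 200 * nL + 50 := by
  unfold constructDu
  simp only [wp_seq, wp_assign]
  refine WP.while (fun σ' τ => ∃ l r, σ'.reg .endL = l ∧ σ'.reg .endR = r ∧ l ≤ nL ∧
      Closed Edge l r ∧ (∀ b, σ'.arr (.ends b) (σ'.reg .pairs) = if b then r else l) ∧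
      Blocks Edge (σ'.reg .pairs) (fun b => σ'.arr (.ends b)) ∧ τ ≤ 200 * l) (200 * nL) ?_ ?_ ?_ ?_
  · refine ⟨0, 0, by simp, by simp, by omega, ?_, by simp [h0], ?_, by omega⟩
    · intro i j h; have := H.range i j h; omega
    · refine ⟨by simp [h0], ?_, ?_, ?_⟩
      · intro b k hk; simp at hk
      · intro k hk i j h
        simp at hk; subst hk
        have := H.range i j h
        simp [h0]; omega
      · intro k hk; simp at hk
  · rintro σ' τ ⟨l, r, _, _, h, _, _, _, h'⟩; omega
  · rintro σ₁ τ₁ hF ⟨l, r, a1, a2, a3, a4, a5, a6, a7⟩ hb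
    have e_sz : σ₁.reg (.size false) = nL := by rw [hF.1]; simp [hL]; simp
    have e_v : ∀ b, σ₁.arr (.vec b) = σ.arr (.vec b) := fun b => by rw [hF.2]; simp; simp
    have e_m : σ₁.arr .max = σ.arr .max := by rw [hF.2]; simp; simp
    clear hF
    have hl : l < nL := by simpa [a1, e_sz] using hb
    obtain ⟨hf1, hf2⟩ := H.first_edge a4 hl
    simp only [wp_seq, wp_assign]
    -- A round that does not end the loop increases `l'`, so `l' - l - 1` rounds and one final round
    -- bound the time.
    refine WP.while (fun σ' τ => ∃ l' r', σ'.reg .endL = l' ∧ σ'.reg .endR = r' ∧ l < l' ∧ l' ≤ nL ∧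
      Connected Edge l r l' r' ∧ 
      ((σ'.reg .go = 1 ∧ ((l' = l + 1 ∧ r' = r) ∨ (B r' = l' ∧ r < r' ∧ Edge l' r')) ∧
        τ ≤ 60 * (l' - l - 1)) ∨
       (σ'.reg .go = 0 ∧ A l' = r' ∧ B r' = l' ∧ r < r' ∧ τ ≤ 60 * (l' - l - 1) + 60)))
      (60 * nL + 60) ?_ ?_ ?_ ?_
    · refine ⟨l + 1, r, by simp [a1], by simp [a2], by omega, hl, ?_, .inl ⟨by simp, .inl ⟨rfl, rfl⟩, by omega⟩⟩
      intro Q hQ h0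
      refine ⟨fun i i1 i2 => ?_, fun j j1 j2 => by omega⟩
      obtain rfl : i = l + 1 := by omega
      exact h0
    · rintro σ' τ ⟨l', r', _, _, _, h, _, ⟨_, _, h'⟩ | ⟨_, _, _, _, h'⟩⟩ <;> omega
    · rintro σ₂ τ₂ hF₂ ⟨l', r', b1, b2, b3, b4, b5, b6⟩ hb₂
      have e_v₂ : ∀ b, σ₂.arr (.vec b) = σ.arr (.vec b) := fun b => by rw [hF₂.2]; simp [e_v]; simp
      have e_m₂ : σ₂.arr .max = σ.arr .max := by rw [hF₂.2]; simp [e_m]; simp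
      clear hF₂
      have hgo : σ₂.reg .go = 1 := by simpa using hb₂
      obtain ⟨_, b6, b7⟩ := b6.resolve_right fun k => by omega
      have hEA := H.edgeA l' (by omega) b4
      have hrg := H.range _ _ hEA
      rw [wp_seq, wp_assign, wp_ite]
      simp only [Test.Holds, Expr.eval, State.reg_setReg, State.arr_setReg, reduceCtorEq, if_true, if_false,
        b1, b2, e_v₂, e_m₂, hA l' (by omega) b4, Expr.cost, Test.cost]
      constructor
      · intro heq
        rw [wp_assign]
        obtain ⟨b8, b9, b10⟩ := b6.resolve_left (by rintro ⟨rfl, rfl⟩; omega)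
        refine ⟨l', r', by simp [b1], by simp [b2], b3, b4, b5, .inr ⟨by simp, heq, b8, b9, ?_⟩⟩
        simp [Expr.cost]; omega
      · intro hne
        have hlt : r' < A l' ∧ r < A l' := by
          rcases b6 with ⟨rfl, rfl⟩ | ⟨b8, b9, b10⟩
          · exact ⟨hf1, hf1⟩
          · have := H.leA _ _ b10; omega
        have hEB := H.edgeB (A l') (by omega) (by omega)
        have hrg' := H.range _ _ hEB
        have hleB := H.leB _ _ hEA
        have hconn : Connected Edge l r l' (A l') := by
          refine b5.extend_right b3 fun k k1 k2 k3 => ?_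
          rcases b6 with ⟨rfl, rfl⟩ | ⟨b8, b9, b10⟩
          · exact H.intervalA _ _ _ _ hf2 hEA (by omega) k3
          · exact H.intervalA _ _ _ _ b10 hEA (by omega) k3
        rw [wp_seq, wp_assign, wp_seq, wp_assign, wp_ite]
        simp only [Test.Holds, Expr.eval, State.reg_setReg, State.arr_setReg, reduceCtorEq, if_true,
          if_false, b1, b2, e_v₂, e_m₂, hB (A l') (by omega) (by omega), Expr.cost, Test.cost]
        constructor
        · intro heq
          rw [wp_assign]
          refine ⟨l', A l', by simp [b1], by simp, b3, b4, hconn, .inr ⟨by simp, rfl, heq, hlt.2, ?_⟩⟩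
          simp [Expr.cost]; omega
        · intro hne'
          rw [wp_assign]
          refine ⟨B (A l'), A l', by simp, by simp, by omega, hrg'.2.1, ?_,
            .inl ⟨by simp [hgo], .inr ⟨rfl, hlt.2, hEB⟩, ?_⟩⟩
          · exact hconn.extend_left hlt.2 fun k k1 k2 => H.intervalB _ _ _ _ hEA hEB k1.le k2
          · simp [Expr.cost]; omega
    · rintro σ₂ τ₂ hF₂ ⟨l', r', b1, b2, b3, b4, b5, b6⟩ hb₂
      have e_p : σ₂.reg .pairs = σ₁.reg .pairs := by rw [hF₂.1]; simp; simp
      have e_e : ∀ b, σ₂.arr (.ends b) = σ₁.arr (.ends b) := fun b => by rw [hF₂.2]; simp; simp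
      clear hF₂
      have hgo : σ₂.reg .go ≠ 1 := by simpa using hb₂
      obtain ⟨_, b6, b7, b8, b9⟩ := b6.resolve_left fun k => hgo k.1
      have hcl := H.closed (by omega) b4 b6 b7
      have hbl := a6.push (x := fun b => if b then r' else l') (by
          rintro (_ | _)
          · rw [a5]; simpa using b3
          · rw [a5]; simpa using b8) (by simpa using hcl)
        (by rw [a5, a5]; simpa using b5)
      simp only [wp_assign, wp_write, Expr.eval, State.reg_setReg, State.arr_setReg, State.reg_setArr,
        State.arr_setArr, reduceCtorEq, if_true, if_false, b1, b2, e_p, Arr.ends.injEq, e_e, Expr.cost,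
        Test.cost]
      refine ⟨l', r', rfl, rfl, b4, hcl, ?_, ?_, by omega⟩
      · rintro (_ | _) <;> simp
      · convert hbl using 1
        funext b
        cases b <;> simp
  · rintro σ₁ τ₁ hF ⟨l, r, a1, a2, a3, a4, a5, a6, a7⟩ hb
    have e_sz : σ₁.reg (.size false) = nL := by rw [hF.1]; simp [hL]; simp
    have hl : l = nL := by
      have : ¬ l < nL := by simpa [a1, e_sz] using hb
      omega
    subst hl
    have hr : r = nR := by
      by_cases hr0 : nR = 0
      · by_cases hl0 : l = 0
        · by_cases hm : σ₁.reg .pairs = 0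
          · have := a5 true; rw [hm, a6.zero] at this; simp at this; omega
          · have := a6.lt false (σ₁.reg .pairs - 1) (by omega)
            rw [Nat.sub_add_cancel (by omega), a5] at this
            simp at this; omega
        · have := H.range _ _ (H.edgeA l (by omega) le_rfl); omega
      -- The loop watches the left vector only. The last right position has a left neighbour, so
      -- closedness gives `nR ≤ r`.
      · have h1 := H.edgeB nR (by omega) le_rfl
        have h2 := H.range _ _ h1
        have h3 := (a4 _ _ h1).1 h2.2.1
        refine le_antisymm ?_ h3
        by_cases hm : σ₁.reg .pairs = 0
        · have := a5 true; rw [hm, a6.zero] at this; simp at this; omega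
        · have hlt := a6.lt false (σ₁.reg .pairs - 1) (by omega)
          rw [Nat.sub_add_cancel (by omega), a5] at hlt
          simp at hlt
          by_contra hgt
          have hc := a6.conn (σ₁.reg .pairs - 1) (by omega)
          rw [Nat.sub_add_cancel (by omega), a5, a5] at hc
          -- Connectedness of the last block, tested with the predicate that right positions are at
          -- most `nR`, shows that the block does not leave the range.
          have := (hc (fun b j => b = true → j ≤ nR) (fun i j h => by
            have := (H.range i j h).2.2.2; simp; exact this) (by simp)).2 r
          have hlt' := a6.lt true (σ₁.reg .pairs - 1) (by omega)
          rw [Nat.sub_add_cancel (by omega), a5] at hlt'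
          simp at this hlt'
          exact hgt (this hlt')
    subst hr
    refine ⟨a6, by rw [a5]; simp, by rw [a5]; simp, ?_⟩
    simp; omega

end DominatorAlg

/-! ### All stages together. -/

namespace DominatorAlg

open RAM

variable {N : Net} {T : Tables}

/-- The tables list all double-vertex dominators. -/
structure Listing (N : Net) (T : Tables) : Prop where
  vec_flag : ∀ b k, 1 ≤ k → k ≤ T.size b → T.flag (T.vec b k) = label b ∧ T.index (T.vec b k) = k
  flag_vec : ∀ v, T.flag v ≠ 0 → ∃ b, T.flag v = label b ∧ 1 ≤ T.index v ∧ T.index v ≤ T.size b ∧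
    T.vec b (T.index v) = v
  partner : ∀ v, T.flag v ≠ 0 → ∃ w, Pair N v w
  pair_flag : ∀ v w, Pair N v w → ∃ b, T.flag v = label b ∧ T.flag w = label !b
  pair_iff : ∀ b v w, T.flag v = label b → T.flag w = label (!b) →
    (Pair N v w ↔ T.min v ≤ T.index w ∧ T.index w ≤ T.max v)
  min : ∀ b v, T.flag v = label b → ∃ w, T.flag w = label (!b) ∧ Pair N v w ∧ T.index w = T.min v
  max : ∀ b v, T.flag v = label b → ∃ w, T.flag w = label (!b) ∧ Pair N v w ∧ T.index w = T.max v
  fwd : ∀ b v, T.flag v = label b → N.Av (T.After b v) N.u v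
  bwd : ∀ b v, T.flag v = label b → N.Av (T.Before b v) v N.root

/-- Only the root itself is live at the root, and it belongs to no pair. -/
theorem Chain.listing (h : Chain N N.root T) : Listing N T where
  vec_flag := h.vec_flag
  flag_vec := h.flag_vec
  partner v hv := (h.done v hv).2
  pair_flag v w hp := h.pair_flag v w hp fun hl => by
    obtain rfl := hl.1.antisymm hl.2
    exact hp.left.right rfl
  pair_iff := h.pair_iff
  min := h.min
  max := h.max
  fwd := h.fwd
  bwd := h.bwd

/-- If `u` is the root, the path of one vertex avoids both members of an alleged pair. If the root
cannot be reached, every single vertex dominates `u` vacuously. -/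
theorem Listing.empty (hs : ∀ b, T.size b = 0) (hf : ∀ v, T.flag v = 0)
    (hn : N.u = N.root ∨ ¬ N.Reach N.u N.root) : Listing N T := by
  have h0 : ∀ b v, T.flag v ≠ label b := fun b v h => label_ne_zero (h.symm.trans (hf v))
  refine ⟨fun b k h1 h2 => ?_, fun v h => absurd (hf v) h, fun v h => absurd (hf v) h,
    fun v w hp => ?_, fun b v w h => absurd h (h0 b v), fun b v h => absurd h (h0 b v),
    fun b v h => absurd h (h0 b v), fun b v h => absurd h (h0 b v), fun b v h => absurd h (h0 b v)⟩
  · rw [hs] at h2; omega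
  · rcases hn with hn | hn
    · have h1 := hp.left.left
      have h2 := hp.right.left
      refine absurd ?_ hp.dom
      rw [← hn]
      exact .refl (by simpa using And.intro h1 h2)
    · exact absurd hp.left.reach hn

/-- A failed search without a flow shows that the sink cannot be reached. -/
theorem ResDone.not_reach {s t m : ℕ} {fl nx pv I₀ O₀ I O pI pO : ℕ → ℕ}
    (h : ResDone N s t fl nx pv I₀ O₀ I O pI pO 0 m) (hfl : ∀ z, fl z = 0) (hI : ∀ z, I₀ z = 0)
    (hO : ∀ z, O₀ z = 0) (hst : s ≠ t) : ¬ N.Reach s t := by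
  obtain ⟨rI, rO, hT⟩ := h.tree
  have key : ∀ x, N.Av {t} s x → New O₀ O x := fun x hx => by
    refine hx.induction hT.source fun a b _ ha hE hb => ?_
    have h1 := ((h.closedO rfl a ha).2 b hE).2 hb
    exact ⟨hO b, (h.closedI b ⟨hI b, h1⟩).2 (by simp [hfl])⟩
  intro hr
  rcases hr.first {t} with k | k | ⟨a, b, h1, h2, h3, -⟩
  · exact k.right rfl
  · exact hst k
  · have := ((h.closedO rfl a (key a h1)).2 b h2).1 h3
    simp [hfl] at this

theorem liveWork_le {s : ℕ} : liveWork N s ≤ N.work fun _ => 0 := by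
  unfold liveWork Net.work
  simp only [if_true]
  classical
  refine Finset.sum_le_sum_of_subset fun v hv => ?_
  exact (Finset.mem_filter.1 hv).1

theorem FlowPath.trunkFlow {g M : ℕ} {fl nx pv P : ℕ → ℕ}
    (hF : FlowInv N N.u N.root {g} N.root fl nx pv) (hP : FlowPath N N.u N.root g fl nx pv P M)
    (hg : nx N.u = g) (hm : ∀ z, fl z = 1 → Mid N N.u N.root z) : TrunkFlow N P M 1 fl nx pv where
  flow i h1 h2 := (hP.inner i h1 h2).1
  nxt i h1 h2 := by
    rcases Nat.lt_or_ge i 2 with h3 | h3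
    · obtain rfl : i = 1 := by omega
      rw [hP.first, hg, hP.second]
    · exact (hP.inner i h3 h2).2.2
  prv := hP.prev
  only z _ hz := by
    obtain ⟨g', rfl, h⟩ := hF.complete hz (hm z hz)
    obtain ⟨i, h1, h2, h3⟩ := h P M hP
    exact ⟨i, by omega, h2, h3.symm⟩

section
open Reg Arr

/-- The stages of the algorithm. -/
def trunkStages : Prog :=
  storeTrunk ;;
     singleDominators ;;
     d ::= 1 ;;
     .while (.lt d nd)
       (s ::= .read trunk (.read dom d) ;;
        f ::= .read trunk (.succ (.read dom d)) ;;
        d ::= .succ d ;;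
        t ::= .read trunk (.read dom d) ;;
        stage)

end

theorem tables_setReg {σ : State Reg Arr} {x : Reg} {k : ℕ} (hx : ∀ b, x ≠ .size b) :
    tables (σ.setReg x k) = tables σ := by
  simp [tables, fun b => (hx b).symm]

/-- The bounds of the stages telescope: together they use up the initial `searchWork` and
`liveWork`, both of which are linear in the `work` of the unmarked network. -/
theorem wp_trunkStages {σ : State Reg Arr} {g : ℕ} (hσ : N.Holds σ) (hu : σ.reg .u = N.u)
    (hr : σ.reg .root = N.root) (ht : σ.reg .t = N.root)
    (hF : FlowInv N N.u N.root {g} N.root (σ.arr .flow) (σ.arr .nxt) (σ.arr .prv))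
    (hg : σ.arr .nxt N.u = g) (hm : ∀ z, σ.arr .flow z = 1 → Mid N N.u N.root z)
    (hz : ∀ a, ¬ (augment 0).SetsArr a → a ≠ .off → a ≠ .adj → ∀ i, σ.arr a i = 0)
    (hsz : ∀ b, σ.reg (.size b) = 0) :
    WP trunkStages σ fun σ' τ => Chain N N.root (tables σ') ∧ τ ≤ 10000 * N.work fun _ => 0 := by
  obtain ⟨P, M, hP⟩ := hF.path rfl
  have hPO := hP.pathOn
  have hM := hP.two_le
  have hMW : M ≤ (N.work fun _ => 0) + 1 :=
    le_pathWork.trans (Nat.add_le_add_right (pathWork_le (.refl _) hPO) 1)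
  have hWu := liveWork_le (N := N) (s := N.u)
  have htr := hP.trunkFlow hF hg hm
  unfold trunkStages
  rw [wp_seq]
  refine (wp_storeTrunk hP hu hr hg).mono_frame ?_
  rintro σ₁ τ₁ hF₁ ⟨a1, a2, a3, a4, a5⟩
  have zero₁ : ∀ a, ¬ (augment 0).SetsArr a → a ≠ .off → a ≠ .adj → ¬ storeTrunk.SetsArr a →
      ∀ i, σ₁.arr a i = 0 := fun a h1 h2 h3 h4 i => by rw [hF₁.2 a h4]; exact hz a h1 h2 h3 i
  have hside : ∀ y, σ₁.arr .trunkSide y = label false ∧ (∃ i, 1 < i ∧ i ≤ M ∧ y = P i) ∨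
      σ₁.arr .trunkSide y = 0 ∧ σ₁.arr .trunkPos y = 0 ∧ ∀ i, 1 < i → i ≤ M → y ≠ P i := by
    intro y
    by_cases h : ∃ i, 1 < i ∧ i ≤ M ∧ y = P i
    · obtain ⟨i, h1, h2, rfl⟩ := h
      exact .inl ⟨(a4 i h1 h2).1, i, h1, h2, rfl⟩
    · push Not at h
      refine .inr ⟨?_, ?_, h⟩
      · rw [(a5 y h).1]; exact hz _ (by simp [augment, residualSearch, visitOutCopy]) (by simp) (by simp) y
      · rw [(a5 y h).2]; exact hz _ (by simp [augment, residualSearch, visitOutCopy]) (by simp) (by simp) y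
  have hrootP : N.root = P M := hPO.last.symm
  have hTL : TrunkLayout N P M {y | y = N.root ∨ ∃ c, σ₁.arr .trunkSide y = label c}
      (posOn N.root M (label false) (σ₁.arr .trunkSide) (σ₁.arr .trunkPos)) := by
    refine ⟨hPO, fun y => ?_, fun i h1 h2 => ?_, fun y hy => ?_⟩
    · constructor
      · rintro (rfl | ⟨c, hc⟩)
        · exact ⟨M, by omega, le_rfl, hrootP⟩
        · rcases hside y with h | h
          · exact h.2
          · exact absurd (hc.symm.trans h.1) label_ne_zero
      · rintro ⟨i, h1, h2, rfl⟩
        exact .inr ⟨false, (a4 i h1 h2).1⟩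
    · unfold posOn
      split_ifs with h3 h4
      · rw [hrootP] at h3
        exact hPO.inj (by omega) le_rfl (by omega) h2 h3.symm
      · exact (a4 i h1 h2).2
      · exact absurd (a4 i h1 h2).1 h4
    · rcases hside y with h | h
      · exact h.2
      · unfold posOn at hy
        split_ifs at hy with h3
        · exact ⟨M, by omega, le_rfl, h3.trans hrootP⟩
        · exact absurd h.2.1 hy
        · exact absurd rfl hy
  have off₁ : σ₁.arr .off = N.off := by rw [hF₁.2 _ (by simp [storeTrunk]), hσ.off]
  have adj₁ : σ₁.arr .adj = N.adj := by rw [hF₁.2 _ (by simp [storeTrunk]), hσ.adj]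
  rw [wp_seq]
  refine (wp_singleDominators ⟨off₁, adj₁⟩ hTL (by rw [hF₁.1 _ (by simp [storeTrunk]), ht]) a2 a3
    rfl rfl ?_ ?_).mono_frame ?_
  · intro y
    rcases hside y with h | h
    · rw [h.1]; simp [label]
    · rw [h.1]; simp [label]
  · exact zero₁ _ (by simp [augment, residualSearch, visitOutCopy]) (by simp) (by simp) (by simp [storeTrunk])
  rintro σ₂ τ₂ hF₂ ⟨⟨n, b1, b2, b3, b4, b5⟩, b6⟩
  set D := σ₂.arr .dom with hD
  have e_arr : ∀ a, ¬ storeTrunk.SetsArr a → ¬ singleDominators.SetsArr a → σ₂.arr a = σ.arr a :=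
    fun a h1 h2 => by rw [hF₂.2 a h2, hF₁.2 a h1]
  have zero₂ : ∀ a, ¬ (augment 0).SetsArr a → a ≠ .off → a ≠ .adj → ¬ storeTrunk.SetsArr a →
      ¬ singleDominators.SetsArr a → ∀ i, σ₂.arr a i = 0 := fun a h1 h2 h3 h4 h5 i => by
    rw [hF₂.2 a h5]; exact zero₁ a h1 h2 h3 h4 i
  have size₂ : ∀ b, σ₂.reg (.size b) = 0 := fun b => by
    rw [hF₂.1 _ (by simp [singleDominators, findReachable]), hF₁.1 _ (by simp [storeTrunk]), hsz]
  -- `d ≤ D d` bounds the number of stages by the length of the stored path.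
  have hD1 : ∀ d, 1 ≤ d → d ≤ n → 1 ≤ D d ∧ d ≤ D d ∧ D d ≤ M := by
    intro d h1
    induction d, h1 using Nat.le_induction with
    | base => intro _; omega
    | succ d h1 ih =>
      intro h2
      have := ih (by omega)
      have := b5 d h1 (by omega)
      omega
  have hn := hD1 n (by omega) le_rfl
  -- The factor is `2 * 400 + 2 * 100`: the four arrays of marks used by the stages are still zero.
  have hsw : searchWork N σ₂ = 1000 * N.work fun _ => 0 := by
    have h1 : ∀ k, k ≠ 0 → σ₂.arr (.visOut k) = fun _ => 0 := fun k hk => funext fun i =>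
      zero₂ _ (by simp [augment, residualSearch, visitOutCopy, hk]) (by simp) (by simp)
        (by simp [storeTrunk]) (by simp [singleDominators, findReachable]) i
    have h2 : ∀ b, σ₂.arr (.marked b) = fun _ => 0 := fun b => funext fun i =>
      zero₂ _ (by simp [augment, residualSearch, visitOutCopy]) (by simp) (by simp)
        (by simp [storeTrunk]) (by simp [singleDominators, findReachable]) i
    rw [searchWork, h1 1 (by simp), h1 2 (by simp), h2, h2]; omega
  have hP1 : P (D 1) = N.u := by rw [b3, hPO.first]
  rw [wp_seq, wp_assign]
  refine WP.while_count 1 n (by omega) (fun d σ' τ => σ'.reg .d = d ∧ Fresh N (P (D d)) σ' ∧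
    TrunkFlow N P M (D d) (σ'.arr .flow) (σ'.arr .nxt) (σ'.arr .prv) ∧ Chain N (P (D d)) (tables σ') ∧
    τ + searchWork N σ' + 4000 * liveWork N (P (D d)) ≤
      searchWork N σ₂ + 4000 * liveWork N N.u + 100 * (d - 1)) ?_ ?_ ?_
  · refine ⟨by simp, ⟨?_, ?_, ?_, ?_⟩, ?_, ?_, ?_⟩
    · intro k hk y _
      exact zero₂ _ (by simp [augment, residualSearch, visitOutCopy, hk]) (by simp) (by simp)
        (by simp [storeTrunk]) (by simp [singleDominators, findReachable]) y
    · intro k hk y _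
      exact zero₂ _ (by simp [augment, residualSearch, visitOutCopy, hk]) (by simp) (by simp)
        (by simp [storeTrunk]) (by simp [singleDominators, findReachable]) y
    · intro b y _ _
      exact zero₂ _ (by simp [augment, residualSearch, visitOutCopy]) (by simp) (by simp)
        (by simp [storeTrunk]) (by simp [singleDominators, findReachable]) y
    · intro y hy
      refine absurd (zero₂ .side ?_ (by simp) (by simp) ?_ ?_ y) (by simpa using hy)
      · simp [augment, residualSearch, visitOutCopy]
      · simp [storeTrunk]
      · simp [singleDominators, findReachable]
    · simp only [State.arr_setReg]
      rw [b3, e_arr .flow, e_arr .nxt, e_arr .prv]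
      · exact htr
      all_goals simp [storeTrunk, singleDominators, findReachable]
    · rw [hP1]
      refine Chain.init (fun b => ?_) fun v => ?_
      · simpa [tables] using size₂ b
      · exact zero₂ .flag (by simp [augment, residualSearch, visitOutCopy]) (by simp) (by simp)
          (by simp [storeTrunk]) (by simp [singleDominators, findReachable]) v
    · rw [hP1]; simp [searchWork]
  · rintro d σ₃ τ₃ hd1 hd2 hF₃ ⟨c1, c2, c3, c4, c5⟩
    obtain ⟨q1, q2, q3, q4⟩ := b5 d hd1 hd2
    have e_nd : σ₃.reg .nd = n := by
      rw [hF₃.1]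
      · simpa using b1
      · simp [stage, augment, residualSearch, visitOutCopy, storePath, assignMinMax, findReachable,
          constructVector, convertMinMax]
    have e_a : ∀ a ∈ [Arr.dom, .trunk, .off, .adj], σ₃.arr a = σ₂.arr a := by
      intro a ha
      rw [hF₃.2]
      · simp
      · simp only [List.mem_cons, List.not_mem_nil, or_false] at ha
        rcases ha with rfl | rfl | rfl | rfl <;>
        simp [stage, augment, residualSearch, visitOutCopy, storePath, assignMinMax, findReachable,
          constructVector, convertMinMax]
    have e_dom : σ₃.arr .dom = D := e_a _ (by simp)
    have e_off : σ₃.arr .off = N.off := by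
      rw [e_a _ (by simp), hF₂.2 _ (by simp [singleDominators, findReachable]), off₁]
    have e_adj : σ₃.arr .adj = N.adj := by
      rw [e_a _ (by simp), hF₂.2 _ (by simp [singleDominators, findReachable]), adj₁]
    have e_tr : ∀ i, 1 ≤ i → i ≤ M → σ₃.arr .trunk i = P i := fun i h1 h2 => by
      rw [e_a _ (by simp), hF₂.2 _ (by simp [singleDominators, findReachable])]; exact a3 i h1 h2
    refine ⟨by simp [c1, e_nd, hd2], ?_⟩
    simp only [wp_seq, wp_assign]
    refine (wp_stage (N := N) (P := P) (M := M) (i₀ := D d) (j₀ := D (d + 1)) ⟨?_, ?_⟩ hPO q4 q1 q2 q3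
      ?_ ?_ ?_ ?_ ?_ ?_).mono_frame ?_
    · simpa using e_off
    · simpa using e_adj
    · simp [c1, e_dom, e_tr (D d) q1 (by omega)]
    · simp [c1, e_dom, e_tr (D (d + 1)) (by omega) (by omega)]
    · simp [c1, e_dom, e_tr (D d + 1) (by omega) (by omega)]
    · exact ⟨by simpa using c2.visIn, by simpa using c2.visOut, by simpa using c2.marked,
        by simpa using c2.side⟩
    · simpa using c3
    · rw [tables_setReg (by simp), tables_setReg (by simp), tables_setReg (by simp),
        tables_setReg (by simp)]
      exact c4
    · rintro σ₄ τ₄ hF₄ ⟨g1, g2, g3, g4⟩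
      refine ⟨?_, g1, g2, g3, ?_⟩
      · rw [hF₄.1]
        · simp [c1]
        · simp [stage, augment, residualSearch, visitOutCopy, storePath, assignMinMax, findReachable,
          constructVector, convertMinMax]
      · simp [searchWork] at g4 c5 ⊢
        omega
  · rintro σ₃ τ₃ hF₃ ⟨c1, c2, c3, c4, c5⟩
    have e_nd : σ₃.reg .nd = n := by
      rw [hF₃.1]
      · simpa using b1
      · simp [stage, augment, residualSearch, visitOutCopy, storePath, assignMinMax, findReachable,
          constructVector, convertMinMax]
    rw [b4, hPO.last] at c4
    refine ⟨by simp [c1, e_nd], c4, ?_⟩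
    simp
    omega

end DominatorAlg

/-! ### Uncrossing of pairs, and the whole program. -/

namespace Net

/-- A path that avoids `B` either avoids `A`, or has a last vertex in `A`. -/
theorem Av.last {N : Net} {B : Set ℕ} (A : Set ℕ) {x y : ℕ} (h : N.Av B x y) :
    N.Av (A ∪ B) x y ∨ ∃ b ∈ A, N.Av (A \ {b} ∪ B) b y := by
  have hr := h.right
  refine h.head_induction (P := fun x => N.Av (A ∪ B) x y ∨ ∃ b ∈ A, N.Av (A \ {b} ∪ B) b y) ?_ ?_
  · by_cases hy : y ∈ A
    · exact .inr ⟨y, hy, .refl (by simp [hr])⟩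
    · exact .inl (.refl (by simp [hr, hy]))
  · rintro a b hE ha - (h | h)
    · by_cases hA : a ∈ A
      · exact .inr ⟨a, hA, .head hE (by simp [ha]) (h.mono (by gcongr; exact Set.diff_subset))⟩
      · exact .inl (.head hE (by simp [ha, hA]) h)
    · exact .inr h

end Net

namespace DominatorAlg

open RAM

variable {N : Net} {T : Tables}

namespace Listing

theorem inj (h : Listing N T) {b : Bool} {v v' : ℕ} (hv : T.flag v = label b)
    (hv' : T.flag v' = label b) (hi : T.index v = T.index v') : v = v' := by
  obtain ⟨c, h1, -, -, h2⟩ := h.flag_vec v (by rw [hv]; exact label_ne_zero)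
  obtain ⟨c', h3, -, -, h4⟩ := h.flag_vec v' (by rw [hv']; exact label_ne_zero)
  obtain rfl := label_inj.1 (hv.symm.trans h1)
  obtain rfl := label_inj.1 (hv'.symm.trans h3)
  rw [← h2, ← h4, hi]

/-- Follow a path that avoids `v` and `w'` up to its first vertex in `{w, v'}`. From `w` there is a
way to the root that avoids `v'` and `w'`, and from `v'` one that avoids `v` and `w` (`bwd`); each
would get round one of the two given pairs. If neither vertex is met, the pair `v`, `w` is avoided.
-/
theorem uncross_left (h : Listing N T) {b : Bool} {v w v' w' : ℕ} (hv : T.flag v = label b)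
    (hw : T.flag w = label !b) (hv' : T.flag v' = label b) (hw' : T.flag w' = label !b)
    (hp : Pair N v w) (hp' : Pair N v' w') (h1 : T.index v < T.index v')
    (h2 : T.index w' < T.index w) : Pair N v w' := by
  refine ⟨hp.left, hp'.right, fun hA => ?_⟩
  rcases hA.first {w, v'} with k | k | ⟨a, c, k1, k2, k3, -⟩
  · exact hp.dom (k.mono (by intro x; simp; tauto))
  · rcases k with k | k
    · exact hp.right.left k
    · exact hp'.left.left k
  · rcases k3 with rfl | rfl
    · refine hp'.dom (((k1.mono ?_).tail k2 ?_).trans ((h.bwd (!b) c hw).mono ?_))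
      · intro x; simp; tauto
      · rintro (rfl | rfl)
        · exact absurd (label_inj.1 (hv'.symm.trans hw)) (by simp)
        · exact lt_irrefl _ h2
      · rintro x (rfl | rfl)
        · exact .inl (by simpa using hv')
        · exact .inr ⟨hw', h2⟩
    · refine hp.dom (((k1.mono ?_).tail k2 ?_).trans ((h.bwd b c hv').mono ?_))
      · intro x; simp; tauto
      · rintro (rfl | rfl)
        · exact lt_irrefl _ h1
        · exact absurd (label_inj.1 (hv'.symm.trans hw)) (by simp)
      · rintro x (rfl | rfl)
        · exact .inr ⟨hv, h1⟩
        · exact .inl hw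

/-- The mirror image of `uncross_left`: take the last vertex of the path in `{v, w'}` and replace
the part before it by a path from `u` (`fwd`). -/
theorem uncross_right (h : Listing N T) {b : Bool} {v w v' w' : ℕ} (hv : T.flag v = label b)
    (hw : T.flag w = label !b) (hv' : T.flag v' = label b) (hw' : T.flag w' = label !b)
    (hp : Pair N v w) (hp' : Pair N v' w') (h1 : T.index v < T.index v')
    (h2 : T.index w' < T.index w) : Pair N v' w := by
  refine ⟨hp'.left, hp.right, fun hA => ?_⟩
  have hvw' : v ≠ w' := by rintro rfl; exact absurd (label_inj.1 (hv.symm.trans hw')) (by simp)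
  rcases hA.last {v, w'} with k | ⟨c, rfl | rfl, k⟩
  · exact hp.dom (k.mono (by intro x; simp; tauto))
  · refine hp'.dom (((h.fwd b _ hv).mono ?_).trans (k.mono ?_))
    · rintro x (rfl | rfl)
      · exact .inr ⟨hv', h1⟩
      · exact .inl hw'
    · rintro x (rfl | rfl)
      · exact .inr (.inl rfl)
      · exact .inl ⟨.inr rfl, hvw'.symm⟩
  · refine hp.dom (((h.fwd (!b) _ hw').mono ?_).trans (k.mono ?_))
    · rintro x (rfl | rfl)
      · exact .inl (by simpa using hv)
      · exact .inr ⟨hw, h2⟩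
    · rintro x (rfl | rfl)
      · exact .inl ⟨.inl rfl, hvw'⟩
      · exact .inr (.inr rfl)

/-- If the last partner of the later vertex preceded that of the earlier one, uncrossing would make
the latter a partner of the later vertex too. -/
theorem max_mono (h : Listing N T) {b : Bool} {v v' : ℕ} (hv : T.flag v = label b)
    (hv' : T.flag v' = label b) (hi : T.index v ≤ T.index v') : T.max v ≤ T.max v' := by
  obtain ⟨w, w1, w2, w3⟩ := h.max b v hv
  obtain ⟨w', w1', w2', w3'⟩ := h.max b v' hv'
  rw [← w3]
  by_contra hlt
  have hp : Pair N v' w := by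
    rcases eq_or_lt_of_le hi with hi | hi
    · rwa [← h.inj hv hv' hi]
    · exact h.uncross_right hv w1 hv' w1' w2 w2' hi (by omega)
  exact hlt ((h.pair_iff b v' w hv' w1).1 hp).2

end Listing

/-- The double-vertex dominators as a relation between the positions in the two vectors. -/
def Tables.Edge (N : Net) (T : Tables) (i j : ℕ) : Prop :=
  (1 ≤ i ∧ i ≤ T.size false ∧ 1 ≤ j ∧ j ≤ T.size true) ∧ Pair N (T.vec false i) (T.vec true j)

/-- Here `meet` is uncrossing and the monotonicity is `max_mono`; the interval properties come from
the bounds `min` and `max`, read from either side. -/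
theorem Listing.staircase (h : Listing N T) : Staircase (T.size false) (T.size true)
    (fun i => T.max (T.vec false i)) (fun j => T.max (T.vec true j)) (T.Edge N) := by
  have hf : ∀ {b i}, 1 ≤ i → i ≤ T.size b → T.flag (T.vec b i) = label b := fun h1 h2 =>
    (h.vec_flag _ _ h1 h2).1
  have hi : ∀ {b i}, 1 ≤ i → i ≤ T.size b → T.index (T.vec b i) = i := fun h1 h2 =>
    (h.vec_flag _ _ h1 h2).2
  have hA : ∀ i j, 1 ≤ i → i ≤ T.size false → 1 ≤ j → j ≤ T.size true →
      (Pair N (T.vec false i) (T.vec true j) ↔ T.min (T.vec false i) ≤ j ∧ j ≤ T.max (T.vec false i)) := by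
    intro i j h1 h2 h3 h4
    have := h.pair_iff false _ (T.vec true j) (hf h1 h2) (hf h3 h4)
    rwa [hi h3 h4] at this
  have hB : ∀ i j, 1 ≤ i → i ≤ T.size false → 1 ≤ j → j ≤ T.size true →
      (Pair N (T.vec false i) (T.vec true j) ↔ T.min (T.vec true j) ≤ i ∧ i ≤ T.max (T.vec true j)) := by
    intro i j h1 h2 h3 h4
    have := h.pair_iff true _ (T.vec false i) (hf h3 h4) (hf h1 h2)
    rw [hi h1 h2] at this
    exact ⟨fun k => this.1 k.symm, fun k => (this.2 k).symm⟩
  have hM : ∀ b v, T.flag v = label b → 1 ≤ T.max v ∧ T.max v ≤ T.size (!b) ∧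
      Pair N v (T.vec (!b) (T.max v)) := by
    intro b v hv
    obtain ⟨w, h1, h2, h3⟩ := h.max b v hv
    obtain ⟨c, h4, h5, h6, h7⟩ := h.flag_vec w (by rw [h1]; exact label_ne_zero)
    obtain rfl := label_inj.1 (h1.symm.trans h4)
    rw [← h3, h7]
    exact ⟨h5, h6, h2⟩
  refine ⟨fun i j h => h.1, fun i h1 h2 => ?_, fun j h1 h2 => ?_, ?_, ?_, fun i i' h1 h2 h3 => ?_,
    fun j j' h1 h2 h3 => ?_, ?_, ?_, ?_⟩
  · obtain ⟨k1, k2, k3⟩ := hM false _ (hf h1 h2)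
    exact ⟨⟨h1, h2, k1, k2⟩, k3⟩
  · obtain ⟨k1, k2, k3⟩ := hM true _ (hf h1 h2)
    exact ⟨⟨k1, k2, h1, h2⟩, k3.symm⟩
  · rintro i j ⟨⟨h1, h2, h3, h4⟩, hp⟩
    exact ((hA i j h1 h2 h3 h4).1 hp).2
  · rintro i j ⟨⟨h1, h2, h3, h4⟩, hp⟩
    exact ((hB i j h1 h2 h3 h4).1 hp).2
  · exact h.max_mono (hf h1 (h2.trans h3)) (hf (h1.trans h2) h3)
      (by rwa [hi h1 (h2.trans h3), hi (h1.trans h2) h3])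
  · exact h.max_mono (hf h1 (h2.trans h3)) (hf (h1.trans h2) h3)
      (by rwa [hi h1 (h2.trans h3), hi (h1.trans h2) h3])
  · rintro i j j' k ⟨⟨h1, h2, h3, h4⟩, hp⟩ ⟨⟨-, -, h3', h4'⟩, hp'⟩ hk hk'
    have k1 := (hA i j h1 h2 h3 h4).1 hp
    have k2 := (hA i j' h1 h2 h3' h4').1 hp'
    exact ⟨⟨h1, h2, by omega, by omega⟩, (hA i k h1 h2 (by omega) (by omega)).2 (by omega)⟩
  · rintro i i' j k ⟨⟨h1, h2, h3, h4⟩, hp⟩ ⟨⟨h1', h2', -, -⟩, hp'⟩ hk hk'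
    have k1 := (hB i j h1 h2 h3 h4).1 hp
    have k2 := (hB i' j h1' h2' h3 h4).1 hp'
    exact ⟨⟨by omega, by omega, h3, h4⟩, (hB k j (by omega) (by omega) h3 h4).2 (by omega)⟩
  · rintro i j i' j' ⟨⟨h1, h2, h3, h4⟩, hp⟩ ⟨⟨h1', h2', h3', h4'⟩, hp'⟩ hii hjj
    refine ⟨⟨h1, h2, h3', h4'⟩, ?_⟩
    rcases eq_or_lt_of_le hii with rfl | hii
    · exact hp'
    rcases eq_or_lt_of_le hjj with rfl | hjj
    · exact hp
    exact h.uncross_left (w := T.vec true j) (w' := T.vec true j') (hf h1 h2) (hf h3 h4) (hf h1' h2')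
      (hf h3' h4') hp hp'
      (by rwa [hi h1 h2, hi h1' h2']) (by rwa [hi h3 h4, hi h3' h4'])

theorem Listing.size_le (h : Listing N T) (b : Bool) : T.size b ≤ N.work fun _ => 0 := by
  have h1 : (Finset.Icc 1 (T.size b)).card ≤ N.verts.card := by
    refine Finset.card_le_card_of_injOn (T.vec b) (fun k hk => ?_) fun k hk k' hk' he => ?_
    · rw [Finset.coe_Icc, Set.mem_Icc] at hk
      obtain ⟨w, hw⟩ := h.partner _ (by rw [(h.vec_flag b k hk.1 hk.2).1]; exact label_ne_zero)
      exact Net.mem_verts.2 hw.live.1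
    · rw [Finset.coe_Icc, Set.mem_Icc] at hk hk'
      rw [← (h.vec_flag b k hk.1 hk.2).2, ← (h.vec_flag b k' hk'.1 hk'.2).2, he]
  have h2 : N.verts.card ≤ N.work fun _ => 0 := by
    rw [Finset.card_eq_sum_ones]
    exact Finset.sum_le_sum fun v _ => by simp
  simpa using h1.trans h2

/-- The result of the algorithm. -/
structure Computed (N : Net) (σ : State Reg Arr) : Prop where
  listing : Listing N (tables σ)
  blocks : Blocks ((tables σ).Edge N) (σ.reg .pairs) fun b => σ.arr (.ends b)
  ends : ∀ b, σ.arr (.ends b) (σ.reg .pairs) = σ.reg (.size b)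

/-- If `u` is the root, no edge that the search meets enters the root, so the search behaves as if
its sink were `N.n`, which is no vertex, and it fails. Otherwise it starts from the zero flow, and
failure means that the root is unreachable. -/
theorem wp_augment_first {σ : State Reg Arr} (hσ : N.Holds σ) (hs : σ.reg .s = N.u)
    (ht : σ.reg .t = N.root) (hz : ∀ a, a ≠ .off → a ≠ .adj → ∀ i, σ.arr a i = 0) :
    WP (augment 0) σ fun σ' τ => τ ≤ 400 * (N.work fun _ => 0) + 200 ∧
      ((σ'.reg .found ≠ 1 ∧ (N.u = N.root ∨ ¬ N.Reach N.u N.root)) ∨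
      (σ'.reg .found = 1 ∧ FlowInv N N.u N.root {σ'.arr .nxt N.u} N.root (σ'.arr .flow) (σ'.arr .nxt)
        (σ'.arr .prv) ∧ ∀ z, σ'.arr .flow z = 1 → Mid N N.u N.root z)) := by
  have hz' : ∀ a, a ≠ .off → a ≠ .adj → σ.arr a = fun _ => 0 := fun a h1 h2 => funext (hz a h1 h2)
  have hfl := hz .flow (by simp) (by simp)
  by_cases hur : N.u = N.root
  · have hno : ∀ z y, N.Reach N.u z → N.E z y → y ≠ N.root := by
      rintro z y h1 h2 rfl
      exact Net.not_E_of_reach (hur ▸ h1) h2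
    unfold augment
    rw [wp_seq]
    refine (wp_residualSearch_sink (T := N.n) hσ ?_ ?_ ?_ (hz _ (by simp) (by simp) _) ?_).mono ?_
    · intro z y h1 h2
      rw [hs] at h1
      rw [ht]
      exact iff_of_false (hno z y h1 h2) (N.lt_right h2).ne
    · rw [hs]; exact .refl _
    · rw [hs]; exact N.u_lt.ne
    · intro y _ h; simp [hfl] at h
    · rintro σ₁ τ₁ ⟨m, h1, h2⟩
      have hf : σ₁.reg .found = 0 := by
        by_contra hf
        exact (N.lt_right (h1.hit hf).2).ne rfl
      rw [wp_when]
      refine ⟨fun h => by simp [hf] at h, fun _ => ⟨?_, .inl ⟨by simp [hf], .inl hur⟩⟩⟩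
      rw [hz' _ (by simp) (by simp)] at h2
      simp
      omega
  · refine (wp_augment (N := N) (F := ∅) hσ (by rw [hs]; exact .refl _) (by rwa [hs, ht])
      (hz _ (by simp) (by simp) _) ⟨?_, ?_, by simp, ?_⟩).mono ?_
    · intro z h; simp [hfl] at h
    · intro z h; simp [hfl] at h
    · intro z _ h; simp [hfl] at h
    · rintro σ₁ τ₁ ⟨-, -, h3, h4⟩
      rw [hz' (.visOut 0) (by simp) (by simp)] at h3
      refine ⟨by omega, ?_⟩
      rcases h4 with ⟨h5, -, -, -, m, h6⟩ | ⟨h5, h6⟩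
      · refine .inl ⟨by simp [h5], .inr ?_⟩
        rw [hs, ht] at h6
        exact h6.not_reach hfl (hz _ (by simp) (by simp)) (hz _ (by simp) (by simp)) hur
      · rw [hs, ht] at h6
        refine .inr ⟨h5, by simpa using h6.flow, fun z hzf => ?_⟩
        by_contra hm
        rw [(h6.frame z hm).1, hfl] at hzf
        simp at hzf

theorem wp_dominatorChain {σ : State Reg Arr} (hσ : N.Holds σ) (hu : σ.reg .u = N.u)
    (hr : σ.reg .root = N.root) (hz : ∀ a, a ≠ .off → a ≠ .adj → ∀ i, σ.arr a i = 0) :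
    WP dominatorChain σ fun σ' τ => Computed N σ' ∧ τ ≤ 20000 * ((N.work fun _ => 0) + 1) := by
  unfold dominatorChain
  rw [← trunkStages.eq_1]
  simp only [wp_seq, wp_assign]
  refine (wp_augment_first (N := N) ⟨by simpa using hσ.off, by simpa using hσ.adj⟩ (by simpa using hu)
    (by simpa using hr) (by simpa using hz)).mono_frame ?_
  rintro σ₁ τ₁ hF₁ ⟨h1, h2⟩
  have size₁ : ∀ b, σ₁.reg (.size b) = 0 := fun b => by
    rw [hF₁.1 _ (by simp [augment, residualSearch, visitOutCopy])]
    cases b <;> simp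
  have zero₁ : ∀ a, ¬ (augment 0).SetsArr a → a ≠ .off → a ≠ .adj → ∀ i, σ₁.arr a i = 0 :=
    fun a h1 h2 h3 i => by rw [hF₁.2 a h1]; simpa using hz a h2 h3 i
  have main : WP (.when (.eq Reg.found 1) trunkStages) σ₁ fun σ₂ τ₂ =>
      Listing N (tables σ₂) ∧ τ₂ ≤ 10000 * (N.work fun _ => 0) + 10 := by
    rw [wp_when]
    refine ⟨fun hf => ?_, fun hf => ?_⟩
    · obtain ⟨h3, h4, h5⟩ := h2.resolve_left fun h => h.1 hf
      refine (wp_trunkStages (N := N) ⟨?_, ?_⟩ ?_ ?_ ?_ h4 rfl h5 zero₁ size₁).mono ?_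
      · rw [hF₁.2 _ (by simp [augment, residualSearch, visitOutCopy])]; simpa using hσ.off
      · rw [hF₁.2 _ (by simp [augment, residualSearch, visitOutCopy])]; simpa using hσ.adj
      · rw [hF₁.1 _ (by simp [augment, residualSearch, visitOutCopy])]; simpa using hu
      · rw [hF₁.1 _ (by simp [augment, residualSearch, visitOutCopy])]; simpa using hr
      · rw [hF₁.1 _ (by simp [augment, residualSearch, visitOutCopy])]; simpa using hr
      · rintro σ₂ τ₂ ⟨k1, k2⟩
        exact ⟨k1.listing, by simp; omega⟩
    · refine ⟨Listing.empty size₁ (zero₁ .flag ?_ (by simp) (by simp)) ?_, by simp⟩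
      · simp [augment, residualSearch, visitOutCopy]
      · exact (h2.resolve_right fun h => hf h.1).2
  refine main.mono_frame ?_
  rintro σ₂ τ₂ hF₂ ⟨k1, k2⟩
  have hsz := k1.size_le false
  refine (wp_constructDu k1.staircase rfl (fun _ _ _ => rfl) (fun _ _ _ => rfl) fun b => ?_).mono_frame ?_
  · rw [hF₂.2]
    · exact zero₁ _ (by simp [augment, residualSearch, visitOutCopy]) (by simp) (by simp) 0
    · simp [trunkStages, storeTrunk, singleDominators, stage, augment, residualSearch, visitOutCopy,
        storePath, assignMinMax, findReachable, constructVector, convertMinMax]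
  · rintro σ₃ τ₃ hF₃ ⟨q1, q2, q3, q4⟩
    have ht : tables σ₃ = tables σ₂ := by
      simp only [tables]
      congr 1
      · funext b; exact hF₃.1 _ (by simp [constructDu])
      · funext b; exact hF₃.2 _ (by simp [constructDu])
      all_goals exact hF₃.2 _ (by simp [constructDu])
    refine ⟨⟨ht ▸ k1, ht ▸ q1, ?_⟩, ?_⟩
    · have hs : ∀ b, σ₃.reg (.size b) = σ₂.reg (.size b) := fun b => hF₃.1 _ (by simp [constructDu])
      intro b
      rw [hs]
      cases b
      · exact q2
      · exact q3
    · simp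
      omega

end DominatorAlg

/-! ### Matching vectors, clusters and composition vectors. -/

namespace DominatorAlg

/-- A list without repetitions does not contain two elements in both orders. -/
theorem pair_sublist_asymm {α : Type*} {l : List α} (h : l.Nodup) {a b : α} (h₁ : [a, b].Sublist l) :
    ¬ [b, a].Sublist l := by
  induction l with
  | nil => simp at h₁
  | cons c l ih =>
    intro h₂
    rw [List.nodup_cons] at h
    rw [List.sublist_cons_iff] at h₁ h₂
    rcases h₁ with h₁ | ⟨r, hr, h₁⟩ <;> rcases h₂ with h₂ | ⟨r', hr', h₂⟩
    · exact ih h.2 h₁ h₂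
    · obtain ⟨rfl, rfl⟩ := List.cons.inj hr'
      exact h.1 (h₁.subset (by simp))
    · obtain ⟨rfl, rfl⟩ := List.cons.inj hr
      exact h.1 (h₂.subset (by simp))
    · obtain ⟨rfl, rfl⟩ := List.cons.inj hr
      obtain ⟨rfl, rfl⟩ := List.cons.inj hr'
      exact h.1 (by simpa using h₁)

variable {n : ℕ} {G : CircuitGraph (Fin n)} {u : Fin n} {V : Bool → ℕ → Fin n} {size : Bool → ℕ}
  {lo hi : Bool → ℕ → ℕ} {m : ℕ} {e : Bool → ℕ → ℕ}

/-- The part of a vector behind position `i` up to position `j`. -/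
def seg (V : Bool → ℕ → Fin n) (b : Bool) (i j : ℕ) : List (Fin n) :=
  (List.range' (i + 1) (j - i)).map (V b)

theorem mem_seg {b : Bool} {i j : ℕ} {x : Fin n} :
    x ∈ seg V b i j ↔ ∃ k, i < k ∧ k ≤ j ∧ V b k = x := by
  simp only [seg, List.mem_map, List.mem_range'_1]
  exact ⟨fun ⟨k, h, h'⟩ => ⟨k, by omega, by omega, h'⟩, fun ⟨k, h, h', h''⟩ => ⟨k, by omega, h''⟩⟩

theorem seg_append {b : Bool} {i j k : ℕ} (h1 : i ≤ j) (h2 : j ≤ k) :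
    seg V b i j ++ seg V b j k = seg V b i k := by
  unfold seg
  rw [← List.map_append]
  congr 1
  have := List.range'_append_1 (s := i + 1) (m := j - i) (n := k - j)
  rw [show i + 1 + (j - i) = j + 1 by omega, show j - i + (k - j) = k - i by omega] at this
  exact this

theorem seg_infix {b : Bool} {i j i' j' : ℕ} (h1 : i ≤ i') (h2 : i' ≤ j') (h3 : j' ≤ j) :
    seg V b i' j' <:+: seg V b i j :=
  ⟨seg V b i i', seg V b j' j, by
    rw [seg_append h1 h2, seg_append (h1.trans h2) h3]⟩

theorem length_seg {b : Bool} {i j : ℕ} : (seg V b i j).length = j - i := by simp [seg]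

theorem getElem_seg {b : Bool} {i j k : ℕ} (h : k < (seg V b i j).length) :
    (seg V b i j)[k] = V b (i + 1 + k) := by
  simp [seg]

/-- The vertices of the double-vertex dominators are listed in two vectors, and those that form a
double-vertex dominator with the `i`-th one are the vertices of the other vector at the positions from
`lo` to `hi`. -/
structure Ladder (G : CircuitGraph (Fin n)) (u : Fin n) (V : Bool → ℕ → Fin n) (size : Bool → ℕ)
    (lo hi : Bool → ℕ → ℕ) : Prop where
  inj : ∀ {b i c j}, 1 ≤ i → i ≤ size b → 1 ≤ j → j ≤ size c → V b i = V c j → b = c ∧ i = j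
  mem : ∀ {v w : Fin n}, {v, w} ∈ G.doubleDominators u → ∃ b i, 1 ≤ i ∧ i ≤ size b ∧ v = V b i
  pair : ∀ {b i} {w : Fin n}, 1 ≤ i → i ≤ size b → ({V b i, w} ∈ G.doubleDominators u ↔
    ∃ j, lo b i ≤ j ∧ j ≤ hi b i ∧ w = V (!b) j)
  lo_pos : ∀ {b i}, 1 ≤ i → i ≤ size b → 1 ≤ lo b i
  lo_le : ∀ {b i}, 1 ≤ i → i ≤ size b → lo b i ≤ hi b i
  hi_le : ∀ {b i}, 1 ≤ i → i ≤ size b → hi b i ≤ size (!b)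
  dom : ∀ {b i j j'}, 1 ≤ i → i ≤ size b → lo b i ≤ j → j ≤ hi b i → 1 ≤ j' → j' < j →
    G.Dominates {V b i, V (!b) j} {V (!b) j'}
  not_dom : ∀ {b i j j'}, 1 ≤ i → i ≤ size b → lo b i ≤ j → j ≤ hi b i → j < j' → j' ≤ size (!b) →
    ¬ G.Dominates {V b i, V (!b) j} {V (!b) j'}

namespace Ladder

theorem symm (H : Ladder G u V size lo hi) {b : Bool} {i j : ℕ} (h1 : 1 ≤ i) (h2 : i ≤ size b)
    (h3 : lo b i ≤ j) (h4 : j ≤ hi b i) : lo (!b) j ≤ i ∧ i ≤ hi (!b) j := by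
  have h5 := H.lo_pos h1 h2
  have h6 := H.hi_le h1 h2
  have h : ({V b i, V (!b) j} : Set (Fin n)) ∈ G.doubleDominators u :=
    (H.pair h1 h2).2 ⟨j, h3, h4, rfl⟩
  rw [Set.pair_comm, H.pair (by omega) (by omega), Bool.not_not] at h
  obtain ⟨i', k1, k2, k3⟩ := h
  have h7 := H.lo_pos (b := !b) (i := j) (by omega) (by omega)
  have h8 := H.hi_le (b := !b) (i := j) (by omega) (by omega)
  rw [Bool.not_not] at h8
  obtain ⟨-, rfl⟩ := H.inj h1 h2 (by omega) (by omega) k3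
  exact ⟨k1, k2⟩

theorem nodup_seg (H : Ladder G u V size lo hi) {b : Bool} {i j : ℕ} (hj : j ≤ size b) :
    (seg V b i j).Nodup := by
  refine List.Nodup.map_on ?_ (List.nodup_range' ..)
  intro x hx y hy h
  rw [List.mem_range'_1] at hx hy
  exact (H.inj (by omega) (by omega) (by omega) (by omega) h).2

theorem sublist_seg {b : Bool} {i j k l : ℕ} (h1 : i < k) (h2 : k < l) (h3 : l ≤ j) :
    [V b k, V b l].Sublist (seg V b i j) := by
  rw [← seg_append (V := V) (b := b) (i := i) (j := k) (k := j) (by omega) (by omega),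
    show [V b k, V b l] = [V b k] ++ [V b l] from rfl]
  refine List.Sublist.append ?_ ?_ <;> rw [List.singleton_sublist, mem_seg]
  · exact ⟨k, h1, le_rfl, rfl⟩
  · exact ⟨l, h2, h3, rfl⟩

theorem dominates_pair {v w w' : Fin n} (h : G.Dominates {v, w} {w'}) :
    G.Dominates {v, w} {v, w'} := by
  rintro x (rfl | hx) y hy p hp
  · exact ⟨x, .inl rfl, List.mem_of_mem_head? hp.2.1⟩
  · exact h x hx y hy p hp

/-- The matching vectors. -/
theorem isMatchingVector_iff (H : Ladder G u V size lo hi) {b : Bool} {i : ℕ} (h1 : 1 ≤ i)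
    (h2 : i ≤ size b) {M : List (Fin n)} :
    G.IsMatchingVector u (V b i) M ↔ M = seg V (!b) (lo b i - 1) (hi b i) := by
  have hlo := H.lo_pos h1 h2
  have hle := H.lo_le h1 h2
  have hhi := H.hi_le h1 h2
  have hmem : ∀ w, w ∈ seg V (!b) (lo b i - 1) (hi b i) ↔
      ({V b i, w} : Set (Fin n)) ∈ G.doubleDominators u := by
    intro w
    rw [mem_seg, H.pair h1 h2]
    exact ⟨fun ⟨k, a, b, c⟩ => ⟨k, by omega, b, c.symm⟩, fun ⟨k, a, b, c⟩ => ⟨k, by omega, b, c.symm⟩⟩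
  have hsub : ∀ j j', lo b i ≤ j → j ≤ hi b i → lo b i ≤ j' → j' ≤ hi b i →
      V (!b) j ≠ V (!b) j' → G.Dominates {V b i, V (!b) j} {V b i, V (!b) j'} → j' < j := by
    intro j j' k1 k2 k3 k4 hne hd
    by_contra hlt
    have hjj : j ≠ j' := by rintro rfl; exact hne rfl
    refine H.not_dom h1 h2 k1 k2 (by omega : j < j') (by omega) fun x hx => hd x ?_
    exact .inr hx
  constructor
  · rintro ⟨k1, k2, k3⟩
    have hperm : M.Perm (seg V (!b) (lo b i - 1) (hi b i)) :=
      (List.perm_ext_iff_of_nodup k1 (H.nodup_seg hhi)).2 fun w => by rw [k2, hmem]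
    -- Both lists have the same elements and are sorted by the position in the vector; as this order
    -- is antisymmetric, they coincide.
    let R : Fin n → Fin n → Prop := fun x y => ∃ j j', lo b i ≤ j ∧ j < j' ∧ j' ≤ hi b i ∧
      x = V (!b) j ∧ y = V (!b) j'
    refine hperm.eq_of_pairwise (le := R) ?_ ?_ ?_
    · rintro x y - - ⟨j, j', a1, a2, a3, rfl, rfl⟩ ⟨l, l', b1, b2, b3, b4, b5⟩
      have := (H.inj (by omega) (by omega) (by omega) (by omega) b4).2
      have := (H.inj (by omega) (by omega) (by omega) (by omega) b5).2
      omega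
    · rw [List.pairwise_iff_forall_sublist]
      intro x y hxy
      have hx := (H.pair h1 h2).1 ((k2 x).1 (hxy.subset (by simp)))
      have hy := (H.pair h1 h2).1 ((k2 y).1 (hxy.subset (by simp)))
      obtain ⟨j, a1, a2, rfl⟩ := hx
      obtain ⟨j', b1, b2, rfl⟩ := hy
      refine ⟨j, j', a1, ?_, b2, rfl, rfl⟩
      have hne : V (!b) j ≠ V (!b) j' := by
        have := k1.sublist hxy
        simpa using this
      have hjj : j ≠ j' := by rintro rfl; exact hne rfl
      by_contra hlt
      -- If the order were reversed, the pair with the later vertex would dominate the earlier one,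
      -- and the defining order of `M` would put the two in the opposite order as well.
      refine pair_sublist_asymm k1 hxy (k3 _ (hxy.subset (by simp)) _ (hxy.subset (by simp)) hne ?_)
      exact dominates_pair (H.dom h1 h2 a1 a2 (by omega) (by omega))
    · rw [seg, List.pairwise_map]
      refine (List.pairwise_lt_range' (s := lo b i - 1 + 1) (n := hi b i - (lo b i - 1))).imp_of_mem ?_
      intro j j' hj hj' hlt
      rw [List.mem_range'_1] at hj hj'
      exact ⟨j, j', by omega, hlt, by omega, rfl, rfl⟩
  · rintro rfl
    refine ⟨H.nodup_seg hhi, hmem, fun w hw w' hw' hne hd => ?_⟩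
    rw [mem_seg] at hw hw'
    obtain ⟨j, a1, a2, rfl⟩ := hw
    obtain ⟨j', b1, b2, rfl⟩ := hw'
    exact sublist_seg (by omega) (hsub j j' (by omega) a2 (by omega) b2 hne hd) a2

theorem mem_matchingVectors (H : Ladder G u V size lo hi) {M : List (Fin n)} :
    M ∈ G.matchingVectors u ↔
      ∃ b i, 1 ≤ i ∧ i ≤ size b ∧ M = seg V (!b) (lo b i - 1) (hi b i) := by
  constructor
  · rintro ⟨hM, v, hv⟩
    obtain ⟨w, hw⟩ := List.exists_mem_of_ne_nil M hM
    obtain ⟨b, i, h1, h2, rfl⟩ := H.mem ((hv.2.1 w).1 hw)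
    exact ⟨b, i, h1, h2, (H.isMatchingVector_iff h1 h2).1 hv⟩
  · rintro ⟨b, i, h1, h2, rfl⟩
    refine ⟨fun h => ?_, V b i, (H.isMatchingVector_iff h1 h2).2 rfl⟩
    have := congrArg List.length h
    rw [length_seg, List.length_nil] at this
    have := H.lo_le h1 h2
    have := H.lo_pos h1 h2
    omega

theorem mem_matchingVectorsOf (H : Ladder G u V size lo hi) {b : Bool} {i j : ℕ} (hj : j ≤ size b)
    {M : List (Fin n)} : M ∈ G.matchingVectorsOf u (seg V b i j) ↔
      ∃ k, i < k ∧ k ≤ j ∧ M = seg V (!b) (lo b k - 1) (hi b k) := by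
  constructor
  · rintro ⟨v, hv, h⟩
    obtain ⟨k, h1, h2, rfl⟩ := mem_seg.1 hv
    exact ⟨k, h1, h2, (H.isMatchingVector_iff (by omega) (by omega)).1 h⟩
  · rintro ⟨k, h1, h2, h⟩
    exact ⟨V b k, mem_seg.2 ⟨k, h1, h2, rfl⟩, (H.isMatchingVector_iff (by omega) (by omega)).2 h⟩

end Ladder

/-- Two separated sets of matching vectors divide each other into separated sets. -/
theorem _root_.CircuitGraph.IsCluster.subset {S S' : Set (List (Fin n))} (hS : G.IsCluster u S)
    (hS' : G.IsSeparated u S') (h : (S ∩ S').Nonempty) : S ⊆ S' := by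
  by_contra hsub
  obtain ⟨M, hM, hM'⟩ := Set.not_subset.1 hsub
  refine hS.2.2 ⟨S ∩ S', S \ S', h, ⟨M, hM, hM'⟩, ?_, Set.inter_union_diff _ _, ?_, ?_⟩
  · exact Set.disjoint_left.2 fun x hx hx' => hx'.2 hx.2
  · refine ⟨fun x hx => hS.2.1.1 hx.1, fun x hx y hy => ?_⟩
    by_cases hyS : y ∈ S
    · exact hS'.2 x hx.2 y ⟨hy.1, fun k => hy.2 ⟨hyS, k⟩⟩
    · exact hS.2.1.2 x hx.1 y ⟨hy.1, hyS⟩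
  · refine ⟨fun x hx => hS.2.1.1 hx.1, fun x hx y hy => ?_⟩
    by_cases hyS : y ∈ S
    · exact (hS'.2 y (by by_contra k; exact hy.2 ⟨hyS, k⟩) x ⟨hS.2.1.1 hx.1, hx.2⟩).symm
    · exact hS.2.1.2 x hx.1 y ⟨hy.1, hyS⟩

/-- The division of both vectors into composition vectors of clusters. -/
structure Division (size : Bool → ℕ) (lo hi : Bool → ℕ → ℕ) (m : ℕ) (e : Bool → ℕ → ℕ) : Prop where
  zero : ∀ b, e b 0 = 0
  top : ∀ b, e b m = size b
  lt : ∀ b k, k < m → e b k < e b (k + 1)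
  closed : ∀ k ≤ m, ∀ b i j, 1 ≤ i → i ≤ size b → lo b i ≤ j → j ≤ hi b i → (i ≤ e b k ↔ j ≤ e (!b) k)
  conn : ∀ k < m, ∀ Q : Bool → ℕ → Prop,
    (∀ b i j, 1 ≤ i → i ≤ size b → lo b i ≤ j → j ≤ hi b i → (Q b i ↔ Q (!b) j)) →
    (∀ b i, e b k < i → i ≤ e b (k + 1) → Q b i) ∨ (∀ b i, e b k < i → i ≤ e b (k + 1) → ¬ Q b i)
  first : ∀ k < m, lo false (e false k + 1) ≤ e true k + 1 ∧ e true k + 1 ≤ hi false (e false k + 1)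

/-- The composition vector of a block. -/
def block (V : Bool → ℕ → Fin n) (e : Bool → ℕ → ℕ) (b : Bool) (k : ℕ) : List (Fin n) :=
  seg V b (e b k) (e b (k + 1))

/-- The cluster of a block. -/
def cluster (G : CircuitGraph (Fin n)) (u : Fin n) (V : Bool → ℕ → Fin n) (e : Bool → ℕ → ℕ)
    (b : Bool) (k : ℕ) : Set (List (Fin n)) :=
  G.matchingVectorsOf u (block V e (!b) k)

namespace Division

theorem mono (E : Division size lo hi m e) {b : Bool} {k l : ℕ} (h : k ≤ l) (hl : l ≤ m) :
    e b k ≤ e b l := by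
  induction l, h using Nat.le_induction with
  | base => exact le_rfl
  | succ l h ih => exact (ih (by omega)).trans (E.lt b l (by omega)).le

theorem le_size (E : Division size lo hi m e) {b : Bool} {k : ℕ} (h : k ≤ m) : e b k ≤ size b :=
  E.top b ▸ E.mono h le_rfl

theorem exists_block (E : Division size lo hi m e) {b : Bool} {i : ℕ} (h1 : 1 ≤ i) (h2 : i ≤ size b) :
    ∃ k < m, e b k < i ∧ i ≤ e b (k + 1) := by
  by_contra hcon
  push Not at hcon
  have : ∀ k, k ≤ m → e b k < i := by
    intro k
    induction k with
    | zero => intro _; rw [E.zero]; omega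
    | succ k ih => intro hk; exact hcon k (by omega) (ih (by omega))
  have := this m le_rfl
  rw [E.top] at this
  omega

theorem block_unique (E : Division size lo hi m e) {b : Bool} {i k l : ℕ} (hk : k < m) (hl : l < m)
    (h1 : e b k < i) (h2 : i ≤ e b (k + 1)) (h3 : e b l < i) (h4 : i ≤ e b (l + 1)) : k = l := by
  rcases lt_trichotomy k l with h | h | h
  · have := E.mono (b := b) (by omega : k + 1 ≤ l) (by omega); omega
  · exact h
  · have := E.mono (b := b) (by omega : l + 1 ≤ k) (by omega); omega

theorem mem_block_iff (E : Division size lo hi m e) {b : Bool} {i j k : ℕ} (hk : k < m) (h1 : 1 ≤ i)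
    (h2 : i ≤ size b) (h3 : lo b i ≤ j) (h4 : j ≤ hi b i) :
    (e b k < i ∧ i ≤ e b (k + 1)) ↔ (e (!b) k < j ∧ j ≤ e (!b) (k + 1)) := by
  rw [← not_le, ← not_le, E.closed k hk.le b i j h1 h2 h3 h4, E.closed (k + 1) hk b i j h1 h2 h3 h4]


end Division

end DominatorAlg

namespace DominatorAlg

variable {n : ℕ} {G : CircuitGraph (Fin n)} {u : Fin n} {V : Bool → ℕ → Fin n} {size : Bool → ℕ}
  {lo hi : Bool → ℕ → ℕ} {m : ℕ} {e : Bool → ℕ → ℕ}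

namespace Division

theorem mem_cluster (H : Ladder G u V size lo hi) (E : Division size lo hi m e) {b : Bool} {k : ℕ}
    (hk : k < m) {M : List (Fin n)} : M ∈ cluster G u V e b k ↔
      ∃ j, e (!b) k < j ∧ j ≤ e (!b) (k + 1) ∧ M = seg V b (lo (!b) j - 1) (hi (!b) j) := by
  rw [cluster, block, H.mem_matchingVectorsOf (E.le_size hk), Bool.not_not]

theorem cluster_subset (H : Ladder G u V size lo hi) (E : Division size lo hi m e) {b : Bool} {k : ℕ}
    (hk : k < m) : cluster G u V e b k ⊆ G.matchingVectors u := by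
  intro M hM
  obtain ⟨j, h1, h2, rfl⟩ := (E.mem_cluster H hk).1 hM
  have := E.le_size (b := !b) (k := k + 1) hk
  refine H.mem_matchingVectors.2 ⟨!b, j, by omega, by omega, by rw [Bool.not_not]⟩

theorem cluster_nonempty (H : Ladder G u V size lo hi) (E : Division size lo hi m e) {b : Bool} {k : ℕ}
    (hk : k < m) : (cluster G u V e b k).Nonempty :=
  ⟨_, (E.mem_cluster H hk).2 ⟨e (!b) k + 1, by omega, E.lt (!b) k hk, rfl⟩⟩

/-- The vertices of the vectors of a cluster are those of its composition vector. -/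
theorem mem_block_of_mem (H : Ladder G u V size lo hi) (E : Division size lo hi m e) {b : Bool} {k : ℕ}
    (hk : k < m) {M : List (Fin n)} (hM : M ∈ cluster G u V e b k) {x : Fin n} (hx : x ∈ M) :
    ∃ i, e b k < i ∧ i ≤ e b (k + 1) ∧ x = V b i := by
  obtain ⟨j, h1, h2, rfl⟩ := (E.mem_cluster H hk).1 hM
  obtain ⟨i, h3, h4, rfl⟩ := mem_seg.1 hx
  have := E.le_size (b := !b) (k := k + 1) hk
  have h := (E.mem_block_iff hk (b := !b) (i := j) (j := i) (by omega) (by omega) (by omega) h4).1 ⟨h1, h2⟩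
  rw [Bool.not_not] at h
  exact ⟨i, h.1, h.2, rfl⟩

/-- A matching vector that contains a vertex of the block is that of a partner of this vertex. Since
no pair leaves the block and its complement on the other side, the partner is in the opposite block
and the vector in the cluster. -/
theorem isSeparated (H : Ladder G u V size lo hi) (E : Division size lo hi m e) {b : Bool} {k : ℕ}
    (hk : k < m) : G.IsSeparated u (cluster G u V e b k) := by
  refine ⟨E.cluster_subset H hk, fun M hM M' hM' x hx hx' => ?_⟩
  obtain ⟨i, h1, h2, rfl⟩ := E.mem_block_of_mem H hk hM hx
  obtain ⟨c, j, h3, h4, rfl⟩ := H.mem_matchingVectors.1 hM'.1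
  obtain ⟨i', h5, h6, h7⟩ := mem_seg.1 hx'
  have := E.le_size (b := b) (k := k + 1) hk
  have := H.lo_pos h3 h4
  have := H.hi_le h3 h4
  obtain ⟨rfl, rfl⟩ := H.inj (by omega) (by omega) (by omega) (by omega) h7
  have h := (E.mem_block_iff hk h3 h4 (by omega) h6).2 ⟨h1, h2⟩
  refine hM'.2 ((E.mem_cluster H hk).2 ⟨j, ?_, ?_, by rw [Bool.not_not]⟩)
  · rw [Bool.not_not]; exact h.1
  · rw [Bool.not_not]; exact h.2

/-- Suppose the vectors were split into `S₁` and `S₂`. Colour a vertex on the side `b` by whether it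
occurs in a vector of `S₁`, and a vertex on the other side by whether its own matching vector is in
`S₁`. Separation makes the colour constant along pairs, hence on the connected block, and one of the
two parts would be empty. -/
theorem isCluster (H : Ladder G u V size lo hi) (E : Division size lo hi m e) {b : Bool} {k : ℕ}
    (hk : k < m) : G.IsCluster u (cluster G u V e b k) := by
  refine ⟨E.cluster_nonempty H hk, E.isSeparated H hk, ?_⟩
  rintro ⟨S₁, S₂, ⟨M₁, hM₁⟩, ⟨M₂, hM₂⟩, hdisj, hun, hS₁, -⟩
  let mv : Bool → ℕ → List (Fin n) := fun c i => seg V (!c) (lo c i - 1) (hi c i)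
  have hmv : ∀ c i, 1 ≤ i → i ≤ size c → mv c i ∈ G.matchingVectors u := fun c i h1 h2 =>
    H.mem_matchingVectors.2 ⟨c, i, h1, h2, rfl⟩
  have hin : ∀ c i j, lo c i ≤ j → j ≤ hi c i → 1 ≤ j → V (!c) j ∈ mv c i := fun c i j h1 h2 h3 =>
    mem_seg.2 ⟨j, by omega, h2, rfl⟩
  have key : ∀ c i j, 1 ≤ i → i ≤ size c → lo c i ≤ j → j ≤ hi c i →
      (mv c i ∈ S₁ ↔ ∃ M ∈ S₁, V (!c) j ∈ M) := by
    intro c i j h1 h2 h3 h4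
    have h5 := H.lo_pos h1 h2
    refine ⟨fun h => ⟨_, h, hin c i j h3 h4 (by omega)⟩, ?_⟩
    rintro ⟨M, hM, hj⟩
    by_contra hno
    exact hS₁.2 M hM _ ⟨hmv c i h1 h2, hno⟩ hj (hin c i j h3 h4 (by omega))
  have hmem : ∀ M, M ∈ S₁ ∨ M ∈ S₂ → ∃ j, e (!b) k < j ∧ j ≤ e (!b) (k + 1) ∧ M = mv (!b) j := by
    intro M hM
    have : M ∈ cluster G u V e b k := hun ▸ hM
    obtain ⟨j, h1, h2, h3⟩ := (E.mem_cluster H hk).1 this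
    exact ⟨j, h1, h2, by simpa [mv] using h3⟩
  refine (E.conn k hk (fun c i => if c = b then ∃ M ∈ S₁, V c i ∈ M else mv c i ∈ S₁) ?_).elim
    (fun h => ?_) fun h => ?_
  · intro c i j h1 h2 h3 h4
    by_cases hc : c = b
    · subst hc
      have h5 := H.symm h1 h2 h3 h4
      have h6 := H.lo_pos h1 h2
      have h7 := H.hi_le h1 h2
      have := key (!c) j i (by omega) (by omega) h5.1 h5.2
      rw [Bool.not_not] at this
      simp [this]
    · have hcb : (!c) = b := by cases b <;> cases c <;> simp_all
      rw [if_neg hc, if_pos hcb]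
      exact key c i j h1 h2 h3 h4
  · obtain ⟨j, h1, h2, rfl⟩ := hmem M₂ (.inr hM₂)
    have := h (!b) j h1 h2
    rw [if_neg (by simp)] at this
    exact Set.disjoint_left.1 hdisj this hM₂
  · obtain ⟨j, h1, h2, rfl⟩ := hmem M₁ (.inl hM₁)
    have := h (!b) j h1 h2
    rw [if_neg (by simp)] at this
    exact this hM₁

/-- A matching vector of the given cluster belongs to the cluster of some block, and clusters with a
common vector are equal by `IsCluster.subset` in both directions. -/
theorem exists_cluster (H : Ladder G u V size lo hi) (E : Division size lo hi m e)
    {S : Set (List (Fin n))} (hS : G.IsCluster u S) : ∃ b, ∃ k < m, S = cluster G u V e b k := by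
  obtain ⟨M, hM⟩ := hS.1
  obtain ⟨b, j, h1, h2, rfl⟩ := H.mem_matchingVectors.1 (hS.2.1.1 hM)
  obtain ⟨k, hk, h3, h4⟩ := E.exists_block h1 h2
  have hmem : seg V (!b) (lo b j - 1) (hi b j) ∈ cluster G u V e (!b) k := by
    refine (E.mem_cluster H hk).2 ⟨j, ?_, ?_, by rw [Bool.not_not]⟩
    · rwa [Bool.not_not]
    · rwa [Bool.not_not]
  refine ⟨!b, k, hk, Set.Subset.antisymm ?_ ?_⟩
  · exact hS.subset (E.isSeparated H hk) ⟨_, hM, hmem⟩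
  · exact (E.isCluster H hk).subset hS.2.1 ⟨_, hmem, hM⟩

theorem cluster_inj (H : Ladder G u V size lo hi) (E : Division size lo hi m e) {b c : Bool} {k l : ℕ}
    (hk : k < m) (hl : l < m) (h : cluster G u V e b k = cluster G u V e c l) : b = c ∧ k = l := by
  obtain ⟨M, hM⟩ := E.cluster_nonempty (b := b) H hk
  obtain ⟨x, hx⟩ := List.exists_mem_of_ne_nil M (E.cluster_subset H hk hM).1
  obtain ⟨i, h1, h2, rfl⟩ := E.mem_block_of_mem H hk hM hx
  obtain ⟨j, h3, h4, h5⟩ := E.mem_block_of_mem H hl (h ▸ hM) hx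
  have := E.le_size (b := b) (k := k + 1) hk
  have := E.le_size (b := c) (k := l + 1) hl
  obtain ⟨rfl, rfl⟩ := H.inj (by omega) (by omega) (by omega) (by omega) h5
  exact ⟨rfl, E.block_unique hk hl h1 h2 h3 h4⟩

/-- A matching vector is an interval of positions whose two ends are partners of the same vertex of
the opposite block, so it lies entirely in the block and is contiguous there. Conversely, a vertex
of the block occurs in the vector of any of its partners. -/
theorem isComposition (H : Ladder G u V size lo hi) (E : Division size lo hi m e) {b : Bool} {k : ℕ}
    (hk : k < m) : CircuitGraph.IsComposition (cluster G u V e b k) (block V e b k) := by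
  have hs := E.le_size (b := b) (k := k + 1) hk
  have hs' := E.le_size (b := !b) (k := k + 1) hk
  refine ⟨fun M hM => ?_, fun x hx => ?_, H.nodup_seg hs⟩
  · obtain ⟨j, h1, h2, rfl⟩ := (E.mem_cluster H hk).1 hM
    have h3 := H.lo_pos (b := !b) (i := j) (by omega) (by omega)
    have h4 := H.lo_le (b := !b) (i := j) (by omega) (by omega)
    have h5 := (E.mem_block_iff hk (b := !b) (i := j) (by omega) (by omega) le_rfl h4).1 ⟨h1, h2⟩
    have h6 := (E.mem_block_iff hk (b := !b) (i := j) (by omega) (by omega) h4 le_rfl).1 ⟨h1, h2⟩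
    rw [Bool.not_not] at h5 h6
    exact seg_infix (by omega) (by omega) h6.2
  · obtain ⟨i, h1, h2, rfl⟩ := mem_seg.1 hx
    have h3 := H.lo_pos (b := b) (i := i) (by omega) (by omega)
    have h4 := H.lo_le (b := b) (i := i) (by omega) (by omega)
    have h5 := (E.mem_block_iff hk (b := b) (i := i) (by omega) (by omega) le_rfl h4).1 ⟨h1, h2⟩
    have h6 := H.symm (b := b) (i := i) (by omega) (by omega) le_rfl h4
    exact ⟨_, (E.mem_cluster H hk).2 ⟨_, h5.1, h5.2, rfl⟩, mem_seg.2 ⟨i, by omega, h6.2, rfl⟩⟩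

end Division

/-- The dominator chain of a division. -/
def chainOf (V : Bool → ℕ → Fin n) (e : Bool → ℕ → ℕ) (m : ℕ) : List (List (Fin n) × List (Fin n)) :=
  (List.range m).map fun k => (block V e false k, block V e true k)

theorem length_chainOf : (chainOf V e m).length = m := by simp [chainOf]

theorem partVec_chainOf (E : Division size lo hi m e) {b : Bool} {k : ℕ} (hk : k ≤ m) :
    partVec b ((chainOf V e m).take k) = seg V b 0 (e b k) := by
  have htake : (chainOf V e m).take k = chainOf V e k := by
    unfold chainOf
    rw [← List.map_take, List.take_range, min_eq_left hk]
  rw [htake]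
  clear htake
  induction k with
  | zero => simp [chainOf, partVec, E.zero, seg]
  | succ k ih =>
    have : partVec b (chainOf V e (k + 1)) = partVec b (chainOf V e k) ++ block V e b k := by
      unfold chainOf partVec
      rw [List.range_succ]
      cases b <;> simp [part]
    rw [this, ih (by omega), block, seg_append (Nat.zero_le _) (E.lt b k hk).le]

/-- The first vertices of a block form a pair, and a pair dominates all vertices before it in either
vector; this is the required order. Complementarity is built into the definition of `cluster`. -/
theorem isDominatorChain_chainOf (H : Ladder G u V size lo hi) (E : Division size lo hi m e) :
    G.IsDominatorChain u (chainOf V e m) := by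
  refine ⟨⟨(List.range m).map fun k => (cluster G u V e false k, cluster G u V e true k), ?_, ?_, ?_⟩, ?_⟩
  · rw [chainOf, List.forall₂_map_left_iff, List.forall₂_map_right_iff, List.forall₂_same]
    intro k hk
    rw [List.mem_range] at hk
    exact ⟨E.isCluster H hk, E.isCluster H hk, E.isComposition H hk, E.isComposition H hk, rfl, rfl⟩
  · rw [List.map_map, List.map_map, List.nodup_append]
    refine ⟨?_, ?_, ?_⟩
    · refine List.Nodup.map_on (fun k hk l hl h => ?_) List.nodup_range
      rw [List.mem_range] at hk hl
      exact (E.cluster_inj H hk hl h).2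
    · refine List.Nodup.map_on (fun k hk l hl h => ?_) List.nodup_range
      rw [List.mem_range] at hk hl
      exact (E.cluster_inj H hk hl h).2
    · intro S hS S' hS' h
      obtain ⟨k, hk, rfl⟩ := List.mem_map.1 hS
      obtain ⟨l, hl, rfl⟩ := List.mem_map.1 hS'
      rw [List.mem_range] at hk hl
      exact absurd (E.cluster_inj H hk hl h).1 (by simp)
  · intro S hS
    obtain ⟨b, k, hk, rfl⟩ := E.exists_cluster H hS
    rw [List.mem_append, List.map_map, List.map_map, List.mem_map, List.mem_map]
    cases b
    · exact .inl ⟨k, List.mem_range.2 hk, rfl⟩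
    · exact .inr ⟨k, List.mem_range.2 hk, rfl⟩
  · rw [chainOf, List.pairwise_map]
    refine (List.pairwise_lt_range).imp_of_mem ?_
    intro k l hk hl hlt
    rw [List.mem_range] at hk hl
    have hhead : ∀ b, ∀ v ∈ (block V e b l).head?, v = V b (e b l + 1) := by
      intro b v hv
      have h1 := E.lt b l hl
      rw [block, seg, show e b (l + 1) - e b l = (e b (l + 1) - e b l - 1) + 1 by omega,
        List.range'_succ] at hv
      simpa using hv.symm
    intro v hv w hw x hx
    rw [hhead _ v hv, hhead _ w hw]
    obtain ⟨f1, f2⟩ := E.first l hl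
    have hsz : e false l + 1 ≤ size false := (E.lt false l hl).trans_le (E.le_size hl)
    have hsz' : e true l + 1 ≤ size true := (E.lt true l hl).trans_le (E.le_size hl)
    rcases List.mem_append.1 hx with hx | hx
    · obtain ⟨i, h1, h2, rfl⟩ := mem_seg.1 hx
      have := E.mono (b := false) (by omega : k + 1 ≤ l) hl.le
      have h3 := H.symm (b := false) (by omega) hsz f1 f2
      rw [Set.pair_comm]
      exact H.dom (b := true) (by omega) hsz' h3.1 h3.2 (by omega) (by omega)
    · obtain ⟨i, h1, h2, rfl⟩ := mem_seg.1 hx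
      have := E.mono (b := true) (by omega : k + 1 ≤ l) hl.le
      exact H.dom (b := false) (by omega) hsz f1 f2 (by omega) (by omega)

end DominatorAlg

/-! ### From the stored graph to the network and back. -/

namespace DominatorAlg

open RAM

variable {n : ℕ} {G : CircuitGraph (Fin n)} {u : Fin n} {σ : State Reg Arr}

theorem mem_fanoutList {v w : ℕ} (hv : σ.arr .off v ≤ σ.arr .off (v + 1)) : w ∈ fanoutList σ v ↔
    ∃ e, σ.arr .off v ≤ e ∧ e < σ.arr .off (v + 1) ∧ σ.arr .adj e = w := by
  rw [fanoutList, List.mem_map]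
  exact exists_congr fun e => by rw [List.mem_range'_1, and_assoc, Nat.add_sub_cancel' hv]

/-- The network in the memory. -/
noncomputable def IsInput.net (h : IsInput G u σ) : Net where
  n := n
  E a b := ∃ v w : Fin n, (v, w) ∈ G.edges ∧ (v : ℕ) = a ∧ (w : ℕ) = b
  h a := {x : Fin n | ∃ v : Fin n, (v : ℕ) = a ∧
    Relation.TransGen (fun a b => (a, b) ∈ G.edges) v x}.ncard
  off := σ.arr .off
  adj := σ.arr .adj
  u := u
  root := G.root
  lt_right := by rintro a b ⟨v, w, -, rfl, rfl⟩; exact w.2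
  h_lt := by
    rintro a b ⟨v, w, hE, rfl, rfl⟩
    -- The height counts proper descendants. Along an edge the descendants of the head are among
    -- those of the tail, and the head itself is lost since it is not its own descendant.
    refine Set.ncard_lt_ncard ⟨?_, fun hsub => ?_⟩ (Set.toFinite _)
    · rintro x ⟨w', hw, hx⟩
      obtain rfl := Fin.ext hw
      exact ⟨v, rfl, .head hE hx⟩
    · obtain ⟨w', hw, hx⟩ := hsub ⟨v, rfl, .single hE⟩
      obtain rfl := Fin.ext hw
      exact G.acyclic _ hx
  mono v hv := h.mono ⟨v, hv⟩
  edge v hv w := by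
    rw [← mem_fanoutList (h.mono ⟨v, hv⟩)]
    refine Iff.trans ?_ (h.fanout ⟨v, hv⟩ w).symm
    constructor
    · rintro ⟨v', w', hE, rfl, rfl⟩; exact ⟨w', hE, rfl⟩
    · rintro ⟨w', hE, rfl⟩; exact ⟨_, w', hE, rfl, rfl⟩
  u_lt := u.2

theorem IsInput.holds (h : IsInput G u σ) : h.net.Holds σ := ⟨rfl, rfl⟩

theorem IsInput.edge_iff (h : IsInput G u σ) {v w : Fin n} : h.net.E v w ↔ (v, w) ∈ G.edges := by
  constructor
  · rintro ⟨v', w', hE, hv, hw⟩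
    rwa [← Fin.ext hv, ← Fin.ext hw]
  · exact fun hE => ⟨v, w, hE, rfl, rfl⟩

/-- Paths as lists and reachability. -/
theorem IsInput.av_iff (h : IsInput G u σ) {A : Set (Fin n)} {x y : Fin n} :
    h.net.Av (Fin.val '' A) x y ↔ ∃ p, G.IsPath p x y ∧ ∀ a ∈ A, a ∉ p := by
  have hA : ∀ z : Fin n, (z : ℕ) ∈ Fin.val '' A ↔ z ∈ A := fun z =>
    Fin.val_injective.mem_set_image
  constructor
  · intro hav
    refine hav.head_induction (P := fun a => ∀ x : Fin n, (x : ℕ) = a →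
      ∃ p, G.IsPath p x y ∧ ∀ a ∈ A, a ∉ p) ?_ ?_ x rfl
    · intro x hx
      obtain rfl := Fin.ext hx
      refine ⟨[x], ⟨by simp, by simp, by simp⟩, fun a ha hx => ?_⟩
      obtain rfl := List.mem_singleton.1 hx
      exact hav.right ((hA _).2 ha)
    · rintro _ _ ⟨v, w, hE, rfl, rfl⟩ hv - ih x hx
      obtain rfl := Fin.ext hx
      obtain ⟨p, ⟨h1, h2, h3⟩, h4⟩ := ih w rfl
      obtain ⟨q, rfl⟩ : ∃ q, p = w :: q := by
        cases p with
        | nil => simp at h2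
        | cons a q => exact ⟨q, by simpa using h2⟩
      refine ⟨x :: w :: q, ⟨List.isChain_cons_cons.2 ⟨hE, h1⟩, rfl, by
        rw [List.getLast?_cons_cons]; exact h3⟩, fun a ha hx => ?_⟩
      rcases List.mem_cons.1 hx with rfl | hx
      · exact hv ((hA _).2 ha)
      · exact h4 a ha hx
  · rintro ⟨p, ⟨h1, h2, h3⟩, h4⟩
    induction p generalizing x with
    | nil => simp at h2
    | cons z q ih =>
      obtain rfl : z = x := by simpa using h2
      have hz : (z : ℕ) ∉ Fin.val '' A := fun k => h4 z ((hA z).1 k) (by simp)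
      cases q with
      | nil =>
        obtain rfl : z = y := by simpa using h3
        exact .refl hz
      | cons w q =>
        rw [List.isChain_cons_cons] at h1
        refine .head (h.edge_iff.2 h1.1) hz (ih (fun a ha k => h4 a ha (List.mem_cons_of_mem _ k)) h1.2 rfl ?_)
        rwa [List.getLast?_cons_cons] at h3

theorem IsInput.dominates_iff (h : IsInput G u σ) {A : Set (Fin n)} {x : Fin n} :
    G.Dominates A {x} ↔ ¬ h.net.Av (Fin.val '' A) x G.root := by
  rw [h.av_iff]
  constructor
  · rintro hd ⟨p, hp, hA⟩
    obtain ⟨a, ha, hap⟩ := hd x rfl _ rfl p hp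
    exact hA a ha hap
  · rintro hd _ rfl _ rfl p hp
    by_contra hcon
    push Not at hcon
    exact hd ⟨p, hp, hcon⟩

/-- Minimality says that neither vertex dominates alone. Removing `v` leaves `w` and vice versa,
hence the exchange of `left` and `right`. -/
theorem IsInput.pair_iff (h : IsInput G u σ) {v w : Fin n} :
    ({v, w} : Set (Fin n)) ∈ G.doubleDominators u ↔ Pair h.net v w := by
  have h1 : ∀ x : Fin n, G.Dominates {x} {u} ↔ ¬ h.net.Av {(x : ℕ)} u G.root := fun x => by
    rw [h.dominates_iff, Set.image_singleton]
  have h2 : G.Dominates {v, w} {u} ↔ ¬ h.net.Av {(v : ℕ), (w : ℕ)} u G.root := by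
    rw [h.dominates_iff, Set.image_pair]
  have hdiff : v ≠ w → ({v, w} \ {v} : Set (Fin n)) = {w} ∧ ({v, w} \ {w} : Set (Fin n)) = {v} := by
    intro hne
    constructor <;> ext x <;> simp <;> aesop
  constructor
  · rintro ⟨hc, hd, hm⟩
    have hne : v ≠ w := by rintro rfl; simp at hc
    obtain ⟨e1, e2⟩ := hdiff hne
    have k1 := hm v (by simp)
    have k2 := hm w (by simp)
    rw [e1, h1, not_not] at k1
    rw [e2, h1, not_not] at k2
    exact ⟨k2, k1, h2.1 hd⟩
  · intro hp
    have hne : v ≠ w := by rintro rfl; exact hp.ne rfl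
    obtain ⟨e1, e2⟩ := hdiff hne
    refine ⟨Set.ncard_pair hne, h2.2 hp.dom, ?_⟩
    rintro x (rfl | rfl)
    · rw [e1, h1, not_not]; exact hp.right
    · rw [e2, h1, not_not]; exact hp.left

/-- A vertex reachable from `u` is `u` or the head of an edge, so at most |E| + 1 vertices matter,
however many the graph has, and their degrees add up to at most |E|. -/
theorem IsInput.work_le (h : IsInput G u σ) : (h.net.work fun _ => 0) ≤ 2 * G.edges.card + 1 := by
  have hdeg : ∀ v : Fin n, h.net.deg v ≤ {p ∈ G.edges | p.1 = v}.card := by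
    intro v
    have h1 : h.net.deg v = (fanoutList σ v).toFinset.card := by
      rw [List.toFinset_card_of_nodup (h.nodup v)]
      simp [fanoutList, Net.deg, IsInput.net]
    rw [h1]
    refine (Finset.card_le_card (t := {p ∈ G.edges | p.1 = v}.image fun p => (p.2 : ℕ)) ?_).trans
      Finset.card_image_le
    intro w hw
    obtain ⟨w', hE, rfl⟩ := (h.fanout v w).1 (List.mem_toFinset.1 hw)
    exact Finset.mem_image.2 ⟨(v, w'), Finset.mem_filter.2 ⟨hE, rfl⟩, rfl⟩
  have h1 : ∑ v ∈ h.net.verts, h.net.deg v ≤ G.edges.card := by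
    calc ∑ v ∈ h.net.verts, h.net.deg v ≤ ∑ v ∈ Finset.range n, h.net.deg v :=
          Finset.sum_le_sum_of_subset fun v hv =>
            Finset.mem_range.2 ((Net.mem_verts.1 hv).lt h.net.u_lt)
      _ = ∑ v : Fin n, h.net.deg v := Finset.sum_range _
      _ ≤ ∑ v : Fin n, {p ∈ G.edges | p.1 = v}.card := Finset.sum_le_sum fun v _ => hdeg v
      _ = G.edges.card := (Finset.card_eq_sum_card_fiberwise fun _ _ => by simp).symm
  have h2 : h.net.verts.card ≤ G.edges.card + 1 := by
    refine (Finset.card_le_card (t := insert (u : ℕ) (G.edges.image fun p => (p.2 : ℕ))) ?_).trans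
      ((Finset.card_insert_le _ _).trans (Nat.add_le_add_right Finset.card_image_le 1))
    intro v hv
    rcases Relation.ReflTransGen.cases_tail (Net.mem_verts.1 hv) with hv | ⟨a, _, a', v', hE, -, rfl⟩
    · rw [hv]; exact Finset.mem_insert_self _ _
    · exact Finset.mem_insert_of_mem (Finset.mem_image.2 ⟨(a', v'), hE, rfl⟩)
  simp only [Net.work, if_true, Finset.sum_add_distrib, Finset.sum_const, smul_eq_mul, mul_one]
  omega

/-- The vertices of the vectors. -/
def Tables.vertex (T : Tables) (u : Fin n) (b : Bool) (k : ℕ) : Fin n :=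
  if h : T.vec b k < n then ⟨T.vec b k, h⟩ else u

section
variable {T : Tables}

theorem Listing.vertex (h : IsInput G u σ) (H : Listing h.net T) {b : Bool} {k : ℕ} (h1 : 1 ≤ k)
    (h2 : k ≤ T.size b) : (T.vertex u b k : ℕ) = T.vec b k := by
  obtain ⟨w, hw⟩ := H.partner _ (by rw [(H.vec_flag b k h1 h2).1]; exact label_ne_zero)
  have hlt : T.vec b k < n := hw.live.1.lt h.net.u_lt
  rw [Tables.vertex, dif_pos hlt]

theorem Listing.eq_vertex (h : IsInput G u σ) (H : Listing h.net T) {b : Bool} {v : Fin n}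
    (hv : T.flag v = label b) :
    1 ≤ T.index v ∧ T.index v ≤ T.size b ∧ v = T.vertex u b (T.index v) := by
  obtain ⟨c, h1, h2, h3, h4⟩ := H.flag_vec v (by rw [hv]; exact label_ne_zero)
  obtain rfl := label_inj.1 (hv.symm.trans h1)
  exact ⟨h2, h3, Fin.ext (by rw [H.vertex h h2 h3, h4])⟩

theorem Listing.range {N : Net} (H : Listing N T) {b : Bool} {v : ℕ} (hv : T.flag v = label b) :
    1 ≤ T.min v ∧ T.min v ≤ T.max v ∧ T.max v ≤ T.size (!b) := by
  have key : ∀ w, T.flag w = label (!b) → 1 ≤ T.index w ∧ T.index w ≤ T.size (!b) := by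
    intro w hw
    obtain ⟨c, h1, h2, h3, -⟩ := H.flag_vec w (by rw [hw]; exact label_ne_zero)
    obtain rfl := label_inj.1 (hw.symm.trans h1)
    exact ⟨h2, h3⟩
  obtain ⟨w, w1, w2, w3⟩ := H.min b v hv
  obtain ⟨w', w1', w2', w3'⟩ := H.max b v hv
  have := (H.pair_iff b v w hv w1).1 w2
  have := key w w1
  have := key w' w1'
  omega

/-- If a pair failed to dominate a vertex listed before it, the path from `u` to that vertex (`fwd`)
could be continued to the root around the pair. A vertex listed behind one member on its side
reaches the root past the pair by `bwd`. -/
theorem Listing.ladder (h : IsInput G u σ) (H : Listing h.net T) : Ladder G u (T.vertex u) T.size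
    (fun b i => T.min (T.vec b i)) (fun b i => T.max (T.vec b i)) := by
  have flag : ∀ {b i}, 1 ≤ i → i ≤ T.size b → T.flag (T.vec b i) = label b := fun h1 h2 =>
    (H.vec_flag _ _ h1 h2).1
  have index : ∀ {b i}, 1 ≤ i → i ≤ T.size b → T.index (T.vec b i) = i := fun h1 h2 =>
    (H.vec_flag _ _ h1 h2).2
  have pair : ∀ {b i j}, 1 ≤ i → i ≤ T.size b → T.min (T.vec b i) ≤ j → j ≤ T.max (T.vec b i) →
      1 ≤ j ∧ j ≤ T.size (!b) ∧ Pair h.net (T.vec b i) (T.vec (!b) j) := by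
    intro b i j h1 h2 h3 h4
    obtain ⟨r1, r2, r3⟩ := H.range (flag h1 h2)
    refine ⟨by omega, by omega, (H.pair_iff b _ _ (flag h1 h2) (flag (by omega) (by omega))).2 ?_⟩
    rw [index (by omega) (by omega)]
    exact ⟨h3, h4⟩
  refine ⟨fun {b i c j} h1 h2 h3 h4 he => ?_, fun {v w} hvw => ?_, fun {b i w} h1 h2 => ⟨fun hp => ?_, ?_⟩,
    fun h1 h2 => (H.range (flag h1 h2)).1, fun h1 h2 => (H.range (flag h1 h2)).2.1,
    fun h1 h2 => (H.range (flag h1 h2)).2.2, fun {b i j j'} h1 h2 h3 h4 h5 h6 => ?_,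
    fun {b i j j'} h1 h2 h3 h4 h5 h6 => ?_⟩
  · have he' : T.vec b i = T.vec c j := by rw [← H.vertex h h1 h2, he, H.vertex h h3 h4]
    have hbc := flag h1 h2
    rw [he', flag h3 h4, label_inj] at hbc
    exact ⟨hbc.symm, by rw [← index h1 h2, he', index h3 h4]⟩
  · obtain ⟨b, hv, -⟩ := H.pair_flag v w (h.pair_iff.1 hvw)
    obtain ⟨k1, k2, k3⟩ := H.eq_vertex h hv
    exact ⟨b, _, k1, k2, k3⟩
  · rw [h.pair_iff, H.vertex h h1 h2] at hp
    obtain ⟨c, k1, k2⟩ := H.pair_flag _ _ hp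
    obtain rfl := label_inj.1 ((flag h1 h2).symm.trans k1)
    obtain ⟨q1, q2⟩ := (H.pair_iff b _ _ k1 k2).1 hp
    exact ⟨T.index w, q1, q2, (H.eq_vertex h k2).2.2⟩
  · rintro ⟨j, h3, h4, rfl⟩
    obtain ⟨k1, k2, k3⟩ := pair h1 h2 h3 h4
    rwa [h.pair_iff, H.vertex h h1 h2, H.vertex h k1 k2]
  · obtain ⟨k1, k2, k3⟩ := pair h1 h2 h3 h4
    rw [h.dominates_iff, Set.image_pair, H.vertex h h1 h2, H.vertex h k1 k2, H.vertex h h5 (by omega)]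
    intro hav
    refine k3.dom (((H.fwd (!b) _ (flag h5 (by omega))).mono ?_).trans hav)
    rintro x (rfl | rfl)
    · exact .inl (by simpa using flag h1 h2)
    · exact .inr ⟨flag k1 k2, by rwa [index k1 k2, index h5 (by omega)]⟩
  · obtain ⟨k1, k2, k3⟩ := pair h1 h2 h3 h4
    rw [h.dominates_iff, Set.image_pair, H.vertex h h1 h2, H.vertex h k1 k2, H.vertex h (by omega) h6,
      not_not]
    refine (H.bwd (!b) _ (flag (by omega) h6)).mono ?_
    rintro x (rfl | rfl)
    · exact .inl (by simpa using flag h1 h2)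
    · exact .inr ⟨flag k1 k2, by rwa [index k1 k2, index (by omega) h6]⟩

/-- `Blocks` treats left and right differently, whereas `Division` is symmetric. Predicates that are
false at the first vertex of a block are handled by passing to their negation. -/
theorem Computed.division {N : Net} (H : Computed N σ) : Division (tables σ).size
    (fun b i => (tables σ).min ((tables σ).vec b i)) (fun b i => (tables σ).max ((tables σ).vec b i))
    (σ.reg .pairs) (fun b => σ.arr (.ends b)) := by
  have hL := H.listing
  set T := tables σ with hT
  have flag : ∀ {b i}, 1 ≤ i → i ≤ T.size b → T.flag (T.vec b i) = label b := fun h1 h2 =>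
    (hL.vec_flag _ _ h1 h2).1
  have index : ∀ {b i}, 1 ≤ i → i ≤ T.size b → T.index (T.vec b i) = i := fun h1 h2 =>
    (hL.vec_flag _ _ h1 h2).2
  have edge : ∀ b i j, 1 ≤ i → i ≤ T.size b → T.min (T.vec b i) ≤ j → j ≤ T.max (T.vec b i) →
      if b then T.Edge N j i else T.Edge N i j := by
    intro b i j h1 h2 h3 h4
    obtain ⟨r1, r2, r3⟩ := hL.range (flag h1 h2)
    have hp := (hL.pair_iff b _ (T.vec (!b) j) (flag h1 h2) (flag (by omega) (by omega))).2
      (by rw [index (by omega) (by omega)]; exact ⟨h3, h4⟩)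
    cases b
    · exact ⟨⟨h1, h2, r1.trans h3, h4.trans r3⟩, hp⟩
    · exact ⟨⟨r1.trans h3, h4.trans r3, h1, h2⟩, hp.symm⟩
  have of_edge : ∀ i j, T.Edge N i j →
      T.min (T.vec false i) ≤ j ∧ j ≤ T.max (T.vec false i) := by
    rintro i j ⟨⟨h1, h2, h3, h4⟩, hp⟩
    have := (hL.pair_iff false _ (T.vec true j) (flag h1 h2) (flag h3 h4)).1 hp
    rwa [index h3 h4] at this
  have hlt := H.blocks.lt
  have hend := H.ends
  have conn : ∀ k < σ.reg .pairs, ∀ Q : Bool → ℕ → Prop,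
      (∀ b i j, 1 ≤ i → i ≤ T.size b → T.min (T.vec b i) ≤ j → j ≤ T.max (T.vec b i) →
        (Q b i ↔ Q (!b) j)) → Q false (σ.arr (.ends false) k + 1) →
      ∀ b i, σ.arr (.ends b) k < i → i ≤ σ.arr (.ends b) (k + 1) → Q b i := by
    intro k hk Q hQ h0 b i h1 h2
    have := H.blocks.conn k hk Q (fun i j hE => hQ false i j hE.1.1 hE.1.2.1 (of_edge i j hE).1
      (of_edge i j hE).2) h0
    cases b
    · exact this.1 i h1 h2
    · exact this.2 i h1 h2
  refine ⟨H.blocks.zero, H.ends, hlt, fun k hk b i j h1 h2 h3 h4 => ?_, fun k hk Q hQ => ?_,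
    fun k hk => ?_⟩
  · have hE := edge b i j h1 h2 h3 h4
    have hc := H.blocks.closed k hk
    cases b
    · exact hc i j hE
    · exact (hc j i hE).symm
  · by_cases h0 : Q false (σ.arr (.ends false) k + 1)
    · exact .inl (conn k hk Q hQ h0)
    · exact .inr (conn k hk (fun b i => ¬ Q b i)
        (fun b i j h1 h2 h3 h4 => not_congr (hQ b i j h1 h2 h3 h4)) h0)
  · have hle : ∀ l, k + 1 ≤ l → l ≤ σ.reg .pairs →
        σ.arr (.ends false) (k + 1) ≤ σ.arr (.ends false) l := by
      intro l h
      induction l, h using Nat.le_induction with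
      | base => exact fun _ => le_rfl
      | succ l h ih => exact fun hl => (ih (by omega)).trans (hlt false l (by omega)).le
    have h1 := hle _ hk le_rfl
    rw [hend] at h1
    exact of_edge _ _ (hL.staircase.first_edge (H.blocks.closed k hk.le)
      ((hlt false k hk).trans_le h1)).2

end

theorem Computed.stores {σ' : State Reg Arr} (h : IsInput G u σ) (H : Computed h.net σ') :
    ∃ D, G.IsDominatorChain u D ∧ Stores G u σ' D := by
  have hL := H.listing
  have La := hL.ladder h
  have E := H.division
  refine ⟨_, isDominatorChain_chainOf La E, ?_⟩
  set T := tables σ' with hT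
  set D := chainOf (T.vertex u) (fun b => σ'.arr (.ends b)) (σ'.reg .pairs) with hD
  have hlen : D.length = σ'.reg .pairs := length_chainOf
  have hpv : ∀ b, partVec b D = seg (T.vertex u) b 0 (T.size b) := fun b => by
    have := partVec_chainOf (V := T.vertex u) E (b := b) (le_refl (σ'.reg .pairs))
    rw [← hD, List.take_of_length_le hlen.le, E.top] at this
    exact this
  have hvl : ∀ b, (partVec b D).length = T.size b := fun b => by rw [hpv, length_seg, Nat.sub_zero]
  have hget : ∀ b i (hi : i < (partVec b D).length), (((partVec b D)[i] : Fin n) : ℕ) = T.vec b (i + 1) := by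
    intro b i hi
    have hi' := hi
    rw [hvl] at hi'
    rw [List.getElem_of_eq (hpv b), getElem_seg, Nat.zero_add, Nat.add_comm, hL.vertex h (by omega) hi']
  have hmv : ∀ v M, G.IsMatchingVector u v M → ∀ w ∈ M, ∃ b i, 1 ≤ i ∧ i ≤ T.size b ∧ v = T.vertex u b i ∧
      M = seg (T.vertex u) (!b) (T.min (T.vec b i) - 1) (T.max (T.vec b i)) := by
    intro v M hM w hw
    obtain ⟨b, i, h1, h2, rfl⟩ := La.mem ((hM.2.1 w).1 hw)
    exact ⟨b, i, h1, h2, rfl, (La.isMatchingVector_iff h1 h2).1 hM⟩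
  refine ⟨hlen.symm, fun b => (hvl b).symm, fun b i hi => (hget b i hi).symm, fun b k hk => ?_,
    fun b v hv => ?_, fun v hv => ?_, fun b i hi => ?_, fun v M hM w hw => ?_, fun v M hM w hw => ?_⟩
  · rw [partVec_chainOf E (hlen ▸ hk), length_seg, Nat.sub_zero]
  · rw [hpv, mem_seg] at hv
    obtain ⟨k, h1, h2, rfl⟩ := hv
    rw [hL.vertex h h1 h2]
    exact (hL.vec_flag b k h1 h2).1
  · by_contra hne
    obtain ⟨b, h1, h2, h3, h4⟩ := hL.flag_vec v hne
    refine hv b ?_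
    rw [hpv, mem_seg]
    exact ⟨T.index v, h2, h3, (hL.eq_vertex h h1).2.2.symm⟩
  · rw [hget]
    rw [hvl] at hi
    exact (hL.vec_flag b (i + 1) (by omega) hi).2
  · obtain ⟨b, i, h1, h2, rfl, rfl⟩ := hmv v M hM w (List.mem_of_mem_head? hw)
    obtain ⟨r1, r2, r3⟩ := hL.range (hL.vec_flag b i h1 h2).1
    rw [seg, show T.max (T.vec b i) - (T.min (T.vec b i) - 1) =
      T.max (T.vec b i) - T.min (T.vec b i) + 1 by omega, List.range'_succ] at hw
    have hw' : w = T.vertex u (!b) (T.min (T.vec b i)) := by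
      have : T.min (T.vec b i) - 1 + 1 = T.min (T.vec b i) := by omega
      simpa [this] using hw.symm
    rw [hw', hL.vertex h h1 h2, hL.vertex h r1 (by omega)]
    exact (hL.vec_flag (!b) _ r1 (by omega)).2.symm
  · obtain ⟨b, i, h1, h2, rfl, rfl⟩ := hmv v M hM w (List.mem_of_mem_getLast? hw)
    obtain ⟨r1, r2, r3⟩ := hL.range (hL.vec_flag b i h1 h2).1
    rw [← seg_append (j := T.max (T.vec b i) - 1) (by omega) (by omega)] at hw
    have hw' : w = T.vertex u (!b) (T.max (T.vec b i)) := by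
      have e1 : T.max (T.vec b i) - 1 + 1 = T.max (T.vec b i) := by omega
      have e2 : T.max (T.vec b i) - (T.max (T.vec b i) - 1) = 1 := by omega
      rw [seg, seg, e2, e1] at hw
      simpa using hw.symm
    rw [hw', hL.vertex h h1 h2, hL.vertex h (by omega) r3]
    exact (hL.vec_flag (!b) _ (by omega) r3).2.symm

theorem Listing.query {N : Net} {T : Tables} (H : Listing N T) {v w : ℕ} : Pair N v w ↔
    (T.flag v ≠ 0 ∧ T.flag w ≠ 0) ∧ T.flag v ≠ T.flag w ∧ T.min v ≤ T.index w ∧ T.index w ≤ T.max v := by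
  constructor
  · intro hp
    obtain ⟨b, h1, h2⟩ := H.pair_flag v w hp
    refine ⟨⟨by rw [h1]; exact label_ne_zero, by rw [h2]; exact label_ne_zero⟩, ?_,
      (H.pair_iff b v w h1 h2).1 hp⟩
    rw [h1, h2, Ne, label_inj]
    simp
  · rintro ⟨⟨h1, h2⟩, h3, h4⟩
    obtain ⟨b, hb, -⟩ := H.flag_vec v h1
    obtain ⟨c, hc, -⟩ := H.flag_vec w h2
    have hcb : c = !b := by
      rw [hb, hc, Ne, label_inj] at h3
      cases b <;> cases c <;> simp_all
    subst hcb
    exact (H.pair_iff b v w hb hc).2 h4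

theorem wp_isDominatorPair {N : Net} {σ τ : State Reg Arr} (H : Listing N (tables σ))
    (hτ : τ.arr = σ.arr) :
    WP isDominatorPair τ fun τ' t => t ≤ 60 ∧ τ'.arr = σ.arr ∧
      (Pair N (τ.reg .qv) (τ.reg .qw) → τ'.reg .answer = 1) ∧
      (¬ Pair N (τ.reg .qv) (τ.reg .qw) → τ'.reg .answer = 0) := by
  rw [H.query]
  simp only [tables]
  unfold isDominatorPair
  simp only [wp_seq, wp_when, wp_assign]
  simp [hτ]
  grind

end DominatorAlg

theorem mainTheorem5 :
    ∃ C c : ℕ, ∀ (n : ℕ) (G : CircuitGraph (Fin n)) (u : Fin n)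
      (σ : RAM.State DominatorAlg.Reg DominatorAlg.Arr),
      DominatorAlg.IsInput G u σ →
      ∃ (σ' : RAM.State DominatorAlg.Reg DominatorAlg.Arr) (t : ℕ),
        RAM.Exec DominatorAlg.dominatorChain σ σ' t ∧
        t ≤ C * (G.edges.card + 1) ∧
        (∃ D : List (List (Fin n) × List (Fin n)),
          G.IsDominatorChain u D ∧ DominatorAlg.Stores G u σ' D) ∧
        ∀ (v w : Fin n) (τ : RAM.State DominatorAlg.Reg DominatorAlg.Arr),
          τ.arr = σ'.arr → τ.reg .qv = v → τ.reg .qw = w →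
          ∃ (τ' : RAM.State DominatorAlg.Reg DominatorAlg.Arr) (t' : ℕ),
            RAM.Exec DominatorAlg.isDominatorPair τ τ' t' ∧ t' ≤ c ∧ τ'.arr = σ'.arr ∧
            (({v, w} : Set (Fin n)) ∈ G.doubleDominators u → τ'.reg .answer = 1) ∧
            (({v, w} : Set (Fin n)) ∉ G.doubleDominators u → τ'.reg .answer = 0) := by
  -- The program takes at most `20000 * (work + 1)` steps, and `work` is at most `2 * |E| + 1`; this
  -- gives `40000 * (|E| + 1)`.
  refine ⟨40000, 60, fun n G u σ h => ?_⟩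
  obtain ⟨σ', t, he, H, ht⟩ := DominatorAlg.wp_dominatorChain (N := h.net) h.holds h.source h.root
    fun a h1 h2 => h.zero a h1 h2
  have hw := h.work_le
  refine ⟨σ', t, he, by omega, H.stores h, fun v w τ hτ hv hw => ?_⟩
  obtain ⟨τ', t', he', h1, h2, h3, h4⟩ := DominatorAlg.wp_isDominatorPair H.listing hτ
  rw [hv, hw] at h3 h4
  exact ⟨τ', t', he', h1, h2, fun k => h3 (h.pair_iff.1 k), fun k => h4 fun p => k (h.pair_iff.2 p)⟩
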